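/- For a family $S$ of $k$-subsets of $[n]=\{1,\dots,n\}$, let $\Delta^i(S)$ be its $i$-th iterated shadow. The $k$-binomial decomposition of $m\ge 1$ is $m=\binom{a_0}{k}+\binom{a_1}{k-1}+\cdots+\binom{a_s}{k-s}$ with $a_0>a_1>\cdots>a_s\ge k-s\ge 1$. A non-empty family $S\subseteq\binom{[n]}{k}$ with $|S|=m$ is extremal if $|\Delta(S)|=\binom{a_0}{k-1}+\cdots+\binom{a_s}{k-s-1}$, the minimum in the Kruskal--Katona theorem. Colex initial segments are considered up to permutations of $[n]$. The hypergraph of $S$ has as edges the sets $e\subseteq[n]$, $1\le |e|\le k$, that are minimal under inclusion with the property $e\notin\Delta^{k-|e|}(S)$. (i) There is an algorithm with running time $O(nk)$ that, for all given $n\ge 1$, $k$, $m$ and $t$ with $2\le t<k-1$, decides whether there is an extremal family $S\subseteq\binom{[n]}{k}$ of cardinality $m$ such that $\Delta^t(S)$ is not a colex initial segment and $\Delta^{t+1}(S)$ is one, and, if such a family exists, constructs one within the same time, giving it as the list of the edges of its hypergraph. The algorithm runs on a random access machine whose unit-cost operations are addition, subtraction, indirect reading and writing of memory, output, and tests for zero,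 on words of $O(\log I)$ bits, where $I$ is the sum of the input numbers. This holds both when $m$ is given as a number, in one word, and when $m\ge 1$ is given by the entries of its $k$-binomial decomposition (then $I$ is the sum of $n$, $k$, $t$, the number of entries and the entries). (ii) Let $n_1,\dots,n_k\ge 0$ be integers, $N_i=n_1+\cdots+n_i$, and let $1\le j<k$, $n_{j+1}\ge 1$ and $N_k+k\le n$. Arrange vertices in the decreasing order $u_1,\dots,u_{N_1},v_1,u_{N_1+1},\dots,u_{N_2},v_2,\dots,u_{N_k},v_k$, starting at $n$, and let $H_C(n_1,\dots,n_k)$ be the hypergraph with the edges $e_r=\{v_1,\dots,v_{i-1},u_r\}$ for $N_{i-1}<r\le N_i$, $1\le i\le k$. Suppose that some $v_s$ with $1\le s\le j$ lies in at least two of the edges $e_1,\dots,e_{N_{j+1}}$, let $p$ be the largest such index $s$, and put $N=N_{j+1}$. Construction A, $H_{A,j}(n_1,\dots,n_k)$, is obtained from $H_C(n_1,\dots,n_k)$ by exchanging, in the edge $e_N$, the vertex $v_p$ by $u_{N-1}$ and the vertex $u_N$ by $v_{j+1}$; Construction B, $H_{B,j}(n_1,\dots,n_k)$, by exchanging, in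 the edge $e_N$, the vertex $v_p$ by $v_{j+1}$. Then, whenever $0\le t<k-1$ and there is an extremal family $S\subseteq\binom{[n]}{k}$ such that $\Delta^t(S)$ is not a colex initial segment and $\Delta^{t+1}(S)$ is one, there is also an extremal family $S'\subseteq\binom{[n]}{k}$ with $|S'|=|S|$, such that $\Delta^t(S')$ is not a colex initial segment and $\Delta^{t+1}(S')$ is one, whose hypergraph is $H_{A,j}(n_1,\dots,n_k)$ or $H_{B,j}(n_1,\dots,n_k)$ for $j=k-t-1$ and some $n_1,\dots,n_k$ as above. -/

import Mathlib

namespace ShadowDepth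

/-! ### Binomial decompositions, extremal families, depth -/

/-- `binomSum k a = C(a₀, k) + C(a₁, k - 1) + ⋯ + C(aₜ, k - t)` for `a = [a₀, …, aₜ]`. It is used
only for `t ≤ k`, so the subtraction does not truncate. -/
def binomSum (k : ℕ) (a : List ℕ) : ℕ :=
  ∑ i : Fin a.length, (a.get i).choose (k - i.val)

/-- `a = [a₀, …, aₜ]` is the `k`-binomial decomposition of `m`: `a₀ > a₁ > ⋯ > aₜ ≥ k - t ≥ 1` and
`m = C(a₀, k) + ⋯ + C(aₜ, k - t)`. -/
def IsBinomDecomp (k m : ℕ) (a : List ℕ) : Prop :=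
  a ≠ [] ∧ a.length ≤ k ∧ a.Pairwise (fun x y => y < x) ∧
    (∀ i : Fin a.length, k - i.val ≤ a.get i) ∧ binomSum k a = m

/-- `S` is an extremal family of `k`-subsets of an `n`-element set: it is non-empty, and its shadow
has the minimum cardinality that the Kruskal–Katona theorem allows. -/
def Extremal {n : ℕ} (k : ℕ) (S : Finset (Finset (Fin n))) : Prop :=
  (S : Set (Finset (Fin n))).Sized k ∧ S.Nonempty ∧
    ∃ a : List ℕ, IsBinomDecomp k S.card a ∧ S.shadow.card = binomSum (k - 1) a

/-- Up to a permutation of the ground set, `A` is an initial segment of the colex order on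
`r`-sets. -/
def IsColexSegment {n : ℕ} (A : Finset (Finset (Fin n))) (r : ℕ) : Prop :=
  ∃ σ : Equiv.Perm (Fin n), Finset.Colex.IsInitSeg (A.image fun s => s.image σ) r

/-- The `t`-th shadow of `S` is not a colex initial segment, but the `(t + 1)`-th shadow is. -/
def HasDepthSucc {n : ℕ} (k t : ℕ) (S : Finset (Finset (Fin n))) : Prop :=
  ¬ IsColexSegment (Finset.shadow^[t] S) (k - t) ∧
    IsColexSegment (Finset.shadow^[t + 1] S) (k - (t + 1))

/-- The families in question: extremal families of `k`-subsets of `[n]` of cardinality `m` whose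
`t`-th shadow is not a colex initial segment while the `(t + 1)`-th shadow is. -/
def IsSolution (n k t m : ℕ) (S : Finset (Finset (Fin n))) : Prop :=
  Extremal k S ∧ S.card = m ∧ HasDepthSucc k t S

/-! ### The hypergraph of a family of `k`-sets -/

/-- The hypergraph of the family `S` of `k`-sets: its edges are the sets `e` with `1 ≤ |e| ≤ k`
that are minimal, under inclusion, with the property of not belonging to the `(k - |e|)`-th
shadow of `S`. -/
def hypergraph {n : ℕ} (k : ℕ) (S : Finset (Finset (Fin n))) : Finset (Finset (Fin n)) :=
  Finset.univ.filter fun e =>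
    1 ≤ e.card ∧ e.card ≤ k ∧ e ∉ Finset.shadow^[k - e.card] S ∧
      ∀ f ∈ e.ssubsets, f.Nonempty → f ∈ Finset.shadow^[k - f.card] S

/-- The same hypergraph, on the vertex set `{1, …, n}`. -/
def labelledHypergraph {n : ℕ} (k : ℕ) (S : Finset (Finset (Fin n))) : Finset (Finset ℕ) :=
  (hypergraph k S).image fun e => e.image fun v => v.val + 1

/-! ### Constructions A and B

A vector `ν = (ν 1, …, ν k)` of numbers of edges is given. The vertices `u₁, u₂, …` and
`v₁, v₂, …` are arranged in `{1, …, n}` in the decreasing order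
`u₁, …, u_{N₁}, v₁, u_{N₁+1}, …, u_{N₂}, v₂, u_{N₂+1}, …`, where `Nᵢ = ν 1 + ⋯ + ν i`, starting
at `n`. -/

/-- `Nᵢ = ν 1 + ⋯ + ν i`. -/
def edgesUpTo (ν : ℕ → ℕ) (i : ℕ) : ℕ := ∑ l ∈ Finset.Icc 1 i, ν l

/-- The vertex `vᵢ`. -/
def vVertex (n : ℕ) (ν : ℕ → ℕ) (i : ℕ) : ℕ := n + 1 - (edgesUpTo ν i + i)

/-- The vertex `u_r`, for `1 ≤ r ≤ N_k`. -/
def uVertex (n k : ℕ) (ν : ℕ → ℕ) (r : ℕ) : ℕ :=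
  n + 1 - (r + ((Finset.Icc 1 k).filter fun i => edgesUpTo ν i < r).card)

/-- The edge `{v₁, …, v_{i-1}, u_r}`; it is the edge `e_r` of the colex hypergraph when
`N_{i-1} < r ≤ N_i`. -/
def colexEdge (n k : ℕ) (ν : ℕ → ℕ) (i r : ℕ) : Finset ℕ :=
  insert (uVertex n k ν r) ((Finset.Icc 1 (i - 1)).image (vVertex n ν))

/-- The edges of size at most `l` of the hypergraph `H_C(ν 1, …, ν k)` of a colex initial
segment. -/
def colexHypergraph (n k : ℕ) (ν : ℕ → ℕ) (l : ℕ) : Finset (Finset ℕ) :=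
  (Finset.Icc 1 l).biUnion fun i =>
    (Finset.Ioc (edgesUpTo ν (i - 1)) (edgesUpTo ν i)).image (colexEdge n k ν i)

/-- `p` is the largest index in `[1, j]` such that `v_p` has degree at least `2` in the
hypergraph formed by the edges of size at most `j + 1` of `H_C(ν 1, …, ν k)`. -/
def IsPivot (n k j : ℕ) (ν : ℕ → ℕ) (p : ℕ) : Prop :=
  IsGreatest {s : ℕ | 1 ≤ s ∧ s ≤ j ∧
    2 ≤ ((colexHypergraph n k ν (j + 1)).filter fun e => vVertex n ν s ∈ e).card} p

/-- Conditions under which the constructions are made: there is an edge of size `j + 1 ≤ k`, and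
the vertices in use fit into `{1, …, n}`. -/
def Admissible (n k j : ℕ) (ν : ℕ → ℕ) : Prop :=
  1 ≤ j ∧ j + 1 ≤ k ∧ 1 ≤ ν (j + 1) ∧ edgesUpTo ν k + k ≤ n

/-- `H` is a hypergraph of Construction A, `H_{A,j}(ν 1, …, ν k)`: with `N = N_{j+1}` and the pivot
`p`, in the edge `e_N` of `H_C(ν 1, …, ν k)` the vertex `v_p` is exchanged by `u_{N-1}` and the
vertex `u_N` by `v_{j+1}`. -/
def IsConstructionA (n k j : ℕ) (H : Finset (Finset ℕ)) : Prop :=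
  ∃ (ν : ℕ → ℕ) (p : ℕ), Admissible n k j ν ∧ IsPivot n k j ν p ∧
    H = insert
      (insert (uVertex n k ν (edgesUpTo ν (j + 1) - 1)) (insert (vVertex n ν (j + 1))
        (((colexEdge n k ν (j + 1) (edgesUpTo ν (j + 1))).erase (vVertex n ν p)).erase
          (uVertex n k ν (edgesUpTo ν (j + 1))))))
      ((colexHypergraph n k ν k).erase (colexEdge n k ν (j + 1) (edgesUpTo ν (j + 1))))

/-- `H` is a hypergraph of Construction B, `H_{B,j}(ν 1, …, ν k)`: with `N = N_{j+1}` and the pivot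
`p`, in the edge `e_N` of `H_C(ν 1, …, ν k)` the vertex `v_p` is exchanged by `v_{j+1}`. -/
def IsConstructionB (n k j : ℕ) (H : Finset (Finset ℕ)) : Prop :=
  ∃ (ν : ℕ → ℕ) (p : ℕ), Admissible n k j ν ∧ IsPivot n k j ν p ∧
    H = insert
      (insert (vVertex n ν (j + 1))
        ((colexEdge n k ν (j + 1) (edgesUpTo ν (j + 1))).erase (vVertex n ν p)))
      ((colexHypergraph n k ν k).erase (colexEdge n k ν (j + 1) (edgesUpTo ν (j + 1))))

/-! ### Word random access machines -/

/-- Programs of a random access machine with registers `0, 1, 2, …`, an addressable memory and an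
output tape, in structured form. -/
inductive Prog : Type
  /-- `x := c` -/
  | const (x c : ℕ)
  /-- `x := y + z` -/
  | plus (x y z : ℕ)
  /-- `x := y - z`, truncated at zero -/
  | minus (x y z : ℕ)
  /-- `x := mem[y]` -/
  | load (x y : ℕ)
  /-- `mem[x] := y` -/
  | store (x y : ℕ)
  /-- append the content of `x` to the output -/
  | write (x : ℕ)
  /-- first `c`, then `d` -/
  | seq (c d : Prog)
  /-- if `x ≠ 0` then `c` else `d` -/
  | cond (x : ℕ) (c d : Prog)
  /-- while `x ≠ 0` do `c` -/
  | loop (x : ℕ) (c : Prog)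

/-- Configurations of the machine. -/
structure Config : Type where
  /-- contents of the registers -/
  reg : ℕ → ℕ
  /-- contents of the memory cells -/
  mem : ℕ → ℕ
  /-- what has been written so far -/
  out : List ℕ

/-- The configuration with the value `v` placed in register `x`. -/
def Config.setReg (s : Config) (x v : ℕ) : Config := { s with reg := Function.update s.reg x v }

/-- `Exec W c s T s'`: on a machine whose words hold the numbers `0, …, W`, the program `c` started
in the configuration `s` halts after `T` steps in the configuration `s'`. Every elementary
instruction and every test costs one step. An operation whose result exceeds `W` has no rule: a run
that needs it does not halt. -/
inductive Exec (W : ℕ) : Prog → Config → ℕ → Config → Prop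
  | const {s : Config} {x c : ℕ} : c ≤ W → Exec W (.const x c) s 1 (s.setReg x c)
  | plus {s : Config} {x y z : ℕ} : s.reg y + s.reg z ≤ W →
      Exec W (.plus x y z) s 1 (s.setReg x (s.reg y + s.reg z))
  | minus {s : Config} {x y z : ℕ} :
      Exec W (.minus x y z) s 1 (s.setReg x (s.reg y - s.reg z))
  | load {s : Config} {x y : ℕ} :
      Exec W (.load x y) s 1 (s.setReg x (s.mem (s.reg y)))
  | store {s : Config} {x y : ℕ} :
      Exec W (.store x y) s 1 { s with mem := Function.update s.mem (s.reg x) (s.reg y) }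
  | write {s : Config} {x : ℕ} :
      Exec W (.write x) s 1 { s with out := s.out ++ [s.reg x] }
  | seq {c d : Prog} {s s' s'' : Config} {T T' : ℕ} : Exec W c s T s' → Exec W d s' T' s'' →
      Exec W (.seq c d) s (T + T') s''
  | condTrue {x : ℕ} {c d : Prog} {s s' : Config} {T : ℕ} : s.reg x ≠ 0 → Exec W c s T s' →
      Exec W (.cond x c d) s (T + 1) s'
  | condFalse {x : ℕ} {c d : Prog} {s s' : Config} {T : ℕ} : s.reg x = 0 → Exec W d s T s' →
      Exec W (.cond x c d) s (T + 1) s'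
  | loopStep {x : ℕ} {c : Prog} {s s' s'' : Config} {T T' : ℕ} : s.reg x ≠ 0 →
      Exec W c s T s' → Exec W (.loop x c) s' T' s'' → Exec W (.loop x c) s (T + T' + 1) s''
  | loopDone {x : ℕ} {c : Prog} {s : Config} : s.reg x = 0 → Exec W (.loop x c) s 1 s

/-- The initial configuration: the input occupies the memory cells `0, 1, 2, …`, everything else is
zero, and nothing has been written. -/
def initConfig (inp : List ℕ) : Config where
  reg := fun _ => 0
  mem := fun i => inp.getD i 0
  out := []

/-- The program `P`, run on the input `inp` on a machine with words of `O(log I)` bits, where `I` is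
the sum of the input numbers (words hold the numbers up to `(I + 2) ^ c`), halts after at most `T`
steps, having written exactly `out`. -/
def RunsTo (P : Prog) (c : ℕ) (inp : List ℕ) (T : ℕ) (out : List ℕ) : Prop :=
  ∃ (T' : ℕ) (s : Config), T' ≤ T ∧ Exec ((inp.sum + 2) ^ c) P (initConfig inp) T' s ∧ s.out = out

/-! ### The required answer -/

/-- `L` lists the edges of the hypergraph `H` without repetition, each edge being a list of its
vertices without repetition. -/
def ListsEdges (L : List (List ℕ)) (H : Finset (Finset ℕ)) : Prop :=
  (∀ e ∈ L, e.Nodup) ∧ (L.map List.toFinset).Nodup ∧ (L.map List.toFinset).toFinset = H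

/-- `out` is a correct answer for the data `n, k, t, m`: it is `0` if there is no solution, and
otherwise it is `1` followed by the edges of the hypergraph of a solution, each edge being written
as its size followed by its vertices. -/
def IsAnswer (n k t m : ℕ) (out : List ℕ) : Prop :=
  ((¬ ∃ S : Finset (Finset (Fin n)), IsSolution n k t m S) ∧ out = [0]) ∨
    ∃ (S : Finset (Finset (Fin n))) (L : List (List ℕ)), IsSolution n k t m S ∧
      ListsEdges L (labelledHypergraph k S) ∧ out = 1 :: L.flatMap fun e => e.length :: e

end ShadowDepth

open ShadowDepth

/-!
Up to the order of the vertices, an initial segment of colex consists of the sets that avoid the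
edges of a hypergraph `H_C(ν 1, …, ν k)`, and the same hypergraph describes all its shadows
(`isInitSeg_colexFamily`, `shadow_colexFamily`, `exists_eq_colexFamily`). The sets of a given size
that contain some edge are counted by `kills`, a sum of binomial coefficients along the vector of the
numbers of edges (`card_killed`). The shadow of an extremal family is extremal again
(`MinShadow.shadow`). Hence the cardinalities of all shadows of an extremal family are those of the
colex hypergraph with the same number of sets, and the question becomes which other families have
these cardinalities.

Let `j = k - t - 1`, and suppose that the shadow on level `j` is colex, but the one on level `j + 1`
is not. For a suitable vertex, the deletion and the link are extremal as well (`MinShadow.vertex`), so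
that their shadows are counted by vectors of numbers of edges, too. After the edges common to these
counts have been removed (`ColexBelow.split`), comparing them shows that one may move an edge of
size `j + 1` upwards and balance the additional kills by edges of larger sizes. This is
`CarryCondition`; all remaining terms of the comparison can be absorbed, because a vector of numbers
of edges stays one when its positions are lowered or further edges are inserted in late enough
positions (`kills_shift_absorb_merge`). If no vertex is suitable, then the edges of size `j + 1` have `j`
vertices in common, and level `j + 1` is colex (`ColexBelow.criterion`).

Conversely, a solution `L` of the carry condition gives the numbers of edges of Construction A or B:
the exchanged edge kills more sets than the edge that it replaces, and `L` balances the excess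
(`exchange_of_carry`). So the sets avoiding the construction are as many as in the colex case, on
every level. By the Kruskal–Katona theorem the shadow of one level is then the whole next level
(`Exchangeable.minShadow_family`), and the family is extremal. Level `j + 1` is not colex,
since the numbers of killed sets of size `j + 2` differ (`Exchangeable.not_isColexSegment`). This
shows that the constructions suffice (`exists_construction`).

The carry condition can be decided level by level. Its equation on the lowest level determines the
first number of edges; the excess moves to the next level by `C(y, s + 1) = ∑_{l < y} C(l, s)`, and
the condition fails precisely when on some level more edges are required than there are
(`carry_iff`). One level takes `O(n)` steps, which makes `O(nk)` altogether. The positions of the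
vertices `v_i` come from the binomial decomposition, or, if `m` is a number, from greedy unranking in
Pascal's triangle, whose entries are cut off at `m` so that they fit into a word. The edges
are written in a single pass over the positions of their last vertices (`listing`); there are at
most `n` edges of size at most `k`, which is `O(nk)` again. The programs are analysed with `Ends`, a
total correctness triple with a bound for the number of steps, in `ends_solve`, `ends_solveDecomp`
and `ends_solveNumber`.
-/

namespace ShadowDepth

/-! ### Sums of binomial coefficients along a vector of edge numbers -/

/-- The number of `(s + 1)`-sets killed by a colex hypergraph with `l i` edges of size `i + 1`, where
`P` is the number of vertices other than the first one. The `r`-th edge kills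
`C(P - r - (size - 1), s + 1 - size)` sets. Binomial coefficients with an integral upper entry are
used, so that Pascal's rule holds without exception. -/
def kills (l : ℕ → ℕ) (P : ℤ) : ℕ → ℤ
  | 0 => l 0
  | s + 1 => ∑ i ∈ Finset.range (l 0), Ring.choose (P - i) (s + 1) +
      kills (fun i => l (i + 1)) (P - l 0 - 1) s

theorem kills_zero (l : ℕ → ℕ) (P : ℤ) : kills l P 0 = l 0 := rfl

theorem kills_succ (l : ℕ → ℕ) (P : ℤ) (s : ℕ) :
    kills l P (s + 1) = ∑ i ∈ Finset.range (l 0), Ring.choose (P - i) (s + 1) +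
      kills (fun i => l (i + 1)) (P - l 0 - 1) s := rfl

theorem choose_pascal (y : ℤ) (s : ℕ) :
    Ring.choose (y + 1) (s + 1) = Ring.choose y s + Ring.choose y (s + 1) :=
  Ring.choose_succ_succ y s

theorem kills_congr {l l' : ℕ → ℕ} {P : ℤ} {s : ℕ} (h : ∀ i ≤ s, l i = l' i) :
    kills l P s = kills l' P s := by
  induction s generalizing l l' P with
  | zero => simp [kills_zero, h 0 le_rfl]
  | succ s ih =>
    rw [kills_succ, kills_succ, h 0 (Nat.zero_le _)]
    congr 1
    exact ih fun i hi => h (i + 1) (by omega)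

/-- The values `kills l P 0, …, kills l P n` determine `l 0, …, l n`. -/
theorem kills_inj {n : ℕ} {l l' : ℕ → ℕ} {P : ℤ} (h : ∀ s ≤ n, kills l P s = kills l' P s) :
    ∀ i ≤ n, l i = l' i := by
  induction n generalizing l l' P with
  | zero =>
    intro i hi
    obtain rfl : i = 0 := by omega
    have := h 0 le_rfl
    simpa [kills_zero] using this
  | succ n ih =>
    have h0 : l 0 = l' 0 := by simpa [kills_zero] using h 0 (Nat.zero_le _)
    intro i hi
    rcases i with _ | i
    · exact h0
    · refine ih (l := fun i => l (i + 1)) (l' := fun i => l' (i + 1)) (P := P - l 0 - 1)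
        (fun s hs => ?_) i (by omega)
      have := h (s + 1) (by omega)
      rw [kills_succ, kills_succ, h0] at this
      rw [h0]
      linarith

theorem kills_eq_zero {l : ℕ → ℕ} {P : ℤ} {s : ℕ} (h : ∀ i ≤ s, l i = 0) : kills l P s = 0 := by
  induction s generalizing l P with
  | zero => simp [kills_zero, h 0 le_rfl]
  | succ s ih =>
    rw [kills_succ, h 0 (Nat.zero_le _), ih fun i hi => h (i + 1) (by omega)]
    simp

/-- A single edge of size `1`. -/
theorem kills_single (Q : ℤ) (s : ℕ) :
    kills (fun i => if i = 0 then 1 else 0) Q s = Ring.choose Q s := by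
  rcases s with _ | s
  · simp [kills_zero]
  · rw [kills_succ, kills_eq_zero fun i _ => by simp]
    simp

/-- Splitting off the first `a` of the edges of size `1`. -/
theorem kills_add_head (a : ℕ) (l : ℕ → ℕ) (P : ℤ) (s : ℕ) :
    kills (fun i => if i = 0 then a + l 0 else l i) P s =
      ∑ i ∈ Finset.range a, Ring.choose (P - i) s + kills l (P - a) s := by
  rcases s with _ | s
  · simp [kills_zero]
  · rw [kills_succ, kills_succ]
    simp only [if_true, Nat.add_eq_zero_iff, one_ne_zero, and_false, if_false, Nat.cast_add]
    rw [Finset.sum_range_add, ← add_assoc]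
    congr 1
    · congr 1
      refine Finset.sum_congr rfl fun i _ => ?_
      congr 1; push_cast; ring
    · congr 1; ring

theorem sum_choose_telescope (Q : ℤ) (m s : ℕ) :
    Ring.choose (Q + m) (s + 1) = Ring.choose Q (s + 1) +
      ∑ i ∈ Finset.range m, Ring.choose (Q + i) s := by
  induction m with
  | zero => simp
  | succ m ih =>
    rw [Finset.sum_range_succ, Nat.cast_succ, ← add_assoc, choose_pascal, ih]
    ring

/-- Shifting, absorbing a finite family of single edges, and merging: the positions in a list of
edges may be lowered, and further edges may be inserted, at the cost of additional edges of larger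
sizes. The three facts are proved by a simultaneous induction on the number of levels. -/
theorem kills_shift_absorb_merge (n : ℕ) :
    (∀ (l : ℕ → ℕ) (P : ℤ) (m : ℕ), ∃ l' : ℕ → ℕ, (∀ i, l i ≤ l' i) ∧ l' 0 = l 0 ∧
      ∀ s ≤ n, kills l' (P - m) s = kills l P s) ∧
    (∀ (l : ℕ → ℕ) (P : ℤ) (Y : Multiset ℤ), (∀ y ∈ Y, P - l 0 ≤ y) → ∃ l' : ℕ → ℕ,
      (∀ i, l i ≤ l' i) ∧ l' 0 = l 0 + Y.card ∧
      ∀ s ≤ n, kills l' P s = kills l P s + (Y.map fun y => Ring.choose y s).sum) ∧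
    (∀ (l l₂ : ℕ → ℕ) (P Q : ℤ), P - l 0 ≤ Q → ∃ l' : ℕ → ℕ,
      (∀ i, l i ≤ l' i) ∧ l' 0 = l 0 + l₂ 0 ∧
      ∀ s ≤ n, kills l' P s = kills l P s + kills l₂ Q s) := by
  induction n with
  | zero =>
    refine ⟨fun l P m => ⟨l, fun _ => le_rfl, rfl, fun s hs => ?_⟩, fun l P Y hY =>
      ⟨fun i => if i = 0 then l 0 + Y.card else l i, fun i => ?_, by simp, fun s hs => ?_⟩,
      fun l l₂ P Q h => ⟨fun i => if i = 0 then l 0 + l₂ 0 else l i, fun i => ?_, by simp,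
        fun s hs => ?_⟩⟩
    · obtain rfl : s = 0 := by omega
      rfl
    · by_cases hi : i = 0 <;> simp [hi]
    · obtain rfl : s = 0 := by omega
      simp [kills_zero]
    · by_cases hi : i = 0 <;> simp [hi]
    · obtain rfl : s = 0 := by omega
      simp [kills_zero]
  | succ n ih =>
    obtain ⟨ihs, iha, ihm⟩ := ih
    -- lowering `Q` by `m` changes `C(Q, s + 1)` by `m` terms `C(y, s)` (Pascal), which are single
    -- edges one level up and are absorbed there
    have shift : ∀ (l : ℕ → ℕ) (P : ℤ) (m : ℕ), ∃ l' : ℕ → ℕ, (∀ i, l i ≤ l' i) ∧ l' 0 = l 0 ∧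
        ∀ s ≤ n + 1, kills l' (P - m) s = kills l P s := by
      intro l P m
      obtain ⟨l₁, h₁, h₁', h₁''⟩ := ihs (fun i => l (i + 1)) (P - l 0 - 1) m
      obtain ⟨l₂, h₂, h₂', h₂''⟩ := iha l₁ (P - m - l 0 - 1)
        (((Finset.range (l 0)).val.bind fun i : ℕ => (Finset.range m).val.map
          fun r : ℕ => (P - m - i + r : ℤ))) (by
          intro y hy
          simp only [Multiset.mem_bind, Finset.mem_val, Finset.mem_range, Multiset.mem_map] at hy
          obtain ⟨i, hi, r, hr, rfl⟩ := hy
          have : (i : ℤ) < l 0 := by exact_mod_cast hi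
          have : (0 : ℤ) ≤ r := by positivity
          have : (0 : ℤ) ≤ l₁ 0 := by positivity
          linarith)
      refine ⟨fun i => if i = 0 then l 0 else l₂ (i - 1), ?_, by simp, ?_⟩
      · intro i
        rcases i with _ | i
        · simp
        · simpa using (h₁ i).trans (h₂ i)
      · intro s hs
        rcases s with _ | s
        · simp [kills_zero]
        · rw [kills_succ, kills_succ]
          simp only [if_true, Nat.add_eq_zero_iff, one_ne_zero, and_false, if_false,
            Nat.add_sub_cancel]
          rw [h₂'' s (by omega)]
          have e : P - (m : ℤ) - l 0 - 1 = P - l 0 - 1 - m := by ring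
          rw [e, h₁'' s (by omega)]
          have key : ∑ i ∈ Finset.range (l 0), Ring.choose (P - i) (s + 1) =
              ∑ i ∈ Finset.range (l 0), Ring.choose (P - (m : ℤ) - i) (s + 1) +
              ∑ i ∈ Finset.range (l 0), ∑ r ∈ Finset.range m, Ring.choose (P - m - i + r : ℤ) s := by
            rw [← Finset.sum_add_distrib]
            refine Finset.sum_congr rfl fun i _ => ?_
            rw [← sum_choose_telescope]
            congr 1; ring
          rw [key]
          simp only [Multiset.map_bind, Multiset.sum_bind, Multiset.map_map, Function.comp_def]
          simp only [Finset.sum]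
          ring
    have absorb : ∀ (l : ℕ → ℕ) (P : ℤ) (Y : Multiset ℤ), (∀ y ∈ Y, P - l 0 ≤ y) →
        ∃ l' : ℕ → ℕ, (∀ i, l i ≤ l' i) ∧ l' 0 = l 0 + Y.card ∧
        ∀ s ≤ n + 1, kills l' P s = kills l P s + (Y.map fun y => Ring.choose y s).sum := by
      intro l P Y
      induction Y using Multiset.induction_on with
      | empty => exact fun _ => ⟨l, fun _ => le_rfl, by simp, fun s _ => by simp⟩
      | cons y Y ihY =>
        intro hY
        obtain ⟨l₀, h₀, h₀', h₀''⟩ := ihY fun y hy => hY y (Multiset.mem_cons_of_mem hy)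
        -- the new edge is put behind the edges of size `1` of `l₀`; the difference to its actual
        -- position `y` is absorbed one level up
        have hy : P - l₀ 0 ≤ y := by
          have h1 := hY y (Multiset.mem_cons_self _ _)
          have h2 : (l 0 : ℤ) ≤ l₀ 0 := by exact_mod_cast h₀ 0
          linarith
        obtain ⟨m, hm⟩ := Int.eq_ofNat_of_zero_le (sub_nonneg.2 hy)
        have hm' : y = P - l₀ 0 + m := by linarith
        obtain ⟨l₁, h₁, h₁', h₁''⟩ := ihs (fun i => l₀ (i + 1)) (P - l₀ 0 - 1) 1
        obtain ⟨l₂, h₂, h₂', h₂''⟩ := iha l₁ (P - l₀ 0 - 1 - (1 : ℕ))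
          ((Finset.range m).val.map fun r : ℕ => (P - l₀ 0 + r : ℤ)) (by
            intro y hy
            simp only [Finset.mem_val, Finset.mem_range, Multiset.mem_map] at hy
            obtain ⟨r, hr, rfl⟩ := hy
            have : (0 : ℤ) ≤ r := by positivity
            have : (0 : ℤ) ≤ l₁ 0 := by positivity
            push_cast
            linarith)
        refine ⟨fun i => if i = 0 then l₀ 0 + 1 else l₂ (i - 1), ?_, ?_, ?_⟩
        · intro i
          rcases i with _ | i
          · simpa using (h₀ 0).trans (Nat.le_succ _)
          · simpa using (h₀ (i + 1)).trans ((h₁ i).trans (h₂ i))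
        · simp [h₀']; ring
        · intro s hs
          have e1 := h₀'' s hs
          rcases s with _ | s
          · simp only [kills_zero, Multiset.map_cons, Multiset.sum_cons] at e1 ⊢
            simp only [if_true]
            push_cast
            rw [e1]
            simp
            ring
          · rw [Multiset.map_cons, Multiset.sum_cons]
            rw [kills_succ l₀] at e1
            rw [kills_succ]
            simp only [if_true, Nat.add_eq_zero_iff, one_ne_zero, and_false, if_false,
              Nat.add_sub_cancel]
            have e : P - ((l₀ 0 + 1 : ℕ) : ℤ) - 1 = P - l₀ 0 - 1 - (1 : ℕ) := by push_cast; ring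
            rw [e, h₂'' s (by omega), h₁'' s (by omega), Finset.sum_range_succ, hm',
              sum_choose_telescope]
            simp only [Multiset.map_map, Function.comp_def, Finset.sum] at e1 ⊢
            linarith
    -- merging: the edges of size `1` of `l₂` are put behind those of `l`, and the vectors of the
    -- larger edges are merged by induction
    refine ⟨shift, absorb, ?_⟩
    intro l l₂ P Q hQ
    obtain ⟨m, hm⟩ := Int.eq_ofNat_of_zero_le (sub_nonneg.2 hQ)
    obtain ⟨l₁, h₁, h₁', h₁''⟩ := ihs (fun i => l (i + 1)) (P - l 0 - 1) (l₂ 0)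
    obtain ⟨l₃, h₃, h₃', h₃''⟩ := iha l₁ (P - l 0 - 1 - l₂ 0)
      (((Finset.range (l₂ 0)).val.bind fun r : ℕ => (Finset.range m).val.map
        fun q : ℕ => (P - l 0 - r + q : ℤ))) (by
        intro y hy
        simp only [Multiset.mem_bind, Finset.mem_val, Finset.mem_range, Multiset.mem_map] at hy
        obtain ⟨r, hr, q, hq, rfl⟩ := hy
        have : (r : ℤ) < l₂ 0 := by exact_mod_cast hr
        have : (0 : ℤ) ≤ q := by positivity
        have : (0 : ℤ) ≤ l₁ 0 := by positivity
        linarith)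
    obtain ⟨l₄, h₄, h₄', h₄''⟩ := ihm l₃ (fun i => l₂ (i + 1)) (P - l 0 - 1 - l₂ 0)
      (Q - l₂ 0 - 1) (by
        have : (0 : ℤ) ≤ l₃ 0 := by positivity
        linarith)
    refine ⟨fun i => if i = 0 then l 0 + l₂ 0 else l₄ (i - 1), ?_, by simp, ?_⟩
    · intro i
      rcases i with _ | i
      · simp
      · simpa using ((h₁ i).trans (h₃ i)).trans (h₄ i)
    · intro s hs
      rcases s with _ | s
      · simp [kills_zero]
      · rw [kills_succ, kills_succ l, kills_succ l₂]
        simp only [if_true, Nat.add_eq_zero_iff, one_ne_zero, and_false, if_false,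
          Nat.add_sub_cancel]
        have e : P - ((l 0 + l₂ 0 : ℕ) : ℤ) - 1 = P - l 0 - 1 - l₂ 0 := by push_cast; ring
        rw [e, h₄'' s (by omega), h₃'' s (by omega), h₁'' s (by omega), Finset.sum_range_add]
        have key : ∑ r ∈ Finset.range (l₂ 0), Ring.choose (Q - r) (s + 1) =
            ∑ r ∈ Finset.range (l₂ 0), Ring.choose (P - ((l 0 + r : ℕ) : ℤ)) (s + 1) +
            ∑ r ∈ Finset.range (l₂ 0), ∑ q ∈ Finset.range m,
              Ring.choose (P - l 0 - r + q : ℤ) s := by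
          rw [← Finset.sum_add_distrib]
          refine Finset.sum_congr rfl fun r _ => ?_
          have e1 : P - ((l 0 + r : ℕ) : ℤ) = P - l 0 - r := by push_cast; ring
          rw [e1, ← sum_choose_telescope]
          have : (m : ℤ) = Q - (P - l 0) := hm.symm
          rw [this]
          congr 1; ring
        rw [key]
        simp only [Multiset.map_bind, Multiset.sum_bind, Multiset.map_map, Function.comp_def]
        simp only [Finset.sum]
        ring

theorem kills_shift (n : ℕ) (l : ℕ → ℕ) (P : ℤ) (m : ℕ) : ∃ l' : ℕ → ℕ, (∀ i, l i ≤ l' i) ∧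
    l' 0 = l 0 ∧ ∀ s ≤ n, kills l' (P - m) s = kills l P s :=
  (kills_shift_absorb_merge n).1 l P m

theorem kills_absorb (n : ℕ) (l : ℕ → ℕ) (P : ℤ) (Y : Multiset ℤ) (hY : ∀ y ∈ Y, P - l 0 ≤ y) :
    ∃ l' : ℕ → ℕ, (∀ i, l i ≤ l' i) ∧ l' 0 = l 0 + Y.card ∧
      ∀ s ≤ n, kills l' P s = kills l P s + (Y.map fun y => Ring.choose y s).sum :=
  (kills_shift_absorb_merge n).2.1 l P Y hY

theorem kills_merge (n : ℕ) (l l₂ : ℕ → ℕ) (P Q : ℤ) (h : P - l 0 ≤ Q) :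
    ∃ l' : ℕ → ℕ, (∀ i, l i ≤ l' i) ∧ l' 0 = l 0 + l₂ 0 ∧
      ∀ s ≤ n, kills l' P s = kills l P s + kills l₂ Q s :=
  (kills_shift_absorb_merge n).2.2 l l₂ P Q h

/-- Splitting off the edges of the `a` smallest sizes. -/
theorem kills_add (l : ℕ → ℕ) (P : ℤ) (a s : ℕ) :
    kills l P (s + a) = kills (fun i => if i < a then l i else 0) P (s + a) +
      kills (fun i => l (i + a)) (P - ∑ i ∈ Finset.range a, (l i : ℤ) - a) s := by
  induction a generalizing l P with
  | zero => simp [kills_eq_zero]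
  | succ a ih =>
    rw [← add_assoc, kills_succ, kills_succ, ih]
    simp only [Nat.zero_lt_succ, if_true, Nat.add_lt_add_iff_right]
    rw [Finset.sum_range_succ']
    have : P - (∑ i ∈ Finset.range a, (l (i + 1) : ℤ) + l 0) - ((a + 1 : ℕ) : ℤ) =
        P - l 0 - 1 - ∑ i ∈ Finset.range a, (l (i + 1) : ℤ) - a := by push_cast; ring
    rw [this]
    simp only [add_assoc]

theorem kills_add_of_zero {l : ℕ → ℕ} {a : ℕ} (h : ∀ i < a, l i = 0) (P : ℤ) (s : ℕ) :
    kills l P (s + a) = kills (fun i => l (i + a)) (P - a) s := by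
  rw [kills_add, kills_eq_zero, Finset.sum_eq_zero, zero_add, sub_zero]
  · exact fun i hi => by simp [h i (Finset.mem_range.1 hi)]
  · exact fun i _ => by by_cases hi : i < a <;> simp [hi, h]

/-- The number of killed sets as an explicit double sum. -/
theorem kills_eq_sum (l : ℕ → ℕ) (P : ℤ) (s : ℕ) :
    kills l P s = ∑ i ∈ Finset.range (s + 1), ∑ r ∈ Finset.range (l i),
      Ring.choose (P - ∑ q ∈ Finset.range i, (l q : ℤ) - i - r) (s - i) := by
  induction s generalizing l P with
  | zero => simp [kills_zero]
  | succ s ih =>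
    rw [kills_succ, Finset.sum_range_succ', ih, add_comm]
    congr 1
    · refine Finset.sum_congr rfl fun i _ => Finset.sum_congr rfl fun r _ => ?_
      rw [Finset.sum_range_succ', Nat.succ_sub_succ]
      congr 1; push_cast; ring
    · simp

/-- One step of `kills_peel`: by Pascal's rule, the common edges of size `1` cancel in the deletion,
and as many edges of size `1` cancel in the link. -/
theorem kills_peel_one {l g h : ℕ → ℕ} {P : ℤ} {n : ℕ} (hn : 1 ≤ n)
    (hs : ∀ s < n, kills l P (s + 1) = kills g (P - 1) (s + 1) + kills h (P - 1) s)
    (hg : g 0 = l 0) (hle : g 1 ≤ l 1) :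
    h 0 = l 0 + (l 1 - g 1) ∧
    ∀ s ≤ n - 1, kills (fun i => l (i + 1)) (P - l 0 - 1) s =
      kills (fun i => g (i + 1)) (P - l 0 - 1 - 1) s +
      kills (fun i => if i = 0 then l 1 - g 1 else h i) (P - l 0 - 1) s := by
  have hP (s : ℕ) : ∑ i ∈ Finset.range (l 0), Ring.choose (P - i) (s + 1) =
      ∑ i ∈ Finset.range (l 0), Ring.choose (P - 1 - i) s +
      ∑ i ∈ Finset.range (l 0), Ring.choose (P - 1 - i) (s + 1) := by
    rw [← Finset.sum_add_distrib]
    refine Finset.sum_congr rfl fun i _ => ?_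
    rw [← choose_pascal]
    congr 1; ring
  have h0 : h 0 = l 0 + (l 1 - g 1) := by
    have := hs 0 hn
    rw [kills_succ, kills_succ g, hg, hP] at this
    simp only [kills_zero, Ring.choose_zero_right, Finset.sum_const, Finset.card_range,
      nsmul_eq_mul, mul_one, zero_add] at this
    omega
  refine ⟨h0, fun s hsn => ?_⟩
  have := hs s (by omega)
  rw [kills_succ, kills_succ g, hg, hP] at this
  have e : kills h (P - 1) s = ∑ i ∈ Finset.range (l 0), Ring.choose (P - 1 - i) s +
      kills (fun i => if i = 0 then l 1 - g 1 else h i) (P - 1 - l 0) s := by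
    rw [← kills_add_head]
    refine kills_congr fun i _ => ?_
    rcases i with _ | i
    · simp [h0]
    · simp
  rw [e] at this
  have e1 : P - 1 - (l 0 : ℤ) = P - l 0 - 1 := by ring
  rw [e1] at this
  linarith

/-- Suppose that the sets killed by `l` are counted by splitting them according to whether they
contain a given vertex, the deletion being counted by `g` and the link by `h`. If `l` and `g` begin
with the same `a` numbers of edges, then these edges can be removed from both counts. -/
theorem kills_peel (a : ℕ) (ha : 1 ≤ a) {l g h : ℕ → ℕ} {P : ℤ} {n : ℕ} (hn : a ≤ n)
    (h0 : kills l P 0 = kills g (P - 1) 0)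
    (hs : ∀ s < n, kills l P (s + 1) = kills g (P - 1) (s + 1) + kills h (P - 1) s)
    (hg : ∀ i < a, g i = l i) (hle : g a ≤ l a) :
    (∀ i < a - 1, h i = l i) ∧ h (a - 1) = l (a - 1) + (l a - g a) ∧
    ∀ s ≤ n - a, kills (fun i => l (i + a)) (P - ∑ i ∈ Finset.range a, (l i : ℤ) - a) s =
      kills (fun i => g (i + a)) (P - ∑ i ∈ Finset.range a, (l i : ℤ) - a - 1) s +
      kills (fun i => if i = 0 then l a - g a else h (i + a - 1))
        (P - ∑ i ∈ Finset.range a, (l i : ℤ) - a) s := by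
  induction a, ha using Nat.le_induction generalizing l g h P n with
  | base =>
    obtain ⟨h1, h2⟩ := kills_peel_one hn hs (hg 0 (by omega)) hle
    refine ⟨fun i hi => absurd hi (by omega), h1, fun s hs' => ?_⟩
    simpa using h2 s hs'
  | succ a ha ih =>
    have e0 := hg 0 (by omega)
    have e1 := hg 1 (by omega)
    obtain ⟨h1, h2⟩ := kills_peel_one (by omega) hs e0 e1.le
    have h1' : h 0 = l 0 := by omega
    obtain ⟨h3, h4, h5⟩ := ih (l := fun i => l (i + 1)) (g := fun i => g (i + 1))
      (h := fun i => h (i + 1)) (P := P - l 0 - 1) (n := n - 1) (by omega)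
      (by simp [kills_zero, e1]) (fun s hsn => by
        rw [h2 (s + 1) (by omega), add_right_inj, kills_succ]
        simp [e1]) (fun i hi => hg (i + 1) (by omega)) hle
    have hsum : P - ∑ i ∈ Finset.range (a + 1), (l i : ℤ) - ((a + 1 : ℕ) : ℤ) =
        P - l 0 - 1 - ∑ i ∈ Finset.range a, (l (i + 1) : ℤ) - a := by
      rw [Finset.sum_range_succ']
      push_cast; ring
    refine ⟨fun i hi => ?_, ?_, fun s hs' => ?_⟩
    · rcases i with _ | i
      · exact h1'
      · exact h3 i (by omega)
    · have : a + 1 - 1 = a - 1 + 1 := by omega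
      rw [this, h4]
    · have := h5 s (by omega)
      rw [hsum]
      simp only [add_assoc] at this ⊢
      rw [this]
      congr 1
      refine kills_congr fun i _ => ?_
      by_cases hi : i = 0
      · simp [hi]
      · simp only [hi, if_false]
        congr 1; omega

/-- The arithmetical condition that decides about the depth. Here `m` is the vector of the numbers of
edges of size larger than `j + 1` of a colex hypergraph, `x` is the number of vertices below
`v_{j+1}`, and `t` is the number of levels concerned. A hypergraph that differs from the colex one in
one edge of size `j + 1` kills `C(x + 1, s) + ⋯ + C(x + c - 1, s)` sets more than that one does, and
these must be balanced by having only `L 0, L 1, …` instead of `m 0, m 1, …` edges. -/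
def CarryCondition (c t : ℕ) (x : ℤ) (m : ℕ → ℕ) : Prop :=
  ∃ L : ℕ → ℕ, (c = 1 → 1 ≤ L 0) ∧ ∀ s < t,
    kills m (x - 1) s = kills L x s + ∑ q ∈ Finset.range (c - 1), Ring.choose (x + 1 + q) s

/-- The condition gets weaker when the exchanged edge is moved less far: the terms that are no longer
in the sum are absorbed by `L`. -/
theorem CarryCondition.mono {c c' t : ℕ} {x : ℤ} {m : ℕ → ℕ} (hc : 1 ≤ c) (hcc : c ≤ c')
    (h : CarryCondition c' t x m) : CarryCondition c t x m := by
  obtain ⟨L, hL, h⟩ := h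
  obtain ⟨L', hL₁, hL₂, hL₃⟩ := kills_absorb t L x
    ((Finset.range (c' - c)).val.map fun q : ℕ => x + 1 + (c - 1 : ℕ) + q) (by
      intro y hy
      obtain ⟨q, -, rfl⟩ := Multiset.mem_map.1 hy
      have : (0 : ℤ) ≤ L 0 := by positivity
      have : (0 : ℤ) ≤ (c - 1 : ℕ) := by positivity
      have : (0 : ℤ) ≤ q := by positivity
      linarith)
  refine ⟨L', fun h1 => ?_, fun s hs => ?_⟩
  · rw [hL₂]
    rcases hcc.eq_or_lt with rfl | hlt
    · exact (hL h1).trans (Nat.le_add_right _ _)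
    · simp; omega
  · rw [h s hs, hL₃ s hs.le]
    have : c' - 1 = (c - 1) + (c' - c) := by omega
    rw [this, Finset.sum_range_add, Multiset.map_map]
    simp only [Finset.sum, Function.comp_def, Nat.cast_add, ← add_assoc]
    ring

/-- The count behind the necessity of the carry condition when at least two of the relevant edges
contain the chosen vertex: all but one of the edges avoiding the vertex can be moved to the link. -/
theorem carry_of_two {l g h : ℕ → ℕ} {P : ℤ} {H n : ℕ} (hg : 1 ≤ g 0) (hh : 2 ≤ H + h 0)
    (hs : ∀ s ≤ n, kills l P s = kills h P s + kills g (P + H - 1) s) :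
    CarryCondition (H + l 0 - 1) n (P - l 0) fun i => l (i + 1) := by
  have h0 : l 0 = h 0 + g 0 := by
    have := hs 0 (Nat.zero_le _)
    simp only [kills_zero] at this
    exact_mod_cast this
  -- one edge of `g`, at the position `P + H - 1`, is kept apart, and the others are merged into `h`
  obtain ⟨l', h₁, h₂, h₃⟩ := kills_merge n h (fun i => if i = 0 then g 0 - 1 else g i) P
    (P + H - 2) (by
      have : (2 : ℤ) ≤ H + h 0 := by exact_mod_cast hh
      linarith)
  refine ⟨fun i => l' (i + 1), fun hc => absurd hc (by omega), fun s hsn => ?_⟩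
  have e1 := hs (s + 1) (by omega)
  have e2 := h₃ (s + 1) (by omega)
  have e3 : kills g (P + H - 1) (s + 1) = Ring.choose (P + H - 1) (s + 1) +
      kills (fun i => if i = 0 then g 0 - 1 else g i) (P + H - 2) (s + 1) := by
    have := kills_add_head 1 (fun i => if i = 0 then g 0 - 1 else g i) (P + H - 1) (s + 1)
    have e : P + H - 1 - ((1 : ℕ) : ℤ) = P + H - 2 := by push_cast; ring
    rw [e] at this
    simp only [Finset.sum_range_one, Nat.cast_zero, sub_zero] at this
    rw [← this]
    refine kills_congr fun i _ => ?_
    rcases i with _ | i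
    · simp; omega
    · simp
  rw [kills_succ] at e1
  rw [kills_succ l'] at e2
  have h2' : l 0 = l' 0 + 1 := by simp at h₂; omega
  rw [h2', Finset.sum_range_succ] at e1
  have e4 : P - (l' 0 : ℤ) = P - l 0 + 1 := by rw [h2']; push_cast; ring
  -- in the position of the last edge of size `1` of `l` there is the edge that has been kept apart;
  -- the difference of the positions telescopes to the sum in the carry condition
  have e5 : P + H - 1 = P - l 0 + 1 + (H + l 0 - 1 - 1 : ℕ) := by
    have : H + l 0 - 1 - 1 + 2 = H + l 0 := by omega
    have : ((H + l 0 - 1 - 1 : ℕ) : ℤ) + 2 = H + l 0 := by exact_mod_cast this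
    linarith
  rw [e3, e5, sum_choose_telescope] at e1
  have e6 : P - ((l' 0 + 1 : ℕ) : ℤ) - 1 = P - l 0 - 1 := by rw [h2']
  have e7 : P - (l' 0 : ℤ) - 1 = P - l 0 := by rw [e4]; ring
  rw [e6, e4] at e1
  rw [e7] at e2
  linarith

/-- The same when only one relevant edge contains the chosen vertex; here the edges avoiding the
vertex account for additional edges of the link. -/
theorem carry_of_one {l g h : ℕ → ℕ} {P : ℤ} {H n : ℕ} (hg : 1 ≤ g 0) (hh : H + h 0 = 1)
    (hs : ∀ s ≤ n, kills l P s = kills h P s + kills g (P + H - 1) s) (h1 : 1 ≤ n → g 0 ≤ h 1) :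
    CarryCondition (H + l 0 - 1) n (P - l 0) fun i => l (i + 1) := by
  rcases n with _ | n
  · exact ⟨fun _ => 1, fun _ => le_rfl, fun s hs => absurd hs (by omega)⟩
  replace h1 := h1 (by omega)
  have h0 : l 0 = h 0 + g 0 := by
    have := hs 0 (Nat.zero_le _)
    simp only [kills_zero] at this
    exact_mod_cast this
  have hc : H + l 0 - 1 = g 0 := by omega
  rw [hc]
  set x : ℤ := P - l 0 with hx
  have hH : (H : ℤ) + h 0 = 1 := by exact_mod_cast hh
  have h0' : (l 0 : ℤ) = h 0 + g 0 := by exact_mod_cast h0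
  obtain ⟨L, hL₁, hL₂, hL₃⟩ := kills_merge n
    (fun i => if i = 0 then h 1 - (g 0 - 1) else h (i + 1)) (fun i => g (i + 1)) x (x - 1) (by
      have : 1 ≤ h 1 - (g 0 - 1) := by omega
      have : (1 : ℤ) ≤ (h 1 - (g 0 - 1) : ℕ) := by exact_mod_cast this
      simp only [if_true]
      linarith)
  refine ⟨L, fun _ => ?_, fun s hsn => ?_⟩
  · have := hL₁ 0
    simp only [if_true] at this
    omega
  · have e1 := hs (s + 1) (by omega)
    rw [kills_succ, kills_succ h, kills_succ g, h0, Finset.sum_range_add] at e1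
    have e2 : P - ((h 0 + g 0 : ℕ) : ℤ) - 1 = x - 1 := by rw [hx, h0]
    have e3 : P + (H : ℤ) - 1 - g 0 - 1 = x - 1 := by linarith
    have e4 : ∑ i ∈ Finset.range (g 0), Ring.choose (P - ((h 0 + i : ℕ) : ℤ)) (s + 1) =
        ∑ i ∈ Finset.range (g 0), Ring.choose (P + (H : ℤ) - 1 - i) (s + 1) := by
      refine Finset.sum_congr rfl fun i _ => ?_
      congr 1; push_cast; linarith
    -- `g 0 - 1` of the edges of size `2` of the link are those in the sum of the carry condition
    have e5 : kills (fun i => h (i + 1)) (P - h 0 - 1) s =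
        ∑ q ∈ Finset.range (g 0 - 1), Ring.choose (x + 1 + q) s +
        kills (fun i => if i = 0 then h 1 - (g 0 - 1) else h (i + 1)) x s := by
      have := kills_add_head (g 0 - 1) (fun i => if i = 0 then h 1 - (g 0 - 1) else h (i + 1))
        (P - h 0 - 1) s
      have hgc : ((g 0 - 1 : ℕ) : ℤ) = g 0 - 1 := by push_cast [hg]; ring
      have e6 : P - h 0 - 1 - ((g 0 - 1 : ℕ) : ℤ) = x := by rw [hgc]; linarith
      rw [e6, ← Finset.sum_range_reflect] at this
      have e7 : ∑ j ∈ Finset.range (g 0 - 1),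
          Ring.choose (P - (h 0 : ℤ) - 1 - ((g 0 - 1 - 1 - j : ℕ) : ℤ)) s =
          ∑ q ∈ Finset.range (g 0 - 1), Ring.choose (x + 1 + q) s := by
        refine Finset.sum_congr rfl fun q hq => ?_
        have hq := Finset.mem_range.1 hq
        have : g 0 - 1 - 1 - q + q + 2 = g 0 := by omega
        have : ((g 0 - 1 - 1 - q : ℕ) : ℤ) + q + 2 = g 0 := by exact_mod_cast this
        congr 1; linarith
      rw [e7] at this
      rw [← this]
      refine kills_congr fun i _ => ?_
      rcases i with _ | i
      · simp; omega
      · simp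
    rw [e2, e3, e4, e5] at e1
    have e8 := hL₃ s (by omega)
    linarith

/-- Removing the edges of size at most `a` from a count split by the deletion and the link. -/
theorem kills_split_tail {l g h : ℕ → ℕ} {P : ℤ} {a n : ℕ}
    (hs : ∀ s ≤ n + a, kills l P s = kills h P s + kills g (P - 1) s) (hg : ∀ i < a, g i = 0) :
    (∀ i < a, l i = h i) ∧
    ∀ s ≤ n, kills (fun i => l (i + a)) (P - ∑ i ∈ Finset.range a, (l i : ℤ) - a) s =
      kills (fun i => h (i + a)) (P - ∑ i ∈ Finset.range a, (l i : ℤ) - a) s +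
      kills (fun i => g (i + a)) (P - ∑ i ∈ Finset.range a, (l i : ℤ) - a +
        (∑ i ∈ Finset.range a, l i : ℕ) - 1) s := by
  have hl : ∀ i < a, l i = h i := by
    rcases a with _ | a
    · exact fun i hi => absurd hi (by omega)
    · intro i hi
      refine kills_inj (n := a) (P := P) (fun s hsa => ?_) i (by omega)
      rw [hs s (by omega), kills_eq_zero (l := g) fun i hi => hg i (by omega), add_zero]
  refine ⟨hl, fun s hsn => ?_⟩
  have e := hs (s + a) (by omega)
  rw [kills_add l, kills_add h, kills_add_of_zero hg] at e
  have e1 : (fun i => if i < a then l i else 0) = fun i => if i < a then h i else 0 := by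
    funext i
    by_cases hi : i < a <;> simp [hi, hl]
  have e2 : ∑ i ∈ Finset.range a, (h i : ℤ) = ∑ i ∈ Finset.range a, (l i : ℤ) :=
    Finset.sum_congr rfl fun i hi => by rw [hl i (Finset.mem_range.1 hi)]
  have e3 : P - ∑ i ∈ Finset.range a, (l i : ℤ) - a + (∑ i ∈ Finset.range a, l i : ℕ) - 1 =
      P - 1 - a := by push_cast; ring
  rw [e1, e2] at e
  rw [e3]
  linarith

open Finset Finset.Colex

/-! ### Families with minimum shadow -/

/-- `S` is a family of `k`-sets whose shadow is as small as that of an initial segment of the colex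
order. -/
def MinShadow {n : ℕ} (k : ℕ) (S : Finset (Finset (Fin n))) : Prop :=
  (S : Set (Finset (Fin n))).Sized k ∧
    ∀ C : Finset (Finset (Fin n)), IsInitSeg C k → C.card = S.card → S.shadow.card ≤ C.shadow.card

theorem exists_isInitSeg {n k m : ℕ} (hm : m ≤ n.choose k) :
    ∃ C : Finset (Finset (Fin n)), IsInitSeg C k ∧ C.card = m := by
  induction m with
  | zero => exact ⟨∅, by simp, rfl⟩
  | succ m ih =>
    obtain ⟨C, hC, rfl⟩ := ih (by omega)
    have hsub : C ⊆ powersetCard k univ := fun s hs => mem_powersetCard_univ.2 (hC.1 hs)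
    have hne : ((powersetCard k univ \ C).image toColex).Nonempty := by
      rw [image_nonempty, ← card_pos, card_sdiff_of_subset hsub, card_powersetCard, card_fin]
      omega
    obtain ⟨a, ha, hmin⟩ := exists_minimal hne
    obtain ⟨s, hs, rfl⟩ := mem_image.1 ha
    rw [mem_sdiff, mem_powersetCard_univ] at hs
    refine ⟨insert s C, ⟨?_, ?_⟩, card_insert_of_notMem hs.2⟩
    · intro t ht
      rcases mem_insert.1 (mem_coe.1 ht) with rfl | ht
      · exact hs.1
      · exact hC.1 ht
    · rintro t u ht ⟨hut, hu⟩
      rcases mem_insert.1 ht with rfl | ht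
      · by_contra hu'
        rw [mem_insert, not_or] at hu'
        have := hmin (mem_image_of_mem _ (mem_sdiff.2 ⟨mem_powersetCard_univ.2 hu, hu'.2⟩)) hut.le
        exact absurd hut (not_lt.2 this)
      · exact mem_insert_of_mem (hC.2 ht ⟨hut, hu⟩)

theorem isInitSeg_eq_of_card_eq {n k : ℕ} {C C' : Finset (Finset (Fin n))} (h : IsInitSeg C k)
    (h' : IsInitSeg C' k) (hc : C.card = C'.card) : C = C' := by
  rcases h.total h' with h | h
  · exact eq_of_subset_of_card_le h hc.ge
  · exact (eq_of_subset_of_card_le h hc.le).symm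

theorem exists_isInitSeg_of_sized {n k : ℕ} {S : Finset (Finset (Fin n))}
    (hS : (S : Set (Finset (Fin n))).Sized k) : ∃ C : Finset (Finset (Fin n)),
    IsInitSeg C k ∧ C.card = S.card := by
  refine exists_isInitSeg ?_
  have : S ⊆ powersetCard k univ := fun s hs => mem_powersetCard_univ.2 (hS hs)
  simpa using card_le_card this

theorem MinShadow.card_eq {n k : ℕ} {S C : Finset (Finset (Fin n))} (hS : MinShadow k S)
    (hC : IsInitSeg C k) (hc : C.card = S.card) : S.shadow.card = C.shadow.card :=
  (hS.2 C hC hc).antisymm (kruskal_katona hS.1 hc.le hC)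

theorem minShadow_of_isInitSeg {n k : ℕ} {C : Finset (Finset (Fin n))} (hC : IsInitSeg C k) :
    MinShadow k C :=
  ⟨hC.1, fun _ hC' hc => (isInitSeg_eq_of_card_eq hC' hC hc) ▸ le_rfl⟩

theorem MinShadow.mono {n k : ℕ} {S S' : Finset (Finset (Fin n))} (hS : MinShadow k S)
    (hS' : (S' : Set (Finset (Fin n))).Sized k) (h : S.card ≤ S'.card) :
    S.shadow.card ≤ S'.shadow.card := by
  obtain ⟨C, hC, hc⟩ := exists_isInitSeg_of_sized hS.1
  rw [hS.card_eq hC hc]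
  exact kruskal_katona hS' (hc.le.trans h) hC

theorem MinShadow.congr {n k : ℕ} {S S' : Finset (Finset (Fin n))} (hS : MinShadow k S)
    (hS' : (S' : Set (Finset (Fin n))).Sized k) (h : S'.card = S.card)
    (h' : S'.shadow.card ≤ S.shadow.card) : MinShadow k S' :=
  ⟨hS', fun C hC hc => h'.trans (hS.2 C hC (hc.trans h))⟩

section Vertex

variable {α : Type*} [DecidableEq α]

theorem memberSubfamily_shadow (v : α) (S : Finset (Finset α)) :
    S.shadow.memberSubfamily v = (S.memberSubfamily v).shadow := by
  ext s
  simp only [mem_memberSubfamily, mem_shadow_iff_insert_mem]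
  constructor
  · rintro ⟨⟨a, ha, h⟩, hv⟩
    rw [mem_insert, not_or] at ha
    refine ⟨a, ha.2, by rwa [insert_comm], ?_⟩
    rw [mem_insert, not_or]
    exact ⟨fun h => ha.1 h.symm, hv⟩
  · rintro ⟨a, ha, h, hv⟩
    rw [mem_insert, not_or] at hv
    refine ⟨⟨a, ?_, by rwa [insert_comm]⟩, hv.2⟩
    rw [mem_insert, not_or]
    exact ⟨fun h => hv.1 h.symm, ha⟩

theorem nonMemberSubfamily_shadow (v : α) (S : Finset (Finset α)) :
    S.shadow.nonMemberSubfamily v =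
      (S.nonMemberSubfamily v).shadow ∪ S.memberSubfamily v := by
  ext s
  simp only [mem_nonMemberSubfamily, mem_union, mem_memberSubfamily, mem_shadow_iff_insert_mem]
  constructor
  · rintro ⟨⟨a, ha, h⟩, hv⟩
    by_cases hav : a = v
    · subst hav
      exact Or.inr ⟨h, ha⟩
    · refine Or.inl ⟨a, ha, h, ?_⟩
      rw [mem_insert, not_or]
      exact ⟨fun h => hav h.symm, hv⟩
  · rintro (⟨a, ha, h, hv⟩ | ⟨h, hv⟩)
    · rw [mem_insert, not_or] at hv
      exact ⟨⟨a, ha, h⟩, hv.2⟩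
    · exact ⟨⟨v, hv, h⟩, hv⟩

theorem card_shadow_eq (v : α) (S : Finset (Finset α)) :
    S.shadow.card = ((S.nonMemberSubfamily v).shadow ∪ S.memberSubfamily v).card +
      (S.memberSubfamily v).shadow.card := by
  rw [← card_memberSubfamily_add_card_nonMemberSubfamily v, memberSubfamily_shadow,
    nonMemberSubfamily_shadow, add_comm]

theorem sized_memberSubfamily {v : α} {S : Finset (Finset α)} {k : ℕ}
    (hS : (S : Set (Finset α)).Sized (k + 1)) :
    (S.memberSubfamily v : Set (Finset α)).Sized k := by
  intro s hs
  obtain ⟨h, hv⟩ := mem_memberSubfamily.1 (mem_coe.1 hs)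
  have := hS (mem_coe.2 h)
  rw [card_insert_of_notMem hv] at this
  omega

theorem sized_nonMemberSubfamily {v : α} {S : Finset (Finset α)} {k : ℕ}
    (hS : (S : Set (Finset α)).Sized k) :
    (S.nonMemberSubfamily v : Set (Finset α)).Sized k := fun _ hs =>
  hS (mem_coe.2 (mem_nonMemberSubfamily.1 (mem_coe.1 hs)).1)

end Vertex

theorem card_le_choose_of_notMem {N k : ℕ} {v : Fin (N + 1)} {S : Finset (Finset (Fin (N + 1)))}
    (hS : (S : Set (Finset (Fin (N + 1)))).Sized k) (hv : ∀ s ∈ S, v ∉ s) :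
    S.card ≤ N.choose k := by
  have : S ⊆ powersetCard k (univ.erase v) := fun s hs => mem_powersetCard.2
    ⟨fun x hx => mem_erase.2 ⟨fun h => hv s hs (h ▸ hx), mem_univ _⟩, hS hs⟩
  simpa using card_le_card this

theorem last_notMem_of_card_le {N k : ℕ} {C : Finset (Finset (Fin (N + 1)))}
    (hC : IsInitSeg C k) (hc : C.card ≤ N.choose k) : ∀ s ∈ C, Fin.last N ∉ s := by
  intro s hs hl
  have hsub : insert s (powersetCard k (univ.erase (Fin.last N))) ⊆ C := by
    intro t ht
    rcases mem_insert.1 ht with rfl | ht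
    · exact hs
    · obtain ⟨h1, h2⟩ := mem_powersetCard.1 ht
      refine hC.2 hs ⟨?_, h2⟩
      rw [toColex_lt_toColex_iff_exists_forall_lt]
      refine ⟨Fin.last N, hl, fun h => by simpa using h1 h, fun b hb _ => ?_⟩
      have := h1 hb
      exact Fin.lt_last_iff_ne_last.2 (mem_erase.1 this).1
  have := card_le_card hsub
  rw [card_insert_of_notMem, card_powersetCard, card_erase_of_mem (mem_univ _), card_fin] at this
  · simp at this; omega
  · intro h
    simpa using (mem_powersetCard.1 h).1 hl

/-- The comparison of a family with minimum shadow with the family obtained by replacing the deletion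
and the link of a vertex by initial segments, the vertex becoming the last one. As the shadow cannot
get smaller, the deletion and the link are rather special. -/
theorem MinShadow.vertex {N k : ℕ} {S : Finset (Finset (Fin (N + 1)))} (hS : MinShadow (k + 1) S)
    (v : Fin (N + 1)) :
    MinShadow k (S.memberSubfamily v) ∧
    ((S.nonMemberSubfamily v).shadow ⊆ S.memberSubfamily v ∨
      MinShadow (k + 1) (S.nonMemberSubfamily v) ∧
      S.memberSubfamily v ⊆ (S.nonMemberSubfamily v).shadow ∧
      ∃ S' : Finset (Finset (Fin (N + 1))), MinShadow (k + 1) S' ∧ S'.card = S.card ∧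
        S'.shadow.card = S.shadow.card ∧
        IsInitSeg (S'.nonMemberSubfamily (Fin.last N)) (k + 1) ∧
        IsInitSeg (S'.memberSubfamily (Fin.last N)) k ∧
        (S'.nonMemberSubfamily (Fin.last N)).card = (S.nonMemberSubfamily v).card ∧
        (S'.memberSubfamily (Fin.last N)).card = (S.memberSubfamily v).card ∧
        S'.memberSubfamily (Fin.last N) ⊆ (S'.nonMemberSubfamily (Fin.last N)).shadow) := by
  set D := S.nonMemberSubfamily v with hD
  set L := S.memberSubfamily v with hL
  have hDs : (D : Set (Finset (Fin (N + 1)))).Sized (k + 1) := sized_nonMemberSubfamily hS.1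
  have hLs : (L : Set (Finset (Fin (N + 1)))).Sized k := sized_memberSubfamily hS.1
  have hDc : D.card ≤ N.choose (k + 1) :=
    card_le_choose_of_notMem hDs fun s hs => (mem_nonMemberSubfamily.1 hs).2
  have hLc : L.card ≤ N.choose k :=
    card_le_choose_of_notMem hLs fun s hs => (mem_memberSubfamily.1 hs).2
  obtain ⟨D', hD', hDc'⟩ := exists_isInitSeg_of_sized hDs
  obtain ⟨L', hL', hLc'⟩ := exists_isInitSeg_of_sized hLs
  have hDl := last_notMem_of_card_le hD' (hDc' ▸ hDc)
  have hLl := last_notMem_of_card_le hL' (hLc' ▸ hLc)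
  -- initial segments of the same sizes replace the deletion and the link, and the last vertex `v`
  set S' := D' ∪ L'.image (insert (Fin.last N)) with hS'
  have hSD : S'.nonMemberSubfamily (Fin.last N) = D' := by
    rw [hS', nonMemberSubfamily_union, nonMemberSubfamily_image_insert, union_empty]
    ext s
    rw [mem_nonMemberSubfamily]
    exact ⟨fun h => h.1, fun h => ⟨h, hDl s h⟩⟩
  have hSL : S'.memberSubfamily (Fin.last N) = L' := by
    rw [hS', memberSubfamily_union, memberSubfamily_image_insert hLl]
    convert empty_union _
    ext s
    rw [mem_memberSubfamily]
    simpa using fun h => absurd (mem_insert_self _ _) (hDl _ h)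
  have hSc : S'.card = S.card := by
    rw [← card_memberSubfamily_add_card_nonMemberSubfamily (Fin.last N), hSD, hSL, hDc', hLc', hD,
      hL, card_memberSubfamily_add_card_nonMemberSubfamily]
  have hSs : (S' : Set (Finset (Fin (N + 1)))).Sized (k + 1) := by
    intro s hs
    rcases mem_union.1 (mem_coe.1 hs) with h | h
    · exact hD'.1 h
    · obtain ⟨t, ht, rfl⟩ := mem_image.1 h
      rw [card_insert_of_notMem (hLl t ht), hL'.1 ht]
  have e1 := card_shadow_eq v S
  have e2 := card_shadow_eq (Fin.last N) S'
  rw [← hD, ← hL] at e1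
  rw [hSD, hSL] at e2
  have e3 := hS.mono hSs hSc.ge
  have e4 : L'.shadow.card ≤ L.shadow.card := kruskal_katona hLs hLc'.le hL'
  have e5 : D'.shadow.card ≤ D.shadow.card := kruskal_katona hDs hDc'.le hD'
  have e6 : D.shadow.card ≤ (D.shadow ∪ L).card := card_le_card subset_union_left
  have e7 : L.card ≤ (D.shadow ∪ L).card := card_le_card subset_union_right
  -- initial segments are comparable: the union of the shadow of `D'` and `L'` is one of the two
  have hLmin : L.shadow.card ≤ L'.shadow.card := by
    rcases (hD'.shadow).total hL' with h | h
    · rw [union_eq_right.2 h] at e2; omega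
    · rw [union_eq_left.2 h] at e2; omega
  refine ⟨⟨hLs, fun C hC hc => ?_⟩, ?_⟩
  · rwa [isInitSeg_eq_of_card_eq hC hL' (hc.trans hLc'.symm)]
  · rcases (hD'.shadow).total hL' with h | h
    · left
      rw [union_eq_right.2 h] at e2
      have : L = D.shadow ∪ L := eq_of_subset_of_card_le subset_union_right (by omega)
      rw [this]
      exact subset_union_left
    · rw [union_eq_left.2 h] at e2
      right
      have hle : (D.shadow ∪ L).card ≤ D.shadow.card := by omega
      have : D.shadow = D.shadow ∪ L := eq_of_subset_of_card_le subset_union_left hle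
      refine ⟨⟨hDs, fun C hC hc => ?_⟩, this ▸ subset_union_right, S', ⟨hSs, fun C hC hc => ?_⟩,
        hSc, by omega, hSD ▸ hD', hSL ▸ hL', by rw [hSD, hDc'], by rw [hSL, hLc'], by
          rw [hSD, hSL]; exact h⟩
      · rw [isInitSeg_eq_of_card_eq hC hD' (hc.trans hDc'.symm)]
        omega
      · have := hS.2 C hC (hc.trans hSc)
        omega

/-- The shadow of the shadow, when the deletion of `v` has its shadow in the link. -/
theorem card_shadow_shadow_of_subset {α : Type*} [DecidableEq α] {v : α} {S : Finset (Finset α)}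
    (h : (S.nonMemberSubfamily v).shadow ⊆ S.memberSubfamily v) :
    S.shadow.card = (S.memberSubfamily v).card + (S.memberSubfamily v).shadow.card ∧
    S.shadow.shadow.card =
      (S.memberSubfamily v).shadow.card + (S.memberSubfamily v).shadow.shadow.card := by
  constructor
  · rw [card_shadow_eq v, union_eq_right.2 h]
  · rw [card_shadow_eq v, nonMemberSubfamily_shadow, memberSubfamily_shadow, union_eq_right.2 h,
      union_self]

theorem card_shadow_shadow_of_superset {α : Type*} [DecidableEq α] {v : α} {S : Finset (Finset α)}
    (h : S.memberSubfamily v ⊆ (S.nonMemberSubfamily v).shadow) :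
    S.shadow.shadow.card =
      (S.nonMemberSubfamily v).shadow.shadow.card + (S.memberSubfamily v).shadow.shadow.card := by
  rw [card_shadow_eq v, nonMemberSubfamily_shadow, memberSubfamily_shadow, union_eq_left.2 h,
    union_eq_left.2 (shadow_mono h)]

/-- Replacing an element by the least vertex leads to a smaller set. -/
theorem insert_zero_erase_lt {N : ℕ} {s : Finset (Fin (N + 1))} {x : Fin (N + 1)} (h0 : 0 ∉ s)
    (hx : x ∈ s) : toColex (insert 0 (s.erase x)) < toColex s := by
  rw [toColex_lt_toColex_iff_exists_forall_lt]
  have hx0 : x ≠ 0 := fun h => h0 (h ▸ hx)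
  refine ⟨x, hx, by simp [hx0], fun b hb hbs => ?_⟩
  rcases mem_insert.1 hb with rfl | hb
  · exact Fin.pos_iff_ne_zero.2 hx0
  · exact absurd (mem_of_mem_erase hb) hbs

theorem insert_zero_erase_mem {N k : ℕ} {C : Finset (Finset (Fin (N + 1)))}
    (hC : IsInitSeg C k) {s : Finset (Fin (N + 1))} (hs : s ∈ C) {x : Fin (N + 1)} (h0 : 0 ∉ s)
    (hx : x ∈ s) : insert 0 (s.erase x) ∈ C := by
  refine hC.2 hs ⟨insert_zero_erase_lt h0 hx, ?_⟩
  rw [card_insert_of_notMem fun h => h0 (mem_of_mem_erase h), card_erase_add_one hx, hC.1 hs]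

/-- If `S` is closed under replacing elements by the least vertex, then that vertex has the shadow of
its deletion in its link. -/
theorem shadow_nonMember_zero_subset {N : ℕ} {S : Finset (Finset (Fin (N + 1)))}
    (h : ∀ s ∈ S, 0 ∉ s → ∀ x ∈ s, insert 0 (s.erase x) ∈ S) :
    (S.nonMemberSubfamily 0).shadow ⊆ S.memberSubfamily 0 := by
  intro t ht
  obtain ⟨s, hs, x, hx, rfl⟩ := mem_shadow_iff.1 ht
  obtain ⟨hs, h0⟩ := mem_nonMemberSubfamily.1 hs
  exact mem_memberSubfamily.2 ⟨h s hs h0 x hx, fun h => h0 (mem_of_mem_erase h)⟩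

/-- Persistence, in the case that some vertex has the shadow of its deletion in its link. -/
theorem MinShadow.shadow_aux {N k : ℕ}
    (ih : ∀ S : Finset (Finset (Fin (N + 1))), MinShadow k S → MinShadow (k - 1) S.shadow)
    {S C : Finset (Finset (Fin (N + 1)))} (hS : MinShadow (k + 1) S) (hC : IsInitSeg C (k + 1))
    (hc : C.card = S.card) {v : Fin (N + 1)}
    (hv : (S.nonMemberSubfamily v).shadow ⊆ S.memberSubfamily v) :
    S.shadow.shadow.card = C.shadow.shadow.card := by
  have hC0 := shadow_nonMember_zero_subset
    fun s hs h0 x hx => insert_zero_erase_mem hC hs h0 hx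
  obtain ⟨a1, a2⟩ := card_shadow_shadow_of_subset hv
  obtain ⟨b1, b2⟩ := card_shadow_shadow_of_subset hC0
  have hL := (hS.vertex v).1
  have hL0 := ((minShadow_of_isInitSeg hC).vertex 0).1
  have e := hS.card_eq hC hc
  -- `|ΔS| = |L| + |ΔL|` for the link `L`, and `|ΔL|` is monotone in `|L|`; so the links have the same
  -- cardinality
  have hcard : (S.memberSubfamily v).card = (C.memberSubfamily 0).card := by
    rcases lt_trichotomy (S.memberSubfamily v).card (C.memberSubfamily 0).card with h | h | h
    · have := hL.mono hL0.1 h.le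
      omega
    · exact h
    · have := hL0.mono hL.1 h.le
      omega
  have e' : (S.memberSubfamily v).shadow.card = (C.memberSubfamily 0).shadow.card := by omega
  have e'' := (ih _ hL).mono (ih _ hL0).1 e'.le
  have e''' := (ih _ hL0).mono (ih _ hL).1 e'.ge
  omega

/-- Persistence: the shadow of a family with minimum shadow has minimum shadow. -/
theorem MinShadow.shadow {N k : ℕ} {S : Finset (Finset (Fin (N + 1)))} (hS : MinShadow k S) :
    MinShadow (k - 1) S.shadow := by
  induction k generalizing S with
  | zero =>
    have hsub : S ⊆ {∅} := fun s hs => mem_singleton.2 (card_eq_zero.1 (hS.1 hs))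
    have : S.shadow = ∅ := by
      have := shadow_mono hsub
      rwa [shadow_singleton_empty, subset_empty] at this
    rw [this]
    exact minShadow_of_isInitSeg (by simp)
  | succ k ih =>
    obtain ⟨m, hm⟩ : ∃ m, S.card = m := ⟨_, rfl⟩
    induction m using Nat.strong_induction_on generalizing S with
    | _ m ihm =>
      refine ⟨hS.1.shadow, fun C' hC' hc' => ?_⟩
      obtain ⟨C, hC, hc⟩ := exists_isInitSeg_of_sized hS.1
      have : C' = C.shadow := isInitSeg_eq_of_card_eq hC' hC.shadow
        (hc'.trans (hS.card_eq hC hc))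
      rw [this]
      rcases S.eq_empty_or_nonempty with rfl | ⟨s, hs⟩
      · simp
      obtain ⟨v, hv⟩ : s.Nonempty := by
        rw [← card_pos, hS.1 hs]; omega
      obtain ⟨hL, h | ⟨hD, hLD, S', hS', hSc, hSs, hD', hL', hDc, hLc, hLD'⟩⟩ := hS.vertex v
      · exact (MinShadow.shadow_aux (fun S hS => ih hS) hS hC hc h).le
      -- `S'` need not be an initial segment, but the least vertex `0` serves for it as `v` does in
      -- `MinShadow.shadow_aux`; then `S` is compared with `S'` by the induction hypotheses for the
      -- deletion and the link
      · have h0 : (S'.nonMemberSubfamily 0).shadow ⊆ S'.memberSubfamily 0 := by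
          refine shadow_nonMember_zero_subset fun s hs h0 x hx => ?_
          have hlast : (0 : Fin (N + 1)) ≠ Fin.last N ∨ Fin.last N ∉ s := by
            by_cases h : (0 : Fin (N + 1)) = Fin.last N
            · exact Or.inr (h ▸ h0)
            · exact Or.inl h
          by_cases hl : Fin.last N ∈ s
          · have h0l := hlast.resolve_right (not_not.2 hl)
            have hsL : s.erase (Fin.last N) ∈ S'.memberSubfamily (Fin.last N) :=
              mem_memberSubfamily.2 ⟨by rwa [insert_erase hl], notMem_erase _ _⟩
            by_cases hxl : x = Fin.last N
            · subst hxl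
              obtain ⟨y, hy, hyD⟩ := mem_shadow_iff_insert_mem.1 (hLD' hsL)
              by_cases hy0 : y = 0
              · subst hy0
                exact (mem_nonMemberSubfamily.1 hyD).1
              · have := insert_zero_erase_mem hD' hyD (x := y) (by
                  rw [mem_insert, not_or]
                  exact ⟨fun h => hy0 h.symm, fun h => h0 (mem_of_mem_erase h)⟩)
                  (mem_insert_self _ _)
                rw [erase_insert hy] at this
                exact (mem_nonMemberSubfamily.1 this).1
            · have := insert_zero_erase_mem hL' hsL (x := x)
                (fun h => h0 (mem_of_mem_erase h)) (mem_erase.2 ⟨hxl, hx⟩)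
              have := (mem_memberSubfamily.1 this).1
              rwa [insert_comm, erase_right_comm, insert_erase
                (mem_erase.2 ⟨fun h => hxl h.symm, hl⟩)] at this
          · have := insert_zero_erase_mem hD' (mem_nonMemberSubfamily.2 ⟨hs, hl⟩) h0 hx
            exact (mem_nonMemberSubfamily.1 this).1
        have e := MinShadow.shadow_aux (fun S hS => ih hS) hS' hC (hc.trans hSc.symm) h0
        rw [← e, card_shadow_shadow_of_superset hLD, card_shadow_shadow_of_superset hLD']
        have hlt : (S.nonMemberSubfamily v).card < m := by
          rw [← hm, ← card_memberSubfamily_add_card_nonMemberSubfamily v S]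
          have : 0 < (S.memberSubfamily v).card := card_pos.2
            ⟨s.erase v, mem_memberSubfamily.2 ⟨by rwa [insert_erase hv], notMem_erase _ _⟩⟩
          omega
        have i1 := (ihm _ hlt hD rfl).mono
          ((minShadow_of_isInitSeg hD').1.shadow) (by
            rw [hD.card_eq hD' hDc])
        have i2 := (ih hL).mono ((minShadow_of_isInitSeg hL').1.shadow) (by
            rw [hL.card_eq hL' hLc])
        omega

theorem MinShadow.shadow_iterate {N k : ℕ} {S : Finset (Finset (Fin (N + 1)))}
    (hS : MinShadow k S) (i : ℕ) : MinShadow (k - i) (Finset.shadow^[i] S) := by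
  induction i with
  | zero => exact hS
  | succ i ih =>
    rw [Function.iterate_succ_apply']
    exact ih.shadow

theorem isInitSeg_shadow_iterate {n k : ℕ} {C : Finset (Finset (Fin n))} (hC : IsInitSeg C k)
    (i : ℕ) : IsInitSeg (Finset.shadow^[i] C) (k - i) := by
  induction i with
  | zero => exact hC
  | succ i ih =>
    rw [Function.iterate_succ_apply']
    exact ih.shadow

theorem MinShadow.card_shadow_iterate {N k : ℕ} {S C : Finset (Finset (Fin (N + 1)))}
    (hS : MinShadow k S) (hC : IsInitSeg C k) (hc : C.card = S.card) (i : ℕ) :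
    (Finset.shadow^[i] S).card = (Finset.shadow^[i] C).card := by
  induction i with
  | zero => exact hc.symm
  | succ i ih =>
    rw [Function.iterate_succ_apply', Function.iterate_succ_apply']
    exact (hS.shadow_iterate i).card_eq (isInitSeg_shadow_iterate hC i) ih.symm

/-! ### Vertices and edges of the colex hypergraphs -/

theorem edgesUpTo_zero (ν : ℕ → ℕ) : edgesUpTo ν 0 = 0 := by simp [edgesUpTo]

theorem edgesUpTo_succ (ν : ℕ → ℕ) (i : ℕ) : edgesUpTo ν (i + 1) = edgesUpTo ν i + ν (i + 1) := by
  simp [edgesUpTo, sum_Icc_succ_top]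

theorem edgesUpTo_mono (ν : ℕ → ℕ) : Monotone (edgesUpTo ν) :=
  monotone_nat_of_le_succ fun i => by rw [edgesUpTo_succ]; omega

theorem edgesUpTo_eq_sum_range (ν : ℕ → ℕ) (i : ℕ) :
    edgesUpTo ν i = ∑ q ∈ range i, ν (q + 1) := by
  induction i with
  | zero => simp [edgesUpTo_zero]
  | succ i ih => rw [edgesUpTo_succ, sum_range_succ, ih]

theorem edgesUpTo_congr {ν ν' : ℕ → ℕ} {i : ℕ} (h : ∀ q, 1 ≤ q → q ≤ i → ν q = ν' q) :
    edgesUpTo ν i = edgesUpTo ν' i :=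
  sum_congr rfl fun q hq => h q (mem_Icc.1 hq).1 (mem_Icc.1 hq).2

/-- The `r`-th edge has size `i`. -/
def HasSize (ν : ℕ → ℕ) (i r : ℕ) : Prop :=
  1 ≤ i ∧ edgesUpTo ν (i - 1) < r ∧ r ≤ edgesUpTo ν i

theorem HasSize.one_le {ν : ℕ → ℕ} {i r : ℕ} (h : HasSize ν i r) : 1 ≤ r := by
  have := h.2.1; omega

theorem HasSize.mono {ν : ℕ → ℕ} {i r i' r' : ℕ} (h : HasSize ν i r) (h' : HasSize ν i' r')
    (hr : r ≤ r') : i ≤ i' := by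
  by_contra hlt
  have := edgesUpTo_mono ν (show i' ≤ i - 1 by omega)
  have := h.2.1
  have := h'.2.2
  omega

theorem HasSize.unique {ν : ℕ → ℕ} {i r i' : ℕ} (h : HasSize ν i r) (h' : HasSize ν i' r) :
    i = i' := (h.mono h' le_rfl).antisymm (h'.mono h le_rfl)

theorem exists_hasSize {ν : ℕ → ℕ} {l r : ℕ} (h1 : 1 ≤ r) (h2 : r ≤ edgesUpTo ν l) :
    ∃ i, i ≤ l ∧ HasSize ν i r := by
  induction l with
  | zero => rw [edgesUpTo_zero] at h2; omega
  | succ l ih =>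
    by_cases h : r ≤ edgesUpTo ν l
    · obtain ⟨i, hi, hs⟩ := ih h
      exact ⟨i, by omega, hs⟩
    · exact ⟨l + 1, le_rfl, by omega, by simpa using h, h2⟩

theorem HasSize.uVertex_eq {n k : ℕ} {ν : ℕ → ℕ} {i r : ℕ} (h : HasSize ν i r) (hi : i ≤ k) :
    uVertex n k ν r = n + 2 - (r + i) := by
  have : (Icc 1 k).filter (fun i' => edgesUpTo ν i' < r) = Icc 1 (i - 1) := by
    ext q
    simp only [mem_filter, mem_Icc]
    constructor
    · rintro ⟨⟨h1, h2⟩, h3⟩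
      refine ⟨h1, ?_⟩
      by_contra hq
      have := edgesUpTo_mono ν (show i ≤ q by omega)
      have := h.2.2
      omega
    · rintro ⟨h1, h2⟩
      refine ⟨⟨h1, by omega⟩, ?_⟩
      have := edgesUpTo_mono ν h2
      have := h.2.1
      omega
  have hi1 := h.1
  rw [uVertex, this, Nat.card_Icc]
  omega

section Order

variable {n k : ℕ} {ν : ℕ → ℕ}

theorem add_le_of_le (hν : edgesUpTo ν k + k ≤ n) {i : ℕ} (hi : i ≤ k) : edgesUpTo ν i + i ≤ n := by
  have := edgesUpTo_mono ν hi
  omega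

theorem vVertex_mem (hν : edgesUpTo ν k + k ≤ n) {i : ℕ} (h1 : 1 ≤ i) (hi : i ≤ k) :
    vVertex n ν i ∈ Icc 1 n := by
  have := add_le_of_le hν hi
  rw [vVertex, mem_Icc]
  omega

theorem uVertex_mem (hν : edgesUpTo ν k + k ≤ n) {i r : ℕ} (h : HasSize ν i r) (hi : i ≤ k) :
    uVertex n k ν r ∈ Icc 1 n := by
  have := add_le_of_le hν hi
  have := h.2.2
  have := h.one_le
  have := h.1
  rw [h.uVertex_eq hi, mem_Icc]
  omega

theorem vVertex_lt (hν : edgesUpTo ν k + k ≤ n) {i i' : ℕ} (h : i < i') (hi : i' ≤ k) :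
    vVertex n ν i' < vVertex n ν i := by
  have := add_le_of_le hν hi
  have := edgesUpTo_mono ν h.le
  rw [vVertex, vVertex]
  omega

theorem vVertex_injOn (hν : edgesUpTo ν k + k ≤ n) {i i' : ℕ} (hi : i ≤ k) (hi' : i' ≤ k)
    (h : vVertex n ν i = vVertex n ν i') : i = i' := by
  rcases lt_trichotomy i i' with hlt | h' | hlt
  · exact absurd h (vVertex_lt hν hlt hi').ne'
  · exact h'
  · exact absurd h (vVertex_lt hν hlt hi).ne

theorem uVertex_lt_vVertex (hν : edgesUpTo ν k + k ≤ n) {i i' r : ℕ} (h : HasSize ν i r)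
    (hi : i ≤ k) (hlt : i' < i) : uVertex n k ν r < vVertex n ν i' := by
  have := add_le_of_le hν hi
  have := edgesUpTo_mono ν (show i' ≤ i - 1 by omega)
  have := h.2.1
  have := h.2.2
  rw [h.uVertex_eq hi, vVertex]
  omega

theorem vVertex_lt_uVertex (hν : edgesUpTo ν k + k ≤ n) {i i' r : ℕ} (h : HasSize ν i r)
    (hi : i ≤ i') (hi' : i' ≤ k) : vVertex n ν i' < uVertex n k ν r := by
  have := add_le_of_le hν hi'
  have := edgesUpTo_mono ν hi
  have := h.2.2
  rw [h.uVertex_eq (hi.trans hi'), vVertex]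
  omega

theorem uVertex_ne_vVertex (hν : edgesUpTo ν k + k ≤ n) {i i' r : ℕ} (h : HasSize ν i r)
    (hi : i ≤ k) (hi' : i' ≤ k) : uVertex n k ν r ≠ vVertex n ν i' := by
  rcases lt_or_ge i' i with hlt | hge
  · exact (uVertex_lt_vVertex hν h hi hlt).ne
  · exact (vVertex_lt_uVertex hν h hge hi').ne'

theorem uVertex_lt (hν : edgesUpTo ν k + k ≤ n) {r r' : ℕ} (h1 : 1 ≤ r) (hr : r < r')
    (hr' : r' ≤ edgesUpTo ν k) : uVertex n k ν r' < uVertex n k ν r := by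
  obtain ⟨i, hi, h⟩ := exists_hasSize h1 (hr.le.trans hr')
  obtain ⟨i', hi', h'⟩ := exists_hasSize (by omega) hr'
  have := h.mono h' hr.le
  have := add_le_of_le hν hi'
  have := h'.2.2
  rw [h.uVertex_eq hi, h'.uVertex_eq hi']
  omega

theorem uVertex_injOn (hν : edgesUpTo ν k + k ≤ n) {r r' : ℕ} (h1 : 1 ≤ r) (h1' : 1 ≤ r')
    (hr : r ≤ edgesUpTo ν k) (hr' : r' ≤ edgesUpTo ν k) (h : uVertex n k ν r = uVertex n k ν r') :
    r = r' := by
  rcases lt_trichotomy r r' with hlt | h' | hlt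
  · exact absurd h (uVertex_lt hν h1 hlt hr').ne'
  · exact h'
  · exact absurd h (uVertex_lt hν h1' hlt hr).ne

/-- The vertices above `v_s` are the `v_i` and the `u_r`. -/
theorem vertex_cases (hν : edgesUpTo ν k + k ≤ n) {s y : ℕ} (hs : s ≤ k) (hy : vVertex n ν s < y)
    (hyn : y ≤ n) : (∃ i, 1 ≤ i ∧ i < s ∧ y = vVertex n ν i) ∨
      ∃ i r, i ≤ s ∧ HasSize ν i r ∧ y = uVertex n k ν r := by
  induction s with
  | zero =>
    rw [vVertex, edgesUpTo_zero] at hy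
    omega
  | succ s ih =>
    rcases lt_trichotomy (vVertex n ν s) y with h | h | h
    · rcases ih (by omega) h with ⟨i, h1, h2, h3⟩ | ⟨i, r, h1, h2, h3⟩
      · exact Or.inl ⟨i, h1, by omega, h3⟩
      · exact Or.inr ⟨i, r, by omega, h2, h3⟩
    · rcases s with _ | s
      · rw [vVertex, edgesUpTo_zero] at h
        omega
      · exact Or.inl ⟨s + 1, by omega, by omega, h.symm⟩
    · have hb := add_le_of_le hν hs
      have hb' := add_le_of_le hν (show s ≤ k by omega)
      rw [vVertex] at hy h
      have hsz : HasSize ν (s + 1) (n + 2 - (s + 1) - y) := by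
        refine ⟨by omega, ?_, ?_⟩
        · simp only [Nat.add_sub_cancel]; omega
        · omega
      refine Or.inr ⟨s + 1, _, le_rfl, hsz, ?_⟩
      rw [hsz.uVertex_eq hs]
      have := hsz.one_le
      omega

theorem mem_colexHypergraph {l : ℕ} {e : Finset ℕ} :
    e ∈ colexHypergraph n k ν l ↔ ∃ i r, i ≤ l ∧ HasSize ν i r ∧ e = colexEdge n k ν i r := by
  simp only [colexHypergraph, mem_biUnion, mem_Icc, mem_image, mem_Ioc]
  constructor
  · rintro ⟨i, ⟨h1, h2⟩, r, ⟨h3, h4⟩, rfl⟩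
    exact ⟨i, r, h2, ⟨h1, h3, h4⟩, rfl⟩
  · rintro ⟨i, r, h2, ⟨h1, h3, h4⟩, rfl⟩
    exact ⟨i, ⟨h1, h2⟩, r, ⟨h3, h4⟩, rfl⟩

theorem colexHypergraph_mono {l l' : ℕ} (h : l ≤ l') :
    colexHypergraph n k ν l ⊆ colexHypergraph n k ν l' := by
  intro e he
  obtain ⟨i, r, hi, hs, rfl⟩ := mem_colexHypergraph.1 he
  exact mem_colexHypergraph.2 ⟨i, r, hi.trans h, hs, rfl⟩

theorem colexEdge_subset_iff {i r : ℕ} {T : Finset ℕ} : colexEdge n k ν i r ⊆ T ↔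
    uVertex n k ν r ∈ T ∧ ∀ q, 1 ≤ q → q < i → vVertex n ν q ∈ T := by
  rw [colexEdge, insert_subset_iff]
  refine and_congr_right fun _ => ⟨fun h q h1 h2 => h (mem_image_of_mem _ (mem_Icc.2 ⟨h1, by omega⟩)),
    fun h x hx => ?_⟩
  obtain ⟨q, hq, rfl⟩ := mem_image.1 hx
  rw [mem_Icc] at hq
  exact h q hq.1 (by omega)

theorem mem_colexEdge {i r y : ℕ} : y ∈ colexEdge n k ν i r ↔
    y = uVertex n k ν r ∨ ∃ q, 1 ≤ q ∧ q < i ∧ y = vVertex n ν q := by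
  rw [colexEdge, mem_insert, mem_image]
  refine or_congr_right ⟨?_, ?_⟩
  · rintro ⟨q, hq, rfl⟩
    rw [mem_Icc] at hq
    exact ⟨q, hq.1, by omega, rfl⟩
  · rintro ⟨q, h1, h2, rfl⟩
    exact ⟨q, mem_Icc.2 ⟨h1, by omega⟩, rfl⟩

theorem vVertex_mem_colexEdge (hν : edgesUpTo ν k + k ≤ n) {i r q : ℕ} (h : HasSize ν i r)
    (hi : i ≤ k) (h1 : 1 ≤ q) (hq : q ≤ k) : vVertex n ν q ∈ colexEdge n k ν i r ↔ q < i := by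
  rw [mem_colexEdge]
  constructor
  · rintro (h' | ⟨q', h1', h2, h3⟩)
    · exact absurd h'.symm (uVertex_ne_vVertex hν h hi hq)
    · exact (vVertex_injOn hν hq (by omega) h3) ▸ h2
  · exact fun h' => Or.inr ⟨q, h1, h', rfl⟩

theorem uVertex_mem_colexEdge (hν : edgesUpTo ν k + k ≤ n) {i r i' r' : ℕ} (h : HasSize ν i r)
    (hi : i ≤ k) (h' : HasSize ν i' r') (hi' : i' ≤ k) :
    uVertex n k ν r' ∈ colexEdge n k ν i r ↔ r' = r := by
  rw [mem_colexEdge]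
  constructor
  · rintro (h1 | ⟨q', h1', h2, h3⟩)
    · exact uVertex_injOn hν h'.one_le h.one_le (h'.2.2.trans (edgesUpTo_mono ν hi'))
        (h.2.2.trans (edgesUpTo_mono ν hi)) h1
    · exact absurd h3 (uVertex_ne_vVertex hν h' hi' (by omega))
  · rintro rfl
    exact Or.inl rfl

theorem card_image_vVertex (hν : edgesUpTo ν k + k ≤ n) {s : ℕ} (hs : s ≤ k) :
    ((Icc 1 s).image (vVertex n ν)).card = s := by
  rw [card_image_of_injOn, Nat.card_Icc, Nat.add_sub_cancel]
  intro a ha b hb h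
  rw [mem_coe, mem_Icc] at ha hb
  exact vVertex_injOn hν (by omega) (by omega) h

theorem card_colexEdge (hν : edgesUpTo ν k + k ≤ n) {i r : ℕ} (h : HasSize ν i r) (hi : i ≤ k) :
    (colexEdge n k ν i r).card = i := by
  have h1 := h.1
  rw [colexEdge, card_insert_of_notMem, card_image_vVertex hν (by omega)]
  · omega
  · intro h'
    obtain ⟨q, hq, hq'⟩ := mem_image.1 h'
    rw [mem_Icc] at hq
    exact uVertex_ne_vVertex hν h hi (by omega) hq'.symm

theorem colexEdge_subset_Icc (hν : edgesUpTo ν k + k ≤ n) {i r : ℕ} (h : HasSize ν i r)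
    (hi : i ≤ k) : colexEdge n k ν i r ⊆ Icc 1 n :=
  colexEdge_subset_iff.2 ⟨uVertex_mem hν h hi, fun q h1 h2 => vVertex_mem hν h1 (by omega)⟩

/-- The vertices `u_1, …, u_{r-1}`. -/
def uBefore (n k : ℕ) (ν : ℕ → ℕ) (r : ℕ) : Finset ℕ := (Ico 1 r).image (uVertex n k ν)

theorem card_uBefore (hν : edgesUpTo ν k + k ≤ n) {r : ℕ} (hr : r ≤ edgesUpTo ν k + 1) :
    (uBefore n k ν r).card = r - 1 := by
  rw [uBefore, card_image_of_injOn, Nat.card_Ico]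
  intro a ha b hb h
  rw [mem_coe, mem_Ico] at ha hb
  exact uVertex_injOn hν (by omega) (by omega) (by omega) (by omega) h

theorem disjoint_colexEdge_uBefore (hν : edgesUpTo ν k + k ≤ n) {i r : ℕ} (h : HasSize ν i r)
    (hi : i ≤ k) : Disjoint (colexEdge n k ν i r) (uBefore n k ν r) := by
  rw [disjoint_left]
  intro y hy hy'
  obtain ⟨r', hr', rfl⟩ := mem_image.1 hy'
  rw [mem_Ico] at hr'
  obtain ⟨i', hi', h'⟩ := exists_hasSize (l := k) hr'.1
    (hr'.2.le.trans (h.2.2.trans (edgesUpTo_mono ν hi)))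
  have := (uVertex_mem_colexEdge hν h hi h' hi').1 hy
  omega

/-- A set containing an edge of a colex hypergraph contains a first one, that is, one whose
predecessors `u_{r'}` it avoids. -/
theorem exists_colexEdge_subset_iff {l : ℕ} {T : Finset ℕ} :
    (∃ e ∈ colexHypergraph n k ν l, e ⊆ T) ↔ ∃ i r, i ≤ l ∧ HasSize ν i r ∧
      colexEdge n k ν i r ⊆ T ∧ Disjoint T (uBefore n k ν r) := by
  constructor
  · rintro ⟨e, he, heT⟩
    obtain ⟨i, r, hi, hs, rfl⟩ := mem_colexHypergraph.1 he
    induction r using Nat.strong_induction_on generalizing i with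
    | _ r ih =>
      by_cases hd : Disjoint T (uBefore n k ν r)
      · exact ⟨i, r, hi, hs, heT, hd⟩
      · obtain ⟨y, hy, hy'⟩ := not_disjoint_iff.1 hd
        obtain ⟨r', hr', rfl⟩ := mem_image.1 hy'
        rw [mem_Ico] at hr'
        obtain ⟨i', hi', hs'⟩ := exists_hasSize (l := l) hr'.1
          (hr'.2.le.trans (hs.2.2.trans (edgesUpTo_mono ν hi)))
        refine ih r' hr'.2 i' hi' hs' (mem_colexHypergraph.2 ⟨i', r', hi', hs', rfl⟩) ?_
        rw [colexEdge_subset_iff] at heT ⊢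
        have := hs'.mono hs hr'.2.le
        exact ⟨hy, fun q h1 h2 => heT.2 q h1 (by omega)⟩
  · rintro ⟨i, r, hi, hs, h, -⟩
    exact ⟨_, mem_colexHypergraph.2 ⟨i, r, hi, hs, rfl⟩, h⟩

end Order

/-! ### Counting sets avoiding hypergraphs -/

/-- The number of `s`-sets that contain `e` and are disjoint from `U`. -/
theorem card_filter_subset_disjoint {G e U : Finset ℕ} (he : e ⊆ G) (hU : U ⊆ G)
    (hd : Disjoint e U) (s : ℕ) :
    ((powersetCard s G).filter fun T => e ⊆ T ∧ Disjoint T U).card =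
      if e.card ≤ s then (G.card - e.card - U.card).choose (s - e.card) else 0 := by
  split_ifs with h
  · have hc : ((G \ e) \ U).card = G.card - e.card - U.card := by
      rw [card_sdiff_of_subset, card_sdiff_of_subset he]
      intro x hx
      exact mem_sdiff.2 ⟨hU hx, fun h => disjoint_left.1 hd h hx⟩
    rw [← hc, ← card_powersetCard]
    symm
    refine card_bij' (fun T _ => e ∪ T) (fun T _ => T \ e) ?_ ?_ ?_ ?_
    · intro T hT
      obtain ⟨h1, h2⟩ := mem_powersetCard.1 hT
      have hTe : Disjoint e T := disjoint_left.2 fun x hx hx' =>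
        (mem_sdiff.1 (mem_sdiff.1 (h1 hx')).1).2 hx
      refine mem_filter.2 ⟨mem_powersetCard.2 ⟨union_subset he fun x hx =>
        (mem_sdiff.1 (mem_sdiff.1 (h1 hx)).1).1, ?_⟩, subset_union_left, ?_⟩
      · rw [card_union_of_disjoint hTe, h2]
        omega
      · rw [disjoint_union_left]
        exact ⟨hd, disjoint_left.2 fun x hx => (mem_sdiff.1 (h1 hx)).2⟩
    · intro T hT
      obtain ⟨h1, h2, h3⟩ := mem_filter.1 hT
      obtain ⟨h4, h5⟩ := mem_powersetCard.1 h1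
      refine mem_powersetCard.2 ⟨fun x hx => ?_, ?_⟩
      · obtain ⟨hx1, hx2⟩ := mem_sdiff.1 hx
        exact mem_sdiff.2 ⟨mem_sdiff.2 ⟨h4 hx1, hx2⟩, disjoint_left.1 h3 hx1⟩
      · rw [card_sdiff_of_subset h2, h5]
    · intro T hT
      obtain ⟨h1, h2⟩ := mem_powersetCard.1 hT
      refine union_sdiff_cancel_left (disjoint_left.2 fun x hx hx' =>
        (mem_sdiff.1 (mem_sdiff.1 (h1 hx')).1).2 hx)
    · intro T hT
      exact union_sdiff_of_subset (mem_filter.1 hT).2.1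
  · rw [card_eq_zero, filter_eq_empty_iff]
    rintro T hT ⟨h1, -⟩
    have := card_le_card h1
    rw [(mem_powersetCard.1 hT).2] at this
    omega

/-- The indices `(i, r)` of the edges of size at most `l`. -/
def edgeIndex (ν : ℕ → ℕ) (l : ℕ) : Finset (Σ _ : ℕ, ℕ) :=
  (Icc 1 l).sigma fun i => Ioc (edgesUpTo ν (i - 1)) (edgesUpTo ν i)

theorem mem_edgeIndex {ν : ℕ → ℕ} {l : ℕ} {x : Σ _ : ℕ, ℕ} :
    x ∈ edgeIndex ν l ↔ x.1 ≤ l ∧ HasSize ν x.1 x.2 := by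
  simp only [edgeIndex, mem_sigma, mem_Icc, mem_Ioc, HasSize]
  tauto

theorem sum_edgeIndex (ν : ℕ → ℕ) (l : ℕ) (f : ℕ → ℕ → ℤ) :
    ∑ x ∈ edgeIndex ν l, f x.1 x.2 =
      ∑ i ∈ range l, ∑ r ∈ range (ν (i + 1)), f (i + 1) (edgesUpTo ν i + r + 1) := by
  rw [edgeIndex, sum_sigma]
  have : Icc 1 l = (range l).image (· + 1) := by
    ext q
    simp only [mem_Icc, mem_image, mem_range]
    exact ⟨fun h => ⟨q - 1, by omega, by omega⟩, by rintro ⟨a, h, rfl⟩; omega⟩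
  rw [this, sum_image (by intro a _ b _ h; simpa using h)]
  refine sum_congr rfl fun i _ => ?_
  have : Ioc (edgesUpTo ν (i + 1 - 1)) (edgesUpTo ν (i + 1)) =
      (range (ν (i + 1))).image (fun r => edgesUpTo ν i + r + 1) := by
    ext q
    simp only [Nat.add_sub_cancel, mem_Ioc, mem_image, mem_range, edgesUpTo_succ]
    exact ⟨fun h => ⟨q - edgesUpTo ν i - 1, by omega, by omega⟩, by rintro ⟨a, h, rfl⟩; omega⟩
  rw [this, sum_image (by intro a _ b _ h; simpa using h)]

/-- The numbers of edges of size at most `l`, with indices shifted by one. -/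
def truncated (ν : ℕ → ℕ) (l : ℕ) : ℕ → ℕ := fun i => if i < l then ν (i + 1) else 0

/-- The sets of an arbitrary ground set killed by the edges of size at most `l` of a colex
hypergraph. -/
theorem card_killed {n k : ℕ} {ν : ℕ → ℕ} (hν : edgesUpTo ν k + k ≤ n) {G : Finset ℕ} {l : ℕ}
    (hl : l ≤ k) (hG : ∀ e ∈ colexHypergraph n k ν l, e ⊆ G) (s : ℕ) :
    (((powersetCard (s + 1) G).filter fun T => ∃ e ∈ colexHypergraph n k ν l, e ⊆ T).card : ℤ) =
      kills (truncated ν l) (G.card - 1) s := by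
  have hU : ∀ i r, i ≤ l → HasSize ν i r → uBefore n k ν r ⊆ G := by
    intro i r hi hs y hy
    obtain ⟨r', hr', rfl⟩ := mem_image.1 hy
    rw [mem_Ico] at hr'
    obtain ⟨i', hi', hs'⟩ := exists_hasSize (l := l) hr'.1
      (hr'.2.le.trans (hs.2.2.trans (edgesUpTo_mono ν hi)))
    exact (colexEdge_subset_iff.1 (hG _ (mem_colexHypergraph.2 ⟨i', r', hi', hs', rfl⟩))).1
  have hset : (powersetCard (s + 1) G).filter (fun T => ∃ e ∈ colexHypergraph n k ν l, e ⊆ T) =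
      (edgeIndex ν l).biUnion fun x => (powersetCard (s + 1) G).filter fun T =>
        colexEdge n k ν x.1 x.2 ⊆ T ∧ Disjoint T (uBefore n k ν x.2) := by
    ext T
    simp only [mem_filter, exists_colexEdge_subset_iff, mem_biUnion, mem_edgeIndex]
    constructor
    · rintro ⟨h, i, r, h1, h2, h3, h4⟩
      exact ⟨⟨i, r⟩, ⟨h1, h2⟩, h, h3, h4⟩
    · rintro ⟨⟨i, r⟩, ⟨h1, h2⟩, h, h3, h4⟩
      exact ⟨h, i, r, h1, h2, h3, h4⟩
  rw [hset, card_biUnion]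
  · push_cast
    rw [kills_eq_sum]
    have hterm : ∀ x ∈ edgeIndex ν l,
        ((((powersetCard (s + 1) G).filter fun T =>
          colexEdge n k ν x.1 x.2 ⊆ T ∧ Disjoint T (uBefore n k ν x.2)).card : ℕ) : ℤ) =
        (fun i r => if i ≤ s + 1 then Ring.choose ((G.card : ℤ) - i - (r - 1)) (s + 1 - i) else 0)
          x.1 x.2 := by
      intro x hx
      obtain ⟨hi, hs⟩ := mem_edgeIndex.1 hx
      have hik := hi.trans hl
      have hd := disjoint_colexEdge_uBefore hν hs hik
      have heG := hG _ (mem_colexHypergraph.2 ⟨x.1, x.2, hi, hs, rfl⟩)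
      have hUG := hU _ _ hi hs
      have c1 := card_colexEdge hν hs hik
      have c2 := card_uBefore (n := n) hν (r := x.2) (by
        have := hs.2.2.trans (edgesUpTo_mono ν hik); omega)
      rw [card_filter_subset_disjoint heG hUG hd, c1, c2]
      have hle : x.1 + (x.2 - 1) ≤ G.card := by
        rw [← c1, ← c2, ← card_union_of_disjoint hd]
        exact card_le_card (union_subset heG hUG)
      have h1 := hs.one_le
      dsimp only
      split_ifs
      · rw [← Ring.choose_natCast]
        congr 1
        omega
      · simp
    rw [sum_congr rfl hterm, sum_edgeIndex ν l
      (fun i r => if i ≤ s + 1 then Ring.choose ((G.card : ℤ) - i - (r - 1)) (s + 1 - i) else 0)]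
    have hA : ∀ i, ∑ r ∈ range (truncated ν l i), Ring.choose ((G.card : ℤ) - 1 -
        ∑ q ∈ range i, (truncated ν l q : ℤ) - i - r) (s - i) = if i < l then
          ∑ r ∈ range (ν (i + 1)), Ring.choose ((G.card : ℤ) - ((i + 1 : ℕ) : ℤ) -
            (((edgesUpTo ν i + r + 1 : ℕ) : ℤ) - 1)) (s - i) else 0 := by
      intro i
      by_cases hi : i < l
      · simp only [truncated, hi, if_true]
        have : ∑ q ∈ range i, (((if q < l then ν (q + 1) else 0 : ℕ)) : ℤ) = edgesUpTo ν i := by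
          rw [edgesUpTo_eq_sum_range]
          push_cast
          refine sum_congr rfl fun q hq => ?_
          rw [if_pos (by have := mem_range.1 hq; omega)]
        rw [this]
        refine sum_congr rfl fun r _ => ?_
        congr 1
        push_cast; ring
      · simp [truncated, hi]
    rw [sum_congr rfl fun i _ => hA i]
    rw [← sum_filter]
    have hB : ∀ i ∈ range l, ∑ r ∈ range (ν (i + 1)), (if i + 1 ≤ s + 1 then
        Ring.choose ((G.card : ℤ) - ((i + 1 : ℕ) : ℤ) - (((edgesUpTo ν i + r + 1 : ℕ) : ℤ) - 1))
          (s + 1 - (i + 1)) else 0) = if i < s + 1 then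
        ∑ r ∈ range (ν (i + 1)), Ring.choose ((G.card : ℤ) - ((i + 1 : ℕ) : ℤ) -
            (((edgesUpTo ν i + r + 1 : ℕ) : ℤ) - 1)) (s - i) else 0 := by
      intro i _
      by_cases h : i < s + 1
      · simp [h, Nat.lt_succ_iff.1 h]
      · simp [h, show ¬ i ≤ s by omega]
    rw [sum_congr rfl hB, ← sum_filter]
    refine sum_congr ?_ fun _ _ => rfl
    ext i
    simp only [mem_filter, mem_range]
    tauto
  · rintro ⟨i, r⟩ hx ⟨i', r'⟩ hy hne
    rw [mem_coe, mem_edgeIndex] at hx hy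
    rw [Function.onFun, disjoint_left]
    intro T hT hT'
    obtain ⟨-, h1, h2⟩ := mem_filter.1 hT
    obtain ⟨-, h1', h2'⟩ := mem_filter.1 hT'
    rw [colexEdge_subset_iff] at h1 h1'
    rcases lt_trichotomy r r' with h | h | h
    · exact disjoint_left.1 h2' h1.1 (mem_image_of_mem _ (mem_Ico.2 ⟨hx.2.one_le, h⟩))
    · subst h
      exact hne (by obtain rfl : i = i' := hx.2.unique hy.2; rfl)
    · exact disjoint_left.1 h2 h1'.1 (mem_image_of_mem _ (mem_Ico.2 ⟨hy.2.one_le, h⟩))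

theorem card_avoiding {G : Finset ℕ} (H : Finset (Finset ℕ)) (s : ℕ) :
    (((powersetCard s G).filter fun T => ∀ e ∈ H, ¬ e ⊆ T).card : ℤ) = G.card.choose s -
      ((powersetCard s G).filter fun T => ∃ e ∈ H, e ⊆ T).card := by
  have := card_filter_add_card_filter_not (s := powersetCard s G) (fun T => ∃ e ∈ H, e ⊆ T)
  rw [card_powersetCard] at this
  simp only [not_exists, not_and] at this
  omega

/-! ### Families of sets avoiding a hypergraph -/

/-- The subset of `{1, …, n}` that corresponds to a subset of `Fin n`. -/
def labels {n : ℕ} (T : Finset (Fin n)) : Finset ℕ := T.image fun v => v.val + 1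

section Labels

variable {n : ℕ}

theorem mem_labels {T : Finset (Fin n)} {y : ℕ} :
    y ∈ labels T ↔ ∃ x ∈ T, x.val + 1 = y := by simp [labels]

theorem succ_mem_labels {T : Finset (Fin n)} {x : Fin n} : x.val + 1 ∈ labels T ↔ x ∈ T := by
  rw [mem_labels]
  refine ⟨?_, fun h => ⟨x, h, rfl⟩⟩
  rintro ⟨y, hy, h⟩
  obtain rfl : y = x := Fin.ext (by omega)
  exact hy

theorem succ_injective : Function.Injective fun v : Fin n => v.val + 1 :=
  fun a b h => Fin.ext (by simpa using h)

theorem labels_injective : Function.Injective (labels (n := n)) := image_injective succ_injective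

theorem card_labels (T : Finset (Fin n)) : (labels T).card = T.card :=
  card_image_of_injective _ succ_injective

theorem labels_subset_labels {T U : Finset (Fin n)} : labels T ⊆ labels U ↔ T ⊆ U :=
  image_subset_image_iff succ_injective

theorem labels_subset_Icc (T : Finset (Fin n)) : labels T ⊆ Icc 1 n := by
  intro y hy
  obtain ⟨x, -, rfl⟩ := mem_labels.1 hy
  rw [mem_Icc]; omega

theorem exists_fin_of_mem_Icc {y : ℕ} (hy : y ∈ Icc 1 n) : ∃ x : Fin n, x.val + 1 = y := by
  rw [mem_Icc] at hy
  exact ⟨⟨y - 1, by omega⟩, by simp only; omega⟩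

theorem exists_labels_eq {U : Finset ℕ} (hU : U ⊆ Icc 1 n) :
    ∃ T : Finset (Fin n), labels T = U := by
  refine ⟨univ.filter fun x => x.val + 1 ∈ U, ?_⟩
  ext y
  rw [mem_labels]
  constructor
  · rintro ⟨x, hx, rfl⟩
    exact (mem_filter.1 hx).2
  · intro hy
    obtain ⟨x, rfl⟩ := exists_fin_of_mem_Icc (hU hy)
    exact ⟨x, mem_filter.2 ⟨mem_univ _, hy⟩, rfl⟩

theorem labels_insert (x : Fin n) (T : Finset (Fin n)) :
    labels (insert x T) = insert (x.val + 1) (labels T) := image_insert _ _ _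

theorem labels_erase (x : Fin n) (T : Finset (Fin n)) :
    labels (T.erase x) = (labels T).erase (x.val + 1) := image_erase succ_injective _ _

end Labels

/-- The `s`-subsets of `Fin n` that contain no edge of the hypergraph `H` on `{1, …, n}`. -/
def avoiding (n s : ℕ) (H : Finset (Finset ℕ)) : Finset (Finset (Fin n)) :=
  univ.filter fun T => T.card = s ∧ ∀ e ∈ H, ¬ e ⊆ labels T

theorem mem_avoiding {n s : ℕ} {H : Finset (Finset ℕ)} {T : Finset (Fin n)} :
    T ∈ avoiding n s H ↔ T.card = s ∧ ∀ e ∈ H, ¬ e ⊆ labels T := by simp [avoiding]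

theorem sized_avoiding (n s : ℕ) (H : Finset (Finset ℕ)) :
    (avoiding n s H : Set (Finset (Fin n))).Sized s := fun _ hT => (mem_avoiding.1 hT).1

theorem card_eq_filter_powersetCard {n s : ℕ} {A : Finset (Finset (Fin n))} {p : Finset ℕ → Prop}
    [DecidablePred p] {G : Finset ℕ} (hG : G ⊆ Icc 1 n)
    (hA : ∀ T, T ∈ A ↔ T.card = s ∧ labels T ⊆ G ∧ p (labels T)) :
    A.card = ((powersetCard s G).filter p).card := by
  rw [← card_image_of_injective A labels_injective]
  congr 1
  ext U
  simp only [mem_image, mem_filter, mem_powersetCard]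
  constructor
  · rintro ⟨T, hT, rfl⟩
    obtain ⟨h1, h2, h3⟩ := (hA T).1 hT
    exact ⟨⟨h2, by rw [card_labels, h1]⟩, h3⟩
  · rintro ⟨⟨h1, h2⟩, h3⟩
    obtain ⟨T, rfl⟩ := exists_labels_eq (h1.trans hG)
    exact ⟨T, (hA T).2 ⟨by rw [← card_labels, h2], h1, h3⟩, rfl⟩

theorem card_avoiding_eq (n s : ℕ) (H : Finset (Finset ℕ)) :
    ((avoiding n s H).card : ℤ) = n.choose s -
      ((powersetCard s (Icc 1 n)).filter fun T => ∃ e ∈ H, e ⊆ T).card := by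
  rw [card_eq_filter_powersetCard (p := fun T => ∀ e ∈ H, ¬ e ⊆ T) subset_rfl
    (fun T => by rw [mem_avoiding]; exact and_congr_right fun _ =>
      (and_iff_right (labels_subset_Icc T)).symm), card_avoiding, Nat.card_Icc,
    Nat.add_sub_cancel]

theorem shadow_avoiding_subset {n s : ℕ} {H H' : Finset (Finset ℕ)} (h : H' ⊆ H) :
    (avoiding n (s + 1) H).shadow ⊆ avoiding n s H' := by
  intro T hT
  obtain ⟨x, hx, hT⟩ := mem_shadow_iff_insert_mem.1 hT
  obtain ⟨h1, h2⟩ := mem_avoiding.1 hT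
  rw [card_insert_of_notMem hx] at h1
  refine mem_avoiding.2 ⟨by omega, fun e he he' => h2 e (h he) (he'.trans ?_)⟩
  exact labels_subset_labels.2 (subset_insert _ _)

/-! ### Colex initial segments as avoiding families -/

/-- The sets of size `s` that avoid the edges of size at most `s` of `H_C(ν 1, …, ν k)`. -/
def colexFamily (n k : ℕ) (ν : ℕ → ℕ) (s : ℕ) : Finset (Finset (Fin n)) :=
  avoiding n s (colexHypergraph n k ν s)

section ColexFamily

variable {n k : ℕ} {ν : ℕ → ℕ}

/-- If `T` precedes an avoiding set `S`, and `T` contained an edge, then `S` would contain that edge or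
the edge whose last vertex is the greatest element `x` of `S` that is not in `T`. -/
theorem isInitSeg_colexFamily (hν : edgesUpTo ν k + k ≤ n) {s : ℕ} (hs : s ≤ k) :
    IsInitSeg (colexFamily n k ν s) s := by
  refine ⟨sized_avoiding _ _ _, ?_⟩
  rintro S T hS ⟨hlt, hc⟩
  obtain ⟨-, hS'⟩ := mem_avoiding.1 hS
  refine mem_avoiding.2 ⟨hc, fun e he heT => ?_⟩
  obtain ⟨i, r, hi, hr, rfl⟩ := mem_colexHypergraph.1 he
  obtain ⟨x, hx', hx⟩ := lt_iff_exists_filter_lt.1 hlt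
  obtain ⟨hxS, hxT⟩ := mem_sdiff.1 hx'
  have hgt : ∀ y, x.val + 1 < y → (y ∈ labels T ↔ y ∈ labels S) := by
    intro y hy
    simp only [mem_labels]
    constructor <;> rintro ⟨z, hz, rfl⟩
    · have : z ∈ T.filter (x < ·) := mem_filter.2 ⟨hz, Fin.lt_def.2 (by omega)⟩
      rw [hx] at this
      exact ⟨z, (mem_filter.1 this).1, rfl⟩
    · have : z ∈ S.filter (x < ·) := mem_filter.2 ⟨hz, Fin.lt_def.2 (by omega)⟩
      rw [← hx] at this
      exact ⟨z, (mem_filter.1 this).1, rfl⟩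
  have hik := hi.trans hs
  rw [colexEdge_subset_iff] at heT
  have hxT' : x.val + 1 ∉ labels T := fun h => hxT (succ_mem_labels.1 h)
  -- an edge above `x` lies in `S` as well; otherwise `x` is a vertex `v_q` of the edge, or the last
  -- vertex of an earlier edge, whose other vertices are above `x`
  rcases lt_trichotomy (x.val + 1) (uVertex n k ν r) with h | h | h
  · refine hS' _ he (colexEdge_subset_iff.2 ⟨(hgt _ h).1 heT.1, fun q h1 h2 =>
      (hgt _ (h.trans ?_)).1 (heT.2 q h1 h2)⟩)
    exact uVertex_lt_vVertex hν hr hik h2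
  · exact hxT' (h ▸ heT.1)
  · rcases vertex_cases hν hik ((vVertex_lt_uVertex hν hr le_rfl hik).trans h) (by omega) with
      ⟨q, h1, h2, h3⟩ | ⟨i', r', h1, h2, h3⟩
    · exact hxT' (h3 ▸ heT.2 q h1 h2)
    · refine hS' _ (mem_colexHypergraph.2 ⟨i', r', h1.trans hi, h2, rfl⟩)
        (colexEdge_subset_iff.2 ⟨h3 ▸ succ_mem_labels.2 hxS, fun q h4 h5 =>
          (hgt _ (h3 ▸ ?_)).1 (heT.2 q h4 (by omega))⟩)
      exact uVertex_lt_vVertex hν h2 (h1.trans hik) h5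

/-- A member of the family of `s`-sets can be enlarged by the least vertex outside. -/
theorem shadow_colexFamily (hν : edgesUpTo ν k + k ≤ n) {s : ℕ} (hs : s + 1 ≤ k) :
    (colexFamily n k ν (s + 1)).shadow = colexFamily n k ν s := by
  refine (shadow_avoiding_subset (colexHypergraph_mono (Nat.le_succ s))).antisymm ?_
  intro T hT
  obtain ⟨h1, h2⟩ := mem_avoiding.1 hT
  have hne : (univ \ T).Nonempty := by
    rw [← card_pos, card_univ_sdiff, Fintype.card_fin]
    omega
  set x := (univ \ T).min' hne with hxdef
  have hxT : x ∉ T := (mem_sdiff.1 (min'_mem _ hne)).2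
  refine mem_shadow_iff_insert_mem.2 ⟨x, hxT, mem_avoiding.2
    ⟨by rw [card_insert_of_notMem hxT, h1], fun e he heT => ?_⟩⟩
  obtain ⟨i, r, hi, hr, rfl⟩ := mem_colexHypergraph.1 he
  have hik := hi.trans hs
  have hlow : ∀ y, 1 ≤ y → y ≤ x.val + 1 → y ∈ labels (insert x T) := by
    intro y hy hyx
    obtain ⟨z, rfl⟩ := exists_fin_of_mem_Icc (n := n) (mem_Icc.2 ⟨hy, by omega⟩)
    rw [succ_mem_labels, mem_insert]
    by_contra hz
    rw [not_or] at hz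
    have := min'_le _ z (mem_sdiff.2 ⟨mem_univ _, hz.2⟩)
    rw [← hxdef, Fin.le_def] at this
    exact hz.1 (Fin.ext (by omega))
  have hb := add_le_of_le hν hik
  have hr2 := hr.2.2
  have hNk := edgesUpTo_mono ν hik
  have hu := hr.uVertex_eq (n := n) (k := k) hik
  have hr1 := hr.1
  have hxe : uVertex n k ν r ≤ x.val + 1 := by
    have hxmem : x.val + 1 ∈ colexEdge n k ν i r := by
      by_contra hx
      rw [labels_insert, subset_insert_iff_of_notMem hx] at heT
      by_cases his : i ≤ s
      · exact h2 _ (mem_colexHypergraph.2 ⟨i, r, his, hr, rfl⟩) heT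
      · have := card_le_card heT
        rw [card_colexEdge hν hr hik, card_labels, h1] at this
        omega
    rcases mem_colexEdge.1 hxmem with h | ⟨q, h3, h4, h5⟩
    · exact h.ge
    · rw [h5]
      exact (uVertex_lt_vVertex hν hr hik h4).le
  -- an edge in the enlarged set would force all labels up to its last vertex into the set, which has
  -- too few elements
  have hsub : Icc 1 (uVertex n k ν r) ∪ (Icc 1 (i - 1)).image (vVertex n ν) ⊆
      labels (insert x T) := by
    refine union_subset (fun y hy => ?_) (fun y hy => ?_)
    · rw [mem_Icc] at hy
      exact hlow y hy.1 (by omega)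
    · obtain ⟨q, hq, rfl⟩ := mem_image.1 hy
      rw [mem_Icc] at hq
      exact (colexEdge_subset_iff.1 heT).2 q hq.1 (by omega)
  have hc := card_le_card hsub
  rw [card_labels, card_insert_of_notMem hxT, h1, card_union_of_disjoint, Nat.card_Icc,
    card_image_vVertex hν (by omega)] at hc
  · omega
  · rw [disjoint_left]
    intro y hy hy'
    obtain ⟨q, hq, rfl⟩ := mem_image.1 hy'
    rw [mem_Icc] at hq hy
    have := uVertex_lt_vVertex hν hr hik (show q < i by omega)
    omega

theorem shadow_iterate_colexFamily (hν : edgesUpTo ν k + k ≤ n) {s : ℕ} (hs : s ≤ k) (i : ℕ)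
    (hi : i ≤ s) : Finset.shadow^[i] (colexFamily n k ν s) = colexFamily n k ν (s - i) := by
  induction i with
  | zero => rfl
  | succ i ih =>
    rw [Function.iterate_succ_apply', ih (by omega), show s - i = (s - (i + 1)) + 1 by omega,
      shadow_colexFamily hν (by omega)]

theorem card_colexFamily_succ (hν : edgesUpTo ν k + k ≤ n) {s : ℕ} (hs : s + 1 ≤ k) :
    ((colexFamily n k ν (s + 1)).card : ℤ) =
      n.choose (s + 1) - kills (fun i => ν (i + 1)) (n - 1) s := by
  rw [colexFamily, card_avoiding_eq, card_killed hν hs, Nat.card_Icc, Nat.add_sub_cancel]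
  · congr 1
    exact kills_congr fun i hi => by simp [truncated, Nat.lt_succ_iff.2 hi]
  · intro e he
    obtain ⟨i, r, hi, hr, rfl⟩ := mem_colexHypergraph.1 he
    exact colexEdge_subset_Icc hν hr (hi.trans hs)

theorem card_colexFamily_zero : (colexFamily n k ν 0).card = 1 := by
  have : colexFamily n k ν 0 = {∅} := by
    ext T
    rw [colexFamily, mem_avoiding, mem_singleton, card_eq_zero, and_iff_left_iff_imp]
    rintro - e he
    obtain ⟨i, r, hi, hr, -⟩ := mem_colexHypergraph.1 he
    have := hr.1
    omega
  rw [this, card_singleton]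

end ColexFamily

/-! ### Binomial decompositions and the numbers of edges -/

theorem choose_sub_kills (l : ℕ → ℕ) (P : ℤ) (s : ℕ) :
    Ring.choose (P + 1) (s + 1) - kills l P s = 1 + ∑ i ∈ range (s + 1),
      Ring.choose (P - ∑ q ∈ range (i + 1), (l q : ℤ) - i) (s + 1 - i) := by
  induction s generalizing l P with
  | zero => simp [kills_zero]; ring
  | succ s ih =>
    have h1 : ∑ i ∈ range (l 0), Ring.choose (P - i) (s + 1) =
        Ring.choose (P + 1) (s + 2) - Ring.choose (P - l 0 + 1) (s + 2) := by
      have h := sum_choose_telescope (P - l 0 + 1) (l 0) (s + 1)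
      rw [show P - (l 0 : ℤ) + 1 + l 0 = P + 1 by ring] at h
      rw [h, add_sub_cancel_left, ← Finset.sum_range_reflect]
      refine sum_congr rfl fun i hi => ?_
      have := mem_range.1 hi
      congr 1
      rw [show l 0 - 1 - i = l 0 - (i + 1) by omega, Nat.cast_sub (by omega)]
      push_cast; ring
    have h2 := ih (fun i => l (i + 1)) (P - l 0 - 1)
    rw [kills_succ, h1, sum_range_succ']
    have h3 := choose_pascal (P - l 0) (s + 1)
    have h4 : ∀ i ∈ range (s + 1), Ring.choose (P - l 0 - 1 -
        ∑ q ∈ range (i + 1), (l (q + 1) : ℤ) - i) (s + 1 - i) =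
        Ring.choose (P - ∑ q ∈ range (i + 1 + 1), (l q : ℤ) - (i + 1 : ℕ)) (s + 1 + 1 - (i + 1)) := by
      intro i _
      rw [sum_range_succ' _ (i + 1), Nat.add_sub_add_right]
      congr 1; push_cast; ring
    rw [sum_congr rfl h4] at h2
    simp only [zero_add, sum_range_one, CharP.cast_eq_zero, sub_zero]
    rw [show P - (l 0 : ℤ) - 1 + 1 = P - l 0 by ring] at h2
    rw [show s + 1 + 1 - 0 = s + 2 by omega]
    rw [show s + 1 + 1 = s + 2 by omega] at h3 ⊢
    linarith

/-- The cardinality of a colex family as a sum of binomial coefficients. -/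
theorem card_colexFamily_eq_sum {n k : ℕ} {ν : ℕ → ℕ} (hν : edgesUpTo ν k + k ≤ n) {s : ℕ}
    (hs : s ≤ k) : (colexFamily n k ν s).card =
      1 + ∑ i ∈ range s, (n - edgesUpTo ν (i + 1) - (i + 1)).choose (s - i) := by
  rcases s with _ | s
  · simp [card_colexFamily_zero]
  · have h1 := card_colexFamily_succ hν hs
    have h2 := choose_sub_kills (fun i => ν (i + 1)) (n - 1) s
    rw [sub_add_cancel, Ring.choose_natCast, ← h1] at h2
    have h3 : ∀ i ∈ range (s + 1), Ring.choose ((n : ℤ) - 1 -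
        ∑ q ∈ range (i + 1), (ν (q + 1) : ℤ) - i) (s + 1 - i) =
        (((n - edgesUpTo ν (i + 1) - (i + 1)).choose (s + 1 - i) : ℕ) : ℤ) := by
      intro i hi
      have := add_le_of_le hν (show i + 1 ≤ k by have := mem_range.1 hi; omega)
      rw [← Ring.choose_natCast]
      congr 1
      have h := edgesUpTo_eq_sum_range ν (i + 1)
      have h' : ∑ q ∈ range (i + 1), (ν (q + 1) : ℤ) = edgesUpTo ν (i + 1) := by
        rw [h]; push_cast; rfl
      rw [h']
      omega
    rw [sum_congr rfl h3] at h2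
    exact_mod_cast h2

/-- The entries `b 0 > b 1 > ⋯ > b (k - 1)` lie below `n`. -/
def IsPlaced (n k : ℕ) (b : ℕ → ℕ) : Prop :=
  (∀ i < k, b i < n) ∧ ∀ i, i + 1 < k → b (i + 1) < b i

/-- The numbers of edges for which `v_i` is the vertex `b (i - 1) + 1`. -/
def gaps (n : ℕ) (b : ℕ → ℕ) (i : ℕ) : ℕ :=
  if i = 1 then n - 1 - b 0 else b (i - 2) - b (i - 1) - 1

theorem edgesUpTo_gaps {n k : ℕ} {b : ℕ → ℕ} (hb : IsPlaced n k b) {i : ℕ} (hi : i < k) :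
    edgesUpTo (gaps n b) (i + 1) + (i + 1) + b i = n := by
  induction i with
  | zero =>
    have := hb.1 0 hi
    rw [edgesUpTo_succ, edgesUpTo_zero, gaps]
    simp; omega
  | succ i ih =>
    have h1 := ih (by omega)
    have h2 := hb.2 i hi
    rw [edgesUpTo_succ, gaps, if_neg (by omega), show i + 1 + 1 - 2 = i by omega,
      Nat.add_sub_cancel]
    omega

theorem edgesUpTo_gaps_le {n k : ℕ} {b : ℕ → ℕ} (hb : IsPlaced n k b) :
    edgesUpTo (gaps n b) k + k ≤ n := by
  rcases k with _ | k
  · simp [edgesUpTo_zero]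
  · have := edgesUpTo_gaps hb (Nat.lt_succ_self k)
    omega

theorem card_colexFamily_gaps {n k : ℕ} {b : ℕ → ℕ} (hb : IsPlaced n k b) {s : ℕ} (hs : s ≤ k) :
    (colexFamily n k (gaps n b) s).card = 1 + ∑ i ∈ range s, (b i).choose (s - i) := by
  rw [card_colexFamily_eq_sum (edgesUpTo_gaps_le hb) hs]
  congr 1
  refine sum_congr rfl fun i hi => ?_
  have := edgesUpTo_gaps hb (show i < k by have := mem_range.1 hi; omega)
  congr 1; omega

/-- The greedy choice of entries. -/
theorem exists_isPlaced {n k r : ℕ} (hr : r < n.choose k) :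
    ∃ b : ℕ → ℕ, IsPlaced n k b ∧ ∑ i ∈ range k, (b i).choose (k - i) = r := by
  induction k generalizing n r with
  | zero => exact ⟨fun _ => 0, ⟨by simp, by simp⟩, by simp at hr ⊢; omega⟩
  | succ k ih =>
    obtain ⟨y, hy, hmax⟩ : ∃ y : ℕ, (y < n ∧ y.choose (k + 1) ≤ r) ∧ r < (y + 1).choose (k + 1) := by
      have hn : ∃ y : ℕ, r < y.choose (k + 1) := ⟨n, hr⟩
      have h1 := Nat.find_spec hn
      have h0 : Nat.find hn ≠ 0 := fun h => by rw [h] at h1; simp at h1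
      refine ⟨Nat.find hn - 1, ⟨?_, ?_⟩, ?_⟩
      · have := Nat.find_min' hn hr
        omega
      · have := Nat.find_min hn (m := Nat.find hn - 1) (by omega)
        omega
      · rwa [Nat.sub_add_cancel (by omega)]
    rw [Nat.choose_succ_succ] at hmax
    obtain ⟨b, hb, hsum⟩ := ih (n := y) (r := r - y.choose (k + 1)) (by
      simp only [Nat.succ_eq_add_one] at hmax
      omega)
    refine ⟨fun i => if i = 0 then y else b (i - 1), ⟨fun i hi => ?_, fun i hi => ?_⟩, ?_⟩
    · rcases i with _ | i
      · simpa using hy.1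
      · simpa using (hb.1 i (by omega)).trans hy.1
    · rcases i with _ | i
      · simpa using hb.1 0 (by omega)
      · simpa using hb.2 i (by omega)
    · rw [sum_range_succ']
      simp [hsum]
      omega

/-- Every non-empty initial segment is one of the colex families. -/
theorem exists_eq_colexFamily {n k : ℕ} {C : Finset (Finset (Fin n))} (hC : IsInitSeg C k)
    (hne : C.Nonempty) : ∃ ν : ℕ → ℕ, edgesUpTo ν k + k ≤ n ∧ C = colexFamily n k ν k := by
  have h1 : C.card ≤ n.choose k := by
    have : C ⊆ powersetCard k univ := fun s hs => mem_powersetCard_univ.2 (hC.1 hs)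
    simpa using card_le_card this
  have h2 := card_pos.2 hne
  obtain ⟨b, hb, hsum⟩ := exists_isPlaced (n := n) (k := k) (r := C.card - 1) (by omega)
  refine ⟨gaps n b, edgesUpTo_gaps_le hb, isInitSeg_eq_of_card_eq hC
    (isInitSeg_colexFamily (edgesUpTo_gaps_le hb) le_rfl) ?_⟩
  rw [card_colexFamily_gaps hb le_rfl, hsum]
  omega

theorem binomSum_cons (k x : ℕ) (a : List ℕ) :
    binomSum k (x :: a) = x.choose k + binomSum (k - 1) a := by
  rw [binomSum, binomSum]
  have := Fin.sum_univ_succ (fun i : Fin (a.length + 1) =>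
    ((x :: a).get i).choose (k - i.val))
  simp only [List.length_cons]
  rw [this]
  simp [Nat.sub_sub, add_comm]

theorem isBinomDecomp_cons {k m x : ℕ} {a : List ℕ} (ha : a ≠ []) :
    IsBinomDecomp (k + 1) m (x :: a) ↔ k + 1 ≤ x ∧ (∀ y ∈ a, y < x) ∧
      ∃ m', IsBinomDecomp k m' a ∧ m = x.choose (k + 1) + m' := by
  rw [IsBinomDecomp, List.pairwise_cons, binomSum_cons]
  simp only [ne_eq, reduceCtorEq, not_false_eq_true, List.length_cons, true_and, IsBinomDecomp, ha,
    Nat.add_le_add_iff_right, Nat.add_sub_cancel]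
  constructor
  · rintro ⟨h1, ⟨h2, h3⟩, h4, h5⟩
    refine ⟨h4 ⟨0, by simp⟩, h2, _, ⟨h1, h3, fun i => ?_, rfl⟩, h5.symm⟩
    have := h4 ⟨i.val + 1, by simp⟩
    simpa using this
  · rintro ⟨h1, h2, m', ⟨h3, h4, h5, rfl⟩, rfl⟩
    refine ⟨h3, ⟨h2, h4⟩, fun i => ?_, rfl⟩
    obtain ⟨i, hi⟩ := i
    rcases i with _ | i
    · simpa using h1
    · have := h5 ⟨i, by simpa using hi⟩
      simpa using this

theorem isBinomDecomp_singleton {k m x : ℕ} :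
    IsBinomDecomp k m [x] ↔ 1 ≤ k ∧ k ≤ x ∧ x.choose k = m := by
  simp [IsBinomDecomp, binomSum, Nat.one_le_iff_ne_zero]

/-- Greedy existence of binomial decompositions. -/
theorem exists_isBinomDecomp {k m : ℕ} (hk : 1 ≤ k) (hm : 1 ≤ m) :
    ∃ a, IsBinomDecomp k m a := by
  suffices h : ∃ x a, IsBinomDecomp k m (x :: a) ∧ m < (x + 1).choose k by
    obtain ⟨x, a, h, -⟩ := h; exact ⟨_, h⟩
  induction k, hk using Nat.le_induction generalizing m with
  | base => exact ⟨m, [], isBinomDecomp_singleton.2 ⟨le_rfl, hm, by simp⟩, by simp⟩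
  | succ k hk ih =>
    obtain ⟨y, hy, hmax⟩ : ∃ y : ℕ, y.choose (k + 1) ≤ m ∧ m < (y + 1).choose (k + 1) := by
      have hn : ∃ y : ℕ, m < y.choose (k + 1) := by
        refine ⟨m + k + 1, ?_⟩
        clear hm
        induction m with
        | zero => simp
        | succ m ih =>
          have : 0 < (m + k + 1).choose k := Nat.choose_pos (by omega)
          rw [show m + 1 + k + 1 = (m + k + 1) + 1 by omega, Nat.choose_succ_succ]
          simp only [Nat.succ_eq_add_one]
          omega
      have h1 := Nat.find_spec hn
      have h0 : Nat.find hn ≠ 0 := fun h => by rw [h] at h1; simp at h1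
      refine ⟨Nat.find hn - 1, ?_, ?_⟩
      · have := Nat.find_min hn (m := Nat.find hn - 1) (by omega)
        omega
      · rwa [Nat.sub_add_cancel (by omega)]
    have hyk : k + 1 ≤ y := by
      by_contra h
      rcases (show y + 1 < k + 1 ∨ y = k by omega) with h | rfl
      · rw [Nat.choose_eq_zero_of_lt h] at hmax; omega
      · simp at hmax; omega
    rcases hy.eq_or_lt with h | h
    · exact ⟨y, [], isBinomDecomp_singleton.2 ⟨by omega, hyk, h⟩, hmax⟩
    · obtain ⟨x, a, h1, h2⟩ := ih (m := m - y.choose (k + 1)) (by omega)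
      refine ⟨y, x :: a, (isBinomDecomp_cons (by simp)).2 ⟨hyk, ?_, _, h1, by omega⟩, hmax⟩
      have hx : x < y := by
        by_contra hxy
        have h3 : x.choose k ≤ m - y.choose (k + 1) := by
          have := h1.2.2.2.2
          rw [binomSum_cons] at this
          omega
        have h4 := Nat.choose_le_choose k (show y ≤ x by omega)
        rw [Nat.choose_succ_succ] at hmax
        simp only [Nat.succ_eq_add_one] at hmax
        omega
      intro z hz
      rcases List.mem_cons.1 hz with rfl | hz
      · exact hx
      · exact ((List.pairwise_cons.1 h1.2.2.1).1 z hz).trans hx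

/-- The entries that come from a binomial decomposition `a` of length `len`: its last entry is
lowered by one, and the entries are continued downwards in steps of one. -/
def entries (a : List ℕ) (i : ℕ) : ℕ :=
  if i + 1 < a.length then a.getD i 0 else a.getD (a.length - 1) 0 - (i + 2 - a.length)

theorem entries_cons {x : ℕ} {a : List ℕ} (ha : a ≠ []) (i : ℕ) :
    entries (x :: a) i = if i = 0 then x else entries a (i - 1) := by
  have hl := List.length_pos_iff.2 ha
  rcases i with _ | i
  · simp [entries, hl]
  · have : a.length = (a.length - 1) + 1 := by omega
    simp only [entries, List.length_cons, Nat.add_lt_add_iff_right, List.getD_cons_succ,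
      Nat.add_sub_cancel, Nat.succ_ne_zero, if_false]
    congr 1
    rw [this, List.getD_cons_succ]
    congr 1
    omega

theorem entries_singleton (x i : ℕ) : entries [x] i = x - (i + 1) := by
  simp [entries]

theorem choose_eq_sum_entries {k x : ℕ} (h : k ≤ x) :
    x.choose k = 1 + ∑ i ∈ range k, (x - (i + 1)).choose (k - i) := by
  induction k generalizing x with
  | zero => simp
  | succ k ih =>
    obtain ⟨x, rfl⟩ : ∃ y, x = y + 1 := ⟨x - 1, by omega⟩
    rw [sum_range_succ', Nat.choose_succ_succ, Nat.succ_eq_add_one, ih (by omega)]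
    simp only [Nat.add_sub_add_right, zero_add, Nat.sub_zero, Nat.add_sub_cancel]
    ring

theorem IsBinomDecomp.exists_tail {k m x y : ℕ} {a : List ℕ} (h : IsBinomDecomp k m (x :: y :: a)) :
    ∃ k' m', k = k' + 1 ∧ 1 ≤ k' ∧ IsBinomDecomp k' m' (y :: a) ∧ k ≤ x ∧ y < x ∧
      m = x.choose k + m' := by
  obtain ⟨k, rfl⟩ : ∃ k', k = k' + 1 := ⟨k - 1, by have := h.2.1; simp at this; omega⟩
  obtain ⟨h1, h2, m', h3, h4⟩ := (isBinomDecomp_cons (by simp)).1 h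
  refine ⟨k, m', rfl, ?_, h3, h1, h2 y (by simp), h4⟩
  have := h3.2.1
  simp at this; omega

theorem IsBinomDecomp.entries_lt {k m : ℕ} {a : List ℕ} (h : IsBinomDecomp k m a) :
    ∀ i, i + 1 < k → entries a (i + 1) < entries a i := by
  induction a generalizing k m with
  | nil => exact absurd rfl h.1
  | cons x a ih =>
    rcases a with _ | ⟨y, a⟩
    · intro i hi
      have := (isBinomDecomp_singleton.1 h).2.1
      rw [entries_singleton, entries_singleton]
      omega
    · obtain ⟨k, m', rfl, h1, h2, h3, h4, -⟩ := h.exists_tail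
      intro i hi
      rw [entries_cons (List.cons_ne_nil y a), entries_cons (List.cons_ne_nil y a),
        if_neg (by omega)]
      rcases i with _ | i
      · have : entries (y :: a) 0 ≤ y := by
          rcases a with _ | ⟨z, a⟩
          · rw [entries_singleton]; omega
          · rw [entries_cons (by simp)]; simp
        simpa using this.trans_lt h4
      · simpa using ih h2 i (by omega)

/-- The entries determine the colex family of cardinality `m`, and its shadow. -/
theorem IsBinomDecomp.eq_sum {k m : ℕ} {a : List ℕ} (h : IsBinomDecomp k m a) :
    m = 1 + ∑ i ∈ range k, (entries a i).choose (k - i) ∧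
    binomSum (k - 1) a = 1 + ∑ i ∈ range (k - 1), (entries a i).choose (k - 1 - i) := by
  induction a generalizing k m with
  | nil => exact absurd rfl h.1
  | cons x a ih =>
    rcases a with _ | ⟨y, a⟩
    · obtain ⟨-, h1, rfl⟩ := isBinomDecomp_singleton.1 h
      simp only [entries_singleton]
      refine ⟨choose_eq_sum_entries h1, ?_⟩
      rw [binomSum_cons, ← choose_eq_sum_entries (by omega)]
      simp [binomSum]
    · obtain ⟨k, m', rfl, h1, h2, h3, h4, rfl⟩ := h.exists_tail
      obtain ⟨e1, e2⟩ := ih h2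
      have e (i : ℕ) : entries (x :: y :: a) (i + 1) = entries (y :: a) i := by
        rw [entries_cons (by simp)]; simp
      have e0 : entries (x :: y :: a) 0 = x := by rw [entries_cons (by simp)]; simp
      constructor
      · rw [e1, sum_range_succ', e0]
        simp only [e, Nat.add_sub_add_right, Nat.sub_zero]
        ring
      · rw [binomSum_cons, Nat.add_sub_cancel, e2]
        obtain ⟨k, rfl⟩ : ∃ k', k = k' + 1 := ⟨k - 1, by omega⟩
        rw [sum_range_succ', e0]
        simp only [e, Nat.add_sub_add_right, Nat.sub_zero, Nat.add_sub_cancel]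
        ring

theorem isPlaced_of_lt {n k : ℕ} {b : ℕ → ℕ} (h0 : 0 < k → b 0 < n)
    (h : ∀ i, i + 1 < k → b (i + 1) < b i) : IsPlaced n k b := by
  refine ⟨fun i hi => ?_, h⟩
  induction i with
  | zero => exact h0 hi
  | succ i ih => exact (h i hi).trans (ih (by omega))

theorem IsBinomDecomp.le_choose_iff {n k m : ℕ} {a : List ℕ} (h : IsBinomDecomp k m a) :
    m ≤ n.choose k ↔ entries a 0 < n := by
  have hk : 1 ≤ k := by
    have := h.2.1
    have := List.length_pos_iff.2 h.1
    omega
  obtain ⟨e, -⟩ := h.eq_sum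
  constructor
  · intro hm
    by_contra hn
    have h1 := Nat.choose_le_choose k (not_lt.1 hn)
    have h2 : (entries a 0).choose (k - 0) ≤ ∑ i ∈ range k, (entries a i).choose (k - i) :=
      single_le_sum (f := fun i => (entries a i).choose (k - i)) (fun _ _ => Nat.zero_le _)
        (mem_range.2 (by omega))
    rw [Nat.sub_zero] at h2
    omega
  · intro hn
    have hb : IsPlaced n k (entries a) := isPlaced_of_lt (fun _ => hn) h.entries_lt
    rw [e, ← card_colexFamily_gaps hb le_rfl, ← card_fin n, ← card_powersetCard]
    rw [Finset.card_fin]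
    exact card_le_card fun s hs => mem_powersetCard_univ.2 (sized_avoiding _ _ _ hs)

/-- The decomposition yields the numbers of edges of the colex family with the given cardinality. -/
theorem IsBinomDecomp.card_eq {n k m : ℕ} {a : List ℕ} (h : IsBinomDecomp k m a)
    (hm : m ≤ n.choose k) : IsPlaced n k (entries a) ∧
      (colexFamily n k (gaps n (entries a)) k).card = m ∧
      (colexFamily n k (gaps n (entries a)) (k - 1)).card = binomSum (k - 1) a := by
  have hb : IsPlaced n k (entries a) := isPlaced_of_lt (fun _ => h.le_choose_iff.1 hm) h.entries_lt
  obtain ⟨e1, e2⟩ := h.eq_sum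
  refine ⟨hb, by rw [card_colexFamily_gaps hb le_rfl, ← e1], ?_⟩
  rw [card_colexFamily_gaps hb (Nat.sub_le _ _), e2]

theorem card_le_choose_of_sized {n k : ℕ} {S : Finset (Finset (Fin n))}
    (hS : (S : Set (Finset (Fin n))).Sized k) : S.card ≤ n.choose k := by
  have : S ⊆ powersetCard k univ := fun s hs => mem_powersetCard_univ.2 (hS hs)
  simpa using card_le_card this

theorem extremal_iff {n k : ℕ} (hk : 1 ≤ k) {S : Finset (Finset (Fin n))} :
    Extremal k S ↔ S.Nonempty ∧ MinShadow k S := by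
  have key (a : List ℕ) (hS : (S : Set (Finset (Fin n))).Sized k) (ha : IsBinomDecomp k S.card a) :
      ∃ C : Finset (Finset (Fin n)), IsInitSeg C k ∧ C.card = S.card ∧ C.shadow.card = binomSum (k - 1) a := by
    obtain ⟨hb, h1, h2⟩ := ha.card_eq (card_le_choose_of_sized hS)
    refine ⟨_, isInitSeg_colexFamily (edgesUpTo_gaps_le hb) le_rfl, h1, ?_⟩
    obtain ⟨k, rfl⟩ : ∃ k', k = k' + 1 := ⟨k - 1, by omega⟩
    rw [shadow_colexFamily (edgesUpTo_gaps_le hb) le_rfl]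
    exact h2
  constructor
  · rintro ⟨hS, hne, a, ha, hsh⟩
    obtain ⟨C, hC, hc, hc'⟩ := key a hS ha
    refine ⟨hne, hS, fun C' hC' hcc => ?_⟩
    rw [isInitSeg_eq_of_card_eq hC' hC (hcc.trans hc.symm), hsh, hc']
  · rintro ⟨hne, hS⟩
    obtain ⟨a, ha⟩ := exists_isBinomDecomp hk (card_pos.2 hne)
    obtain ⟨C, hC, hc, hc'⟩ := key a hS.1 ha
    exact ⟨hS.1, hne, a, ha, by rw [hS.card_eq hC hc, hc']⟩

/-! ### Exchanging one edge of a colex hypergraph -/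

theorem sum_choose_eq_kills (m : ℕ → ℕ) (Q : ℤ) (l s : ℕ) :
    ∑ i ∈ range l, ∑ r ∈ range (m i), (if i ≤ s then
      Ring.choose (Q - ∑ q ∈ range i, (m q : ℤ) - i - r) (s - i) else 0) =
      kills (fun i => if i < l then m i else 0) Q s := by
  rw [kills_eq_sum]
  have h1 : ∀ i ∈ range l, ∑ r ∈ range (m i), (if i ≤ s then
      Ring.choose (Q - ∑ q ∈ range i, (m q : ℤ) - i - r) (s - i) else 0) = if i < s + 1 then
        ∑ r ∈ range (m i), Ring.choose (Q - ∑ q ∈ range i, (m q : ℤ) - i - r) (s - i) else 0 := by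
    intro i _
    by_cases h : i < s + 1
    · simp [h, Nat.lt_succ_iff.1 h]
    · simp [h, show ¬ i ≤ s by omega]
  have h2 : ∀ i ∈ range (s + 1), ∑ r ∈ range (if i < l then m i else 0),
      Ring.choose (Q - ∑ q ∈ range i, ((if q < l then m q else 0 : ℕ) : ℤ) - i - r) (s - i) =
      if i < l then ∑ r ∈ range (m i),
        Ring.choose (Q - ∑ q ∈ range i, (m q : ℤ) - i - r) (s - i) else 0 := by
    intro i _
    by_cases h : i < l
    · have : ∑ q ∈ range i, ((if q < l then m q else 0 : ℕ) : ℤ) = ∑ q ∈ range i, (m q : ℤ) :=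
        sum_congr rfl fun q hq => by rw [if_pos ((mem_range.1 hq).trans h)]
      rw [this]
      simp [h]
    · simp [h]
  rw [sum_congr rfl h1, sum_congr rfl h2, ← sum_filter, ← sum_filter]
  refine sum_congr ?_ fun _ _ => rfl
  ext i
  simp only [mem_filter, mem_range]
  tauto

/-- The edge that replaces `e_N` in the constructions, where `N = N_{j+1}`: it consists of
`v_1, …, v_{j+1}` without `v_p`, and of `u_M`. Here `M = N - 1` in Construction A, and `M = N` in
Construction B. -/
def exchangedEdge (n k j : ℕ) (ν : ℕ → ℕ) (p M : ℕ) : Finset ℕ :=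
  insert (uVertex n k ν M) (((Icc 1 (j + 1)).erase p).image (vVertex n ν))

/-- The edges of size at most `l` of the hypergraph of a construction. -/
def exchangedHypergraph (n k j : ℕ) (ν : ℕ → ℕ) (p M l : ℕ) : Finset (Finset ℕ) :=
  if l ≤ j then colexHypergraph n k ν l else
    insert (exchangedEdge n k j ν p M)
      ((colexHypergraph n k ν l).erase (colexEdge n k ν (j + 1) (edgesUpTo ν (j + 1))))

/-- The hypotheses on the data of a construction. -/
structure Exchangeable (n k j : ℕ) (ν : ℕ → ℕ) (p M : ℕ) : Prop where
  valid : edgesUpTo ν k + k ≤ n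
  lt : j + 1 ≤ k
  one_le : 1 ≤ p
  le : p ≤ j
  pos : 1 ≤ ν (j + 1)
  two : edgesUpTo ν p + 2 ≤ edgesUpTo ν (j + 1)
  M_le : M ≤ edgesUpTo ν (j + 1)
  le_M : edgesUpTo ν (j + 1) ≤ M + 1

section Exchange

variable {n k j p M : ℕ} {ν : ℕ → ℕ}

theorem exchangedEdge_subset_iff {T : Finset ℕ} : exchangedEdge n k j ν p M ⊆ T ↔
    uVertex n k ν M ∈ T ∧ ∀ q, 1 ≤ q → q ≤ j + 1 → q ≠ p → vVertex n ν q ∈ T := by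
  rw [exchangedEdge, insert_subset_iff]
  refine and_congr_right fun _ => ⟨fun h q h1 h2 h3 =>
    h (mem_image_of_mem _ (mem_erase.2 ⟨h3, mem_Icc.2 ⟨h1, h2⟩⟩)), fun h x hx => ?_⟩
  obtain ⟨q, hq, rfl⟩ := mem_image.1 hx
  rw [mem_erase, mem_Icc] at hq
  exact h q hq.2.1 hq.2.2 hq.1

theorem mem_exchangedEdge {y : ℕ} : y ∈ exchangedEdge n k j ν p M ↔
    y = uVertex n k ν M ∨ ∃ q, 1 ≤ q ∧ q ≤ j + 1 ∧ q ≠ p ∧ y = vVertex n ν q := by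
  rw [exchangedEdge, mem_insert, mem_image]
  refine or_congr_right ⟨?_, ?_⟩
  · rintro ⟨q, hq, rfl⟩
    rw [mem_erase, mem_Icc] at hq
    exact ⟨q, hq.2.1, hq.2.2, hq.1, rfl⟩
  · rintro ⟨q, h1, h2, h3, rfl⟩
    exact ⟨q, mem_erase.2 ⟨h3, mem_Icc.2 ⟨h1, h2⟩⟩, rfl⟩

namespace Exchangeable

theorem last (h : Exchangeable n k j ν p M) : HasSize ν (j + 1) (edgesUpTo ν (j + 1)) := by
  have := h.pos
  have := edgesUpTo_succ ν j
  exact ⟨by omega, by simp only [Nat.add_sub_cancel]; omega, le_rfl⟩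

theorem exists_size (h : Exchangeable n k j ν p M) : ∃ i, p < i ∧ i ≤ j + 1 ∧ HasSize ν i M := by
  have h1 := h.two
  have h2 := h.le_M
  obtain ⟨i, hi, hs⟩ := exists_hasSize (l := j + 1) (show 1 ≤ M by omega) h.M_le
  refine ⟨i, ?_, hi, hs⟩
  by_contra hp
  have := edgesUpTo_mono ν (not_lt.1 hp)
  have := hs.2.2
  omega

theorem card_edge (h : Exchangeable n k j ν p M) : (exchangedEdge n k j ν p M).card = j + 1 := by
  have h1 := h.one_le
  have h2 := h.le
  have h3 := h.lt
  obtain ⟨i, -, hi, hs⟩ := h.exists_size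
  rw [exchangedEdge, card_insert_of_notMem, card_image_of_injOn, card_erase_of_mem, Nat.card_Icc]
  · omega
  · rw [mem_Icc]; omega
  · intro a ha b hb hab
    rw [mem_coe, mem_erase, mem_Icc] at ha hb
    exact vVertex_injOn h.valid (by omega) (by omega) hab
  · intro h'
    obtain ⟨q, hq, hq'⟩ := mem_image.1 h'
    rw [mem_erase, mem_Icc] at hq
    exact uVertex_ne_vVertex h.valid hs (by omega) (by omega) hq'.symm

theorem edge_subset_Icc (h : Exchangeable n k j ν p M) : exchangedEdge n k j ν p M ⊆ Icc 1 n := by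
  have h3 := h.lt
  obtain ⟨i, -, hi, hs⟩ := h.exists_size
  exact exchangedEdge_subset_iff.2 ⟨uVertex_mem h.valid hs (by omega),
    fun q h1 h2 _ => vVertex_mem h.valid h1 (by omega)⟩

theorem notMem_edge (h : Exchangeable n k j ν p M) : vVertex n ν p ∉ exchangedEdge n k j ν p M := by
  have h2 := h.le
  have h3 := h.lt
  obtain ⟨i, -, hi, hs⟩ := h.exists_size
  rw [mem_exchangedEdge, not_or]
  refine ⟨(uVertex_ne_vVertex h.valid hs (by omega) (by omega)).symm, ?_⟩
  rintro ⟨q, h4, h5, h6, h7⟩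
  exact h6 (vVertex_injOn h.valid (by omega) (by omega) h7).symm

theorem uVertex_mem_edge (h : Exchangeable n k j ν p M) {i r : ℕ} (hr : HasSize ν i r)
    (hi : i ≤ k) : uVertex n k ν r ∈ exchangedEdge n k j ν p M ↔ r = M := by
  have h3 := h.lt
  obtain ⟨i', -, hi', hs⟩ := h.exists_size
  rw [mem_exchangedEdge]
  constructor
  · rintro (h1 | ⟨q, -, h2, -, h4⟩)
    · exact uVertex_injOn h.valid hr.one_le hs.one_le (hr.2.2.trans (edgesUpTo_mono ν hi))
        (hs.2.2.trans (edgesUpTo_mono ν (by omega))) h1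
    · exact absurd h4 (uVertex_ne_vVertex h.valid hr hi (by omega))
  · rintro rfl
    exact Or.inl rfl

/-- The vertices `u_{r'}` with `r' < r` that are avoided by the sets assigned to the edge `e_r`. -/
def before (n k j : ℕ) (ν : ℕ → ℕ) (M r : ℕ) : Finset ℕ :=
  ((Ico 1 r).filter fun r' => r' = edgesUpTo ν (j + 1) → r' = M).image (uVertex n k ν)

theorem card_before (h : Exchangeable n k j ν p M) {r : ℕ} (hr : 1 ≤ r)
    (hr' : r ≤ edgesUpTo ν k) : ((before n k j ν M r).card : ℤ) =
      r - 1 - if edgesUpTo ν (j + 1) < r then (edgesUpTo ν (j + 1) : ℤ) - M else 0 := by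
  have h1 := h.M_le
  have h2 := h.le_M
  have h3 := h.two
  rw [before, card_image_of_injOn]
  · have hc : (Ico 1 r).card = r - 1 := Nat.card_Ico _ _
    rcases (show M = edgesUpTo ν (j + 1) ∨ M + 1 = edgesUpTo ν (j + 1) by omega) with hM | hM
    · rw [filter_true_of_mem fun r' _ h' => h'.trans hM.symm, hc, hM]
      simp; omega
    · have : (Ico 1 r).filter (fun r' => r' = edgesUpTo ν (j + 1) → r' = M) =
          (Ico 1 r).erase (edgesUpTo ν (j + 1)) := by
        ext x
        rw [mem_filter, mem_erase, and_comm]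
        refine and_congr_left fun _ => ⟨fun h h' => ?_, fun h h' => absurd h' h⟩
        have := h h'
        omega
      rw [this]
      split_ifs with hlt
      · rw [card_erase_of_mem (mem_Ico.2 ⟨by omega, hlt⟩), hc]
        omega
      · rw [erase_eq_of_notMem (by rw [mem_Ico]; omega), hc]
        omega
  · intro a ha b hb hab
    rw [mem_coe, mem_filter, mem_Ico] at ha hb
    exact uVertex_injOn h.valid (by omega) (by omega) (by omega) (by omega) hab

theorem before_subset {r : ℕ} : before n k j ν M r ⊆ uBefore n k ν r :=
  image_subset_image (filter_subset _ _)

theorem edge_ne (h : Exchangeable n k j ν p M) {i r : ℕ} (hr : HasSize ν i r) (hi : i ≤ k)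
    (hne : r ≠ edgesUpTo ν (j + 1)) :
    colexEdge n k ν i r ≠ colexEdge n k ν (j + 1) (edgesUpTo ν (j + 1)) := by
  intro h'
  have := (uVertex_mem_colexEdge h.valid h.last h.lt hr hi).1 (h' ▸ mem_colexEdge.2 (Or.inl rfl))
  exact hne this

open Classical in
/-- The sets that contain the exchanged edge, but none of the edges `e_r` with `r < N`. -/
noncomputable def exchangedClass (n k j : ℕ) (ν : ℕ → ℕ) (p M s : ℕ) : Finset (Finset ℕ) :=
  (powersetCard s (Icc 1 n)).filter fun T => exchangedEdge n k j ν p M ⊆ T ∧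
    ∀ i r, HasSize ν i r → r < edgesUpTo ν (j + 1) → ¬ colexEdge n k ν i r ⊆ T

theorem mem_exchangedClass {s : ℕ} {T : Finset ℕ} : T ∈ exchangedClass n k j ν p M s ↔
    T ∈ powersetCard s (Icc 1 n) ∧ exchangedEdge n k j ν p M ⊆ T ∧
    ∀ i r, HasSize ν i r → r < edgesUpTo ν (j + 1) → ¬ colexEdge n k ν i r ⊆ T := by
  classical
  simp only [exchangedClass, mem_filter]

/-- The sets that contain `e_r`, but none of the edges preceding it. -/
def edgeClass (n k j : ℕ) (ν : ℕ → ℕ) (M s : ℕ) (x : Σ _ : ℕ, ℕ) : Finset (Finset ℕ) :=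
  (powersetCard s (Icc 1 n)).filter fun T =>
    colexEdge n k ν x.1 x.2 ⊆ T ∧ Disjoint T (before n k j ν M x.2)

theorem killed_eq (h : Exchangeable n k j ν p M) {l : ℕ} (hl : j + 1 ≤ l) (hlk : l ≤ k) (s : ℕ) :
    ((powersetCard s (Icc 1 n)).filter fun T =>
      ∃ e ∈ exchangedHypergraph n k j ν p M l, e ⊆ T) =
    exchangedClass n k j ν p M s ∪
      ((edgeIndex ν l).erase ⟨j + 1, edgesUpTo ν (j + 1)⟩).biUnion (edgeClass n k j ν M s) := by
  ext T
  simp only [exchangedHypergraph, show ¬ l ≤ j by omega, if_false, mem_exchangedClass, edgeClass,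
    mem_union, mem_filter, mem_biUnion]
  constructor
  · rintro ⟨hT, e, he, heT⟩
    by_cases hex : ∃ i r, r ≠ edgesUpTo ν (j + 1) ∧ i ≤ l ∧ HasSize ν i r ∧
        colexEdge n k ν i r ⊆ T
    · have hex' : ∃ r i, r ≠ edgesUpTo ν (j + 1) ∧ i ≤ l ∧ HasSize ν i r ∧
          colexEdge n k ν i r ⊆ T := by
        obtain ⟨i, r, h'⟩ := hex; exact ⟨r, i, h'⟩
      classical
      obtain ⟨i, hne, hi, hs, hsub⟩ := Nat.find_spec hex'
      have hmin := fun r' (hr' : r' < Nat.find hex') => Nat.find_min hex' hr'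
      set r := Nat.find hex'
      have hu : ∀ r', 1 ≤ r' → r' < r → r' ≠ edgesUpTo ν (j + 1) → uVertex n k ν r' ∉ T := by
        intro r' h1 h2 h3 h4
        obtain ⟨i', hi', hs'⟩ := exists_hasSize (l := l) h1
          (h2.le.trans (hs.2.2.trans (edgesUpTo_mono ν hi)))
        refine hmin r' h2 ⟨i', h3, hi', hs', colexEdge_subset_iff.2 ⟨h4, fun q h5 h6 =>
          (colexEdge_subset_iff.1 hsub).2 q h5 ?_⟩⟩
        have := hs'.mono hs h2.le
        omega
      by_cases hf : exchangedEdge n k j ν p M ⊆ T ∧ edgesUpTo ν (j + 1) < r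
      · refine Or.inl ⟨hT, hf.1, fun i' r' hs' hr' hsub' => ?_⟩
        exact hu r' hs'.one_le (hr'.trans hf.2) hr'.ne (colexEdge_subset_iff.1 hsub').1
      · refine Or.inr ⟨⟨i, r⟩, ⟨mem_erase.2 ⟨fun h' => hne (by injection h'),
          mem_edgeIndex.2 ⟨hi, hs⟩⟩, hT, hsub, ?_⟩⟩
        rw [disjoint_right]
        intro y hy
        obtain ⟨r', hr', rfl⟩ := mem_image.1 hy
        rw [mem_filter, mem_Ico] at hr'
        by_cases hN : r' = edgesUpTo ν (j + 1)
        · intro hyT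
          have hM := hr'.2 hN
          refine hf ⟨exchangedEdge_subset_iff.2 ⟨hM ▸ hyT, fun q h1 h2 _ =>
            (colexEdge_subset_iff.1 hsub).2 q h1 ?_⟩, by dsimp only at hr'; omega⟩
          by_contra hiq
          have := edgesUpTo_mono ν (show i ≤ j + 1 by omega)
          have := hs.2.2
          dsimp only at hr'
          omega
        · exact hu r' hr'.1.1 hr'.1.2 hN
    · refine Or.inl ⟨hT, ?_, fun i r hs hr hsub => hex ⟨i, r, hr.ne, ?_, hs, hsub⟩⟩
      · rcases mem_insert.1 he with rfl | he
        · exact heT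
        · obtain ⟨hne, he⟩ := mem_erase.1 he
          obtain ⟨i, r, hi, hs, rfl⟩ := mem_colexHypergraph.1 he
          refine absurd ⟨i, r, fun h' => hne ?_, hi, hs, heT⟩ hex
          subst h'
          rw [hs.unique h.last]
      · by_contra hil
        have := edgesUpTo_mono ν (show j + 1 ≤ i - 1 by omega)
        have := hs.2.1
        omega
  · rintro (⟨hT, hf, -⟩ | ⟨⟨i, r⟩, hx, hT, hsub, -⟩)
    · exact ⟨hT, _, mem_insert_self _ _, hf⟩
    · obtain ⟨hne, hx⟩ := mem_erase.1 hx
      obtain ⟨hi, hs⟩ := mem_edgeIndex.1 hx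
      refine ⟨hT, _, mem_insert_of_mem (mem_erase.2 ⟨h.edge_ne hs (hi.trans hlk) ?_,
        mem_colexHypergraph.2 ⟨i, r, hi, hs, rfl⟩⟩), hsub⟩
      rintro h'
      dsimp only at hs h'
      subst h'
      exact hne (by rw [hs.unique h.last])

theorem disjoint_classes (h : Exchangeable n k j ν p M) {l : ℕ} (s : ℕ) :
    Disjoint (exchangedClass n k j ν p M s)
      (((edgeIndex ν l).erase ⟨j + 1, edgesUpTo ν (j + 1)⟩).biUnion (edgeClass n k j ν M s)) := by
  have h1 := h.M_le
  have h2 := h.two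
  have h3 := h.le_M
  rw [disjoint_biUnion_right]
  rintro ⟨i, r⟩ hx
  obtain ⟨hne, hx⟩ := mem_erase.1 hx
  obtain ⟨hi, hs⟩ := mem_edgeIndex.1 hx
  dsimp only at hi hs
  have hne' : r ≠ edgesUpTo ν (j + 1) := by
    rintro rfl
    exact hne (by rw [hs.unique h.last])
  rw [disjoint_left]
  intro T hT hT'
  obtain ⟨-, h4, h5⟩ := mem_exchangedClass.1 hT
  obtain ⟨-, h6, h7⟩ := mem_filter.1 hT'
  rcases lt_or_gt_of_ne hne' with hlt | hgt
  · exact h5 i r hs hlt h6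
  · refine disjoint_left.1 h7 (exchangedEdge_subset_iff.1 h4).1 (mem_image_of_mem _
      (mem_filter.2 ⟨mem_Ico.2 ⟨by omega, by dsimp only; omega⟩, fun _ => rfl⟩))

theorem disjoint_edgeClasses (h : Exchangeable n k j ν p M) {l : ℕ} (s : ℕ) :
    (((edgeIndex ν l).erase ⟨j + 1, edgesUpTo ν (j + 1)⟩ : Finset _) : Set (Σ _ : ℕ, ℕ)).PairwiseDisjoint
      (edgeClass n k j ν M s) := by
  rintro ⟨i, r⟩ hx ⟨i', r'⟩ hx' hne
  obtain ⟨hx1, hx2⟩ := mem_erase.1 (mem_coe.1 hx)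
  obtain ⟨hx1', hx2'⟩ := mem_erase.1 (mem_coe.1 hx')
  obtain ⟨-, hs⟩ := mem_edgeIndex.1 hx2
  obtain ⟨-, hs'⟩ := mem_edgeIndex.1 hx2'
  dsimp only at hs hs'
  rw [Function.onFun, disjoint_left]
  intro T hT hT'
  obtain ⟨-, h1, h2⟩ := mem_filter.1 hT
  obtain ⟨-, h1', h2'⟩ := mem_filter.1 hT'
  rw [colexEdge_subset_iff] at h1 h1'
  rcases lt_trichotomy r r' with hlt | rfl | hgt
  · refine disjoint_left.1 h2' h1.1 (mem_image_of_mem _ (mem_filter.2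
      ⟨mem_Ico.2 ⟨hs.one_le, hlt⟩, fun h' => absurd ?_ hx1⟩))
    dsimp only at h' ⊢
    subst h'
    rw [hs.unique h.last]
  · exact hne (by rw [hs.unique hs'])
  · refine disjoint_left.1 h2 h1'.1 (mem_image_of_mem _ (mem_filter.2
      ⟨mem_Ico.2 ⟨hs'.one_le, hgt⟩, fun h' => absurd ?_ hx1'⟩))
    dsimp only at h' ⊢
    subst h'
    rw [hs'.unique h.last]

theorem uBefore_subset_Icc (h : Exchangeable n k j ν p M) {r : ℕ} (hr : r ≤ edgesUpTo ν k + 1) :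
    uBefore n k ν r ⊆ Icc 1 n := by
  intro y hy
  obtain ⟨r', hr', rfl⟩ := mem_image.1 hy
  rw [mem_Ico] at hr'
  obtain ⟨i', hi', hs'⟩ := exists_hasSize (ν := ν) (l := k) hr'.1 (by omega)
  exact uVertex_mem h.valid hs' hi'

theorem card_edgeClass (h : Exchangeable n k j ν p M) {i r : ℕ} (hs : HasSize ν i r) (hi : i ≤ k)
    (s : ℕ) : ((edgeClass n k j ν M s ⟨i, r⟩).card : ℤ) = if i ≤ s then
      Ring.choose ((n : ℤ) - i - (r - 1 -
        if edgesUpTo ν (j + 1) < r then (edgesUpTo ν (j + 1) : ℤ) - M else 0)) (s - i) else 0 := by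
  have hrk := hs.2.2.trans (edgesUpTo_mono ν hi)
  have hd := (disjoint_colexEdge_uBefore h.valid hs hi).mono_right
    (before_subset (j := j) (M := M))
  have heG := colexEdge_subset_Icc h.valid hs hi
  have hUG := (before_subset (j := j) (M := M)).trans
    (h.uBefore_subset_Icc (show r ≤ edgesUpTo ν k + 1 by omega))
  have c1 := card_colexEdge h.valid hs hi
  have c2 := h.card_before hs.one_le hrk
  have hle : i + (before n k j ν M r).card ≤ n := by
    rw [← c1, ← card_union_of_disjoint hd]
    simpa using card_le_card (union_subset heG hUG)
  rw [edgeClass, card_filter_subset_disjoint heG hUG hd, c1, Nat.card_Icc, Nat.add_sub_cancel,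
    ← c2]
  split_ifs
  · rw [← Ring.choose_natCast]
    congr 1
    omega
  · simp

theorem disjoint_edge_low (h : Exchangeable n k j ν p M) :
    Disjoint (exchangedEdge n k j ν p M)
      (insert (vVertex n ν p) (uBefore n k ν (edgesUpTo ν p + 1))) := by
  have h1 := h.lt
  have h2 := h.le
  rw [disjoint_insert_right]
  refine ⟨h.notMem_edge, disjoint_right.2 fun y hy hy' => ?_⟩
  obtain ⟨r', hr', rfl⟩ := mem_image.1 hy
  rw [mem_Ico] at hr'
  obtain ⟨i', hi', hs'⟩ := exists_hasSize (ν := ν) (l := p) hr'.1 (by omega)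
  rw [h.uVertex_mem_edge hs' (by omega)] at hy'
  have := h.two
  have := h.le_M
  omega

theorem vVertex_notMem_uBefore (h : Exchangeable n k j ν p M) {q r : ℕ} (hq : q ≤ k)
    (hr : r ≤ edgesUpTo ν k + 1) : vVertex n ν q ∉ uBefore n k ν r := by
  intro hy
  obtain ⟨r', hr', hr''⟩ := mem_image.1 hy
  rw [mem_Ico] at hr'
  obtain ⟨i', hi', hs'⟩ := exists_hasSize (ν := ν) (l := k) hr'.1 (by omega)
  exact uVertex_ne_vVertex h.valid hs' hi' hq hr''

/-- The sets of the exchanged class that do not contain `v_p`. -/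
theorem exchangedClass_filter_notMem (h : Exchangeable n k j ν p M) (s : ℕ) :
    (exchangedClass n k j ν p M s).filter (fun T => vVertex n ν p ∉ T) =
      (powersetCard s (Icc 1 n)).filter fun T => exchangedEdge n k j ν p M ⊆ T ∧
        Disjoint T (insert (vVertex n ν p) (uBefore n k ν (edgesUpTo ν p + 1))) := by
  have hp := h.two
  have hp1 := h.one_le
  have hp2 := h.le
  ext T
  rw [mem_filter, mem_exchangedClass, mem_filter, disjoint_insert_right]
  constructor
  · rintro ⟨⟨h1, h2, h3⟩, h4⟩
    refine ⟨h1, h2, h4, disjoint_right.2 fun y hy hy' => ?_⟩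
    obtain ⟨r', hr', rfl⟩ := mem_image.1 hy
    rw [mem_Ico] at hr'
    obtain ⟨i', hi', hs'⟩ := exists_hasSize (ν := ν) (l := p) hr'.1 (by omega)
    exact h3 i' r' hs' (by omega) (colexEdge_subset_iff.2 ⟨hy', fun q h5 h6 =>
      (exchangedEdge_subset_iff.1 h2).2 q h5 (by omega) (by omega)⟩)
  · rintro ⟨h1, h2, h4, h5⟩
    refine ⟨⟨h1, h2, fun i r hs hr hsub => ?_⟩, h4⟩
    rw [colexEdge_subset_iff] at hsub
    by_cases hpi : p < i
    · exact h4 (hsub.2 p hp1 hpi)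
    · have := edgesUpTo_mono ν (not_lt.1 hpi)
      have := hs.2.2
      exact disjoint_left.1 h5 hsub.1 (mem_image_of_mem _ (mem_Ico.2 ⟨hs.one_le, by omega⟩))

theorem exchangedClass_filter_mem (h : Exchangeable n k j ν p M) (s : ℕ) :
    (exchangedClass n k j ν p M s).filter (fun T => vVertex n ν p ∈ T) =
      if M = edgesUpTo ν (j + 1) then (powersetCard s (Icc 1 n)).filter fun T =>
        insert (vVertex n ν p) (exchangedEdge n k j ν p M) ⊆ T ∧
        Disjoint T (uBefore n k ν (edgesUpTo ν (j + 1))) else ∅ := by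
  have hp := h.two
  have hM1 := h.le_M
  have hM2 := h.M_le
  have key : ∀ T, exchangedEdge n k j ν p M ⊆ T → vVertex n ν p ∈ T → ∀ q, 1 ≤ q → q ≤ j + 1 →
      vVertex n ν q ∈ T := by
    -- with `v_p` the set contains all of `v_1, …, v_{j+1}`, and so `e_M` if `M < N`
    intro T h1 h2 q h3 h4
    by_cases hq : q = p
    · exact hq ▸ h2
    · exact (exchangedEdge_subset_iff.1 h1).2 q h3 h4 hq
  ext T
  rw [mem_filter, mem_exchangedClass]
  split_ifs with hM
  · rw [mem_filter, insert_subset_iff]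
    constructor
    · rintro ⟨⟨h1, h2, h3⟩, h4⟩
      refine ⟨h1, ⟨h4, h2⟩, disjoint_right.2 fun y hy hy' => ?_⟩
      obtain ⟨r', hr', rfl⟩ := mem_image.1 hy
      rw [mem_Ico] at hr'
      obtain ⟨i', hi', hs'⟩ := exists_hasSize (ν := ν) (l := j + 1) hr'.1 (by omega)
      exact h3 i' r' hs' (by omega) (colexEdge_subset_iff.2 ⟨hy', fun q h5 h6 =>
        key T h2 h4 q h5 (by omega)⟩)
    · rintro ⟨h1, ⟨h4, h2⟩, h5⟩
      refine ⟨⟨h1, h2, fun i r hs hr hsub => ?_⟩, h4⟩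
      exact disjoint_left.1 h5 (colexEdge_subset_iff.1 hsub).1
        (mem_image_of_mem _ (mem_Ico.2 ⟨hs.one_le, hr⟩))
  · simp only [notMem_empty, iff_false]
    rintro ⟨⟨h1, h2, h3⟩, h4⟩
    obtain ⟨i, hi, hij, hs⟩ := h.exists_size
    exact h3 i M hs (by omega) (colexEdge_subset_iff.2 ⟨(exchangedEdge_subset_iff.1 h2).1,
      fun q h5 h6 => key T h2 h4 q h5 (by omega)⟩)

/-- The sets of the exchanged class that do not contain `v_p` kill as an edge behind `u_1, …, u_{N_p}`
and `v_p` would. Those that contain `v_p` occur in Construction B only. -/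
theorem card_exchangedClass (h : Exchangeable n k j ν p M) (q : ℕ) :
    ((exchangedClass n k j ν p M (j + 1 + q)).card : ℤ) =
      Ring.choose ((n : ℤ) - j - 2 - edgesUpTo ν p) q +
      if M = edgesUpTo ν (j + 1) ∧ 1 ≤ q then
        Ring.choose ((n : ℤ) - j - 1 - edgesUpTo ν (j + 1)) (q - 1) else 0 := by
  have h1 := h.lt
  have h2 := h.le
  have hb := add_le_of_le h.valid h.lt
  have hpj := edgesUpTo_mono ν (show p ≤ j + 1 by omega)
  have hjk := edgesUpTo_mono ν h.lt
  have ht := h.two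
  have hvp := vVertex_mem h.valid h.one_le (show p ≤ k by omega)
  rw [← card_filter_add_card_filter_not (fun T => vVertex n ν p ∈ T),
    h.exchangedClass_filter_mem, h.exchangedClass_filter_notMem,
    card_filter_subset_disjoint h.edge_subset_Icc
      (insert_subset hvp (h.uBefore_subset_Icc (by omega))) h.disjoint_edge_low,
    h.card_edge, card_insert_of_notMem (h.vVertex_notMem_uBefore (by omega) (by omega)),
    card_uBefore h.valid (by omega), Nat.card_Icc, if_pos (show j + 1 ≤ j + 1 + q by omega),
    Nat.add_sub_cancel_left, add_comm]
  push_cast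
  congr 1
  · rw [← Ring.choose_natCast]
    congr 1
    omega
  · by_cases hM : M = edgesUpTo ν (j + 1)
    · have hd : Disjoint (insert (vVertex n ν p) (exchangedEdge n k j ν p M))
          (uBefore n k ν (edgesUpTo ν (j + 1))) := by
        rw [disjoint_insert_left]
        refine ⟨h.vVertex_notMem_uBefore (by omega) (by omega), disjoint_right.2 fun y hy hy' => ?_⟩
        obtain ⟨r', hr', rfl⟩ := mem_image.1 hy
        rw [mem_Ico] at hr'
        obtain ⟨i', hi', hs'⟩ := exists_hasSize (ν := ν) (l := j + 1) hr'.1 (by omega)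
        rw [h.uVertex_mem_edge hs' (by omega)] at hy'
        omega
      rw [if_pos hM, card_filter_subset_disjoint (insert_subset hvp h.edge_subset_Icc)
        (h.uBefore_subset_Icc (by omega)) hd, card_insert_of_notMem h.notMem_edge, h.card_edge,
        card_uBefore h.valid (by omega), Nat.card_Icc]
      by_cases hq : 1 ≤ q
      · rw [if_pos (by omega), if_pos ⟨hM, hq⟩, ← Ring.choose_natCast,
          show j + 1 + q - (j + 1 + 1) = q - 1 by omega]
        congr 1
        omega
      · rw [if_neg (by omega), if_neg (fun h => hq h.2), Nat.cast_zero]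
    · rw [if_neg hM, if_neg (fun h => hM h.1)]
      simp

/-- The number of sets killed by the edges of size at most `l` of a construction. -/
theorem card_killed (h : Exchangeable n k j ν p M) {l : ℕ} (hl : j + 1 ≤ l) (hlk : l ≤ k) (q : ℕ) :
    (((powersetCard (j + 1 + q) (Icc 1 n)).filter fun T =>
      ∃ e ∈ exchangedHypergraph n k j ν p M l, e ⊆ T).card : ℤ) =
    kills (truncated ν (j + 1)) (n - 1) (j + q) -
      Ring.choose ((n : ℤ) - j - edgesUpTo ν (j + 1)) q +
      Ring.choose ((n : ℤ) - j - 2 - edgesUpTo ν p) q +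
      (if 1 ≤ q then (if M = edgesUpTo ν (j + 1) then
        Ring.choose ((n : ℤ) - j - 1 - edgesUpTo ν (j + 1)) (q - 1) else 0) +
        kills (fun i => if i < l - (j + 1) then ν (i + j + 2) else 0)
          ((n : ℤ) - j - 2 - M) (q - 1) else 0) := by
  rw [h.killed_eq hl hlk, card_union_of_disjoint (h.disjoint_classes _),
    card_biUnion (h.disjoint_edgeClasses _)]
  push_cast
  rw [h.card_exchangedClass]
  set f : ℕ → ℕ → ℤ := fun i r => if i ≤ j + 1 + q then
      Ring.choose ((n : ℤ) - i - (r - 1 -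
        if edgesUpTo ν (j + 1) < r then (edgesUpTo ν (j + 1) : ℤ) - M else 0)) (j + 1 + q - i)
      else 0 with hf
  have hsum : ∑ x ∈ (edgeIndex ν l).erase ⟨j + 1, edgesUpTo ν (j + 1)⟩,
      ((edgeClass n k j ν M (j + 1 + q) x).card : ℤ) =
      ∑ x ∈ edgeIndex ν l, f x.1 x.2 - f (j + 1) (edgesUpTo ν (j + 1)) := by
    rw [← Finset.sum_erase_eq_sub (f := fun x : Σ _ : ℕ, ℕ => f x.1 x.2)
      (a := ⟨j + 1, edgesUpTo ν (j + 1)⟩) (mem_edgeIndex.2 ⟨hl, h.last⟩)]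
    refine sum_congr rfl fun x hx => ?_
    obtain ⟨hi, hs⟩ := mem_edgeIndex.1 (mem_erase.1 hx).2
    exact h.card_edgeClass hs (hi.trans hlk) _
  have hlast : f (j + 1) (edgesUpTo ν (j + 1)) =
      Ring.choose ((n : ℤ) - j - edgesUpTo ν (j + 1)) q := by
    simp only [hf, lt_irrefl, if_false, Nat.le_add_right, if_true, Nat.add_sub_cancel_left]
    congr 1
    push_cast; ring
  obtain ⟨l, rfl⟩ : ∃ l', l = j + 1 + l' := ⟨l - (j + 1), by omega⟩
  have hfirst : ∑ i ∈ range (j + 1), ∑ r ∈ range (ν (i + 1)), f (i + 1) (edgesUpTo ν i + r + 1) =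
      kills (truncated ν (j + 1)) (n - 1) (j + q) := by
    rw [show truncated ν (j + 1) = fun i => if i < j + 1 then (fun i => ν (i + 1)) i else 0 from rfl,
      ← sum_choose_eq_kills]
    refine sum_congr rfl fun i hi => sum_congr rfl fun r hr => ?_
    have hi' := mem_range.1 hi
    have hr' := mem_range.1 hr
    have h1 := edgesUpTo_mono ν (show i + 1 ≤ j + 1 by omega)
    rw [edgesUpTo_succ] at h1
    have h2 : ∑ q ∈ range i, (ν (q + 1) : ℤ) = edgesUpTo ν i := by
      rw [edgesUpTo_eq_sum_range]; push_cast; rfl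
    simp only [hf]
    rw [if_neg (show ¬ edgesUpTo ν (j + 1) < edgesUpTo ν i + r + 1 by omega), h2]
    by_cases hle : i ≤ j + q
    · rw [if_pos (by omega), if_pos hle, show j + 1 + q - (i + 1) = j + q - i by omega]
      congr 1
      push_cast; ring
    · rw [if_neg (by omega), if_neg hle]
  have hsecond : ∑ i ∈ range l, ∑ r ∈ range (ν (j + 1 + i + 1)),
      f (j + 1 + i + 1) (edgesUpTo ν (j + 1 + i) + r + 1) = if 1 ≤ q then
        kills (fun i => if i < l then ν (i + j + 2) else 0) ((n : ℤ) - j - 2 - M) (q - 1)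
        else 0 := by
    split_ifs with hq
    · rw [show (fun i => if i < l then ν (i + j + 2) else 0) =
        fun i => if i < l then (fun i => ν (i + j + 2)) i else 0 from rfl, ← sum_choose_eq_kills]
      refine sum_congr rfl fun i hi => ?_
      rw [show j + 1 + i + 1 = i + j + 2 by omega]
      refine sum_congr rfl fun r hr => ?_
      have h1 := edgesUpTo_mono ν (show j + 1 ≤ j + 1 + i by omega)
      have h2 : (edgesUpTo ν (j + 1 + i) : ℤ) = edgesUpTo ν (j + 1) +
          ∑ q ∈ range i, (ν (q + j + 2) : ℤ) := by
        rw [edgesUpTo_eq_sum_range, sum_range_add, edgesUpTo_eq_sum_range]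
        push_cast
        rw [add_right_inj]
        refine sum_congr rfl fun q _ => ?_
        congr 2; omega
      simp only [hf]
      rw [if_pos (show edgesUpTo ν (j + 1) < edgesUpTo ν (j + 1 + i) + r + 1 by omega)]
      by_cases hle : i ≤ q - 1
      · rw [if_pos (by omega), if_pos hle, show j + 1 + q - (i + j + 2) = q - 1 - i by omega]
        congr 1
        push_cast
        rw [h2]
        ring
      · rw [if_neg (by omega), if_neg hle]
    · refine sum_eq_zero fun i _ => sum_eq_zero fun r _ => ?_
      simp only [hf]
      rw [if_neg (by omega)]
  rw [hsum, hlast, sum_edgeIndex, sum_range_add, hfirst, hsecond, Nat.add_sub_cancel_left]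
  by_cases hq : 1 ≤ q
  · simp only [hq, and_true, if_true]
    ring
  · simp only [hq, and_false, if_false]
    ring

end Exchangeable

end Exchange

/-! ### Families whose hypergraph is prescribed -/

/-- The hypergraph of a family is `H` as soon as the iterated shadows consist of the sets avoiding
the edges of an antichain `H`. -/
theorem labelledHypergraph_eq {n k : ℕ} {S : Finset (Finset (Fin n))} {H : Finset (Finset ℕ)}
    (hH : ∀ e ∈ H, 1 ≤ e.card ∧ e.card ≤ k ∧ e ⊆ Icc 1 n)
    (hanti : ∀ e ∈ H, ∀ e' ∈ H, e ⊆ e' → e = e')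
    (hS : ∀ s, 1 ≤ s → s ≤ k → Finset.shadow^[k - s] S = avoiding n s (H.filter fun e => e.card ≤ s)) :
    labelledHypergraph k S = H := by
  have hmem : ∀ T : Finset (Fin n), 1 ≤ T.card → T.card ≤ k →
      (T ∈ Finset.shadow^[k - T.card] S ↔ ∀ e ∈ H, ¬ e ⊆ labels T) := by
    intro T h1 h2
    rw [hS _ h1 h2, mem_avoiding]
    simp only [true_and, mem_filter, and_imp]
    refine ⟨fun h e he hsub => h e he ?_ hsub, fun h e he _ => h e he⟩
    rw [← card_labels]
    exact card_le_card hsub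
  ext e'
  rw [labelledHypergraph, mem_image]
  constructor
  · rintro ⟨T, hT, rfl⟩
    obtain ⟨-, h1, h2, h3, h4⟩ := mem_filter.1 hT
    rw [hmem T h1 h2] at h3
    push Not at h3
    obtain ⟨e, he, hsub⟩ := h3
    obtain ⟨e, rfl⟩ := exists_labels_eq (hH e he).2.2
    rw [labels_subset_labels] at hsub
    rcases hsub.eq_or_ssubset with h | h
    · exact h ▸ he
    · exfalso
      have hc := (hH _ he).1
      rw [card_labels] at hc
      have := h4 e (mem_ssubsets.2 h) (card_pos.1 hc)
      rw [hmem e hc ((card_le_card hsub).trans h2)] at this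
      exact this _ he subset_rfl
  · intro he
    obtain ⟨h1, h2, h3⟩ := hH e' he
    obtain ⟨T, rfl⟩ := exists_labels_eq h3
    rw [card_labels] at h1 h2
    refine ⟨T, mem_filter.2 ⟨mem_univ _, h1, h2, ?_, fun f hf hne => ?_⟩, rfl⟩
    · rw [hmem T h1 h2]
      exact fun h => h _ he subset_rfl
    · have hf' := mem_ssubsets.1 hf
      rw [hmem f (card_pos.2 hne) ((card_le_card hf'.1).trans h2)]
      intro e'' he'' hsub
      have := hanti _ he'' _ he (hsub.trans (labels_subset_labels.2 hf'.1))
      rw [this, labels_subset_labels] at hsub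
      exact hf'.2 hsub

/-- The `(s + 1)`-sets all of whose `s`-subsets belong to a family. -/
def cover {n : ℕ} (s : ℕ) (A : Finset (Finset (Fin n))) : Finset (Finset (Fin n)) :=
  univ.filter fun T => T.card = s + 1 ∧ ∀ x ∈ T, T.erase x ∈ A

theorem mem_cover {n s : ℕ} {A : Finset (Finset (Fin n))} {T : Finset (Fin n)} :
    T ∈ cover s A ↔ T.card = s + 1 ∧ ∀ x ∈ T, T.erase x ∈ A := by simp [cover]

theorem card_cover_image {n s : ℕ} (A : Finset (Finset (Fin n))) (σ : Equiv.Perm (Fin n)) :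
    (cover s (A.image fun T => T.image σ)).card = (cover s A).card := by
  have hinj : Function.Injective fun T : Finset (Fin n) => T.image σ := image_injective σ.injective
  rw [← card_image_of_injective (cover s A) hinj]
  congr 1
  ext U
  rw [mem_image]
  have key : ∀ T : Finset (Fin n),
      T.image σ ∈ cover s (A.image fun T => T.image σ) ↔ T ∈ cover s A := by
    intro T
    rw [mem_cover, mem_cover, card_image_of_injective _ σ.injective]
    refine and_congr_right fun _ => ?_
    rw [forall_mem_image]
    refine forall₂_congr fun x _ => ?_
    rw [← image_erase σ.injective]
    exact hinj.mem_finset_image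
  constructor
  · intro hU
    refine ⟨U.image σ.symm, ?_, ?_⟩
    · rw [← key]
      simpa [image_image] using hU
    · simp [image_image]
  · rintro ⟨T, hT, rfl⟩
    exact (key T).2 hT

theorem cover_avoiding {n s : ℕ} {H : Finset (Finset ℕ)} (hH : ∀ e ∈ H, e.card ≤ s) :
    cover s (avoiding n s H) = avoiding n (s + 1) H := by
  ext T
  rw [mem_cover, mem_avoiding]
  refine and_congr_right fun hc => ?_
  constructor
  · intro h e he hsub
    have : ∃ y ∈ labels T, y ∉ e := by
      by_contra hno
      push Not at hno
      have := card_le_card (show labels T ⊆ e from hno)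
      rw [card_labels, hc] at this
      have := hH e he
      omega
    obtain ⟨y, hy, hye⟩ := this
    obtain ⟨x, hx, rfl⟩ := mem_labels.1 hy
    refine (mem_avoiding.1 (h x hx)).2 e he ?_
    rw [labels_erase]
    exact fun z hz => mem_erase.2 ⟨fun h => hye (h ▸ hz), hsub hz⟩
  · intro h x hx
    rw [mem_avoiding, card_erase_of_mem hx, hc]
    refine ⟨rfl, fun e he hsub => h e he (hsub.trans (labels_subset_labels.2 (erase_subset _ _)))⟩

/-! ### The families of Constructions A and B -/

section Exchange

variable {n k j p M : ℕ} {ν : ℕ → ℕ}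

theorem colexHypergraph_eq_filter (hν : edgesUpTo ν k + k ≤ n) {l : ℕ} (hl : l ≤ k) :
    colexHypergraph n k ν l = (colexHypergraph n k ν k).filter fun e => e.card ≤ l := by
  ext e
  rw [mem_filter, mem_colexHypergraph, mem_colexHypergraph]
  constructor
  · rintro ⟨i, r, hi, hs, rfl⟩
    exact ⟨⟨i, r, hi.trans hl, hs, rfl⟩, (card_colexEdge hν hs (hi.trans hl)).le.trans hi⟩
  · rintro ⟨⟨i, r, hi, hs, rfl⟩, h⟩
    rw [card_colexEdge hν hs hi] at h
    exact ⟨i, r, h, hs, rfl⟩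

namespace Exchangeable

theorem hypergraph_eq_filter (h : Exchangeable n k j ν p M) {l : ℕ} (hl : l ≤ k) :
    exchangedHypergraph n k j ν p M l =
      (exchangedHypergraph n k j ν p M k).filter fun e => e.card ≤ l := by
  have h1 := h.lt
  have hlast := card_colexEdge h.valid h.last h.lt
  rw [exchangedHypergraph, exchangedHypergraph, if_neg (show ¬ k ≤ j by omega)]
  split_ifs with hlj
  · rw [filter_insert, if_neg (by rw [h.card_edge]; omega), colexHypergraph_eq_filter h.valid hl]
    ext e
    rw [mem_filter, mem_filter, mem_erase]
    refine ⟨fun ⟨h2, h3⟩ => ⟨⟨?_, h2⟩, h3⟩, fun ⟨h2, h3⟩ => ⟨h2.2, h3⟩⟩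
    rintro rfl
    omega
  · rw [filter_insert, if_pos (by rw [h.card_edge]; omega), colexHypergraph_eq_filter h.valid hl]
    congr 1
    ext e
    simp only [mem_erase, mem_filter]
    tauto

theorem hypergraph_mono (h : Exchangeable n k j ν p M) {l l' : ℕ} (hl : l ≤ l') (hl' : l' ≤ k) :
    exchangedHypergraph n k j ν p M l ⊆ exchangedHypergraph n k j ν p M l' := by
  rw [h.hypergraph_eq_filter (hl.trans hl'), h.hypergraph_eq_filter hl']
  exact fun e he => mem_filter.2 ⟨(mem_filter.1 he).1, (mem_filter.1 he).2.trans hl⟩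

theorem mem_hypergraph (h : Exchangeable n k j ν p M) {e : Finset ℕ} :
    e ∈ exchangedHypergraph n k j ν p M k ↔ e = exchangedEdge n k j ν p M ∨
      ∃ i r, i ≤ k ∧ HasSize ν i r ∧ r ≠ edgesUpTo ν (j + 1) ∧ e = colexEdge n k ν i r := by
  have h1 := h.lt
  rw [exchangedHypergraph, if_neg (show ¬ k ≤ j by omega), mem_insert, mem_erase,
    mem_colexHypergraph]
  refine or_congr_right ⟨?_, ?_⟩
  · rintro ⟨hne, i, r, hi, hs, rfl⟩
    refine ⟨i, r, hi, hs, ?_, rfl⟩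
    rintro rfl
    exact hne (by rw [hs.unique h.last])
  · rintro ⟨i, r, hi, hs, hr, rfl⟩
    exact ⟨h.edge_ne hs hi hr, i, r, hi, hs, rfl⟩

theorem hypergraph_bounds (h : Exchangeable n k j ν p M) :
    ∀ e ∈ exchangedHypergraph n k j ν p M k, 1 ≤ e.card ∧ e.card ≤ k ∧ e ⊆ Icc 1 n := by
  have h1 := h.lt
  intro e he
  rcases h.mem_hypergraph.1 he with rfl | ⟨i, r, hi, hs, -, rfl⟩
  · rw [h.card_edge]
    exact ⟨by omega, by omega, h.edge_subset_Icc⟩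
  · rw [card_colexEdge h.valid hs hi]
    exact ⟨hs.1, hi, colexEdge_subset_Icc h.valid hs hi⟩

theorem hypergraph_antichain (h : Exchangeable n k j ν p M) :
    ∀ e ∈ exchangedHypergraph n k j ν p M k, ∀ e' ∈ exchangedHypergraph n k j ν p M k,
      e ⊆ e' → e = e' := by
  have h1 := h.lt
  have hjp := h.le
  intro e he e' he' hsub
  rcases h.mem_hypergraph.1 he with rfl | ⟨i, r, hi, hs, hr, rfl⟩ <;>
    rcases h.mem_hypergraph.1 he' with rfl | ⟨i', r', hi', hs', hr', rfl⟩
  · rfl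
  · exfalso
    obtain ⟨i, hpi, hij, hs⟩ := h.exists_size
    obtain ⟨h2, h3⟩ := exchangedEdge_subset_iff.1 hsub
    have h4 := (uVertex_mem_colexEdge h.valid hs' hi' hs (by omega)).1 h2
    have h5 := (vVertex_mem_colexEdge h.valid hs' hi' (by omega) h1).1
      (h3 (j + 1) (by omega) le_rfl (by omega))
    subst h4
    have := hs.unique hs'
    omega
  · exfalso
    obtain ⟨h2, h3⟩ := colexEdge_subset_iff.1 hsub
    have h4 := (h.uVertex_mem_edge hs hi).1 h2
    subst h4
    obtain ⟨i', hpi, hij, hs'⟩ := h.exists_size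
    rw [hs.unique hs'] at h3
    exact h.notMem_edge (h3 p h.one_le hpi)
  · have h2 := (uVertex_mem_colexEdge h.valid hs' hi' hs hi).1 (colexEdge_subset_iff.1 hsub).1
    subst h2
    rw [hs.unique hs']

/-- The `s`-sets that avoid the edges of size at most `s` of a construction. -/
def family (n k j : ℕ) (ν : ℕ → ℕ) (p M s : ℕ) : Finset (Finset (Fin n)) :=
  avoiding n s (exchangedHypergraph n k j ν p M s)

/-- The edges of size larger than `j + 1` of the construction make up for the difference to the
colex hypergraph of `ν₀`. -/
structure Balanced (n k j : ℕ) (ν : ℕ → ℕ) (p M : ℕ) (ν₀ : ℕ → ℕ) : Prop where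
  valid : edgesUpTo ν₀ k + k ≤ n
  congr : ∀ i, 1 ≤ i → i ≤ j + 1 → ν₀ i = ν i
  kills_eq : ∀ q, j + 1 + q < k →
    kills (fun i => ν₀ (i + j + 2)) ((n : ℤ) - j - 2 - edgesUpTo ν (j + 1)) q =
      Ring.choose ((n : ℤ) - j - 2 - edgesUpTo ν p) (q + 1) -
        Ring.choose ((n : ℤ) - j - edgesUpTo ν (j + 1)) (q + 1) +
      ((if M = edgesUpTo ν (j + 1) then Ring.choose ((n : ℤ) - j - 1 - edgesUpTo ν (j + 1)) q
        else 0) + kills (fun i => ν (i + j + 2)) ((n : ℤ) - j - 2 - M) q)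

theorem card_family (h : Exchangeable n k j ν p M) {ν₀ : ℕ → ℕ} (hb : Balanced n k j ν p M ν₀)
    {s : ℕ} (hs : s ≤ k) : (family n k j ν p M s).card = (colexFamily n k ν₀ s).card := by
  rcases s with _ | s
  · rw [family, exchangedHypergraph, if_pos (Nat.zero_le _), ← colexFamily, card_colexFamily_zero,
      card_colexFamily_zero]
  · zify
    rw [card_colexFamily_succ hb.valid hs]
    by_cases hsj : s + 1 ≤ j
    · rw [family, exchangedHypergraph, if_pos hsj, ← colexFamily, card_colexFamily_succ h.valid hs]
      congr 1
      exact kills_congr fun i hi => (hb.congr (i + 1) (by omega) (by omega)).symm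
    · obtain ⟨q, rfl⟩ : ∃ q, s = j + q := ⟨s - j, by omega⟩
      have hk := h.card_killed (l := j + q + 1) (by omega) hs q
      rw [family, card_avoiding_eq, show j + q + 1 = j + 1 + q by omega,
        show j + 1 + q = j + q + 1 by omega]
      rw [show j + 1 + q = j + q + 1 by omega] at hk
      rw [hk]
      rcases q with _ | q
      · rw [if_neg (by omega), Ring.choose_zero_right, Ring.choose_zero_right]
        have : kills (truncated ν (j + 1)) (n - 1) (j + 0) =
            kills (fun i => ν₀ (i + 1)) (n - 1) (j + 0) := kills_congr fun i hi => by
          rw [truncated, if_pos (by omega), hb.congr (i + 1) (by omega) (by omega)]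
        rw [this]
        ring
      · rw [if_pos (by omega), Nat.add_sub_cancel]
        have e1 := kills_add (fun i => ν₀ (i + 1)) (n - 1) (j + 1) q
        have e2 : (fun i => if i < j + 1 then ν₀ (i + 1) else 0) = truncated ν (j + 1) := by
          funext i
          rw [truncated]
          split_ifs
          · exact hb.congr (i + 1) (by omega) (by omega)
          · rfl
        have e3 : ∑ i ∈ range (j + 1), (ν₀ (i + 1) : ℤ) = edgesUpTo ν (j + 1) := by
          rw [edgesUpTo_eq_sum_range]
          push_cast
          refine sum_congr rfl fun i hi => ?_
          rw [hb.congr (i + 1) (by omega) (by have := mem_range.1 hi; omega)]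
        have e4 : kills (fun i => if i < j + (q + 1) + 1 - (j + 1) then ν (i + j + 2) else 0)
            ((n : ℤ) - j - 2 - M) q = kills (fun i => ν (i + j + 2)) ((n : ℤ) - j - 2 - M) q :=
          kills_congr fun i hi => by rw [if_pos (by omega)]
        rw [e2, e3, show q + (j + 1) = j + (q + 1) by omega] at e1
        have e5 := hb.kills_eq q (by omega)
        have e6 : (fun i => ν₀ (i + (j + 1) + 1)) = fun i => ν₀ (i + j + 2) := by
          funext i; congr 1
        rw [e6, show (n : ℤ) - 1 - edgesUpTo ν (j + 1) - ((j + 1 : ℕ) : ℤ) =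
          n - j - 2 - edgesUpTo ν (j + 1) by push_cast; ring] at e1
        rw [e4, e1, e5]
        ring

/-- The avoiding sets of size `s + 1` have their shadow among those of size `s`. By the Kruskal–Katona
theorem that shadow is at least as large as in the colex case, where there are equally many sets on
both levels. So the shadow is everything. -/
theorem minShadow_family (h : Exchangeable n k j ν p M) {ν₀ : ℕ → ℕ}
    (hb : Balanced n k j ν p M ν₀) {s : ℕ} (hs : s + 1 ≤ k) :
    (family n k j ν p M (s + 1)).shadow = family n k j ν p M s ∧
      MinShadow (s + 1) (family n k j ν p M (s + 1)) := by
  have hsub : (family n k j ν p M (s + 1)).shadow ⊆ family n k j ν p M s :=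
    shadow_avoiding_subset (h.hypergraph_mono (Nat.le_succ s) hs)
  have hin := isInitSeg_colexFamily hb.valid hs
  have hkk := kruskal_katona (sized_avoiding n (s + 1) _) (h.card_family hb hs).symm.le hin
  rw [shadow_colexFamily hb.valid hs, ← h.card_family hb (by omega)] at hkk
  have heq := eq_of_subset_of_card_le hsub hkk
  refine ⟨heq, sized_avoiding n (s + 1) _, fun C hC hc => ?_⟩
  rw [isInitSeg_eq_of_card_eq hC hin (hc.trans (h.card_family hb hs)), shadow_colexFamily hb.valid hs,
    heq, h.card_family hb (by omega)]

theorem shadow_iterate_family (h : Exchangeable n k j ν p M) {ν₀ : ℕ → ℕ}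
    (hb : Balanced n k j ν p M ν₀) (i : ℕ) (hi : i ≤ k) :
    Finset.shadow^[i] (family n k j ν p M k) = family n k j ν p M (k - i) := by
  induction i with
  | zero => rfl
  | succ i ih =>
    rw [Function.iterate_succ_apply', ih (by omega), show k - i = (k - (i + 1)) + 1 by omega,
      (h.minShadow_family hb (by omega)).1]

/-- The sets of size `j + 2` distinguish the construction from a colex initial segment. -/
theorem not_isColexSegment (h : Exchangeable n k j ν p M)
    (hex : edgesUpTo ν p + 3 ≤ edgesUpTo ν (j + 1) ∨ M = edgesUpTo ν (j + 1)) :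
    ¬ IsColexSegment (family n k j ν p M (j + 1)) (j + 1) := by
  rintro ⟨σ, hσ⟩
  have hjk := h.lt
  have hcolex := isInitSeg_colexFamily h.valid h.lt
  have htwo := h.two
  have hk0 := h.card_killed (l := j + 1) le_rfl h.lt 0
  have hk1 := h.card_killed (l := j + 1) le_rfl h.lt 1
  have hsub : ∀ e ∈ colexHypergraph n k ν (j + 1), e ⊆ Icc 1 n := by
    intro e he
    obtain ⟨i, r, hi, hr, rfl⟩ := mem_colexHypergraph.1 he
    exact colexEdge_subset_Icc h.valid hr (hi.trans h.lt)
  have hc0 := ShadowDepth.card_killed h.valid h.lt hsub j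
  have hc1 := ShadowDepth.card_killed h.valid h.lt hsub (j + 1)
  rw [Nat.card_Icc, Nat.add_sub_cancel] at hc0 hc1
  have hcard : ((family n k j ν p M (j + 1)).image fun s => s.image σ).card =
      (colexFamily n k ν (j + 1)).card := by
    rw [card_image_of_injective _ (image_injective σ.injective)]
    zify
    rw [family, colexFamily, card_avoiding_eq, card_avoiding_eq, hc0]
    simp only [add_zero] at hk0
    rw [hk0]
    simp
  have heq := isInitSeg_eq_of_card_eq hσ hcolex hcard
  -- the sets all of whose `(j + 1)`-subsets are in the family are invariant under permutations; they
  -- are the `(j + 2)`-sets that avoid the edges of size at most `j + 1`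
  have hcov := card_cover_image (s := j + 1) (family n k j ν p M (j + 1)) σ
  rw [heq, colexFamily, family, cover_avoiding, cover_avoiding] at hcov
  · zify at hcov
    rw [card_avoiding_eq, card_avoiding_eq, hc1, hk1] at hcov
    simp only [Ring.choose_one_right, le_refl, if_true, Nat.sub_self, kills_zero, lt_irrefl,
      if_false, Ring.choose_zero_right] at hcov
    rcases hex with hlt | hM
    · split_ifs at hcov <;> push_cast at hcov <;> omega
    · rw [if_pos hM] at hcov
      push_cast at hcov
      omega
  · intro e he
    rw [h.hypergraph_eq_filter h.lt] at he
    exact (mem_filter.1 he).2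
  · intro e he
    rw [colexHypergraph_eq_filter h.valid h.lt] at he
    exact (mem_filter.1 he).2

/-- A balanced exchange solves the problem. -/
theorem solution (h : Exchangeable n k j ν p M) {ν₀ : ℕ → ℕ} (hb : Balanced n k j ν p M ν₀)
    (hex : edgesUpTo ν p + 3 ≤ edgesUpTo ν (j + 1) ∨ M = edgesUpTo ν (j + 1)) :
    IsSolution n k (k - (j + 1)) (colexFamily n k ν₀ k).card (family n k j ν p M k) ∧
      labelledHypergraph k (family n k j ν p M k) = exchangedHypergraph n k j ν p M k := by
  have hjk := h.lt
  refine ⟨⟨(extremal_iff (by omega)).2 ⟨?_, ?_⟩, h.card_family hb le_rfl, ?_, ?_⟩, ?_⟩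
  · rw [← card_pos, h.card_family hb le_rfl, card_colexFamily_eq_sum hb.valid le_rfl]
    omega
  · have := (h.minShadow_family hb (s := k - 1) (by omega)).2
    rwa [Nat.sub_add_cancel (by omega)] at this
  · rw [h.shadow_iterate_family hb _ (Nat.sub_le _ _), show k - (k - (j + 1)) = j + 1 by omega]
    exact h.not_isColexSegment hex
  · rw [h.shadow_iterate_family hb _ (by omega), show k - (k - (j + 1) + 1) = j by omega]
    refine ⟨1, ?_⟩
    have : family n k j ν p M j = colexFamily n k ν j := by
      rw [family, exchangedHypergraph, if_pos le_rfl, colexFamily]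
    rw [this]
    simpa using isInitSeg_colexFamily h.valid (show j ≤ k by omega)
  · refine labelledHypergraph_eq h.hypergraph_bounds h.hypergraph_antichain fun s h1 h2 => ?_
    rw [h.shadow_iterate_family hb _ (Nat.sub_le _ _), show k - (k - s) = s by omega, family,
      ← h.hypergraph_eq_filter h2]

end Exchangeable

theorem card_filter_vVertex_mem (hν : edgesUpTo ν k + k ≤ n) (hj : j + 1 ≤ k) {s : ℕ} (hs : 1 ≤ s)
    (hsj : s ≤ j) : ((colexHypergraph n k ν (j + 1)).filter fun e => vVertex n ν s ∈ e).card =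
      edgesUpTo ν (j + 1) - edgesUpTo ν s := by
  rw [← Nat.card_Ioc]
  symm
  have hsize : ∀ r ∈ Ioc (edgesUpTo ν s) (edgesUpTo ν (j + 1)), ∃ i, i ≤ j + 1 ∧ s < i ∧
      HasSize ν i r := by
    intro r hr
    rw [mem_Ioc] at hr
    obtain ⟨i, hi, h⟩ := exists_hasSize (ν := ν) (l := j + 1) (by omega) hr.2
    refine ⟨i, hi, ?_, h⟩
    by_contra hsi
    have := edgesUpTo_mono ν (not_lt.1 hsi)
    have := h.2.2
    omega
  choose! i hi hsi hsz using hsize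
  refine card_bij (fun r _ => colexEdge n k ν (i r) r) ?_ ?_ ?_
  · intro r hr
    refine mem_filter.2 ⟨mem_colexHypergraph.2 ⟨_, r, hi r hr, hsz r hr, rfl⟩, ?_⟩
    exact mem_colexEdge.2 (Or.inr ⟨s, hs, hsi r hr, rfl⟩)
  · intro r hr r' hr' h
    refine (uVertex_mem_colexEdge hν (hsz r' hr') ((hi r' hr').trans hj) (hsz r hr)
      ((hi r hr).trans hj)).1 ?_
    rw [← h]
    exact mem_colexEdge.2 (Or.inl rfl)
  · intro e he
    obtain ⟨h1, h2⟩ := mem_filter.1 he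
    obtain ⟨i', r, hi', hs', rfl⟩ := mem_colexHypergraph.1 h1
    rw [vVertex_mem_colexEdge hν hs' (hi'.trans hj) hs (by omega)] at h2
    have hr : r ∈ Ioc (edgesUpTo ν s) (edgesUpTo ν (j + 1)) := by
      have := edgesUpTo_mono ν (show s ≤ i' - 1 by omega)
      have := edgesUpTo_mono ν hi'
      have := hs'.2
      rw [mem_Ioc]; omega
    exact ⟨r, hr, by rw [hs'.unique (hsz r hr)]⟩

theorem isPivot_iff (hν : edgesUpTo ν k + k ≤ n) (hj : j + 1 ≤ k) : IsPivot n k j ν p ↔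
    IsGreatest {s | 1 ≤ s ∧ s ≤ j ∧ edgesUpTo ν s + 2 ≤ edgesUpTo ν (j + 1)} p := by
  have : {s : ℕ | 1 ≤ s ∧ s ≤ j ∧
      2 ≤ ((colexHypergraph n k ν (j + 1)).filter fun e => vVertex n ν s ∈ e).card} =
      {s | 1 ≤ s ∧ s ≤ j ∧ edgesUpTo ν s + 2 ≤ edgesUpTo ν (j + 1)} := by
    ext s
    refine and_congr_right fun h1 => and_congr_right fun h2 => ?_
    rw [card_filter_vVertex_mem hν hj h1 h2]
    omega
  rw [IsPivot, this]

/-- The greatest index of a vertex of degree at least two depends on few of the numbers of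
edges only. -/
theorem isPivot_congr {ν' : ℕ → ℕ} (hν : edgesUpTo ν k + k ≤ n) (hν' : edgesUpTo ν' k + k ≤ n)
    (hj : j + 1 ≤ k) (h : ∀ i, 1 ≤ i → i ≤ j + 1 → ν i = ν' i) (hp : IsPivot n k j ν p) :
    IsPivot n k j ν' p := by
  have key : ∀ s ≤ j + 1, edgesUpTo ν s = edgesUpTo ν' s := fun s hs =>
    edgesUpTo_congr fun i h1 h2 => h i h1 (h2.trans hs)
  rw [isPivot_iff hν hj] at hp
  rw [isPivot_iff hν' hj]
  refine ⟨⟨hp.1.1, hp.1.2.1, ?_⟩, fun s hs => hp.2 ⟨hs.1, hs.2.1, ?_⟩⟩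
  · rw [← key _ le_rfl, ← key p (hp.1.2.1.trans (Nat.le_succ j))]
    exact hp.1.2.2
  · rw [key _ le_rfl, key s (hs.2.1.trans (Nat.le_succ j))]
    exact hs.2.2

theorem IsPivot.exchangeable (hν : Admissible n k j ν) (hp : IsPivot n k j ν p)
    (h1 : M ≤ edgesUpTo ν (j + 1)) (h2 : edgesUpTo ν (j + 1) ≤ M + 1) :
    Exchangeable n k j ν p M := by
  obtain ⟨hj, hjk, hpos, hν⟩ := hν
  obtain ⟨h3, h4, h5⟩ := ((isPivot_iff hν hjk).1 hp).1
  exact ⟨hν, hjk, h3, h4, hpos, h5, h1, h2⟩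

theorem image_vVertex_erase (h : Exchangeable n k j ν p M) :
    ((Icc 1 (j + 1)).erase p).image (vVertex n ν) =
      insert (vVertex n ν (j + 1)) (((Icc 1 j).image (vVertex n ν)).erase (vVertex n ν p)) := by
  have h1 := h.lt
  have h2 := h.le
  have h3 := h.one_le
  ext y
  simp only [mem_image, mem_erase, mem_Icc, mem_insert]
  constructor
  · rintro ⟨q, ⟨h4, h5, h6⟩, rfl⟩
    by_cases hq : q = j + 1
    · exact Or.inl (by rw [hq])
    · exact Or.inr ⟨fun h' => h4 (vVertex_injOn h.valid (by omega) (by omega) h'), q,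
        ⟨h5, by omega⟩, rfl⟩
  · rintro (rfl | ⟨h4, q, ⟨h5, h6⟩, rfl⟩)
    · exact ⟨j + 1, ⟨by omega, by omega, le_rfl⟩, rfl⟩
    · exact ⟨q, ⟨fun h' => h4 (by rw [h']), h5, by omega⟩, rfl⟩

theorem isConstructionA (hν : Admissible n k j ν) (hp : IsPivot n k j ν p) :
    IsConstructionA n k j (exchangedHypergraph n k j ν p (edgesUpTo ν (j + 1) - 1) k) := by
  have h := hp.exchangeable hν (M := edgesUpTo ν (j + 1) - 1) (by omega) (by omega)
  have hjk := h.lt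
  refine ⟨ν, p, hν, hp, ?_⟩
  rw [exchangedHypergraph, if_neg (by omega), exchangedEdge, image_vVertex_erase h]
  congr 3
  rw [colexEdge, Nat.add_sub_cancel, erase_right_comm, erase_insert]
  intro h'
  obtain ⟨q, hq, hq'⟩ := mem_image.1 h'
  rw [mem_Icc] at hq
  exact uVertex_ne_vVertex h.valid h.last h.lt (by omega) hq'.symm

theorem isConstructionB (hν : Admissible n k j ν) (hp : IsPivot n k j ν p) :
    IsConstructionB n k j (exchangedHypergraph n k j ν p (edgesUpTo ν (j + 1)) k) := by
  have h := hp.exchangeable hν (M := edgesUpTo ν (j + 1)) (by omega) (by omega)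
  have hjk := h.lt
  have h2 := h.le
  refine ⟨ν, p, hν, hp, ?_⟩
  rw [exchangedHypergraph, if_neg (by omega), exchangedEdge, image_vVertex_erase h, insert_comm]
  congr 2
  rw [colexEdge, Nat.add_sub_cancel, erase_insert_of_ne]
  exact uVertex_ne_vVertex h.valid h.last h.lt (by omega)

/-- The index `M` of the vertex `u_M` of the exchanged edge. If `v_p` lies in exactly two of the edges
`e_1, …, e_N`, then Construction A would kill as many sets of size `j + 2` as the colex hypergraph, so
that Construction B is used. -/
def exchangeIndex (j : ℕ) (ν : ℕ → ℕ) (p : ℕ) : ℕ :=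
  if edgesUpTo ν p + 2 = edgesUpTo ν (j + 1) then edgesUpTo ν (j + 1) else edgesUpTo ν (j + 1) - 1

/-- The numbers of edges of the construction made from a solution `L` of the carry condition. -/
def exchangeVector (j : ℕ) (ν : ℕ → ℕ) (p : ℕ) (L : ℕ → ℕ) (i : ℕ) : ℕ :=
  if i ≤ j + 1 then ν i else
    if i = j + 2 ∧ edgesUpTo ν p + 2 = edgesUpTo ν (j + 1) then L 0 - 1 else L (i - (j + 2))

/-- The carry condition can only lower the numbers of edges: shifting and absorbing leads back from `L`
to `m`, and neither removes edges. -/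
theorem le_of_carry {c t : ℕ} {x : ℤ} {m L : ℕ → ℕ} (h : ∀ s < t,
    kills m (x - 1) s = kills L x s + ∑ q ∈ range (c - 1), Ring.choose (x + 1 + q) s) :
    ∀ i < t, L i ≤ m i := by
  obtain ⟨L', h1, -, h2⟩ := kills_shift t L x 1
  obtain ⟨L'', h3, -, h4⟩ := kills_absorb t L' (x - 1)
    ((range (c - 1)).val.map fun q : ℕ => x + 1 + q) (by
      intro y hy
      obtain ⟨q, -, rfl⟩ := Multiset.mem_map.1 hy
      have : (0 : ℤ) ≤ L' 0 := by positivity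
      have : (0 : ℤ) ≤ q := by positivity
      linarith)
  intro i hi
  have : m i = L'' i := by
    refine kills_inj (n := t - 1) (P := x - 1) (fun s hs => ?_) i (by omega)
    rw [h s (by omega), h4 s (by omega), ← h2 s (by omega), Multiset.map_map]
    simp only [Nat.cast_one]
    rfl
  rw [this]
  exact (h1 i).trans (h3 i)

variable {L : ℕ → ℕ}

/-- A solution `L` of the carry condition leads to a construction. -/
theorem exchange_of_carry (hν : Admissible n k j ν) (hp : IsPivot n k j ν p)
    (hL0 : edgesUpTo ν p + 2 = edgesUpTo ν (j + 1) → k = j + 1 ∨ 1 ≤ L 0)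
    (hL : ∀ s < k - (j + 1),
      kills (fun i => ν (i + j + 2)) ((n : ℤ) - edgesUpTo ν (j + 1) - (j + 1) - 1) s =
      kills L ((n : ℤ) - edgesUpTo ν (j + 1) - (j + 1)) s +
      ∑ q ∈ range (edgesUpTo ν (j + 1) - 1 - edgesUpTo ν p - 1),
        Ring.choose ((n : ℤ) - edgesUpTo ν (j + 1) - (j + 1) + 1 + q) s) :
    Admissible n k j (exchangeVector j ν p L) ∧ IsPivot n k j (exchangeVector j ν p L) p ∧
      Exchangeable n k j (exchangeVector j ν p L) p (exchangeIndex j ν p) ∧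
      Exchangeable.Balanced n k j (exchangeVector j ν p L) p (exchangeIndex j ν p) ν := by
  obtain ⟨hj, hjk, hpos, hval⟩ := hν
  set ν' := exchangeVector j ν p L with hν'
  have hcongr : ∀ i, i ≤ j + 1 → ν i = ν' i := fun i hi => by
    rw [hν', exchangeVector, if_pos hi]
  have hle := le_of_carry hL
  have hval' : edgesUpTo ν' k + k ≤ n := by
    refine le_trans (Nat.add_le_add_right (sum_le_sum fun i hi => ?_) k) hval
    rw [mem_Icc] at hi
    by_cases hij : i ≤ j + 1
    · exact (hcongr i hij).ge
    · have := hle (i - (j + 2)) (by omega)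
      rw [show i - (j + 2) + j + 2 = i by omega] at this
      rw [hν', exchangeVector, if_neg hij]
      split_ifs with h
      · rw [show i - (j + 2) = 0 by omega] at this
        omega
      · exact this
  have hadm : Admissible n k j ν' := ⟨hj, hjk, by rwa [← hcongr _ le_rfl], hval'⟩
  have hpiv := isPivot_congr hval hval' hjk (fun i _ hi => hcongr i hi) hp
  obtain ⟨hp1, hp2, hp3⟩ := ((isPivot_iff hval hjk).1 hp).1
  have eN : edgesUpTo ν' (j + 1) = edgesUpTo ν (j + 1) :=
    edgesUpTo_congr fun i _ hi => (hcongr i hi).symm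
  have ep : edgesUpTo ν' p = edgesUpTo ν p :=
    edgesUpTo_congr fun i _ hi => (hcongr i (by omega)).symm
  refine ⟨hadm, hpiv, hpiv.exchangeable hadm ?_ ?_, hval, fun i _ hi => hcongr i hi,
    fun q hq => ?_⟩
  · rw [eN, exchangeIndex]; split_ifs <;> omega
  · rw [eN, exchangeIndex]; split_ifs <;> omega
  · have h1 := hL q (by omega)
    rw [eN, ep, show (n : ℤ) - j - 2 - edgesUpTo ν (j + 1) =
      n - edgesUpTo ν (j + 1) - (j + 1) - 1 by ring, h1]
    -- Construction B: the sets of the exchanged class that contain `v_p` count as one edge of size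
    -- `j + 2`, which is taken from `L 0`
    by_cases hc : edgesUpTo ν p + 2 = edgesUpTo ν (j + 1)
    · have e1 : kills L ((n : ℤ) - edgesUpTo ν (j + 1) - (j + 1)) q =
          Ring.choose ((n : ℤ) - j - 1 - edgesUpTo ν (j + 1)) q +
          kills (fun i => ν' (i + j + 2)) ((n : ℤ) - j - 2 - edgesUpTo ν (j + 1)) q := by
        have := kills_add_head 1 (fun i => ν' (i + j + 2))
          ((n : ℤ) - edgesUpTo ν (j + 1) - (j + 1)) q
        simp only [range_one, sum_singleton, Nat.cast_zero, sub_zero, Nat.cast_one] at this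
        rw [show (n : ℤ) - edgesUpTo ν (j + 1) - (j + 1) - 1 =
          n - j - 2 - edgesUpTo ν (j + 1) by ring] at this
        rw [show (n : ℤ) - j - 1 - edgesUpTo ν (j + 1) =
          n - edgesUpTo ν (j + 1) - (j + 1) by ring, ← this]
        refine kills_congr fun i _ => ?_
        have := hL0 hc
        by_cases hi : i = 0
        · subst hi
          rw [if_pos rfl, hν', exchangeVector, if_neg (by omega), if_pos ⟨by omega, hc⟩]
          omega
        · rw [if_neg hi, hν', exchangeVector, if_neg (by omega), if_neg (by omega)]
          congr 1; omega
      rw [exchangeIndex, if_pos hc, if_pos rfl, e1,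
        show edgesUpTo ν (j + 1) - 1 - edgesUpTo ν p - 1 = 0 by omega]
      have e2 : (n : ℤ) - j - 2 - edgesUpTo ν p = n - j - edgesUpTo ν (j + 1) := by
        rw [← hc]; push_cast; ring
      rw [e2]
      simp
    · have e1 := sum_choose_telescope ((n : ℤ) - j - edgesUpTo ν (j + 1))
        (edgesUpTo ν (j + 1) - 1 - edgesUpTo ν p - 1) q
      have e2 : (n : ℤ) - j - edgesUpTo ν (j + 1) +
          ((edgesUpTo ν (j + 1) - 1 - edgesUpTo ν p - 1 : ℕ) : ℤ) =
          n - j - 2 - edgesUpTo ν p := by omega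
      rw [exchangeIndex, if_neg hc, if_neg (by omega)]
      rw [e2] at e1
      rw [e1, show (n : ℤ) - edgesUpTo ν (j + 1) - (j + 1) + 1 =
        n - j - edgesUpTo ν (j + 1) by ring]
      have e3 : kills L ((n : ℤ) - edgesUpTo ν (j + 1) - (j + 1)) q =
          kills (fun i => ν' (i + j + 2))
            ((n : ℤ) - j - 2 - ((edgesUpTo ν (j + 1) - 1 : ℕ) : ℤ)) q := by
        rw [show (n : ℤ) - j - 2 - ((edgesUpTo ν (j + 1) - 1 : ℕ) : ℤ) =
          n - edgesUpTo ν (j + 1) - (j + 1) by omega]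
        refine kills_congr fun i _ => ?_
        rw [hν', exchangeVector, if_neg (by omega), if_neg (fun h => hc h.2)]
        congr 1; omega
      rw [e3]
      ring

/-- A solution of the carry condition leads to a family of the required depth, whose hypergraph is
given by one of the two constructions. -/
theorem solution_of_carry (hν : Admissible n k j ν) (hp : IsPivot n k j ν p)
    (hL0 : edgesUpTo ν p + 2 = edgesUpTo ν (j + 1) → k = j + 1 ∨ 1 ≤ L 0)
    (hL : ∀ s < k - (j + 1),
      kills (fun i => ν (i + j + 2)) ((n : ℤ) - edgesUpTo ν (j + 1) - (j + 1) - 1) s =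
      kills L ((n : ℤ) - edgesUpTo ν (j + 1) - (j + 1)) s +
      ∑ q ∈ range (edgesUpTo ν (j + 1) - 1 - edgesUpTo ν p - 1),
        Ring.choose ((n : ℤ) - edgesUpTo ν (j + 1) - (j + 1) + 1 + q) s) :
    ∃ S, IsSolution n k (k - (j + 1)) (colexFamily n k ν k).card S ∧
      labelledHypergraph k S =
        exchangedHypergraph n k j (exchangeVector j ν p L) p (exchangeIndex j ν p) k ∧
      (IsConstructionA n k j (labelledHypergraph k S) ∨
        IsConstructionB n k j (labelledHypergraph k S)) := by
  obtain ⟨h1, h2, h3, h4⟩ := exchange_of_carry hν hp hL0 hL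
  obtain ⟨hp1, hp2, hp3⟩ := ((isPivot_iff hν.2.2.2 hν.2.1).1 hp).1
  have eN : edgesUpTo (exchangeVector j ν p L) (j + 1) = edgesUpTo ν (j + 1) :=
    edgesUpTo_congr fun i _ hi => by rw [exchangeVector, if_pos hi]
  have ep : edgesUpTo (exchangeVector j ν p L) p = edgesUpTo ν p :=
    edgesUpTo_congr fun i _ hi => by rw [exchangeVector, if_pos (by omega)]
  obtain ⟨h5, h6⟩ := h3.solution h4 (by
    rw [eN, ep, exchangeIndex]
    split_ifs <;> omega)
  refine ⟨_, h5, h6, ?_⟩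
  rw [h6]
  by_cases hc : edgesUpTo ν p + 2 = edgesUpTo ν (j + 1)
  · rw [exchangeIndex, if_pos hc, ← eN]
    exact Or.inr (isConstructionB h1 h2)
  · rw [exchangeIndex, if_neg hc, ← eN]
    exact Or.inl (isConstructionA h1 h2)

end Exchange

/-! ### Families whose shadow is a colex initial segment on level `j` -/

section Iterate

variable {α : Type*} [DecidableEq α]

theorem shadow_union (A B : Finset (Finset α)) : (A ∪ B).shadow = A.shadow ∪ B.shadow := by
  ext T
  simp only [mem_shadow_iff, mem_union]
  constructor
  · rintro ⟨s, h | h, h'⟩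
    · exact Or.inl ⟨s, h, h'⟩
    · exact Or.inr ⟨s, h, h'⟩
  · rintro (⟨s, h, h'⟩ | ⟨s, h, h'⟩)
    · exact ⟨s, Or.inl h, h'⟩
    · exact ⟨s, Or.inr h, h'⟩

theorem memberSubfamily_shadow_iterate (v : α) (S : Finset (Finset α)) (i : ℕ) :
    (Finset.shadow^[i] S).memberSubfamily v = Finset.shadow^[i] (S.memberSubfamily v) := by
  induction i with
  | zero => rfl
  | succ i ih =>
    rw [Function.iterate_succ_apply', Function.iterate_succ_apply', memberSubfamily_shadow, ih]

theorem nonMemberSubfamily_shadow_iterate (v : α) (S : Finset (Finset α)) (i : ℕ) :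
    (Finset.shadow^[i + 1] S).nonMemberSubfamily v =
      Finset.shadow^[i + 1] (S.nonMemberSubfamily v) ∪
        Finset.shadow^[i] (S.memberSubfamily v) := by
  induction i with
  | zero => exact nonMemberSubfamily_shadow v S
  | succ i ih =>
    rw [Function.iterate_succ_apply', nonMemberSubfamily_shadow, ih, shadow_union,
      memberSubfamily_shadow_iterate, ← Function.iterate_succ_apply' Finset.shadow,
      ← Function.iterate_succ_apply' Finset.shadow i, union_assoc, union_self]

theorem shadow_iterate_mono {A B : Finset (Finset α)} (h : A ⊆ B) (i : ℕ) :
    Finset.shadow^[i] A ⊆ Finset.shadow^[i] B := by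
  induction i with
  | zero => exact h
  | succ i ih =>
    rw [Function.iterate_succ_apply', Function.iterate_succ_apply']
    exact shadow_mono ih

theorem shadow_image_perm (σ : Equiv.Perm α) (A : Finset (Finset α)) :
    (A.image fun T => T.image σ).shadow = A.shadow.image fun T => T.image σ := by
  ext T
  simp only [mem_shadow_iff, mem_image]
  constructor
  · rintro ⟨_, ⟨s, hs, rfl⟩, a, ha, rfl⟩
    obtain ⟨x, hx, rfl⟩ := mem_image.1 ha
    exact ⟨s.erase x, ⟨s, hs, x, hx, rfl⟩, image_erase σ.injective _ _⟩
  · rintro ⟨_, ⟨s, hs, x, hx, rfl⟩, rfl⟩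
    exact ⟨_, ⟨s, hs, rfl⟩, σ x, mem_image_of_mem _ hx, (image_erase σ.injective _ _).symm⟩

theorem shadow_iterate_image_perm (σ : Equiv.Perm α) (A : Finset (Finset α)) (i : ℕ) :
    Finset.shadow^[i] (A.image fun T => T.image σ) =
      (Finset.shadow^[i] A).image fun T => T.image σ := by
  induction i with
  | zero => rfl
  | succ i ih =>
    rw [Function.iterate_succ_apply', Function.iterate_succ_apply', ih, shadow_image_perm]

end Iterate

/-- The cardinalities of the iterated shadows of a family that omits a vertex, expressed by a vector
of numbers of edges on the remaining vertices. -/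
theorem MinShadow.exists_vector {n k : ℕ} {v : Fin n} {F : Finset (Finset (Fin n))} (hk : 1 ≤ k)
    (hF : MinShadow k F) (hne : F.Nonempty) (hv : ∀ T ∈ F, v ∉ T) : ∃ g : ℕ → ℕ, ∀ s < k,
      ((Finset.shadow^[k - (s + 1)] F).card : ℤ) = (n - 1).choose (s + 1) - kills g (n - 2) s := by
  obtain ⟨n, rfl⟩ : ∃ n', n = n' + 1 := ⟨n - 1, by have := v.isLt; omega⟩
  obtain ⟨C, hC, hc⟩ := exists_isInitSeg_of_sized hF.1
  obtain ⟨ν, hν, rfl⟩ := exists_eq_colexFamily hC (by rwa [← card_pos, hc, card_pos])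
  have hcard : ∀ s < k, ((Finset.shadow^[k - (s + 1)] F).card : ℤ) =
      (n + 1).choose (s + 1) - kills (fun i => ν (i + 1)) n s := by
    intro s hs
    rw [hF.card_shadow_iterate hC hc, shadow_iterate_colexFamily hν le_rfl _ (Nat.sub_le _ _),
      show k - (k - (s + 1)) = s + 1 by omega, card_colexFamily_succ hν hs]
    push_cast
    ring_nf
  have hpos : 1 ≤ ν 1 := by
    have h1 := hcard 0 hk
    have h2 : (Finset.shadow^[k - 1] F).card ≤ n.choose 1 := by
      refine card_le_choose_of_notMem (v := v) ?_ ?_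
      · have := (hF.shadow_iterate (k - 1)).1
        rwa [show k - (k - 1) = 1 by omega] at this
      · intro T hT hvT
        have : T.erase v ∈ (Finset.shadow^[k - 1] F).memberSubfamily v :=
          mem_memberSubfamily.2 ⟨by rwa [insert_erase hvT], by simp⟩
        rw [memberSubfamily_shadow_iterate] at this
        have he : F.memberSubfamily v = ∅ := by
          rw [eq_empty_iff_forall_notMem]
          intro U hU
          exact hv _ (mem_memberSubfamily.1 hU).1 (mem_insert_self _ _)
        rw [he] at this
        have : ∀ i, Finset.shadow^[i] (∅ : Finset (Finset (Fin (n + 1)))) = ∅ := by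
          intro i
          induction i with
          | zero => rfl
          | succ i ih => rw [Function.iterate_succ_apply', ih, shadow_empty]
        simp_all
    simp only [kills_zero, zero_add, Nat.choose_one_right] at h1 h2
    omega
  refine ⟨fun i => if i = 0 then ν 1 - 1 else ν (i + 1), fun s hs => ?_⟩
  have h1 := kills_add_head 1 (fun i => if i = 0 then ν 1 - 1 else ν (i + 1)) n s
  have h2 : (fun i => if i = 0 then 1 + (fun i => if i = 0 then ν 1 - 1 else ν (i + 1)) 0 else
      (fun i => if i = 0 then ν 1 - 1 else ν (i + 1)) i) = fun i => ν (i + 1) := by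
    funext i
    by_cases hi : i = 0
    · subst hi; simp; omega
    · simp [hi]
  rw [h2] at h1
  simp only [range_one, sum_singleton, Nat.cast_zero, sub_zero, Nat.cast_one,
    Ring.choose_natCast] at h1
  rw [hcard s hs, h1, Nat.add_sub_cancel, Nat.choose_succ_succ]
  push_cast
  rw [show (n : ℤ) + 1 - 2 = n - 1 by ring]
  ring

/-- An extremal family with the numbers of edges `ν`, whose shadow on level `j` is the colex
initial segment. -/
structure ColexBelow (n k j : ℕ) (ν : ℕ → ℕ) (S : Finset (Finset (Fin n))) : Prop where
  valid : edgesUpTo ν k + k ≤ n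
  one_le : 1 ≤ j
  lt : j + 1 ≤ k
  minShadow : MinShadow k S
  card_eq : S.card = (colexFamily n k ν k).card
  shadow_eq : Finset.shadow^[k - j] S = colexFamily n k ν j

/-- The sets of size `j + 1` that are edges of the hypergraph of the family. -/
def missing (n k j : ℕ) (ν : ℕ → ℕ) (S : Finset (Finset (Fin n))) : Finset (Finset (Fin n)) :=
  avoiding n (j + 1) (colexHypergraph n k ν j) \ Finset.shadow^[k - (j + 1)] S

namespace ColexBelow

variable {n k j : ℕ} {ν : ℕ → ℕ} {S : Finset (Finset (Fin n))}

theorem card_level (h : ColexBelow n k j ν S) {s : ℕ} (hs : s ≤ k) :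
    (Finset.shadow^[k - s] S).card = (colexFamily n k ν s).card := by
  have h1 := h.valid
  have h2 := h.lt
  obtain ⟨n, rfl⟩ : ∃ n', n = n' + 1 := ⟨n - 1, by omega⟩
  rw [h.minShadow.card_shadow_iterate (isInitSeg_colexFamily h.valid le_rfl) h.card_eq.symm,
    shadow_iterate_colexFamily h.valid le_rfl _ (Nat.sub_le _ _), show k - (k - s) = s by omega]

theorem shadow_level (S : Finset (Finset (Fin n))) {s : ℕ} (hs : s + 1 ≤ k) :
    (Finset.shadow^[k - (s + 1)] S).shadow = Finset.shadow^[k - s] S := by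
  rw [← Function.iterate_succ_apply' Finset.shadow, show (k - (s + 1)).succ = k - s by omega]

/-- Below level `j` the shadows are colex, too. -/
theorem level_eq (h : ColexBelow n k j ν S) {s : ℕ} (hs : s ≤ j) :
    Finset.shadow^[k - s] S = colexFamily n k ν s := by
  have h2 := h.lt
  rw [show k - s = (j - s) + (k - j) by omega, Function.iterate_add_apply, h.shadow_eq,
    shadow_iterate_colexFamily h.valid (by omega) _ (Nat.sub_le _ _),
    show j - (j - s) = s by omega]

theorem sized_level (h : ColexBelow n k j ν S) {s : ℕ} (hs : s ≤ k) :
    (Finset.shadow^[k - s] S : Set (Finset (Fin n))).Sized s := by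
  have h1 := h.valid
  have h2 := h.lt
  obtain ⟨n, rfl⟩ : ∃ n', n = n' + 1 := ⟨n - 1, by omega⟩
  have := (h.minShadow.shadow_iterate (k - s)).1
  rwa [show k - (k - s) = s by omega] at this

theorem mem_level (h : ColexBelow n k j ν S) {T : Finset (Fin n)} (hT : T.card ≤ j) :
    T ∈ Finset.shadow^[k - T.card] S ↔ ∀ e ∈ colexHypergraph n k ν j, ¬ e ⊆ labels T := by
  have h2 := h.lt
  rw [h.level_eq hT, colexFamily, mem_avoiding, and_iff_right rfl,
    colexHypergraph_eq_filter h.valid (hT.trans (by omega)),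
    colexHypergraph_eq_filter h.valid (show j ≤ k by omega)]
  simp only [mem_filter, and_imp]
  refine ⟨fun h e he _ hsub => h e he ?_ hsub, fun h e he hc => h e he (hc.trans hT)⟩
  rw [← card_labels]
  exact card_le_card hsub

theorem level_succ_subset (h : ColexBelow n k j ν S) :
    Finset.shadow^[k - (j + 1)] S ⊆ avoiding n (j + 1) (colexHypergraph n k ν j) := by
  rw [← cover_avoiding]
  · intro T hT
    refine mem_cover.2 ⟨h.sized_level h.lt hT, fun x hx => ?_⟩
    have := erase_mem_shadow hT hx
    rw [shadow_level S h.lt, h.shadow_eq] at this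
    exact this
  · intro e he
    obtain ⟨i, r, hi, hs, rfl⟩ := mem_colexHypergraph.1 he
    rw [card_colexEdge h.valid hs (by have := h.lt; omega)]
    exact hi

theorem edge_subset_Icc (h : ColexBelow n k j ν S) : ∀ e ∈ colexHypergraph n k ν j, e ⊆ Icc 1 n := by
  intro e he
  obtain ⟨i, r, hi, hs, rfl⟩ := mem_colexHypergraph.1 he
  exact colexEdge_subset_Icc h.valid hs (by have := h.lt; omega)

theorem card_missing (h : ColexBelow n k j ν S) : (missing n k j ν S).card = ν (j + 1) := by
  have h1 := h.lt
  rw [missing, card_sdiff_of_subset h.level_succ_subset, h.card_level h.lt]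
  have e1 := card_avoiding_eq n (j + 1) (colexHypergraph n k ν j)
  rw [card_killed h.valid (by omega) h.edge_subset_Icc, Nat.card_Icc, Nat.add_sub_cancel] at e1
  have e2 := card_colexFamily_succ h.valid h.lt
  have e3 := kills_add (fun i => ν (i + 1)) (n - 1) j 0
  rw [zero_add, kills_zero, zero_add] at e3
  rw [e3] at e2
  change _ = _ - (kills (truncated ν j) _ _ + _) at e2
  omega

theorem mem_missing {T : Finset (Fin n)} : T ∈ missing n k j ν S ↔ (T.card = j + 1 ∧
    ∀ e ∈ colexHypergraph n k ν j, ¬ e ⊆ labels T) ∧ T ∉ Finset.shadow^[k - (j + 1)] S := by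
  rw [missing, mem_sdiff, mem_avoiding]

/-- The vertex `v` lies in exactly those edges of size at most `j` whose size exceeds `i`. -/
def IsUniform (n k j : ℕ) (ν : ℕ → ℕ) (v : Fin n) (i : ℕ) : Prop :=
  1 ≤ i ∧ i ≤ j ∧ ∀ i' r, i' ≤ j → HasSize ν i' r → (v.val + 1 ∈ colexEdge n k ν i' r ↔ i < i')

/-- The number of edges of size `j + 1` that do not contain `v`. -/
def missingAway (n k j : ℕ) (ν : ℕ → ℕ) (S : Finset (Finset (Fin n))) (v : Fin n) : ℕ :=
  ((missing n k j ν S).filter fun T => v ∉ T).card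

variable {v : Fin n} {i : ℕ}

/-- If some edge contains `v`, then the deletion of `v` has minimum shadows, too, and the
iterated shadows of the link are contained in those of the deletion. -/
theorem deletion (h : ColexBelow n k j ν S) {T : Finset (Fin n)} {s : ℕ} (hs : s + 1 ≤ k)
    (hvT : v ∉ T) (hT : T ∈ Finset.shadow^[k - s] S)
    (hT' : insert v T ∉ Finset.shadow^[k - (s + 1)] S) :
    MinShadow k (S.nonMemberSubfamily v) ∧ MinShadow (k - 1) (S.memberSubfamily v) ∧
      (S.nonMemberSubfamily v).Nonempty ∧
      (∀ s ≤ k, (Finset.shadow^[k - s] S).nonMemberSubfamily v =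
        Finset.shadow^[k - s] (S.nonMemberSubfamily v)) := by
  have h1 := h.valid
  have h2 := h.lt
  obtain ⟨n, rfl⟩ : ∃ n', n = n' + 1 := ⟨n - 1, by omega⟩
  obtain ⟨k, rfl⟩ : ∃ k', k = k' + 1 := ⟨k - 1, by omega⟩
  obtain ⟨hL, hD | ⟨hD, hsub, -⟩⟩ := h.minShadow.vertex v
  · exfalso
    have h3 : T ∈ (Finset.shadow^[k + 1 - s] S).nonMemberSubfamily v :=
      mem_nonMemberSubfamily.2 ⟨hT, hvT⟩
    rw [show k + 1 - s = (k + 1 - (s + 1)) + 1 by omega, nonMemberSubfamily_shadow_iterate,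
      Function.iterate_succ_apply, union_eq_right.2 (shadow_iterate_mono hD _),
      ← memberSubfamily_shadow_iterate] at h3
    exact hT' (mem_memberSubfamily.1 h3).1
  · refine ⟨hD, hL, ?_, fun s hs => ?_⟩
    · have hne : S.Nonempty := by
        rw [← card_pos, h.card_eq, card_colexFamily_eq_sum h.valid le_rfl]
        omega
      by_contra hD0
      rw [not_nonempty_iff_eq_empty] at hD0
      rw [hD0, shadow_empty, subset_empty] at hsub
      have := card_memberSubfamily_add_card_nonMemberSubfamily v S
      rw [hD0, hsub, card_empty] at this
      have := card_pos.2 hne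
      omega
    · rcases Nat.eq_zero_or_pos (k + 1 - s) with h0 | h0
      · rw [h0]; rfl
      · rw [show k + 1 - s = (k + 1 - (s + 1)) + 1 by omega, nonMemberSubfamily_shadow_iterate,
          union_eq_left]
        rw [Function.iterate_succ_apply]
        exact shadow_iterate_mono hsub _

theorem disjoint_uniform (hv : IsUniform n k j ν v i) :
    ∀ e ∈ colexHypergraph n k ν i, e ⊆ Icc 1 n → e ⊆ (Icc 1 n).erase (v.val + 1) := by
  intro e he hsub y hy
  obtain ⟨i', r, hi', hs, rfl⟩ := mem_colexHypergraph.1 he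
  refine mem_erase.2 ⟨?_, hsub hy⟩
  rintro rfl
  have := (hv.2.2 i' r (hi'.trans hv.2.1) hs).1 hy
  omega

/-- A set that does not contain `v` has to avoid the edges of size at most `i` only. -/
theorem avoiding_uniform (hv : IsUniform n k j ν v i) {T : Finset (Fin n)} (hT : v ∉ T) :
    (∀ e ∈ colexHypergraph n k ν j, ¬ e ⊆ labels T) ↔
      ∀ e ∈ colexHypergraph n k ν i, ¬ e ⊆ labels T := by
  refine ⟨fun h e he => h e (colexHypergraph_mono hv.2.1 he), fun h e he hsub => ?_⟩
  obtain ⟨i', r, hi', hs, rfl⟩ := mem_colexHypergraph.1 he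
  by_cases hi : i' ≤ i
  · exact h _ (mem_colexHypergraph.2 ⟨i', r, hi, hs, rfl⟩) hsub
  · exact hT (succ_mem_labels.1 (hsub ((hv.2.2 i' r hi' hs).2 (by omega))))

theorem card_avoiding_uniform (h : ColexBelow n k j ν S) (hv : IsUniform n k j ν v i) (s : ℕ) :
    ((univ.filter fun T : Finset (Fin n) => T.card = s + 1 ∧ v ∉ T ∧
      ∀ e ∈ colexHypergraph n k ν i, ¬ e ⊆ labels T).card : ℤ) =
    (n - 1).choose (s + 1) - kills (truncated ν i) (n - 2) s := by
  have hvn : v.val + 1 ∈ Icc 1 n := by rw [mem_Icc]; omega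
  have h2 := h.lt
  have hcard : ((Icc 1 n).erase (v.val + 1)).card = n - 1 := by
    rw [card_erase_of_mem hvn, Nat.card_Icc, Nat.add_sub_cancel]
  rw [card_eq_filter_powersetCard (s := s + 1) (p := fun T => ∀ e ∈ colexHypergraph n k ν i, ¬ e ⊆ T)
    (erase_subset (v.val + 1) (Icc 1 n)), card_avoiding,
    card_killed h.valid (hv.2.1.trans (by omega)), hcard]
  · have := v.isLt
    rw [Nat.cast_sub (by omega)]
    congr 2
    push_cast; ring
  · exact fun e he => disjoint_uniform hv e he
      (h.edge_subset_Icc e (colexHypergraph_mono hv.2.1 he))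
  · intro T
    rw [mem_filter, and_iff_right (mem_univ _)]
    refine and_congr_right fun _ => and_congr_left fun _ => ?_
    rw [← succ_mem_labels]
    exact ⟨fun h' y hy => mem_erase.2 ⟨fun h'' => h' (h'' ▸ hy), labels_subset_Icc T hy⟩,
      fun h' hy => (mem_erase.1 (h' hy)).1 rfl⟩

theorem card_deletion (h : ColexBelow n k j ν S) (hv : IsUniform n k j ν v i) {s : ℕ} (hs : s < j) :
    (((Finset.shadow^[k - (s + 1)] S).nonMemberSubfamily v).card : ℤ) =
    (n - 1).choose (s + 1) - kills (truncated ν i) (n - 2) s := by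
  rw [← h.card_avoiding_uniform hv]
  congr 2
  ext T
  rw [mem_nonMemberSubfamily, mem_filter, and_iff_right (mem_univ _)]
  have h1 := h.lt
  constructor
  · rintro ⟨h1, h2⟩
    have hc := h.sized_level (show s + 1 ≤ k by omega) h1
    rw [← hc, h.mem_level (by omega), avoiding_uniform hv h2] at h1
    exact ⟨hc, h2, h1⟩
  · rintro ⟨hc, h2, h3⟩
    rw [← avoiding_uniform hv h2, ← h.mem_level (by omega), hc] at h3
    exact ⟨h3, h2⟩

theorem card_deletion_succ (h : ColexBelow n k j ν S) (hv : IsUniform n k j ν v i) :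
    (((Finset.shadow^[k - (j + 1)] S).nonMemberSubfamily v).card : ℤ) =
    (n - 1).choose (j + 1) - kills (truncated ν i) (n - 2) j - missingAway n k j ν S v := by
  rw [← h.card_avoiding_uniform hv, eq_sub_iff_add_eq, missingAway]
  norm_cast
  rw [← card_union_of_disjoint]
  · congr 1
    ext T
    rw [mem_union, mem_nonMemberSubfamily, mem_filter, mem_filter, and_iff_right (mem_univ _),
      mem_missing]
    constructor
    · rintro (⟨h1, h2⟩ | ⟨⟨⟨h1, h2⟩, -⟩, h4⟩)
      · obtain ⟨h3, h4⟩ := mem_avoiding.1 (h.level_succ_subset h1)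
        exact ⟨h3, h2, (avoiding_uniform hv h2).1 h4⟩
      · exact ⟨h1, h4, (avoiding_uniform hv h4).1 h2⟩
    · rintro ⟨h1, h2, h3⟩
      rw [← avoiding_uniform hv h2] at h3
      tauto
  · rw [disjoint_left]
    intro T hT hT'
    exact (mem_missing.1 (mem_filter.1 hT').1).2 (mem_nonMemberSubfamily.1 hT).1

end ColexBelow

/-! ### Deleting a vertex from a family that is colex on level `j` -/

/-- Adding a single edge to a vector of numbers of edges of sizes at most `i`. -/
theorem kills_add_single {m : ℕ → ℕ} {i a : ℕ} (hm : ∀ q, i ≤ q → m q = 0) (hi : i ≤ a + 1) (P : ℤ)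
    (s : ℕ) : kills (fun q => m q + if q = a then 1 else 0) P (s + a) =
      kills m P (s + a) + Ring.choose (P - ∑ q ∈ range (a + 1), (m q : ℤ) - a) s := by
  rw [kills_add, kills_add m]
  have e1 : (fun q => if q < a then m q + (if q = a then 1 else 0) else 0) =
      fun q => if q < a then m q else 0 := by
    funext q
    by_cases hq : q < a
    · simp [hq, hq.ne]
    · simp [hq]
  have e2 : ∑ q ∈ range a, ((m q + (if q = a then 1 else 0) : ℕ) : ℤ) = ∑ q ∈ range a, (m q : ℤ) :=
    sum_congr rfl fun q hq => by simp [(mem_range.1 hq).ne]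
  have e3 := kills_add_head (m a) (fun q => if q = 0 then 1 else 0)
    (P - ∑ q ∈ range a, (m q : ℤ) - a) s
  have e4 := kills_add_head (m a) (fun _ => 0) (P - ∑ q ∈ range a, (m q : ℤ) - a) s
  have e5 : (fun q => m (q + a) + if q + a = a then 1 else 0) = fun q => if q = 0 then
      m a + (fun q => if q = 0 then 1 else 0) 0 else (fun q => if q = 0 then 1 else 0) q := by
    funext q
    rcases q with _ | q
    · simp
    · simp [hm (q + 1 + a) (by omega)]
  have e6 : (fun q => m (q + a)) = fun q => if q = 0 then m a + (fun _ => 0) 0 else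
      (fun _ => 0) q := by
    funext q
    rcases q with _ | q
    · simp
    · simp [hm (q + 1 + a) (by omega)]
  rw [e1, e2, e5, e6, e3, e4, kills_single, kills_eq_zero (l := fun _ => 0) fun _ _ => rfl,
    sum_range_succ]
  rw [show P - (∑ q ∈ range a, (m q : ℤ) + m a) - a = P - ∑ q ∈ range a, (m q : ℤ) - a - m a by ring]
  ring

namespace ColexBelow

variable {n k j : ℕ} {ν : ℕ → ℕ} {S : Finset (Finset (Fin n))} {v : Fin n} {i : ℕ}

/-- Comparing a family with the deletion and the link of a vertex, by means of vectors of numbers of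
edges. Here `lam` is the vector of the link. -/
theorem split (h : ColexBelow n k j ν S) (hv : IsUniform n k j ν v i) {T : Finset (Fin n)} {s : ℕ}
    (hs : s + 1 ≤ k) (hvT : v ∉ T) (hT : T ∈ Finset.shadow^[k - s] S)
    (hT' : insert v T ∉ Finset.shadow^[k - (s + 1)] S) :
    ∃ g lam hh : ℕ → ℕ, g 0 = missingAway n k j ν S v ∧
      (∀ s ≤ k - 1 - j, kills (fun q => ν (q + j + 1)) ((n : ℤ) - 1 - edgesUpTo ν j - j) s =
        kills hh ((n : ℤ) - 1 - edgesUpTo ν j - j) s +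
        kills g ((n : ℤ) - 1 - edgesUpTo ν j - j + (edgesUpTo ν j - edgesUpTo ν i : ℕ) - 1) s) ∧
      (∀ s < k - 1, (((Finset.shadow^[k - (s + 2)] S).memberSubfamily v).card : ℤ) =
        (n - 1).choose (s + 1) - kills lam (n - 2) s) ∧
      (∀ q < j, lam q = truncated ν i q +
        if i ≤ q + 1 then ν (q + 2) - (if q + 1 = j then missingAway n k j ν S v else 0) else 0) ∧
      hh 0 + missingAway n k j ν S v = ν (j + 1) ∧ ∀ q, hh (q + 1) = lam (q + j) := by
  have hjk := h.lt
  have hij := hv.2.1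
  have hi1 := hv.1
  obtain ⟨hD, hL, hDne, hlev⟩ := h.deletion hs hvT hT hT'
  have hlink : ∀ s, s + 1 ≤ k → (Finset.shadow^[k - (s + 1)] S).memberSubfamily v =
      Finset.shadow^[k - 1 - s] (S.memberSubfamily v) := by
    intro s hs
    rw [memberSubfamily_shadow_iterate, show k - (s + 1) = k - 1 - s by omega]
  have hn1 : 1 ≤ n := by have := v.isLt; omega
  -- `v` itself belongs to the first level
  have h0 : ((Finset.shadow^[k - 1] S).memberSubfamily v) = {∅} := by
    rw [eq_singleton_iff_unique_mem]
    constructor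
    · rw [mem_memberSubfamily]
      refine ⟨?_, by simp⟩
      have hc : (insert v (∅ : Finset (Fin n))).card = 1 := by simp
      have := h.mem_level (T := insert v ∅) (by rw [hc]; exact h.one_le)
      rw [hc] at this
      rw [this]
      intro e he hsub
      obtain ⟨i', r, hi', hs', rfl⟩ := mem_colexHypergraph.1 he
      have hce := card_colexEdge h.valid hs' (by omega)
      have hcs := card_le_card hsub
      rw [card_labels, hc, hce] at hcs
      have h1 := hs'.1
      have hmem : v.val + 1 ∈ colexEdge n k ν i' r := by
        have heq := eq_of_subset_of_card_le hsub (by rw [card_labels, hc, hce]; omega)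
        rw [heq]
        exact succ_mem_labels.2 (mem_insert_self _ _)
      have := (hv.2.2 i' r hi' hs').1 hmem
      omega
    · intro U hU
      obtain ⟨hU1, hU2⟩ := mem_memberSubfamily.1 hU
      have := h.sized_level (show 1 ≤ k by omega) hU1
      rw [card_insert_of_notMem hU2] at this
      exact card_eq_zero.1 (by omega)
  have hLne : (S.memberSubfamily v).Nonempty := by
    by_contra hL0
    rw [not_nonempty_iff_eq_empty] at hL0
    rw [memberSubfamily_shadow_iterate, hL0, shadow_iterate_empty] at h0
    exact absurd h0.symm (singleton_ne_empty _)
  obtain ⟨g, hg⟩ := hD.exists_vector (by omega) hDne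
    (fun T hT => (mem_nonMemberSubfamily.1 hT).2)
  obtain ⟨lam, hlam⟩ := hL.exists_vector (by omega) hLne
    (fun T hT => (mem_memberSubfamily.1 hT).2)
  have hg' : ∀ s < k, (((Finset.shadow^[k - (s + 1)] S).nonMemberSubfamily v).card : ℤ) =
      (n - 1).choose (s + 1) - kills g (n - 2) s := fun s hs => by
    rw [hlev _ (by omega), hg s hs]
  have hlam' : ∀ s < k - 1, (((Finset.shadow^[k - (s + 2)] S).memberSubfamily v).card : ℤ) =
      (n - 1).choose (s + 1) - kills lam (n - 2) s := fun s hs => by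
    rw [hlink (s + 1) (by omega), hlam s hs]
  have hA : ∀ s < k, ((Finset.shadow^[k - (s + 1)] S).card : ℤ) =
      n.choose (s + 1) - kills (fun i => ν (i + 1)) (n - 1) s := fun s hs => by
    rw [h.card_level (by omega), card_colexFamily_succ h.valid (by omega)]
  have hpart : ∀ s < k, ((Finset.shadow^[k - (s + 1)] S).card : ℤ) =
      ((Finset.shadow^[k - (s + 1)] S).memberSubfamily v).card +
      ((Finset.shadow^[k - (s + 1)] S).nonMemberSubfamily v).card := fun s hs => by
    rw [← card_memberSubfamily_add_card_nonMemberSubfamily v]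
    push_cast; rfl
  obtain ⟨n', rfl⟩ : ∃ n', n = n' + 1 := ⟨n - 1, by omega⟩
  -- the vector of the deletion up to level `j`
  have hgv : ∀ q ≤ j, g q = if q = j then missingAway (n' + 1) k j ν S v else truncated ν i q := by
    refine kills_inj (P := (((n' + 1 : ℕ) : ℤ) - 2)) fun s hsj => ?_
    rcases hsj.eq_or_lt with rfl | hlt
    · have e1 := hg' s (by omega)
      rw [h.card_deletion_succ hv] at e1
      have e2 := kills_add (fun q => if q = s then missingAway (n' + 1) k s ν S v else
        truncated ν i q) (((n' + 1 : ℕ) : ℤ) - 2) s 0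
      rw [zero_add, kills_zero, zero_add, if_pos rfl] at e2
      have e3 : (fun q => if q < s then (if q = s then missingAway (n' + 1) k s ν S v else
          truncated ν i q) else 0) = truncated ν i := by
        funext q
        by_cases hq : q < s
        · rw [if_pos hq, if_neg hq.ne]
        · rw [if_neg hq, truncated, if_neg (by omega)]
      rw [e3] at e2
      linarith
    · have e1 := hg' s (by omega)
      rw [h.card_deletion hv hlt] at e1
      rw [kills_congr (l := fun q => if q = j then _ else _) (l' := truncated ν i)
        fun q hq => if_neg (by omega)]
      linarith
  have hγ : missingAway (n' + 1) k j ν S v ≤ ν (j + 1) := by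
    rw [← h.card_missing]
    exact card_le_card (filter_subset _ _)
  have hPn : (((n' + 1 : ℕ) : ℤ)) - 1 - 1 = ((n' + 1 : ℕ) : ℤ) - 2 := by ring
  -- remove the edges of size at most `i`, which do not contain `v`
  obtain ⟨p1, p2, p3⟩ := kills_peel i hi1 (l := fun q => ν (q + 1)) (g := g) (h := lam)
    (P := ((n' + 1 : ℕ) : ℤ) - 1) (n := k - 1) (by omega) (by
      have e1 := hpart 0 (by omega)
      rw [hA 0 (by omega), hg' 0 (by omega), zero_add, h0, card_singleton] at e1
      rw [hPn]
      simp only [Nat.choose_one_right, Nat.add_sub_cancel] at e1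
      push_cast at e1 ⊢
      linarith) (fun s hs => by
      have e1 := hpart (s + 1) (by omega)
      rw [hA (s + 1) (by omega), hg' (s + 1) (by omega), hlam' s (by omega), Nat.add_sub_cancel,
        Nat.choose_succ_succ] at e1
      rw [hPn]
      simp only [Nat.succ_eq_add_one] at e1
      push_cast at e1 ⊢
      linarith) (fun q hq => by
      rw [hgv q (by omega), if_neg (by omega), truncated, if_pos hq]) (by
      rw [hgv i hij]
      split_ifs with hi
      · subst hi; exact hγ
      · rw [truncated, if_neg (lt_irrefl _)]; exact Nat.zero_le _)
  have hNi : ∑ q ∈ range i, (ν (q + 1) : ℤ) = edgesUpTo ν i := by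
    rw [edgesUpTo_eq_sum_range]; push_cast; rfl
  have hNj : ∑ q ∈ range (j - i), ν (q + i + 1) = edgesUpTo ν j - edgesUpTo ν i := by
    rw [edgesUpTo_eq_sum_range, edgesUpTo_eq_sum_range,
      show range j = range (i + (j - i)) by rw [show i + (j - i) = j by omega],
      sum_range_add, Nat.add_sub_cancel_left]
    refine sum_congr rfl fun q _ => ?_
    congr 1; omega
  have hNj' : ∑ q ∈ range (j - i), (ν (q + i + 1) : ℤ) = edgesUpTo ν j - edgesUpTo ν i := by
    have := edgesUpTo_mono ν hij
    rw [← Nat.cast_sub this, ← hNj]; push_cast; rfl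
  -- remove the edges of sizes from `i + 1` to `j`, all of which contain `v` and belong to the link
  obtain ⟨t1, t2⟩ := kills_split_tail (a := j - i) (n := k - 1 - j)
    (l := fun q => ν (q + i + 1)) (g := fun q => g (q + i))
    (h := fun q => if q = 0 then ν (i + 1) - g i else lam (q + i - 1))
    (P := ((n' + 1 : ℕ) : ℤ) - 1 - ∑ q ∈ range i, (ν (q + 1) : ℤ) - i)
    (fun s hs => by rw [p3 s (by omega), add_comm]) (fun q hq => by
      rw [hgv _ (by omega), if_neg (by omega), truncated, if_neg (by omega)])
  refine ⟨fun q => g (q + (j - i) + i), lam, fun q => if q + (j - i) = 0 then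
      ν (i + 1) - g i else lam (q + (j - i) + i - 1), ?_, fun s hs => ?_, hlam', ?_, ?_, ?_⟩
  · simp only [zero_add]
    rw [show j - i + i = j by omega, hgv j le_rfl, if_pos rfl]
  · have := t2 s hs
    rw [hNj, hNj', hNi] at this
    have e1 : (((n' + 1 : ℕ) : ℤ)) - 1 - edgesUpTo ν i - i - (edgesUpTo ν j - edgesUpTo ν i) -
        (j - i : ℕ) = ((n' + 1 : ℕ) : ℤ) - 1 - edgesUpTo ν j - j := by
      push_cast [hij]; ring
    rw [e1] at this
    have e2 : (fun q => ν (q + (j - i) + i + 1)) = fun q => ν (q + j + 1) := by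
      funext q; congr 1; omega
    rw [e2] at this
    exact this
  · have hzero : (if j - i = 0 then ν (i + 1) - g i else lam (j - i + i - 1)) +
        missingAway (n' + 1) k j ν S v = ν (j + 1) := by
      have := t2 0 (Nat.zero_le _)
      simp only [kills_zero, zero_add] at this
      rw [show j - i + i = j by omega] at this ⊢
      rw [hgv j le_rfl, if_pos rfl] at this
      exact_mod_cast this.symm
    intro q hq
    by_cases hqi : q < i - 1
    · rw [p1 q hqi, truncated, if_pos (by omega), if_neg (by omega)]; rfl
    · by_cases hqi' : q = i - 1
      · rw [hqi', p2, truncated, if_pos (by omega), if_pos (by omega), hgv i hij]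
        rw [show i - 1 + 2 = i + 1 by omega, show i - 1 + 1 = i by omega]
        split_ifs with hi
        · rfl
        · rw [truncated, if_neg (by omega)]
      · rw [truncated, if_neg (by omega), if_pos (by omega), zero_add]
        by_cases hqj : q + 1 = j
        · rw [if_neg (by omega), show j - i + i - 1 = q by omega] at hzero
          rw [if_pos hqj, show q + 2 = j + 1 by omega]
          omega
        · have := t1 (q + 1 - i) (by omega)
          rw [if_neg (by omega)] at this
          rw [if_neg hqj, Nat.sub_zero, show q + 2 = q + 1 - i + i + 1 by omega, this]
          congr 1; omega
  · have := t2 0 (Nat.zero_le _)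
    simp only [kills_zero, zero_add] at this
    rw [show j - i + i = j by omega] at this
    rw [hgv j le_rfl, if_pos rfl] at this
    simp only [zero_add]
    rw [show j - i + i = j by omega]
    exact_mod_cast this.symm
  · intro q
    dsimp only
    rw [if_neg (by omega)]
    congr 1; omega

theorem missingAway_le (h : ColexBelow n k j ν S) : missingAway n k j ν S v ≤ ν (j + 1) := by
  rw [← h.card_missing]
  exact card_le_card (filter_subset _ _)

/-- An edge that contains `v` becomes a face when `v` is removed. -/
theorem exists_edge (h : ColexBelow n k j ν S) (hv : IsUniform n k j ν v i)
    (hh : edgesUpTo ν i + missingAway n k j ν S v < edgesUpTo ν (j + 1)) :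
    ∃ (T : Finset (Fin n)) (s : ℕ), s + 1 ≤ k ∧ v ∉ T ∧ T ∈ Finset.shadow^[k - s] S ∧
      insert v T ∉ Finset.shadow^[k - (s + 1)] S := by
  have hjk := h.lt
  by_cases hN : edgesUpTo ν i < edgesUpTo ν j
  · -- an edge of size at most `j`
    obtain ⟨i', hi', hs⟩ := exists_hasSize (ν := ν) (l := j) (show 1 ≤ edgesUpTo ν j by omega) le_rfl
    have hii : i < i' := by
      by_contra hle
      have := edgesUpTo_mono ν (not_lt.1 hle)
      have := hs.2.2
      omega
    have hvmem := (hv.2.2 i' _ hi' hs).2 hii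
    obtain ⟨e, he⟩ := exists_labels_eq (colexEdge_subset_Icc h.valid hs (show i' ≤ k by omega))
    have hce : e.card = i' := by rw [← card_labels, he, card_colexEdge h.valid hs (by omega)]
    rw [← he] at hvmem
    have hve := succ_mem_labels.1 hvmem
    have hcT : (e.erase v).card = i' - 1 := by rw [card_erase_of_mem hve, hce]
    refine ⟨e.erase v, i' - 1, by omega, by simp, ?_, ?_⟩
    · have := h.mem_level (T := e.erase v) (by omega)
      rw [hcT] at this
      rw [this]
      intro e' he' hsub
      obtain ⟨i'', r, hi'', hs', rfl⟩ := mem_colexHypergraph.1 he'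
      rw [labels_erase, he] at hsub
      have hsub' := hsub.trans (erase_subset _ _)
      have := (uVertex_mem_colexEdge h.valid hs (by omega) hs' (by omega)).1
        (colexEdge_subset_iff.1 hsub').1
      subst this
      have := hs.unique hs'
      subst this
      rw [← he] at hsub
      exact (mem_erase.1 (hsub hvmem)).1 rfl
    · rw [insert_erase hve, show i' - 1 + 1 = e.card by omega, h.mem_level (by omega)]
      exact fun h' => h' _ (mem_colexHypergraph.2 ⟨i', _, hi', hs, rfl⟩) (by rw [he])
  · have hlt : missingAway n k j ν S v < (missing n k j ν S).card := by
      rw [h.card_missing]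
      have := edgesUpTo_succ ν j
      have := edgesUpTo_mono ν hv.2.1
      omega
    have hex : ∃ e ∈ missing n k j ν S, v ∈ e := by
      by_contra hno
      push Not at hno
      rw [missingAway, filter_true_of_mem hno] at hlt
      exact lt_irrefl _ hlt
    obtain ⟨e, he, hve⟩ := hex
    obtain ⟨⟨hc, hav⟩, hne⟩ := mem_missing.1 he
    have hcT : (e.erase v).card = j := by rw [card_erase_of_mem hve, hc, Nat.add_sub_cancel]
    refine ⟨e.erase v, j, h.lt, by simp, ?_, by rwa [insert_erase hve]⟩
    have := h.mem_level (T := e.erase v) hcT.le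
    rw [hcT] at this
    rw [this]
    exact fun e' he' hsub => hav e' he' (hsub.trans (labels_subset_labels.2 (erase_subset _ _)))

theorem carry_eq {H : ℕ} (hH : H = edgesUpTo ν j - edgesUpTo ν i)
    (hij : i ≤ j)
    (hc : CarryCondition (H + ν (j + 1) - 1) (k - 1 - j)
      ((n : ℤ) - 1 - edgesUpTo ν j - j - ν (j + 1)) fun q => ν (q + 1 + j + 1)) :
    CarryCondition (edgesUpTo ν (j + 1) - 1 - edgesUpTo ν i) (k - (j + 1))
      ((n : ℤ) - edgesUpTo ν (j + 1) - (j + 1)) fun q => ν (q + j + 2) := by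
  have e1 := edgesUpTo_succ ν j
  have e2 := edgesUpTo_mono ν hij
  have e3 : H + ν (j + 1) - 1 = edgesUpTo ν (j + 1) - 1 - edgesUpTo ν i := by omega
  have e4 : (fun q => ν (q + 1 + j + 1)) = fun q => ν (q + j + 2) := by
    funext q; congr 1; omega
  have e5 : (n : ℤ) - 1 - edgesUpTo ν j - j - ν (j + 1) =
      n - edgesUpTo ν (j + 1) - (j + 1) := by rw [e1]; push_cast; ring
  rwa [e3, e4, e5, show k - 1 - j = k - (j + 1) by omega] at hc

/-- A vertex that lies in at least two of the relevant edges, but not in all of the edges of size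
`j + 1`. -/
theorem carry_of_vertex_two (h : ColexBelow n k j ν S) (hv : IsUniform n k j ν v i)
    (hg : 1 ≤ missingAway n k j ν S v)
    (hh : edgesUpTo ν i + missingAway n k j ν S v + 2 ≤ edgesUpTo ν (j + 1)) :
    CarryCondition (edgesUpTo ν (j + 1) - 1 - edgesUpTo ν i) (k - (j + 1))
      ((n : ℤ) - edgesUpTo ν (j + 1) - (j + 1)) fun q => ν (q + j + 2) := by
  obtain ⟨T, s, hs, h1, h2, h3⟩ := h.exists_edge hv (by omega)
  obtain ⟨g, lam, hh', g0, e1, -, -, e2, -⟩ := h.split hv hs h1 h2 h3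
  have e3 := edgesUpTo_succ ν j
  have e4 := edgesUpTo_mono ν hv.2.1
  refine carry_eq rfl hv.2.1 ?_
  have := carry_of_two (l := fun q => ν (q + j + 1)) (g := g) (h := hh')
    (P := (n : ℤ) - 1 - edgesUpTo ν j - j) (H := edgesUpTo ν j - edgesUpTo ν i) (n := k - 1 - j)
    (by omega) (by omega) (fun s hs => by rw [e1 s hs])
  simp only [zero_add] at this
  exact this

/-- A vertex that lies in exactly one relevant edge `h₁`, provided that the edges of size `j + 1` that
do not contain the vertex are edges of the link. -/
theorem carry_of_vertex_one (h : ColexBelow n k j ν S) (hv : IsUniform n k j ν v i)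
    (hg : 1 ≤ missingAway n k j ν S v)
    (hh : edgesUpTo ν i + missingAway n k j ν S v + 1 = edgesUpTo ν (j + 1))
    {h₁ : Finset (Fin n)} (hv₁ : v ∈ h₁) (hc₁ : i < h₁.card) (hc₁' : h₁.card ≤ j + 1)
    (hl₁ : 1 ≤ ν h₁.card - if h₁.card = j + 1 then missingAway n k j ν S v else 0)
    (hd₁ : Disjoint (labels h₁) (uBefore n k ν (edgesUpTo ν i + 1)))
    (hn₁ : h₁ ∉ Finset.shadow^[k - h₁.card] S)
    (hs₁ : ∀ e ∈ missing n k j ν S, v ∉ e → ¬ h₁.erase v ⊆ e) :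
    CarryCondition (edgesUpTo ν (j + 1) - 1 - edgesUpTo ν i) (k - (j + 1))
      ((n : ℤ) - edgesUpTo ν (j + 1) - (j + 1)) fun q => ν (q + j + 2) := by
  obtain ⟨T, s, hs, h1, h2, h3⟩ := h.exists_edge hv (by omega)
  obtain ⟨g, lam, hh', g0, e1, hlink, hlam, e2, e2'⟩ := h.split hv hs h1 h2 h3
  have e3 := edgesUpTo_succ ν j
  have e4 := edgesUpTo_mono ν hv.2.1
  have hjk := h.lt
  have hij := hv.2.1
  have hi1 := hv.1
  have hγ := h.missingAway_le (v := v)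
  refine carry_eq rfl hv.2.1 ?_
  have hfin := carry_of_one (l := fun q => ν (q + j + 1)) (g := g) (h := hh')
    (P := (n : ℤ) - 1 - edgesUpTo ν j - j) (H := edgesUpTo ν j - edgesUpTo ν i) (n := k - 1 - j)
    (by omega) (by omega) (fun s hs => by rw [e1 s hs])
  simp only [zero_add] at hfin
  refine hfin fun ht => ?_
  rw [g0, e2' 0, zero_add]
  -- the vector of the link has a single edge of size larger than `i - 1`
  obtain ⟨a, ha⟩ : ∃ a, h₁.card = a + 2 := ⟨h₁.card - 2, by omega⟩
  set γ := missingAway n k j ν S v with hγdef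
  have hsum : ∑ q ∈ Ico i (j + 1), (ν (q + 1) - if q = j then γ else 0) = 1 := by
    rw [sum_Ico_succ_top hij, if_pos rfl]
    have : ∑ q ∈ Ico i j, (ν (q + 1) - if q = j then γ else 0) = edgesUpTo ν j - edgesUpTo ν i := by
      rw [edgesUpTo_eq_sum_range, edgesUpTo_eq_sum_range, ← sum_range_add_sum_Ico _ hij,
        Nat.add_sub_cancel_left]
      refine sum_congr rfl fun q hq => ?_
      rw [mem_Ico] at hq
      rw [if_neg (by omega), Nat.sub_zero]
    rw [this]; omega
  have hdelta : ∀ q, i ≤ q → q ≤ j → ν (q + 1) - (if q = j then γ else 0) =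
      if q = a + 1 then 1 else 0 := by
    have hmem : a + 1 ∈ Ico i (j + 1) := by rw [mem_Ico]; omega
    have hge : 1 ≤ ν (a + 1 + 1) - if a + 1 = j then γ else 0 := by
      rw [ha] at hl₁
      simpa using hl₁
    intro q h1 h2
    set f : ℕ → ℕ := fun q => ν (q + 1) - if q = j then γ else 0
    have h3 := sum_erase_add (Ico i (j + 1)) f hmem
    rw [hsum] at h3
    change f q = _
    change 1 ≤ f (a + 1) at hge
    by_cases hq : q = a + 1
    · rw [if_pos hq, hq]
      omega
    · have h4 := single_le_sum (f := f) (fun _ _ => Nat.zero_le _)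
        (mem_erase.2 ⟨hq, mem_Ico.2 ⟨h1, show q < j + 1 by omega⟩⟩)
      rw [if_neg hq]
      omega
  have hlam' : ∀ q < j, lam q = truncated ν i q + if q = a then 1 else 0 := by
    intro q hq
    rw [hlam q hq]
    congr 1
    by_cases hiq : i ≤ q + 1
    · rw [if_pos hiq]
      have := hdelta (q + 1) hiq (by omega)
      rw [this]
      simp
    · rw [if_neg hiq, if_neg (by omega)]
  -- the sets counted on level `j + 1` of the link
  set Good := univ.filter fun T : Finset (Fin n) => T.card = j + 1 ∧ v ∉ T ∧
      ∀ e ∈ colexHypergraph n k ν i, ¬ e ⊆ labels T with hGood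
  have hvn : v.val + 1 ∈ Icc 1 n := by rw [mem_Icc]; omega
  have hcG : ((Icc 1 n).erase (v.val + 1)).card = n - 1 := by
    rw [card_erase_of_mem hvn, Nat.card_Icc, Nat.add_sub_cancel]
  set X := univ.filter fun T : Finset (Fin n) => T.card = j + 1 ∧ v ∉ T ∧
    labels (h₁.erase v) ⊆ labels T ∧ Disjoint (labels T) (uBefore n k ν (edgesUpTo ν i + 1))
    with hX
  have hNk := edgesUpTo_mono ν (show i ≤ k by omega)
  have hub : uBefore n k ν (edgesUpTo ν i + 1) ⊆ (Icc 1 n).erase (v.val + 1) := by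
    intro y hy
    obtain ⟨r', hr', rfl⟩ := mem_image.1 hy
    rw [mem_Ico] at hr'
    obtain ⟨i', hi', hs'⟩ := exists_hasSize (ν := ν) (l := i) hr'.1 (by omega)
    refine mem_erase.2 ⟨fun h' => ?_, uVertex_mem h.valid hs' (by omega)⟩
    have := (hv.2.2 i' r' (by omega) hs').1 (mem_colexEdge.2 (Or.inl h'.symm))
    omega
  have hh1 : labels (h₁.erase v) ⊆ (Icc 1 n).erase (v.val + 1) := by
    rw [labels_erase]
    exact erase_subset_erase _ (labels_subset_Icc _)
  have hcardX : (X.card : ℤ) =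
      Ring.choose ((n : ℤ) - 2 - edgesUpTo ν i - a) (j - a) := by
    have hcc : (labels (h₁.erase v)).card = a + 1 := by
      rw [card_labels, card_erase_of_mem hv₁, ha]; omega
    have hdd : Disjoint (labels (h₁.erase v)) (uBefore n k ν (edgesUpTo ν i + 1)) :=
      hd₁.mono_left (labels_subset_labels.2 (erase_subset _ _))
    have hcu := card_uBefore (n := n) h.valid (r := edgesUpTo ν i + 1) (by omega)
    rw [card_eq_filter_powersetCard (s := j + 1) (p := fun T => labels (h₁.erase v) ⊆ T ∧
      Disjoint T (uBefore n k ν (edgesUpTo ν i + 1))) (erase_subset (v.val + 1) (Icc 1 n)),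
      card_filter_subset_disjoint hh1 hub hdd, hcc, hcu, hcG, if_pos (by omega),
      ← Ring.choose_natCast]
    · have hle : a + 1 + edgesUpTo ν i ≤ n - 1 := by
        have := card_le_card (union_subset hh1 hub)
        rw [card_union_of_disjoint hdd, hcc, hcu, hcG] at this
        omega
      rw [show j + 1 - (a + 1) = j - a by omega]
      congr 1
      omega
    · intro T
      rw [hX, mem_filter, and_iff_right (mem_univ _)]
      refine and_congr_right fun _ => and_congr_left fun _ => ?_
      rw [← succ_mem_labels]
      exact ⟨fun h' y hy => mem_erase.2 ⟨fun h'' => h' (h'' ▸ hy), labels_subset_Icc T hy⟩,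
        fun h' hy => (mem_erase.1 (h' hy)).1 rfl⟩
  have hXG : X ⊆ Good := by
    intro T hT
    obtain ⟨-, x1, x2, x3, x4⟩ := mem_filter.1 hT
    refine mem_filter.2 ⟨mem_univ _, x1, x2, fun e he hsub => ?_⟩
    obtain ⟨i', r, hi', hs', rfl⟩ := mem_colexHypergraph.1 he
    refine disjoint_left.1 x4 (colexEdge_subset_iff.1 hsub).1 (mem_image_of_mem _ (mem_Ico.2
      ⟨hs'.one_le, ?_⟩))
    have := hs'.2.2.trans (edgesUpTo_mono ν hi')
    omega
  have hEG : (missing n k j ν S).filter (fun T => v ∉ T) ⊆ Good := by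
    intro T hT
    obtain ⟨x1, x2⟩ := mem_filter.1 hT
    obtain ⟨⟨x3, x4⟩, -⟩ := mem_missing.1 x1
    exact mem_filter.2 ⟨mem_univ _, x3, x2, (avoiding_uniform hv x2).1 x4⟩
  have hEX : Disjoint ((missing n k j ν S).filter fun T => v ∉ T) X := by
    rw [disjoint_left]
    intro T hT hT'
    obtain ⟨x1, x2⟩ := mem_filter.1 hT
    obtain ⟨-, -, -, x3, -⟩ := mem_filter.1 hT'
    exact hs₁ T x1 x2 (labels_subset_labels.1 x3)
  have hdown : ∀ {A B : Finset (Fin n)} {s : ℕ}, s ≤ k → B ∈ Finset.shadow^[k - s] S → A ⊆ B →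
      A ∈ Finset.shadow^[k - A.card] S := by
    intro A B s hs hB hAB
    have hc := h.sized_level hs hB
    have hcc := card_le_card hAB
    rw [show k - A.card = (s - A.card) + (k - s) by omega, Function.iterate_add_apply,
      mem_shadow_iterate_iff_exists_mem_card_add]
    exact ⟨B, hB, hAB, by omega⟩
  have hLsub : (Finset.shadow^[k - (j + 2)] S).memberSubfamily v ⊆
      Good \ (((missing n k j ν S).filter fun T => v ∉ T) ∪ X) := by
    intro T hT
    obtain ⟨x1, x2⟩ := mem_memberSubfamily.1 hT
    have hc := h.sized_level (show j + 2 ≤ k by omega) x1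
    rw [card_insert_of_notMem x2] at hc
    have hTlev := hdown (show j + 2 ≤ k by omega) x1 (subset_insert v T)
    rw [show T.card = j + 1 by omega] at hTlev
    have hav := (mem_avoiding.1 (h.level_succ_subset hTlev)).2
    refine mem_sdiff.2 ⟨mem_filter.2 ⟨mem_univ _, by omega, x2, (avoiding_uniform hv x2).1 hav⟩, ?_⟩
    rw [mem_union, not_or]
    refine ⟨fun h' => (mem_missing.1 (mem_filter.1 h').1).2 hTlev, fun h' => hn₁ ?_⟩
    obtain ⟨-, -, -, x3, -⟩ := mem_filter.1 h'
    refine hdown (show j + 2 ≤ k by omega) x1 ?_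
    rw [labels_subset_labels] at x3
    rw [← insert_erase hv₁]
    exact insert_subset_insert _ x3
  have hcount := card_le_card hLsub
  rw [card_sdiff_of_subset (union_subset hEG hXG), card_union_of_disjoint hEX, ← missingAway,
    ← hγdef] at hcount
  have hcount' := card_le_card (union_subset hEG hXG)
  rw [card_union_of_disjoint hEX, ← missingAway, ← hγdef] at hcount'
  have c1 := h.card_avoiding_uniform hv j
  rw [← hGood] at c1
  have c2 := hlink j (by omega)
  have c3 := kills_add lam ((n : ℤ) - 2) j 0
  rw [zero_add, kills_zero, zero_add] at c3
  have c4 : kills (fun q => if q < j then lam q else 0) ((n : ℤ) - 2) j =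
      kills (truncated ν i) (n - 2) j + Ring.choose ((n : ℤ) - 2 - edgesUpTo ν i - a) (j - a) := by
    have c5 := kills_add_single (m := truncated ν i) (i := i) (a := a)
      (fun q hq => by rw [truncated, if_neg (by omega)]) (by omega) ((n : ℤ) - 2) (j - a)
    rw [show j - a + a = j by omega] at c5
    have c6 : (fun q => if q < j then lam q else 0) =
        fun q => truncated ν i q + if q = a then 1 else 0 := by
      funext q
      by_cases hq : q < j
      · rw [if_pos hq, hlam' q hq]
      · rw [if_neg hq, truncated, if_neg (by omega), if_neg (by omega)]
    have c7 : ∑ q ∈ range (a + 1), (truncated ν i q : ℤ) = edgesUpTo ν i := by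
      rw [edgesUpTo_eq_sum_range, ← sum_range_add_sum_Ico _ (show i ≤ a + 1 by omega)]
      push_cast
      rw [sum_eq_zero (s := Ico i (a + 1)), add_zero]
      · exact sum_congr rfl fun q hq => by rw [truncated, if_pos (mem_range.1 hq)]
      · intro q hq
        rw [truncated, if_neg (by rw [mem_Ico] at hq; omega), Nat.cast_zero]
    rw [c6, c5, c7]
  rw [c4] at c3
  omega

end ColexBelow

/-! ### Necessity of the carry condition -/

/-- The arithmetical criterion: there is a pivot, and the carry condition holds for it. -/
def Criterion (n k j : ℕ) (ν : ℕ → ℕ) : Prop :=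
  ∃ p, IsPivot n k j ν p ∧ CarryCondition (edgesUpTo ν (j + 1) - 1 - edgesUpTo ν p) (k - (j + 1))
    ((n : ℤ) - edgesUpTo ν (j + 1) - (j + 1)) fun q => ν (q + j + 2)

theorem criterion_of_carry {n k j i : ℕ} {ν : ℕ → ℕ} (hν : edgesUpTo ν k + k ≤ n) (hj : j + 1 ≤ k)
    (h1 : 1 ≤ i) (hi : i ≤ j) (h2 : edgesUpTo ν i + 2 ≤ edgesUpTo ν (j + 1))
    (hc : CarryCondition (edgesUpTo ν (j + 1) - 1 - edgesUpTo ν i) (k - (j + 1))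
      ((n : ℤ) - edgesUpTo ν (j + 1) - (j + 1)) fun q => ν (q + j + 2)) :
    Criterion n k j ν := by
  set A : Set ℕ := {s | 1 ≤ s ∧ s ≤ j ∧ edgesUpTo ν s + 2 ≤ edgesUpTo ν (j + 1)}
  have hbdd : BddAbove A := ⟨j, fun s hs => hs.2.1⟩
  have hiA : i ∈ A := ⟨h1, hi, h2⟩
  have hmem := Nat.sSup_mem ⟨i, hiA⟩ hbdd
  refine ⟨sSup A, (isPivot_iff hν hj).2 ⟨hmem, fun s hs => le_csSup hbdd hs⟩, ?_⟩
  have hle := edgesUpTo_mono ν (le_csSup hbdd hiA)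
  have h3 := hmem.2.2
  exact hc.mono (by omega) (by omega)

/-- A permutation that carries one hypergraph to another one carries the families of avoiding sets
to each other. -/
theorem image_avoiding {n s : ℕ} {H H' : Finset (Finset ℕ)} (σ : Equiv.Perm (Fin n))
    (hH : ∀ e ∈ H, e ⊆ Icc 1 n) (hH' : ∀ e ∈ H', e ⊆ Icc 1 n)
    (h1 : ∀ E : Finset (Fin n), labels E ∈ H → labels (E.image σ) ∈ H')
    (h2 : ∀ E' : Finset (Fin n), labels E' ∈ H' → ∃ E, labels E ∈ H ∧ E.image σ = E') :
    (avoiding n s H).image (fun T => T.image σ) = avoiding n s H' := by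
  have key : ∀ T : Finset (Fin n), T ∈ avoiding n s H ↔ T.image σ ∈ avoiding n s H' := by
    intro T
    rw [mem_avoiding, mem_avoiding, card_image_of_injective _ σ.injective]
    refine and_congr_right fun _ => ⟨fun h e he hsub => ?_, fun h e he hsub => ?_⟩
    · obtain ⟨E', rfl⟩ := exists_labels_eq (hH' e he)
      obtain ⟨E, hE, rfl⟩ := h2 E' he
      rw [labels_subset_labels, image_subset_image_iff σ.injective] at hsub
      exact h _ hE (labels_subset_labels.2 hsub)
    · obtain ⟨E, rfl⟩ := exists_labels_eq (hH e he)
      rw [labels_subset_labels] at hsub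
      exact h _ (h1 E he) (labels_subset_labels.2 (image_subset_image hsub))
  ext U
  rw [mem_image]
  constructor
  · rintro ⟨T, hT, rfl⟩
    exact (key T).1 hT
  · intro hU
    have hUU : (U.image σ.symm).image σ = U := by simp [image_image]
    exact ⟨U.image σ.symm, (key _).2 (by rwa [hUU]), hUU⟩

/-- There is a permutation with prescribed fixed points that carries given sets to given sets. -/
theorem exists_perm {α : Type*} [Fintype α] [DecidableEq α] {F B B' C C' : Finset α}
    (hB : B.card = B'.card) (hC : C.card = C'.card) (hFB : Disjoint F B) (hFC : Disjoint F C)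
    (hBC : Disjoint B C) (hFB' : Disjoint F B') (hFC' : Disjoint F C') (hBC' : Disjoint B' C') :
    ∃ σ : Equiv.Perm α, (∀ x ∈ F, σ x = x) ∧ B.image σ = B' ∧ C.image σ = C' := by
  set eB := equivOfCardEq hB
  set eC := equivOfCardEq hC
  set f : α → α := fun x => if hx : x ∈ B then eB ⟨x, hx⟩ else if hx : x ∈ C then eC ⟨x, hx⟩ else x
    with hf
  have fB : ∀ x (hx : x ∈ B), f x = eB ⟨x, hx⟩ := fun x hx => by simp only [hf, hx, dite_true]
  have fC : ∀ x (hx : x ∈ C), f x = eC ⟨x, hx⟩ := fun x hx => by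
    simp only [hf, disjoint_right.1 hBC hx, hx, dite_true, dite_false]
  have fF : ∀ x ∈ F, f x = x := fun x hx => by
    simp only [hf, disjoint_left.1 hFB hx, disjoint_left.1 hFC hx, dite_false]
  have mB : ∀ x ∈ B, f x ∈ B' := fun x hx => by rw [fB x hx]; exact (eB _).2
  have mC : ∀ x ∈ C, f x ∈ C' := fun x hx => by rw [fC x hx]; exact (eC _).2
  have mF : ∀ x ∈ F, f x ∈ F := fun x hx => by rwa [fF x hx]
  have hinj : Set.InjOn f (F ∪ B ∪ C : Finset α) := by
    intro x hx y hy hxy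
    rw [mem_coe, mem_union, mem_union] at hx hy
    rcases hx with (hx | hx) | hx <;> rcases hy with (hy | hy) | hy
    · rwa [fF x hx, fF y hy] at hxy
    · exact absurd (hxy ▸ mB y hy) (disjoint_left.1 hFB' (mF x hx))
    · exact absurd (hxy ▸ mC y hy) (disjoint_left.1 hFC' (mF x hx))
    · exact absurd (mB x hx) (disjoint_left.1 hFB' (hxy ▸ mF y hy))
    · rw [fB x hx, fB y hy] at hxy
      simpa using eB.injective (Subtype.ext hxy)
    · exact absurd (mB x hx) (disjoint_right.1 hBC' (hxy ▸ mC y hy))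
    · exact absurd (mC x hx) (disjoint_left.1 hFC' (hxy ▸ mF y hy))
    · exact absurd (mC x hx) (disjoint_left.1 hBC' (hxy ▸ mB y hy))
    · rw [fC x hx, fC y hy] at hxy
      simpa using eC.injective (Subtype.ext hxy)
  obtain ⟨g, hg⟩ := Finset.exists_equiv_extend_of_card_eq (t := (univ : Finset α)) (by simp)
    (subset_univ _) hinj
  set σ : Equiv.Perm α := g.trans (Equiv.subtypeUnivEquiv fun x => mem_univ x) with hσ
  have hσf : ∀ x ∈ F ∪ B ∪ C, σ x = f x := fun x hx => hg x hx
  refine ⟨σ, fun x hx => ?_, ?_, ?_⟩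
  · rw [hσf x (by simp [hx]), fF x hx]
  · refine eq_of_subset_of_card_le (fun y hy => ?_) ?_
    · obtain ⟨x, hx, rfl⟩ := mem_image.1 hy
      rw [hσf x (by simp [hx])]
      exact mB x hx
    · rw [card_image_of_injective _ σ.injective, hB]
  · refine eq_of_subset_of_card_le (fun y hy => ?_) ?_
    · obtain ⟨x, hx, rfl⟩ := mem_image.1 hy
      rw [hσf x (by simp [hx])]
      exact mC x hx
    · rw [card_image_of_injective _ σ.injective, hC]

theorem minShadow_image {n k : ℕ} {S : Finset (Finset (Fin n))} (hS : MinShadow k S)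
    (σ : Equiv.Perm (Fin n)) : MinShadow k (S.image fun T => T.image σ) := by
  have hinj : Function.Injective fun T : Finset (Fin n) => T.image σ := image_injective σ.injective
  refine hS.congr ?_ (card_image_of_injective _ hinj) ?_
  · intro T hT
    obtain ⟨U, hU, rfl⟩ := mem_image.1 (mem_coe.1 hT)
    rw [card_image_of_injective _ σ.injective]
    exact hS.1 hU
  · rw [shadow_image_perm, card_image_of_injective _ hinj]

theorem isColexSegment_image {n r : ℕ} {A : Finset (Finset (Fin n))} (σ : Equiv.Perm (Fin n))
    (h : IsColexSegment (A.image fun T => T.image σ) r) : IsColexSegment A r := by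
  obtain ⟨τ, hτ⟩ := h
  refine ⟨σ.trans τ, ?_⟩
  simpa [image_image, Function.comp_def] using hτ

namespace ColexBelow

variable {n k j : ℕ} {ν : ℕ → ℕ} {S : Finset (Finset (Fin n))} {v : Fin n} {i : ℕ}

theorem missingAway_eq_zero_iff :
    missingAway n k j ν S v = 0 ↔ ∀ e ∈ missing n k j ν S, v ∈ e := by
  rw [missingAway, card_eq_zero, filter_eq_empty_iff]
  simp

theorem missingAway_eq_iff (h : ColexBelow n k j ν S) :
    missingAway n k j ν S v = ν (j + 1) ↔ ∀ e ∈ missing n k j ν S, v ∉ e := by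
  rw [missingAway, ← h.card_missing, card_filter_eq_iff]

theorem isUniform_vVertex (h : ColexBelow n k j ν S) (hv : v.val + 1 = vVertex n ν i) (h1 : 1 ≤ i)
    (hi : i ≤ j) : IsUniform n k j ν v i := by
  have := h.lt
  refine ⟨h1, hi, fun i' r hi' hs => ?_⟩
  rw [hv]
  exact vVertex_mem_colexEdge h.valid hs (by omega) h1 (by omega)

theorem isUniform_of_notMem (h : ColexBelow n k j ν S)
    (hv : ∀ e ∈ colexHypergraph n k ν j, v.val + 1 ∉ e) : IsUniform n k j ν v j :=
  ⟨h.one_le, le_rfl, fun i' r hi' hs => iff_of_false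
    (hv _ (mem_colexHypergraph.2 ⟨i', r, hi', hs, rfl⟩)) (by omega)⟩

/-- The vertex lies in precisely one edge of size at most `j`, which is the last of these edges. -/
def InLast (n k j : ℕ) (ν : ℕ → ℕ) (v : Fin n) : Prop :=
  ∃ i, IsUniform n k j ν v i ∧ edgesUpTo ν i + 1 = edgesUpTo ν j

theorem InLast.mem_iff (hv : InLast n k j ν v) {i r : ℕ} (hi : i ≤ j) (hs : HasSize ν i r) :
    v.val + 1 ∈ colexEdge n k ν i r ↔ r = edgesUpTo ν j := by
  obtain ⟨i', hv, he⟩ := hv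
  rw [hv.2.2 i r hi hs]
  have h1 := hs.2.1
  have h2 := hs.2.2
  have h3 := edgesUpTo_mono ν hi
  constructor
  · intro hlt
    have := edgesUpTo_mono ν (show i' ≤ i - 1 by omega)
    omega
  · rintro rfl
    by_contra hle
    have := edgesUpTo_mono ν (not_lt.1 hle)
    omega

theorem inLast_uVertex (h : ColexBelow n k j ν S) (h1 : 1 ≤ i)
    (hN : edgesUpTo ν i + 1 = edgesUpTo ν j) (hv : v.val + 1 = uVertex n k ν (edgesUpTo ν j)) :
    InLast n k j ν v := by
  have hjk := h.lt
  obtain ⟨i₀, hi₀, hs₀⟩ := exists_hasSize (ν := ν) (l := j) (show 1 ≤ edgesUpTo ν j by omega) le_rfl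
  have hlt : i < i₀ := by
    by_contra hle
    have := edgesUpTo_mono ν (not_lt.1 hle)
    have := hs₀.2.2
    omega
  have h2 := edgesUpTo_mono ν (show i ≤ i₀ - 1 by omega)
  have h3 := hs₀.2.1
  refine ⟨i₀ - 1, ⟨by omega, by omega, fun i' r hi' hs => ?_⟩, by omega⟩
  rw [hv, uVertex_mem_colexEdge h.valid hs (by omega) hs₀ (by omega)]
  have h4 := hs.2.1
  have h5 := hs.2.2
  have h6 := edgesUpTo_mono ν hi'
  constructor
  · rintro rfl
    have := hs.unique hs₀
    omega
  · intro hlt'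
    have := edgesUpTo_mono ν (show i₀ - 1 ≤ i' - 1 by omega)
    omega

/-- A vertex of the last edge of size at most `j` that lies in some, but not in all edges of size
`j + 1`. -/
theorem carry_of_inLast (h : ColexBelow n k j ν S) (hv : InLast n k j ν v)
    (h1 : 1 ≤ missingAway n k j ν S v) (h2 : missingAway n k j ν S v < ν (j + 1)) :
    Criterion n k j ν := by
  obtain ⟨i, hu, hN⟩ := hv
  have := edgesUpTo_succ ν j
  exact criterion_of_carry h.valid h.lt hu.1 hu.2.1 (by omega)
    (h.carry_of_vertex_two hu h1 (by omega))

/-- Two vertices of the last edge of size at most `j` that lie in no edge of size `j + 1`. -/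
theorem carry_of_inLast_inLast (h : ColexBelow n k j ν S) {v' : Fin n} (hv : InLast n k j ν v)
    (hv' : InLast n k j ν v') (hne : v ≠ v') (hpos : 1 ≤ ν (j + 1))
    (h1 : missingAway n k j ν S v = ν (j + 1)) (h2 : missingAway n k j ν S v' = ν (j + 1)) :
    Criterion n k j ν := by
  have hjk := h.lt
  have hv0 := hv
  obtain ⟨i, hu, hN⟩ := hv
  have hNs := edgesUpTo_succ ν j
  obtain ⟨i₀, hi₀, hs₀⟩ := exists_hasSize (ν := ν) (l := j) (show 1 ≤ edgesUpTo ν j by omega) le_rfl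
  obtain ⟨e, he⟩ := exists_labels_eq (colexEdge_subset_Icc h.valid hs₀ (show i₀ ≤ k by omega))
  have hce : e.card = i₀ := by rw [← card_labels, he, card_colexEdge h.valid hs₀ (by omega)]
  have hve : v ∈ e := by
    rw [← succ_mem_labels, he, hv0.mem_iff hi₀ hs₀]
  have hve' : v' ∈ e := by
    rw [← succ_mem_labels, he, hv'.mem_iff hi₀ hs₀]
  have hi : i < i₀ := (hu.2.2 _ _ hi₀ hs₀).1 (by rw [← he, succ_mem_labels]; exact hve)
  refine criterion_of_carry h.valid h.lt hu.1 hu.2.1 (by omega)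
    (h.carry_of_vertex_one hu (by omega) (by omega) hve (by omega) (by omega) ?_ ?_ ?_ ?_)
  · have := hs₀.2.1
    have := hs₀.2.2
    have h3 := edgesUpTo_succ ν (i₀ - 1)
    rw [Nat.sub_add_cancel hs₀.1] at h3
    rw [hce, if_neg (by omega)]
    omega
  · rw [he, hN]
    exact disjoint_colexEdge_uBefore h.valid hs₀ (by omega)
  · rw [h.mem_level (by omega)]
    exact fun h' => h' _ (mem_colexHypergraph.2 ⟨i₀, _, hi₀, hs₀, rfl⟩) (by rw [he])
  · intro g hg _ hsub
    exact h.missingAway_eq_iff.1 h2 g hg (hsub (mem_erase.2 ⟨hne.symm, hve'⟩))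

/-- The family on level `j + 1` consists of the sets that avoid the edges of size at most `j + 1`. -/
theorem level_succ_eq (h : ColexBelow n k j ν S) : Finset.shadow^[k - (j + 1)] S =
    avoiding n (j + 1) (colexHypergraph n k ν j ∪ (missing n k j ν S).image labels) := by
  ext T
  rw [mem_avoiding]
  constructor
  · intro hT
    obtain ⟨h1, h2⟩ := mem_avoiding.1 (h.level_succ_subset hT)
    refine ⟨h1, fun e he hsub => ?_⟩
    rcases mem_union.1 he with he | he
    · exact h2 e he hsub
    · obtain ⟨U, hU, rfl⟩ := mem_image.1 he
      obtain ⟨⟨h3, -⟩, h4⟩ := mem_missing.1 hU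
      rw [labels_subset_labels] at hsub
      rw [eq_of_subset_of_card_le hsub (by omega)] at h4
      exact h4 hT
  · rintro ⟨h1, h2⟩
    by_contra hT
    exact h2 (labels T) (mem_union_right _ (mem_image_of_mem _ (mem_missing.2
      ⟨⟨h1, fun e he => h2 e (mem_union_left _ he)⟩, hT⟩))) subset_rfl

/-- If the edges of size `j + 1` arise from a set of size `j` by adding one vertex, then the
family is colex on level `j + 1`, too. -/
theorem isColexSegment_of_star (h : ColexBelow n k j ν S) {V Y : Finset (Fin n)}
    (hV : V.card = j) (hVY : Disjoint V Y) (hY : Y.card = ν (j + 1))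
    (hW : ∀ i, 1 ≤ i → i ≤ j → edgesUpTo ν i < edgesUpTo ν j → vVertex n ν i ∈ labels V)
    (hVu : Disjoint (labels V) (uBefore n k ν (edgesUpTo ν j + 1)))
    (hYu : Disjoint (labels Y) (uBefore n k ν (edgesUpTo ν j + 1)))
    (hE : missing n k j ν S = Y.image fun y => insert y V) :
    IsColexSegment (Finset.shadow^[k - (j + 1)] S) (j + 1) := by
  have hjk := h.lt
  have hbj := edgesUpTo_mono ν hjk
  have hNs := edgesUpTo_succ ν j
  have hv_mem : ∀ q, 1 ≤ q → q ≤ j → vVertex n ν q ∈ Icc 1 n :=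
    fun q h1 h2 => vVertex_mem h.valid h1 (by omega)
  -- a permutation that fixes `W` and `U` and carries `V` to `V'` and `Y` to `Y'` makes the edges those
  -- of the colex hypergraph
  obtain ⟨W, hWl⟩ := exists_labels_eq (n := n)
    (U := ((Icc 1 j).filter fun i => edgesUpTo ν i < edgesUpTo ν j).image (vVertex n ν)) (by
      intro y hy
      obtain ⟨q, hq, rfl⟩ := mem_image.1 hy
      rw [mem_filter, mem_Icc] at hq
      exact hv_mem q hq.1.1 hq.1.2)
  obtain ⟨V', hV'l⟩ := exists_labels_eq (n := n) (U := (Icc 1 j).image (vVertex n ν)) (by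
      intro y hy
      obtain ⟨q, hq, rfl⟩ := mem_image.1 hy
      rw [mem_Icc] at hq
      exact hv_mem q hq.1 hq.2)
  have hu_mem : ∀ r, 1 ≤ r → r ≤ edgesUpTo ν (j + 1) → uVertex n k ν r ∈ Icc 1 n := by
    intro r h1 h2
    obtain ⟨i', hi', hs'⟩ := exists_hasSize (ν := ν) (l := j + 1) h1 h2
    exact uVertex_mem h.valid hs' (by omega)
  obtain ⟨U, hUl⟩ := exists_labels_eq (n := n) (U := uBefore n k ν (edgesUpTo ν j + 1)) (by
      intro y hy
      obtain ⟨r, hr, rfl⟩ := mem_image.1 hy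
      rw [mem_Ico] at hr
      exact hu_mem r hr.1 (by omega))
  obtain ⟨Y', hY'l⟩ := exists_labels_eq (n := n)
    (U := (Ioc (edgesUpTo ν j) (edgesUpTo ν (j + 1))).image (uVertex n k ν)) (by
      intro y hy
      obtain ⟨r, hr, rfl⟩ := mem_image.1 hy
      rw [mem_Ioc] at hr
      exact hu_mem r (by omega) hr.2)
  have hWV : W ⊆ V := by
    rw [← labels_subset_labels, hWl]
    intro y hy
    obtain ⟨q, hq, rfl⟩ := mem_image.1 hy
    rw [mem_filter, mem_Icc] at hq
    exact hW q hq.1.1 hq.1.2 hq.2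
  have hWV' : W ⊆ V' := by
    rw [← labels_subset_labels, hWl, hV'l]
    exact image_subset_image (filter_subset _ _)
  have hV'c : V'.card = j := by
    rw [← card_labels, hV'l, card_image_vVertex h.valid (by omega)]
  have hY'c : Y'.card = ν (j + 1) := by
    rw [← card_labels, hY'l, card_image_of_injOn, Nat.card_Ioc]
    · omega
    · intro a ha b hb hab
      rw [mem_coe, mem_Ioc] at ha hb
      exact uVertex_injOn h.valid (by omega) (by omega) (by omega) (by omega) hab
  have hdl : ∀ {A B : Finset (Fin n)}, Disjoint (labels A) (labels B) → Disjoint A B := by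
    intro A B hAB
    rw [disjoint_left] at hAB ⊢
    exact fun x hx hx' => hAB (succ_mem_labels.2 hx) (succ_mem_labels.2 hx')
  have hUV : Disjoint U V := hdl (by rw [hUl]; exact hVu.symm)
  have hUY : Disjoint U Y := hdl (by rw [hUl]; exact hYu.symm)
  have huv : ∀ r q, 1 ≤ r → r ≤ edgesUpTo ν (j + 1) → q ≤ j →
      uVertex n k ν r ≠ vVertex n ν q := by
    intro r q h1 h2 h3
    obtain ⟨i', hi', hs'⟩ := exists_hasSize (ν := ν) (l := j + 1) h1 h2
    exact uVertex_ne_vVertex h.valid hs' (by omega) (by omega)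
  have hUV' : Disjoint U V' := hdl (by
    rw [hUl, hV'l, disjoint_left]
    rintro y hy hy'
    obtain ⟨r, hr, rfl⟩ := mem_image.1 hy
    obtain ⟨q, hq, hqr⟩ := mem_image.1 hy'
    rw [mem_Ico] at hr
    rw [mem_Icc] at hq
    exact huv r q hr.1 (by omega) hq.2 hqr.symm)
  have hY'V' : Disjoint V' Y' := hdl (by
    rw [hY'l, hV'l, disjoint_right]
    rintro y hy hy'
    obtain ⟨r, hr, rfl⟩ := mem_image.1 hy
    obtain ⟨q, hq, hqr⟩ := mem_image.1 hy'
    rw [mem_Ioc] at hr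
    rw [mem_Icc] at hq
    exact huv r q (by omega) hr.2 hq.2 hqr.symm)
  have hUY' : Disjoint U Y' := hdl (by
    rw [hUl, hY'l, disjoint_left]
    rintro y hy hy'
    obtain ⟨r, hr, rfl⟩ := mem_image.1 hy
    obtain ⟨r', hr', hrr⟩ := mem_image.1 hy'
    rw [mem_Ico] at hr
    rw [mem_Ioc] at hr'
    have := uVertex_injOn h.valid (by omega) hr.1 (by omega) (by omega) hrr
    omega)
  obtain ⟨σ, hσF, hσB, hσC⟩ := exists_perm (F := W ∪ U) (B := V \ W) (B' := V' \ W) (C := Y)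
    (C' := Y') (by rw [card_sdiff_of_subset hWV, card_sdiff_of_subset hWV', hV, hV'c])
    (by rw [hY, hY'c])
    (disjoint_union_left.2 ⟨disjoint_sdiff, hUV.mono_right sdiff_subset⟩)
    (disjoint_union_left.2 ⟨hVY.mono_left hWV, hUY⟩)
    (hVY.mono_left sdiff_subset)
    (disjoint_union_left.2 ⟨disjoint_sdiff, hUV'.mono_right sdiff_subset⟩)
    (disjoint_union_left.2 ⟨hY'V'.mono_left hWV', hUY'⟩)
    (hY'V'.mono_left sdiff_subset)
  have hσW : W.image σ = W := by
    have : W.image σ = W.image id := image_congr fun x hx => hσF x (mem_union_left _ hx)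
    rw [this, image_id]
  have hσV : V.image σ = V' := by
    rw [← union_sdiff_of_subset hWV, image_union, hσW, hσB, union_sdiff_of_subset hWV']
  -- the edges of size at most `j` are fixed
  have hfix : ∀ E : Finset (Fin n), labels E ∈ colexHypergraph n k ν j → E.image σ = E := by
    intro E hE
    obtain ⟨i', r, hi', hs', heq⟩ := mem_colexHypergraph.1 hE
    have : E.image σ = E.image id := by
      refine image_congr fun x hx => hσF x ?_
      have hx' := succ_mem_labels.2 (mem_coe.1 hx)
      rw [heq, mem_colexEdge] at hx'
      rw [mem_union, ← succ_mem_labels, ← succ_mem_labels, hWl, hUl]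
      have h1 := hs'.2.1
      have h2 := hs'.2.2
      have h3 := edgesUpTo_mono ν hi'
      rcases hx' with hx' | ⟨q, h4, h5, hx'⟩
      · rw [hx']
        exact Or.inr (mem_image_of_mem _ (mem_Ico.2 ⟨hs'.one_le, by omega⟩))
      · rw [hx']
        have := edgesUpTo_mono ν (show q ≤ i' - 1 by omega)
        exact Or.inl (mem_image_of_mem _ (mem_filter.2 ⟨mem_Icc.2 ⟨h4, by omega⟩, by omega⟩))
    rw [this, image_id]
  have hlast : ∀ y ∈ Y', labels (insert y V') ∈ colexHypergraph n k ν (j + 1) := by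
    intro y hy
    have hy' := succ_mem_labels.2 hy
    rw [hY'l] at hy'
    obtain ⟨r, hr, hr'⟩ := mem_image.1 hy'
    rw [mem_Ioc] at hr
    refine mem_colexHypergraph.2 ⟨j + 1, r, le_rfl, ⟨by omega, by simpa using hr.1, hr.2⟩, ?_⟩
    rw [labels_insert, hV'l, ← hr', colexEdge, Nat.add_sub_cancel]
  refine ⟨σ, ?_⟩
  rw [h.level_succ_eq, image_avoiding (H' := colexHypergraph n k ν (j + 1)) σ]
  · exact isInitSeg_colexFamily h.valid h.lt
  · intro e he
    rcases mem_union.1 he with he | he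
    · exact h.edge_subset_Icc e he
    · obtain ⟨E, -, rfl⟩ := mem_image.1 he
      exact labels_subset_Icc E
  · intro e he
    obtain ⟨i', r, hi', hs', rfl⟩ := mem_colexHypergraph.1 he
    exact colexEdge_subset_Icc h.valid hs' (by omega)
  · intro E hE'
    rcases mem_union.1 hE' with hE' | hE'
    · rw [hfix E hE']
      exact colexHypergraph_mono (Nat.le_succ j) hE'
    · obtain ⟨E₁, hE₁, hE₂⟩ := mem_image.1 hE'
      obtain rfl := labels_injective hE₂
      rw [hE] at hE₁
      obtain ⟨y, hy, rfl⟩ := mem_image.1 hE₁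
      rw [image_insert, hσV]
      exact hlast _ (hσC ▸ mem_image_of_mem σ hy)
  · intro E' hE'
    obtain ⟨i', r, hi', hs', heq⟩ := mem_colexHypergraph.1 hE'
    by_cases hij : i' ≤ j
    · have hmem : labels E' ∈ colexHypergraph n k ν j :=
        mem_colexHypergraph.2 ⟨i', r, hij, hs', heq⟩
      exact ⟨E', mem_union_left _ hmem, hfix E' hmem⟩
    · obtain rfl : i' = j + 1 := by omega
      obtain ⟨h1, h2, h3⟩ := hs'
      rw [Nat.add_sub_cancel] at h2
      have hur : uVertex n k ν r ∈ labels Y' := by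
        rw [hY'l]
        exact mem_image_of_mem _ (mem_Ioc.2 ⟨h2, h3⟩)
      obtain ⟨y', hy', hyr⟩ := mem_labels.1 hur
      rw [← hσC] at hy'
      obtain ⟨y, hy, rfl⟩ := mem_image.1 hy'
      refine ⟨insert y V, mem_union_right _ (mem_image_of_mem _ ?_), ?_⟩
      · rw [hE]
        exact mem_image_of_mem _ hy
      · rw [image_insert, hσV]
        refine labels_injective ?_
        rw [labels_insert, heq, hV'l, hyr, colexEdge, Nat.add_sub_cancel]

theorem isColexSegment_of_missing_eq_empty (h : ColexBelow n k j ν S)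
    (hempty : missing n k j ν S = ∅) :
    IsColexSegment (Finset.shadow^[k - (j + 1)] S) (j + 1) := by
  have hjk := h.lt
  obtain ⟨V, hVl⟩ := exists_labels_eq (n := n) (U := (Icc 1 j).image (vVertex n ν)) (by
    intro y hy
    obtain ⟨q, hq, rfl⟩ := mem_image.1 hy
    rw [mem_Icc] at hq
    exact vVertex_mem h.valid hq.1 (by omega))
  refine h.isColexSegment_of_star (V := V) (Y := ∅) ?_ (disjoint_empty_right _) ?_ ?_ ?_ ?_ ?_
  · rw [← card_labels, hVl, card_image_vVertex h.valid (by omega)]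
  · rw [← h.card_missing, hempty]
    rfl
  · intro i h1 h2 _
    rw [hVl]
    exact mem_image_of_mem _ (mem_Icc.2 ⟨h1, h2⟩)
  · rw [hVl, disjoint_left]
    intro y hy hy'
    obtain ⟨q, hq, rfl⟩ := mem_image.1 hy
    obtain ⟨r, hr, hr'⟩ := mem_image.1 hy'
    rw [mem_Icc] at hq
    rw [mem_Ico] at hr
    obtain ⟨i', hi', hs'⟩ := exists_hasSize (ν := ν) (l := j) hr.1 (by omega)
    exact uVertex_ne_vVertex h.valid hs' (by omega) (by omega) hr'
  · simp [labels]
  · rw [hempty, image_empty]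

/-- The case that all edges of size `j + 1` contain every `v_i` that lies in an edge of size at
most `j`. -/
theorem isColexSegment_or_criterion (h : ColexBelow n k j ν S)
    (hW : ∀ e ∈ missing n k j ν S, ∀ i, 1 ≤ i → i ≤ j → edgesUpTo ν i < edgesUpTo ν j →
      vVertex n ν i ∈ labels e) :
    IsColexSegment (Finset.shadow^[k - (j + 1)] S) (j + 1) ∨ Criterion n k j ν := by
  have hjk := h.lt
  have hbj := edgesUpTo_mono ν hjk
  have hNs := edgesUpTo_succ ν j
  have hj1 := h.one_le
  -- the edges of size `j + 1` contain no `u_r` of an edge of size at most `j`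
  have hEu : ∀ e ∈ missing n k j ν S,
      Disjoint (labels e) (uBefore n k ν (edgesUpTo ν j + 1)) := by
    intro e he
    rw [disjoint_right]
    intro y hy hye
    obtain ⟨r, hr, rfl⟩ := mem_image.1 hy
    rw [mem_Ico] at hr
    obtain ⟨i', hi', hs'⟩ := exists_hasSize (ν := ν) (l := j) hr.1 (by omega)
    refine (mem_missing.1 he).1.2 _ (mem_colexHypergraph.2 ⟨i', r, hi', hs', rfl⟩)
      (colexEdge_subset_iff.2 ⟨hye, fun q h1 h2 => hW e he q h1 (by omega) ?_⟩)
    have := edgesUpTo_mono ν (show q ≤ i' - 1 by omega)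
    have := hs'.2.1
    omega
  rcases (missing n k j ν S).eq_empty_or_nonempty with hempty | ⟨e₀, he₀⟩
  · exact Or.inl (h.isColexSegment_of_missing_eq_empty hempty)
  -- if the edges of size `j + 1` have `j` vertices in common, then they form a star
  set Z := univ.filter fun x : Fin n => ∀ e ∈ missing n k j ν S, x ∈ e with hZ
  have hZe : ∀ e ∈ missing n k j ν S, Z ⊆ e := fun e he x hx => (mem_filter.1 hx).2 e he
  obtain ⟨W, hWl⟩ := exists_labels_eq (n := n)
    (U := ((Icc 1 j).filter fun i => edgesUpTo ν i < edgesUpTo ν j).image (vVertex n ν)) (by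
      intro y hy
      obtain ⟨q, hq, rfl⟩ := mem_image.1 hy
      rw [mem_filter, mem_Icc] at hq
      exact vVertex_mem h.valid hq.1.1 (by omega))
  have hWZ : W ⊆ Z := by
    intro x hx
    refine mem_filter.2 ⟨mem_univ _, fun e he => ?_⟩
    have hx' := succ_mem_labels.2 hx
    rw [hWl] at hx'
    obtain ⟨q, hq, hq'⟩ := mem_image.1 hx'
    rw [mem_filter, mem_Icc] at hq
    have := hW e he q hq.1.1 hq.1.2 hq.2
    rwa [hq', succ_mem_labels] at this
  have hWc : W.card ≤ j := by
    rw [← card_labels, hWl]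
    refine card_image_le.trans ((card_le_card (filter_subset _ _)).trans ?_)
    rw [Nat.card_Icc, Nat.add_sub_cancel]
  have hcard : ∀ e ∈ missing n k j ν S, e.card = j + 1 := fun e he => (mem_missing.1 he).1.1
  by_cases hZj : j ≤ Z.card
  · left
    obtain ⟨V, hWV, hVZ, hVc⟩ := exists_subsuperset_card_eq hWZ hWc hZj
    set Y := univ.filter fun y : Fin n => y ∉ V ∧ insert y V ∈ missing n k j ν S with hY
    have hEY : missing n k j ν S = Y.image fun y => insert y V := by
      ext e
      rw [mem_image]
      constructor
      · intro he
        have hVe := hVZ.trans (hZe e he)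
        have hce : (e \ V).card = 1 := by rw [card_sdiff_of_subset hVe, hcard e he, hVc]; omega
        obtain ⟨y, hy⟩ := card_eq_one.1 hce
        have heq : insert y V = e := by
          rw [insert_eq, ← hy, sdiff_union_of_subset hVe]
        have hyV : y ∉ V := (mem_sdiff.1 (hy ▸ mem_singleton_self y)).2
        exact ⟨y, mem_filter.2 ⟨mem_univ _, hyV, heq ▸ he⟩, heq⟩
      · rintro ⟨y, hy, rfl⟩
        exact (mem_filter.1 hy).2.2
    refine h.isColexSegment_of_star (V := V) (Y := Y) hVc ?_ ?_ ?_ ?_ ?_ hEY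
    · exact disjoint_right.2 fun y hy => (mem_filter.1 hy).2.1
    · rw [← h.card_missing, hEY, card_image_of_injOn]
      intro y hy y' hy' hyy
      have h1 := (mem_filter.1 (mem_coe.1 hy)).2.1
      have hyy' : insert y V = insert y' V := hyy
      have : y ∈ insert y' V := hyy' ▸ mem_insert_self y V
      rcases mem_insert.1 this with h2 | h2
      · exact h2
      · exact absurd h2 h1
    · intro i h1 h2 h3
      refine labels_subset_labels.2 hWV ?_
      rw [hWl]
      exact mem_image_of_mem _ (mem_filter.2 ⟨mem_Icc.2 ⟨h1, h2⟩, h3⟩)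
    · exact (hEu e₀ he₀).mono_left (labels_subset_labels.2 (hVZ.trans (hZe e₀ he₀)))
    · rw [disjoint_left]
      intro y hy
      obtain ⟨x, hx, rfl⟩ := mem_labels.1 hy
      exact disjoint_left.1 (hEu _ (mem_filter.1 hx).2.2)
        (succ_mem_labels.2 (mem_insert_self x V))
  · by_contra hcon
    rw [not_or] at hcon
    have hcrit := hcon.2
    -- the other vertices of `e₀` lie in no other edge of size `j + 1`
    have hout : ∀ x ∈ e₀, x ∉ Z → IsUniform n k j ν x j ∧
        missingAway n k j ν S x + 1 = ν (j + 1) ∧ 1 ≤ missingAway n k j ν S x := by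
      intro x hx hxZ
      have hu : IsUniform n k j ν x j := by
        refine h.isUniform_of_notMem fun e he hxe => ?_
        obtain ⟨i', r, hi', hs', rfl⟩ := mem_colexHypergraph.1 he
        have h1 := hs'.2.1
        have h2 := hs'.2.2.trans (edgesUpTo_mono ν hi')
        rcases mem_colexEdge.1 hxe with h3 | ⟨q, h4, h5, h6⟩
        · refine disjoint_left.1 (hEu e₀ he₀) (succ_mem_labels.2 hx) ?_
          rw [h3]
          exact mem_image_of_mem _ (mem_Ico.2 ⟨hs'.one_le, by omega⟩)
        · refine hxZ (hWZ (succ_mem_labels.1 ?_))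
          have := edgesUpTo_mono ν (show q ≤ i' - 1 by omega)
          rw [hWl, h6]
          exact mem_image_of_mem _ (mem_filter.2 ⟨mem_Icc.2 ⟨h4, by omega⟩, by omega⟩)
      have h1 : 1 ≤ missingAway n k j ν S x := by
        rw [Nat.one_le_iff_ne_zero, Ne, missingAway_eq_zero_iff]
        exact fun h' => hxZ (mem_filter.2 ⟨mem_univ _, h'⟩)
      have h2 : missingAway n k j ν S x ≠ ν (j + 1) := fun h' =>
        h.missingAway_eq_iff.1 h' e₀ he₀ hx
      have h3 := h.missingAway_le (v := x)
      refine ⟨hu, ?_, h1⟩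
      by_contra h4
      exact hcrit (criterion_of_carry h.valid h.lt hj1 le_rfl (by omega)
        (h.carry_of_vertex_two hu h1 (by omega)))
    -- otherwise two vertices `x` and `x'` of `e₀` lie in no other edge, and `x` lies in one relevant edge only
    have htwo : 1 < (e₀ \ Z).card := by
      rw [card_sdiff_of_subset (hZe e₀ he₀), hcard e₀ he₀]; omega
    obtain ⟨x, hx, x', hx', hne⟩ := one_lt_card.1 htwo
    rw [mem_sdiff] at hx hx'
    obtain ⟨hu, hm, hm1⟩ := hout x hx.1 hx.2
    obtain ⟨hu', hm', -⟩ := hout x' hx'.1 hx'.2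
    refine hcrit (criterion_of_carry h.valid h.lt hj1 le_rfl (by omega)
      (h.carry_of_vertex_one hu hm1 (by omega) hx.1 (by rw [hcard e₀ he₀]; omega)
        (hcard e₀ he₀).le ?_ (hEu e₀ he₀) ?_ ?_))
    · rw [hcard e₀ he₀, if_pos rfl]
      omega
    · rw [hcard e₀ he₀]
      exact (mem_missing.1 he₀).2
    · intro e he hxe hsub
      have hx'e := hsub (mem_erase.2 ⟨hne.symm, hx'.1⟩)
      -- `x'` lies in one edge only
      have hsum := card_filter_add_card_filter_not (s := missing n k j ν S) (fun T => x' ∈ T)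
      rw [← missingAway, h.card_missing] at hsum
      have hone : ((missing n k j ν S).filter fun T => x' ∈ T).card ≤ 1 := by omega
      have := card_le_one.1 hone e (mem_filter.2 ⟨he, hx'e⟩) e₀ (mem_filter.2 ⟨he₀, hx'.1⟩)
      exact hxe (this ▸ hx.1)

/-- Exchanging two vertices of the last edge of size at most `j` preserves the hypotheses. -/
theorem swap (h : ColexBelow n k j ν S) {z u : Fin n} (hz : InLast n k j ν z)
    (hu : InLast n k j ν u) :
    ColexBelow n k j ν (S.image fun T => T.image (Equiv.swap z u)) ∧
      missing n k j ν (S.image fun T => T.image (Equiv.swap z u)) =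
        (missing n k j ν S).image fun T => T.image (Equiv.swap z u) := by
  have hinj : Function.Injective fun T : Finset (Fin n) => T.image (Equiv.swap z u) :=
    image_injective (Equiv.swap z u).injective
  have hfix : ∀ E : Finset (Fin n), labels E ∈ colexHypergraph n k ν j →
      E.image (Equiv.swap z u) = E := by
    intro E hE
    obtain ⟨i', r, hi', hs', heq⟩ := mem_colexHypergraph.1 hE
    have hiff : z ∈ E ↔ u ∈ E := by
      rw [← succ_mem_labels, ← succ_mem_labels, heq, hz.mem_iff hi' hs', hu.mem_iff hi' hs']
    refine eq_of_subset_of_card_le (fun y hy => ?_) (by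
      rw [card_image_of_injective _ (Equiv.swap z u).injective])
    obtain ⟨x, hx, rfl⟩ := mem_image.1 hy
    rw [Equiv.swap_apply_def]
    split_ifs with h1 h2
    · exact hiff.1 (h1 ▸ hx)
    · exact hiff.2 (h2 ▸ hx)
    · exact hx
  have hav : ∀ s, (avoiding n s (colexHypergraph n k ν j)).image
      (fun T => T.image (Equiv.swap z u)) = avoiding n s (colexHypergraph n k ν j) := fun s =>
    image_avoiding _ h.edge_subset_Icc h.edge_subset_Icc (fun E hE => by rwa [hfix E hE])
      fun E hE => ⟨E, hE, hfix E hE⟩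
  refine ⟨⟨h.valid, h.one_le, h.lt, minShadow_image h.minShadow _, ?_, ?_⟩, ?_⟩
  · rw [card_image_of_injective _ hinj, h.card_eq]
  · rw [shadow_iterate_image_perm, h.shadow_eq]
    exact hav j
  · rw [missing, missing, shadow_iterate_image_perm, image_sdiff _ _ hinj, hav]

/-- A family that is colex on level `j`, but not on level `j + 1`, satisfies the criterion. -/
theorem criterion (h : ColexBelow n k j ν S)
    (hS : ¬ IsColexSegment (Finset.shadow^[k - (j + 1)] S) (j + 1)) :
    1 ≤ ν (j + 1) ∧ Criterion n k j ν := by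
  have hjk := h.lt
  have hNs := edgesUpTo_succ ν j
  by_cases hW : ∀ e ∈ missing n k j ν S, ∀ i, 1 ≤ i → i ≤ j → edgesUpTo ν i < edgesUpTo ν j →
      vVertex n ν i ∈ labels e
  · refine ⟨?_, (h.isColexSegment_or_criterion hW).resolve_left hS⟩
    rw [← h.card_missing, Nat.one_le_iff_ne_zero, Ne, card_eq_zero]
    exact fun h0 => hS (h.isColexSegment_of_missing_eq_empty h0)
  · push Not at hW
    obtain ⟨e, he, i, h1, h2, h3, h4⟩ := hW
    have hpos : 1 ≤ ν (j + 1) := by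
      rw [← h.card_missing]
      exact card_pos.2 ⟨e, he⟩
    refine ⟨hpos, ?_⟩
    by_contra hcrit
    -- a vertex `v_q` that lies in at least two edges of size at most `j` lies in all edges
    have hfull : ∀ q (x : Fin n), 1 ≤ q → q ≤ j → edgesUpTo ν q + 2 ≤ edgesUpTo ν j →
        x.val + 1 = vVertex n ν q → missingAway n k j ν S x = 0 := by
      intro q x h5 h6 h7 hx
      by_contra h0
      have := h.missingAway_le (v := x)
      exact hcrit (criterion_of_carry h.valid h.lt h5 h6 (by omega)
        (h.carry_of_vertex_two (h.isUniform_vVertex hx h5 h6) (by omega) (by omega)))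
    obtain ⟨z, hz⟩ := exists_fin_of_mem_Icc (vVertex_mem h.valid h1 (show i ≤ k by omega))
    have hze : z ∉ e := fun h' => h4 (hz ▸ succ_mem_labels.2 h')
    -- so the vertex `z = v_i` outside `e` lies in the last edge of size at most `j` only
    have hN : edgesUpTo ν i + 1 = edgesUpTo ν j := by
      by_contra hne
      exact hze (missingAway_eq_zero_iff.1 (hfull i z h1 h2 (by omega) hz) e he)
    have hzl : InLast n k j ν z := ⟨i, h.isUniform_vVertex hz h1 h2, hN⟩
    obtain ⟨i₀, hi₀, hs₀⟩ := exists_hasSize (ν := ν) (l := j) (show 1 ≤ edgesUpTo ν j by omega)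
      le_rfl
    obtain ⟨u, hu⟩ := exists_fin_of_mem_Icc (uVertex_mem h.valid hs₀ (show i₀ ≤ k by omega))
    have hul := h.inLast_uVertex h1 hN hu
    have huz : u ≠ z := by
      rintro rfl
      exact uVertex_ne_vVertex h.valid hs₀ (by omega) (show i ≤ k by omega) (hu.symm.trans hz)
    have hdich : ∀ x, InLast n k j ν x → missingAway n k j ν S x = 0 ∨
        missingAway n k j ν S x = ν (j + 1) := by
      intro x hx
      by_contra hno
      rw [not_or] at hno
      have := h.missingAway_le (v := x)
      exact hcrit (h.carry_of_inLast hx (by omega) (by omega))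
    have hzd : missingAway n k j ν S z = ν (j + 1) := (hdich z hzl).resolve_left fun h' =>
      hze (missingAway_eq_zero_iff.1 h' e he)
    have hzero : ∀ x, InLast n k j ν x → x ≠ z → missingAway n k j ν S x = 0 := fun x hx hxz =>
      (hdich x hx).resolve_right fun h' =>
        hcrit (h.carry_of_inLast_inLast hx hzl hxz hpos h' hzd)
    -- every other vertex of the last edge lies in all edges of size `j + 1`; exchanging `z` with the
    -- last vertex `u` leads back to the previous case
    obtain ⟨h', hm'⟩ := h.swap hzl hul
    rcases h'.isColexSegment_or_criterion (fun e' he' q h5 h6 h7 => by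
      rw [hm'] at he'
      obtain ⟨e₁, he₁, rfl⟩ := mem_image.1 he'
      obtain ⟨x, hx⟩ := exists_fin_of_mem_Icc (vVertex_mem h.valid h5 (show q ≤ k by omega))
      rw [← hx, succ_mem_labels, mem_image]
      by_cases hxz : x = z
      · exact ⟨u, missingAway_eq_zero_iff.1 (hzero u hul huz) e₁ he₁, by
          rw [Equiv.swap_apply_right, hxz]⟩
      · have hxu : x ≠ u := by
          rintro rfl
          exact uVertex_ne_vVertex h.valid hs₀ (by omega) (show q ≤ k by omega) (hu.symm.trans hx)
        refine ⟨x, ?_, Equiv.swap_apply_of_ne_of_ne hxz hxu⟩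
        refine missingAway_eq_zero_iff.1 ?_ e₁ he₁
        by_cases hq : edgesUpTo ν q + 1 = edgesUpTo ν j
        · exact hzero x ⟨q, h.isUniform_vVertex hx h5 h6, hq⟩ hxz
        · exact hfull q x h5 h6 (by omega) hx) with hc | hc
    · rw [shadow_iterate_image_perm] at hc
      exact hS (isColexSegment_image _ hc)
    · exact hcrit hc

end ColexBelow

/-! ### The criterion decides the existence of solutions -/

section Solutions

variable {n k t : ℕ} {ν : ℕ → ℕ} {S : Finset (Finset (Fin n))}

/-- After a permutation of the ground set, the `(t + 1)`-th shadow of a solution is the shadow of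
the initial segment of the same size. -/
theorem IsSolution.exists_colexBelow (hν : edgesUpTo ν k + k ≤ n) (ht : t + 1 < k)
    (hS : IsSolution n k t (colexFamily n k ν k).card S) :
    ∃ S', ColexBelow n k (k - (t + 1)) ν S' ∧
      ¬ IsColexSegment (Finset.shadow^[t] S') (k - t) := by
  obtain ⟨hext, hcard, hnot, σ, hσ⟩ := hS
  obtain ⟨-, hmin⟩ := (extremal_iff (by omega)).1 hext
  obtain ⟨n, rfl⟩ : ∃ n', n = n' + 1 := ⟨n - 1, by omega⟩
  have hinj : Function.Injective fun T : Finset (Fin (n + 1)) => T.image σ :=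
    image_injective σ.injective
  refine ⟨S.image fun T => T.image σ, ⟨hν, by omega, by omega, minShadow_image hmin σ, ?_, ?_⟩, ?_⟩
  · rw [card_image_of_injective _ hinj, hcard]
  · rw [show k - (k - (t + 1)) = t + 1 by omega, shadow_iterate_image_perm]
    refine isInitSeg_eq_of_card_eq hσ (isInitSeg_colexFamily hν (by omega)) ?_
    rw [card_image_of_injective _ hinj, hmin.card_shadow_iterate
      (isInitSeg_colexFamily hν le_rfl) hcard.symm, shadow_iterate_colexFamily hν le_rfl _ ht.le]
  · rw [shadow_iterate_image_perm]
    exact fun h => hnot (isColexSegment_image σ h)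

theorem IsSolution.criterion (hν : edgesUpTo ν k + k ≤ n) (ht : t + 1 < k)
    (hS : IsSolution n k t (colexFamily n k ν k).card S) :
    Admissible n k (k - (t + 1)) ν ∧ Criterion n k (k - (t + 1)) ν := by
  obtain ⟨S', hS', hnot⟩ := hS.exists_colexBelow hν ht
  have h := hS'.criterion (by
    rwa [show k - (t + 1) + 1 = k - t by omega, show k - (k - t) = t by omega])
  exact ⟨⟨by omega, by omega, h.1, hν⟩, h.2⟩

theorem Criterion.exists_solution {j : ℕ} (hν : Admissible n k j ν) (h : Criterion n k j ν) :
    ∃ S, IsSolution n k (k - (j + 1)) (colexFamily n k ν k).card S ∧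
      (IsConstructionA n k j (labelledHypergraph k S) ∨
        IsConstructionB n k j (labelledHypergraph k S)) := by
  obtain ⟨p, hp, L, hL0, hL⟩ := h
  have h2 := ((isPivot_iff hν.2.2.2 hν.2.1).1 hp).1.2.2
  obtain ⟨S, hS, -, hAB⟩ := solution_of_carry hν hp (fun h => Or.inr (hL0 (by omega))) hL
  exact ⟨S, hS, hAB⟩

theorem IsSolution.card_pos {m : ℕ} (hS : IsSolution n k t m S) : 1 ≤ m ∧ m ≤ n.choose k :=
  ⟨hS.2.1 ▸ Finset.card_pos.2 hS.1.2.1, hS.2.1 ▸ card_le_choose_of_sized hS.1.1⟩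

/-- Every extremal family has the same size and depth as a family from the constructions. -/
theorem exists_construction (ht : t + 1 < k) (hext : Extremal k S) (hS : HasDepthSucc k t S) :
    ∃ S' : Finset (Finset (Fin n)), Extremal k S' ∧ S'.card = S.card ∧ HasDepthSucc k t S' ∧
      (IsConstructionA n k (k - (t + 1)) (labelledHypergraph k S') ∨
        IsConstructionB n k (k - (t + 1)) (labelledHypergraph k S')) := by
  obtain ⟨C, hC, hc⟩ := exists_isInitSeg_of_sized hext.1
  obtain ⟨ν, hν, rfl⟩ := exists_eq_colexFamily hC
    (by rw [← Finset.card_pos, hc]; exact Finset.card_pos.2 hext.2.1)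
  have hsol : IsSolution n k t (colexFamily n k ν k).card S := ⟨hext, hc.symm, hS⟩
  obtain ⟨hadm, hcrit⟩ := hsol.criterion hν ht
  obtain ⟨S', ⟨h1, h2, h3⟩, h4⟩ := hcrit.exists_solution hadm
  rw [show k - (k - (t + 1) + 1) = t by omega] at h3
  exact ⟨S', h1, h2.trans hc, h3, h4⟩

end Solutions

/-! ### Deciding the carry condition -/

/-- The result of moving every excess of `f` over `g` one level down: the multiplicity of `l` is the
total excess above `l`, since `C(y, s + 1)` is the sum of the `C(l, s)` with `l < y`. -/
def carryDown (n : ℕ) (f g : ℕ → ℕ) (l : ℕ) : ℕ := ∑ y ∈ Ioo l n, f y - ∑ y ∈ Ioo l n, g y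

/-- The indicator function of the open interval from `a` to `b`. -/
def between (a b y : ℕ) : ℕ := if a < y ∧ y < b then 1 else 0

theorem sum_choose_range (y s : ℕ) : ∑ l ∈ range y, l.choose s = y.choose (s + 1) := by
  induction y with
  | zero => simp
  | succ y ih => rw [sum_range_succ, ih, Nat.choose_succ_succ, add_comm]

/-- Moving the excess down preserves the balance, by `C(y, s + 1) = ∑_{l < y} C(l, s)`. -/
theorem sum_carryDown {n : ℕ} {f g : ℕ → ℕ}
    (h : ∀ l, ∑ y ∈ Ioo l n, g y ≤ ∑ y ∈ Ioo l n, f y) (s : ℕ) :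
    ∑ l ∈ range n, carryDown n f g l * l.choose s + ∑ y ∈ range n, g y * y.choose (s + 1) =
      ∑ y ∈ range n, f y * y.choose (s + 1) := by
  have key : ∀ f : ℕ → ℕ, ∑ y ∈ range n, f y * y.choose (s + 1) =
      ∑ l ∈ range n, (∑ y ∈ Ioo l n, f y) * l.choose s := by
    intro f
    simp_rw [← sum_choose_range, mul_sum, sum_mul]
    exact sum_comm' fun y l => by simp only [mem_range, mem_Ioo]; omega
  rw [key f, key g, ← sum_add_distrib]
  refine sum_congr rfl fun l _ => ?_
  rw [← add_mul, carryDown, Nat.sub_add_cancel (h l)]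

theorem sum_between {n a b : ℕ} (hb : b ≤ n) (w : ℕ → ℕ) :
    ∑ y ∈ range n, between a b y * w y = ∑ q ∈ range (b - a - 1), w (b - 1 - q) := by
  have h1 : ∑ y ∈ range n, between a b y * w y = ∑ y ∈ Ioo a b, w y := by
    simp_rw [between, ite_mul, one_mul, zero_mul]
    rw [← sum_filter]
    congr 1
    ext y
    simp only [mem_filter, mem_range, mem_Ioo]
    omega
  rw [h1]
  refine sum_bij' (fun y _ => b - 1 - y) (fun q _ => b - 1 - q) ?_ ?_ ?_ ?_ ?_ <;>
    intro y hy <;> simp only [mem_Ioo, mem_range] at hy ⊢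
  · omega
  · omega
  · omega
  · omega
  · congr 1
    omega

theorem sum_Ioo_between {n a b : ℕ} (hb : b ≤ n) (l : ℕ) :
    ∑ y ∈ Ioo l n, between a b y = b - max a l - 1 := by
  simp_rw [between]
  rw [← sum_filter, sum_const, smul_eq_mul, mul_one,
    show (Ioo l n).filter (fun y => a < y ∧ y < b) = Ioo (max a l) b by
      ext y; simp only [mem_filter, mem_Ioo]; omega, Nat.card_Ioo]

/-- The decision procedure for the carry condition. The positions `c 0 > c 1 > ⋯` of the vertices
`v_{j+1}, v_{j+2}, …` are given. On each level the procedure knows the new position of the vertex in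
question and the multiplicities of the positions whose kills are still to be balanced. -/
def carryState (n δ F : ℕ) (c : ℕ → ℕ) : ℕ → ℕ × (ℕ → ℕ)
  | 0 => (c 0, between (c 0 + δ - 1) (c 0 + δ + F))
  | i + 1 =>
    let B := (carryState n δ F c i).1
    let Y := (carryState n δ F c i).2
    let B' := B - 1 - (c i - c (i + 1) - 1 - ∑ y ∈ range n, Y y)
    (B', carryDown n (fun y => Y y + between (B' + δ) (B + δ) y) (between (c (i + 1)) (c i)))

/-- The number of edges that the positions to be balanced require. -/
def carryLoad (n δ F : ℕ) (c : ℕ → ℕ) (i : ℕ) : ℕ := ∑ y ∈ range n, (carryState n δ F c i).2 y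

/-- The numbers of edges found by the decision procedure. -/
def carryVector (n δ F : ℕ) (c : ℕ → ℕ) (i : ℕ) : ℕ :=
  c i - c (i + 1) - 1 - carryLoad n δ F c i

section Carry

variable {n δ F t : ℕ} {c : ℕ → ℕ}

/-- What holds on each level that the decision procedure reaches. -/
structure CarryValid (n δ F : ℕ) (c : ℕ → ℕ) (i : ℕ) : Prop where
  supp : ∀ y, y < c i → (carryState n δ F c i).2 y = 0
  le : c i ≤ (carryState n δ F c i).1
  bound : (carryState n δ F c i).1 + δ ≤ n

theorem carryState_fst_succ (i : ℕ) : (carryState n δ F c (i + 1)).1 =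
    (carryState n δ F c i).1 - 1 - carryVector n δ F c i := rfl

theorem carryState_snd_succ (i : ℕ) : (carryState n δ F c (i + 1)).2 =
    carryDown n (fun y => (carryState n δ F c i).2 y + between ((carryState n δ F c (i + 1)).1 + δ)
      ((carryState n δ F c i).1 + δ) y) (between (c (i + 1)) (c i)) := rfl

theorem carryValid_zero (hn : c 0 + δ + F ≤ n) : CarryValid n δ F c 0 := by
  refine ⟨fun y hy => ?_, le_rfl, ?_⟩
  · change between _ _ _ = 0
    rw [between, if_neg (by omega)]
  · change c 0 + δ ≤ n
    omega

/-- Above every position there is an excess, so that the subtraction in `carryDown` does not truncate. -/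
theorem CarryValid.dominated {i : ℕ} (h : CarryValid n δ F c i)
    (hc : c (i + 1) < c i) (l : ℕ) :
    ∑ y ∈ Ioo l n, between (c (i + 1)) (c i) y ≤
      ∑ y ∈ Ioo l n, ((carryState n δ F c i).2 y + between ((carryState n δ F c (i + 1)).1 + δ)
        ((carryState n δ F c i).1 + δ) y) := by
  have h1 := h.le
  have h2 := h.bound
  have h3 := carryState_fst_succ (n := n) (δ := δ) (F := F) (c := c) i
  rw [carryVector] at h3
  rw [sum_add_distrib, sum_Ioo_between (by omega), sum_Ioo_between h2]
  by_cases hl : l < c i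
  · have : ∑ y ∈ Ioo l n, (carryState n δ F c i).2 y = carryLoad n δ F c i := by
      by_cases hl0 : (carryState n δ F c i).2 l = 0 ∨ n ≤ l
      · refine sum_subset (fun y hy => mem_range.2 (mem_Ioo.1 hy).2) fun y hy hy' => ?_
        rw [mem_range] at hy
        rw [mem_Ioo] at hy'
        exact h.supp y (by omega)
      · exact absurd (h.supp l hl) (not_or.1 hl0).1
    omega
  · omega

theorem CarryValid.succ {i : ℕ} (h : CarryValid n δ F c i)
    (hF : carryLoad n δ F c i ≤ c i - c (i + 1) - 1) (hc : c (i + 1) < c i) :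
    CarryValid n δ F c (i + 1) := by
  have h1 := h.le
  have h2 := h.bound
  have h3 := carryState_fst_succ (n := n) (δ := δ) (F := F) (c := c) i
  rw [carryVector] at h3
  refine ⟨fun y hy => ?_, by omega, by omega⟩
  rw [carryState_snd_succ, carryDown, sum_add_distrib, sum_Ioo_between h2,
    sum_Ioo_between (by omega)]
  have : ∑ y ∈ Ioo y n, (carryState n δ F c i).2 y ≤ carryLoad n δ F c i :=
    sum_le_sum_of_subset fun y hy => mem_range.2 (mem_Ioo.1 hy).2
  omega

/-- The equations of the carry condition that are left over on level `i`. -/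
def CarryEq (n δ F : ℕ) (c L : ℕ → ℕ) (i s : ℕ) : Prop :=
  kills (fun q => c (q + i) - c (q + i + 1) - 1) ((c i : ℤ) - 1) s =
    kills (fun q => L (q + i)) (((carryState n δ F c i).1 : ℤ) + δ - 1) s +
      ∑ y ∈ range n, ((carryState n δ F c i).2 y : ℤ) * (y.choose s : ℤ)

theorem carryEq_zero {L : ℕ → ℕ} {i : ℕ} : CarryEq n δ F c L i 0 ↔
    c i - c (i + 1) - 1 = L i + carryLoad n δ F c i := by
  rw [CarryEq, kills_zero, kills_zero, carryLoad]
  simp only [zero_add, Nat.choose_zero_right, Nat.cast_one, mul_one]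
  norm_cast

/-- Once the number of edges of size `1` is determined, these edges are removed on both sides, and the
equation with index `s + 1` turns into the equation with index `s` on the next level. -/
theorem CarryValid.carryEq_succ {L : ℕ → ℕ} {i s : ℕ} (h : CarryValid n δ F c i)
    (hL : c i - c (i + 1) - 1 = L i + carryLoad n δ F c i) (hc : c (i + 1) < c i) :
    CarryEq n δ F c L i (s + 1) ↔ CarryEq n δ F c L (i + 1) s := by
  have h1 := h.le
  have h2 := h.bound
  have h3 := carryState_fst_succ (n := n) (δ := δ) (F := F) (c := c) i
  rw [carryVector, hL, Nat.add_sub_cancel] at h3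
  have hdown := sum_carryDown (h.dominated hc) s
  rw [← carryState_snd_succ] at hdown
  simp_rw [add_mul] at hdown
  rw [sum_add_distrib, sum_between h2, sum_between (by omega)] at hdown
  rw [show (carryState n δ F c i).1 + δ - ((carryState n δ F c (i + 1)).1 + δ) - 1 = L i by omega,
    hL] at hdown
  have hcast : ∀ (P : ℕ) (a : ℕ), a ≤ P → ∑ q ∈ range a, Ring.choose ((P : ℤ) - 1 - q) (s + 1) =
      ∑ q ∈ range a, (((P - 1 - q).choose (s + 1) : ℕ) : ℤ) := fun P a ha =>
    sum_congr rfl fun q hq => by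
      rw [mem_range] at hq
      rw [← Ring.choose_natCast, Nat.cast_sub (by omega), Nat.cast_sub (by omega), Nat.cast_one]
  have e1 := hcast (c i) (L i + carryLoad n δ F c i) (by omega)
  have e2 := hcast ((carryState n δ F c i).1 + δ) (L i) (by omega)
  rw [Nat.cast_add] at e2
  rw [CarryEq, CarryEq, kills_succ, kills_succ]
  simp only [zero_add]
  rw [hL, e1, e2, show (fun q => c (q + 1 + i) - c (q + 1 + i + 1) - 1) =
      fun q => c (q + (i + 1)) - c (q + (i + 1) + 1) - 1 by
        funext q; rw [show q + 1 + i = q + (i + 1) by omega],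
    show (fun q => L (q + 1 + i)) = fun q => L (q + (i + 1)) by
      funext q; rw [show q + 1 + i = q + (i + 1) by omega],
    show (c i : ℤ) - 1 - ((L i + carryLoad n δ F c i : ℕ) : ℤ) - 1 = (c (i + 1) : ℤ) - 1 by omega,
    show ((carryState n δ F c i).1 : ℤ) + δ - 1 - (L i : ℤ) - 1 =
      ((carryState n δ F c (i + 1)).1 : ℤ) + δ - 1 by omega]
  have hdown' := congrArg (Nat.cast : ℕ → ℤ) hdown
  push_cast at hdown'
  constructor <;> intro h <;> linarith

theorem carryEq_of_le (hc : ∀ i < t, c (i + 1) < c i)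
    (hF : ∀ i < t, carryLoad n δ F c i ≤ c i - c (i + 1) - 1) (s i : ℕ) (hi : i + s < t)
    (h : CarryValid n δ F c i) : CarryEq n δ F c (carryVector n δ F c) i s := by
  have h1 : c i - c (i + 1) - 1 = carryVector n δ F c i + carryLoad n δ F c i :=
    (Nat.sub_add_cancel (hF i (by omega))).symm
  induction s generalizing i with
  | zero => exact carryEq_zero.2 h1
  | succ s ih =>
    refine (h.carryEq_succ h1 (hc i (by omega))).2 (ih (i + 1) (by omega)
      (h.succ (hF i (by omega)) (hc i (by omega))) ?_)
    exact (Nat.sub_add_cancel (hF (i + 1) (by omega))).symm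

/-- The equations determine the numbers of edges one after the other; as these are not negative, no
level fails. -/
theorem carryValid_of_eq {L : ℕ → ℕ} (hc : ∀ i < t, c (i + 1) < c i)
    (h0 : CarryValid n δ F c 0) (hL : ∀ s < t, CarryEq n δ F c L 0 s) (i : ℕ) (hi : i ≤ t) :
    CarryValid n δ F c i ∧ (∀ s, i + s < t → CarryEq n δ F c L i s) ∧
      ∀ q < i, carryLoad n δ F c q ≤ c q - c (q + 1) - 1 := by
  induction i with
  | zero => exact ⟨h0, fun s hs => hL s (by omega), fun q hq => absurd hq (by omega)⟩
  | succ i ih =>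
    obtain ⟨h1, h2, h3⟩ := ih (by omega)
    have h4 := carryEq_zero.1 (h2 0 (by omega))
    refine ⟨h1.succ (by omega) (hc i (by omega)), fun s hs =>
      (h1.carryEq_succ h4 (hc i (by omega))).1 (h2 (s + 1) (by omega)), fun q hq => ?_⟩
    rcases Nat.lt_succ_iff_lt_or_eq.1 hq with hq | rfl
    · exact h3 q hq
    · omega

theorem carryEq_start {L : ℕ → ℕ} {s : ℕ} (hc : 1 ≤ c 0) (hn : c 0 + δ + F ≤ n) :
    CarryEq n δ F c L 0 s ↔ kills (fun q => c q - c (q + 1) - 1) ((c 0 : ℤ) - 1) s =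
      kills L ((c 0 : ℤ) + δ - 1) s + ∑ q ∈ range F, Ring.choose ((c 0 : ℤ) + δ + q) s := by
  have h1 : ∑ y ∈ range n, ((carryState n δ F c 0).2 y : ℤ) * (y.choose s : ℤ) =
      ∑ q ∈ range F, Ring.choose ((c 0 : ℤ) + δ + q) s := by
    have h2 := congrArg (Nat.cast : ℕ → ℤ)
      (sum_between (a := c 0 + δ - 1) (b := c 0 + δ + F) hn fun y => y.choose s)
    push_cast at h2
    change ∑ y ∈ range n, (between (c 0 + δ - 1) (c 0 + δ + F) y : ℤ) * (y.choose s : ℤ) = _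
    rw [h2, show c 0 + δ + F - (c 0 + δ - 1) - 1 = F by omega, ← sum_range_reflect]
    refine sum_congr rfl fun q hq => ?_
    rw [mem_range] at hq
    rw [← Ring.choose_natCast]
    congr 1
    omega
  rw [CarryEq, h1]
  rfl

/-- The decision procedure is correct: the carry condition holds if and only if no level requires
more edges than there are. -/
theorem carry_iff (hc : ∀ i < t, c (i + 1) < c i) (hc0 : 1 ≤ c 0) (hn : c 0 + δ + F ≤ n) :
    (∃ L, ∀ s < t, kills (fun q => c q - c (q + 1) - 1) ((c 0 : ℤ) - 1) s =
      kills L ((c 0 : ℤ) + δ - 1) s + ∑ q ∈ range F, Ring.choose ((c 0 : ℤ) + δ + q) s) ↔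
    ∀ i < t, carryLoad n δ F c i ≤ c i - c (i + 1) - 1 := by
  constructor
  · rintro ⟨L, hL⟩
    exact (carryValid_of_eq hc (carryValid_zero hn)
      (fun s hs => (carryEq_start hc0 hn).2 (hL s hs)) t le_rfl).2.2
  · exact fun h => ⟨carryVector n δ F c, fun s hs => (carryEq_start hc0 hn).1
      (carryEq_of_le hc h s 0 (by omega) (carryValid_zero hn))⟩

end Carry

/-! ### The criterion in terms of the positions of the vertices -/

/-- The number `N_{j+1} - N_p - 1`, in terms of the positions `b` of the vertices. -/
def pivotGap (b : ℕ → ℕ) (j p : ℕ) : ℕ := b (p - 1) + p - (b j + j + 2)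

/-- The vertices `v_{j+2}, …` of the solution are placed as the decision procedure says. The number
`δ` is `1` in Construction A and `0` in Construction B. -/
def newPlace (n δ j p : ℕ) (b : ℕ → ℕ) (q : ℕ) : ℕ :=
  if q ≤ j then b q else
    (carryState n δ (pivotGap b j p - δ) (fun i => b (j + i)) (q - j)).1

section Place

variable {n k j p δ : ℕ} {b : ℕ → ℕ}

theorem IsPlaced.lt_of_lt (hb : IsPlaced n k b) {i q : ℕ} (h : i < q) (hq : q < k) :
    b q + (q - i) ≤ b i := by
  induction q with
  | zero => omega
  | succ q ih =>
    have h1 := hb.2 q hq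
    rcases Nat.lt_succ_iff_lt_or_eq.1 h with h2 | rfl
    · have := ih h2 (by omega); omega
    · omega

theorem IsPlaced.edgesUpTo_eq (hb : IsPlaced n k b) {i : ℕ} (h1 : 1 ≤ i) (hi : i ≤ k) :
    edgesUpTo (gaps n b) i + i + b (i - 1) = n := by
  have := edgesUpTo_gaps hb (show i - 1 < k by omega)
  rwa [show i - 1 + 1 = i by omega] at this

theorem gaps_eq (q : ℕ) : gaps n b (q + 2) = b q - b (q + 1) - 1 := by
  rw [gaps, if_neg (by omega)]
  rfl

/-- The pivots, in terms of the positions of the vertices. -/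
theorem IsPlaced.isPivot_iff (hb : IsPlaced n k b) (hj : j + 1 ≤ k) :
    IsPivot n k j (gaps n b) p ↔
      IsGreatest {s | 1 ≤ s ∧ s ≤ j ∧ b j + j + 3 ≤ b (s - 1) + s} p := by
  rw [ShadowDepth.isPivot_iff (edgesUpTo_gaps_le hb) hj]
  have h2 := hb.edgesUpTo_eq (show 1 ≤ j + 1 by omega) hj
  rw [Nat.add_sub_cancel] at h2
  have : {s | 1 ≤ s ∧ s ≤ j ∧ edgesUpTo (gaps n b) s + 2 ≤ edgesUpTo (gaps n b) (j + 1)} =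
      {s | 1 ≤ s ∧ s ≤ j ∧ b j + j + 3 ≤ b (s - 1) + s} := by
    ext s
    refine and_congr_right fun h3 => and_congr_right fun h4 => ?_
    have h1 := hb.edgesUpTo_eq h3 (by omega)
    omega
  rw [this]

theorem IsPlaced.pivotGap_eq (hb : IsPlaced n k b) (hj : j + 1 ≤ k) (h1 : 1 ≤ p) (hp : p ≤ j) :
    edgesUpTo (gaps n b) (j + 1) - 1 - edgesUpTo (gaps n b) p = pivotGap b j p := by
  have h2 := hb.edgesUpTo_eq (show 1 ≤ j + 1 by omega) hj
  have h3 := hb.edgesUpTo_eq h1 (show p ≤ k by omega)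
  rw [Nat.add_sub_cancel] at h2
  rw [pivotGap]
  omega

/-- In Construction B one of the edges of size `j + 2` is the one at the position of `v_{j+1}`. -/
theorem kills_add_sum {c : ℕ} (hc : 1 ≤ c) (hδ : δ = if c = 1 then 0 else 1) (L : ℕ → ℕ) (x : ℤ)
    (s : ℕ) : kills (fun i => if i = 0 then (1 - δ) + L 0 else L i) x s +
      ∑ q ∈ range (c - 1), Ring.choose (x + 1 + q) s =
      kills L (x + δ - 1) s + ∑ q ∈ range (c - δ), Ring.choose (x + δ + q) s := by
  rw [kills_add_head]
  by_cases h1 : c = 1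
  · rw [if_pos h1] at hδ
    subst h1 hδ
    simp [add_comm]
  · rw [if_neg h1] at hδ
    subst hδ
    simp

/-- The carry condition for one pivot in the form that the decision procedure handles. -/
theorem carryCondition_iff {c t : ℕ} {x : ℤ} {m : ℕ → ℕ} (hc : 1 ≤ c)
    (hδ : δ = if c = 1 then 0 else 1) :
    CarryCondition c t x m ↔ ∃ L, ∀ s < t, kills m (x - 1) s =
      kills L (x + δ - 1) s + ∑ q ∈ range (c - δ), Ring.choose (x + δ + q) s := by
  constructor
  · rintro ⟨L, hL0, hL⟩
    refine ⟨fun i => if i = 0 then L 0 - (1 - δ) else L i, fun s hs => ?_⟩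
    rw [hL s hs, ← kills_add_sum hc hδ]
    congr 1
    refine kills_congr fun i _ => ?_
    by_cases hi : i = 0
    · subst hi
      simp only [if_true]
      split_ifs at hδ with h1
      · have := hL0 h1; omega
      · omega
    · simp [hi]
  · rintro ⟨L, hL⟩
    refine ⟨fun i => if i = 0 then (1 - δ) + L 0 else L i, fun h1 => ?_, fun s hs => by
      rw [hL s hs, kills_add_sum hc hδ]⟩
    rw [if_pos h1] at hδ
    subst hδ
    simp

theorem IsPlaced.carry_iff (hb : IsPlaced n k b) (hj : j + 1 < k) (h1 : 1 ≤ p) (hp : p ≤ j)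
    (hd : 1 ≤ pivotGap b j p) (hδ : δ = if pivotGap b j p = 1 then 0 else 1) :
    CarryCondition (edgesUpTo (gaps n b) (j + 1) - 1 - edgesUpTo (gaps n b) p) (k - (j + 1))
      ((n : ℤ) - edgesUpTo (gaps n b) (j + 1) - (j + 1)) (fun q => gaps n b (q + j + 2)) ↔
    ∀ i < k - (j + 1), carryLoad n δ (pivotGap b j p - δ) (fun i => b (j + i)) i ≤
      b (j + i) - b (j + i + 1) - 1 := by
  have h2 := hb.edgesUpTo_eq (show 1 ≤ j + 1 by omega) hj.le
  have h3 := hb.1 (p - 1) (by omega)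
  have h4 := hb.lt_of_lt (Nat.lt_succ_self j) hj
  rw [Nat.add_sub_cancel] at h2
  have hδ1 : δ ≤ 1 := by rw [hδ]; split_ifs <;> omega
  rw [hb.pivotGap_eq hj.le h1 hp, carryCondition_iff hd hδ,
    show (n : ℤ) - edgesUpTo (gaps n b) (j + 1) - (j + 1) = (b j : ℤ) by omega,
    show (fun q => gaps n b (q + j + 2)) = fun q => b (j + q) - b (j + (q + 1)) - 1 by
      funext q
      rw [gaps_eq, add_comm q j, add_assoc]]
  exact ShadowDepth.carry_iff (c := fun i => b (j + i)) (fun i hi => hb.2 (j + i) (by omega))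
    (by simp only [add_zero]; omega) (by simp only [add_zero]; rw [pivotGap] at hd ⊢; omega)

/-- What the decision procedure needs of the data. -/
structure Pivotal (n k j p δ : ℕ) (b : ℕ → ℕ) : Prop where
  placed : IsPlaced n k b
  lt : j + 1 < k
  one_le : 1 ≤ p
  le : p ≤ j
  pos : b j + 1 < b (j - 1)
  gap_pos : 1 ≤ pivotGap b j p
  greatest : ∀ s, p < s → s ≤ j → b (s - 1) + s ≤ b j + j + 2
  delta : δ = if pivotGap b j p = 1 then 0 else 1

namespace Pivotal

theorem isPivot (h : Pivotal n k j p δ b) : IsPivot n k j (gaps n b) p := by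
  have h1 := h.gap_pos
  rw [pivotGap] at h1
  refine (h.placed.isPivot_iff h.lt.le).2 ⟨⟨h.one_le, h.le, by omega⟩, fun s hs => ?_⟩
  by_contra hlt
  have := h.greatest s (not_le.1 hlt) hs.2.1
  have := hs.2.2
  omega

theorem gap_le (h : Pivotal n k j p δ b) : b j + pivotGap b j p ≤ n := by
  have h3 := h.placed.1 (p - 1) (by have := h.lt; have := h.le; omega)
  have := h.le
  have := h.gap_pos
  rw [pivotGap] at *
  omega

theorem delta_le (h : Pivotal n k j p δ b) : δ ≤ 1 ∧ δ ≤ pivotGap b j p := by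
  have := h.gap_pos
  rw [h.delta]
  split_ifs <;> omega

theorem admissible (h : Pivotal n k j p δ b) : Admissible n k j (gaps n b) := by
  have h1 := h.one_le
  have h2 := h.le
  refine ⟨by omega, h.lt.le, ?_, edgesUpTo_gaps_le h.placed⟩
  have := h.pos
  rw [show j + 1 = j - 1 + 2 by omega, gaps_eq, show j - 1 + 1 = j by omega]
  omega

theorem load_le_of_solution (h : Pivotal n k j p δ b) {S : Finset (Finset (Fin n))} {t : ℕ}
    (ht : t + 1 < k) (hj : j = k - (t + 1))
    (hS : IsSolution n k t (colexFamily n k (gaps n b) k).card S) (i : ℕ) (hi : i < t) :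
    carryLoad n δ (pivotGap b j p - δ) (fun i => b (j + i)) i ≤ b (j + i) - b (j + i + 1) - 1 := by
  obtain ⟨-, hcrit⟩ := hS.criterion (edgesUpTo_gaps_le h.placed) ht
  rw [← hj] at hcrit
  obtain ⟨p', hp', hc⟩ := hcrit
  rw [hp'.unique h.isPivot] at hc
  exact (h.placed.carry_iff h.lt h.one_le h.le h.gap_pos h.delta).1 hc i (by omega)

/-- Success of the decision procedure on all levels. -/
def Succeeds (n k j p δ : ℕ) (b : ℕ → ℕ) : Prop :=
  ∀ i < k - (j + 1), carryLoad n δ (pivotGap b j p - δ) (fun i => b (j + i)) i ≤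
    b (j + i) - b (j + i + 1) - 1

theorem carryValid (h : Pivotal n k j p δ b) (hs : Succeeds n k j p δ b) (i : ℕ)
    (hi : i ≤ k - (j + 1)) : CarryValid n δ (pivotGap b j p - δ) (fun i => b (j + i)) i := by
  induction i with
  | zero =>
    refine carryValid_zero ?_
    have := h.gap_le
    have := h.delta_le
    simp only [add_zero]
    omega
  | succ i ih => exact (ih (by omega)).succ (hs i (by omega)) (h.placed.2 (j + i) (by omega))

theorem newPlace_succ (h : Pivotal n k j p δ b) (hs : Succeeds n k j p δ b) {i : ℕ}
    (hi : i < k - (j + 1)) : newPlace n δ j p b (j + i + 1) + 1 +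
      carryVector n δ (pivotGap b j p - δ) (fun i => b (j + i)) i = newPlace n δ j p b (j + i) := by
  have h1 := (h.carryValid hs i hi.le).le
  have h2 := h.placed.2 (j + i) (by omega)
  have h3 := carryState_fst_succ (n := n) (δ := δ) (F := pivotGap b j p - δ)
    (c := fun i => b (j + i)) i
  have h4 : newPlace n δ j p b (j + i) =
      (carryState n δ (pivotGap b j p - δ) (fun i => b (j + i)) i).1 := by
    rw [newPlace]
    split_ifs with hle
    · rw [show i = 0 by omega]; rfl
    · rw [Nat.add_sub_cancel_left]
  rw [h4, newPlace, if_neg (by omega), show j + i + 1 - j = i + 1 by omega, h3]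
  have h5 := hs i hi
  rw [carryVector] at h3 ⊢
  simp only [← add_assoc] at h1 h5 ⊢
  omega

theorem isPlaced_newPlace (h : Pivotal n k j p δ b) (hs : Succeeds n k j p δ b) :
    IsPlaced n k (newPlace n δ j p b) := by
  have hdec : ∀ i, i + 1 < k → newPlace n δ j p b (i + 1) < newPlace n δ j p b i := by
    intro i hi
    by_cases hij : i < j
    · rw [newPlace, newPlace, if_pos (by omega), if_pos (by omega)]
      exact h.placed.2 i hi
    · have := h.newPlace_succ hs (i := i - j) (by omega)
      rw [show j + (i - j) = i by omega] at this
      omega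
  refine ⟨fun i hi => ?_, hdec⟩
  induction i with
  | zero => rw [newPlace, if_pos (by omega)]; exact h.placed.1 0 hi
  | succ i ih => exact (hdec i hi).trans (ih (by omega))

theorem exchangedHypergraph_congr {ν ν' : ℕ → ℕ} {M : ℕ} (hj : j + 1 ≤ k)
    (h : ∀ i, 1 ≤ i → i ≤ k → ν i = ν' i) :
    exchangedHypergraph n k j ν p M k = exchangedHypergraph n k j ν' p M k := by
  have hE : ∀ i, i ≤ k → edgesUpTo ν i = edgesUpTo ν' i := fun i hi =>
    edgesUpTo_congr fun q h1 h2 => h q h1 (h2.trans hi)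
  have hV : ∀ i, i ≤ k → vVertex n ν i = vVertex n ν' i := fun i hi => by
    rw [vVertex, vVertex, hE i hi]
  have hU : ∀ r, uVertex n k ν r = uVertex n k ν' r := fun r => by
    rw [uVertex, uVertex]
    congr 3
    exact filter_congr fun i hi => by rw [hE i (mem_Icc.1 hi).2]
  have hC : ∀ i r, i ≤ k → colexEdge n k ν i r = colexEdge n k ν' i r := fun i r hi => by
    rw [colexEdge, colexEdge, hU]
    congr 1
    exact image_congr fun q hq => hV q (by have := mem_Icc.1 (mem_coe.1 hq); omega)
  have hH : colexHypergraph n k ν k = colexHypergraph n k ν' k := by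
    refine biUnion_congr rfl fun i hi => ?_
    have := (mem_Icc.1 hi).2
    rw [hE i this, hE (i - 1) (by omega)]
    exact image_congr fun r _ => hC i r this
  rw [exchangedHypergraph, exchangedHypergraph, if_neg (by omega), if_neg (by omega), hH,
    hE (j + 1) hj, hC _ _ hj]
  congr 1
  rw [exchangedEdge, exchangedEdge, hU]
  congr 1
  refine image_congr fun q hq => hV q ?_
  have := mem_Icc.1 (mem_of_mem_erase (mem_coe.1 hq))
  omega

theorem exists_solution (h : Pivotal n k j p δ b) (hs : Succeeds n k j p δ b) :
    ∃ S, IsSolution n k (k - (j + 1)) (colexFamily n k (gaps n b) k).card S ∧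
      labelledHypergraph k S = exchangedHypergraph n k j (gaps n (newPlace n δ j p b)) p
        (edgesUpTo (gaps n (newPlace n δ j p b)) (j + 1) - δ) k ∧
      Exchangeable n k j (gaps n (newPlace n δ j p b)) p
        (edgesUpTo (gaps n (newPlace n δ j p b)) (j + 1) - δ) := by
  set L' := carryVector n δ (pivotGap b j p - δ) (fun i => b (j + i)) with hL'
  set L : ℕ → ℕ := fun i => if i = 0 then (1 - δ) + L' 0 else L' i with hLdef
  have hb := h.placed
  have hjk := h.lt
  have h1 := h.one_le
  have h2 := h.le
  have hd := h.gap_pos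
  have hδ := h.delta
  have hδ1 := h.delta_le
  have hgap := hb.pivotGap_eq hjk.le h1 h2
  have e1 := hb.edgesUpTo_eq (show 1 ≤ j + 1 by omega) hjk.le
  rw [Nat.add_sub_cancel] at e1
  have hiff : edgesUpTo (gaps n b) p + 2 = edgesUpTo (gaps n b) (j + 1) ↔ δ = 0 := by
    split_ifs at hδ <;> omega
  have hmain : ∀ s < k - (j + 1), kills (fun i => gaps n b (i + j + 2))
      ((n : ℤ) - edgesUpTo (gaps n b) (j + 1) - (j + 1) - 1) s =
      kills L ((n : ℤ) - edgesUpTo (gaps n b) (j + 1) - (j + 1)) s +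
      ∑ q ∈ range (edgesUpTo (gaps n b) (j + 1) - 1 - edgesUpTo (gaps n b) p - 1),
        Ring.choose ((n : ℤ) - edgesUpTo (gaps n b) (j + 1) - (j + 1) + 1 + q) s := by
    intro s hs'
    have h4 := hb.lt_of_lt (Nat.lt_succ_self j) hjk
    have h5 := (carryEq_start (c := fun i => b (j + i)) (δ := δ) (F := pivotGap b j p - δ)
      (by simp only [add_zero]; omega) (by have := h.gap_le; simp only [add_zero]; omega)).1
      (carryEq_of_le (fun i hi => hb.2 (j + i) (by omega)) hs s 0 (by omega)
        (h.carryValid hs 0 (Nat.zero_le _)))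
    rw [hgap, show (n : ℤ) - edgesUpTo (gaps n b) (j + 1) - (j + 1) = (b j : ℤ) by omega,
      hLdef, kills_add_sum hd hδ,
      show (fun q => gaps n b (q + j + 2)) = fun q => b (j + q) - b (j + (q + 1)) - 1 by
        funext q
        rw [gaps_eq, add_comm q j, add_assoc]]
    exact h5
  have hL0 : edgesUpTo (gaps n b) p + 2 = edgesUpTo (gaps n b) (j + 1) → k = j + 1 ∨ 1 ≤ L 0 := by
    intro h'
    right
    rw [hLdef, hiff.1 h']
    simp
  obtain ⟨S, hS, hlab, -⟩ := solution_of_carry h.admissible h.isPivot hL0 hmain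
  have hexch := (exchange_of_carry h.admissible h.isPivot hL0 hmain).2.2.1
  have hvec : ∀ i, 1 ≤ i → i ≤ k →
      exchangeVector j (gaps n b) p L i = gaps n (newPlace n δ j p b) i := by
    intro i hi1 hik
    rw [exchangeVector]
    by_cases hij : i ≤ j + 1
    · rw [if_pos hij, gaps, gaps, newPlace, newPlace, newPlace, if_pos (Nat.zero_le j),
        if_pos (show i - 2 ≤ j by omega), if_pos (show i - 1 ≤ j by omega)]
    · rw [if_neg hij]
      obtain ⟨q, rfl⟩ : ∃ q, i = j + q + 2 := ⟨i - (j + 2), by omega⟩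
      have := h.newPlace_succ hs (i := q) (by omega)
      rw [← hL'] at this
      rw [gaps_eq, hLdef, show j + q + 2 - (j + 2) = q by omega]
      simp only [hiff, if_true]
      rcases Nat.eq_zero_or_pos q with rfl | hq
      · split_ifs <;> omega
      · rw [if_neg (by omega), if_neg (by omega)]
        omega
  have hE : edgesUpTo (gaps n (newPlace n δ j p b)) (j + 1) - δ =
      exchangeIndex j (gaps n b) p := by
    rw [← edgesUpTo_congr (ν := exchangeVector j (gaps n b) p L) fun i h3 h4 =>
      hvec i h3 (by omega), edgesUpTo_congr (ν' := gaps n b) fun i h3 h4 => by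
        rw [exchangeVector, if_pos h4], exchangeIndex]
    split_ifs with h'
    · rw [hiff.1 h', Nat.sub_zero]
    · have := mt hiff.2 h'
      rw [show δ = 1 by omega]
  refine ⟨S, hS, ?_, ?_⟩
  · rw [hlab, hE]
    exact exchangedHypergraph_congr hjk.le hvec
  · have hE' : ∀ i ≤ k, edgesUpTo (exchangeVector j (gaps n b) p L) i =
        edgesUpTo (gaps n (newPlace n δ j p b)) i := fun i hi =>
      edgesUpTo_congr fun q h3 h4 => hvec q h3 (by omega)
    rw [hE]
    refine ⟨edgesUpTo_gaps_le (h.isPlaced_newPlace hs), hjk.le, h1, h2, ?_, ?_, ?_, ?_⟩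
    · rw [← hvec _ (by omega) hjk.le]; exact hexch.pos
    · rw [← hE' _ (by omega), ← hE' _ hjk.le]; exact hexch.two
    · rw [← hE' _ hjk.le]; exact hexch.M_le
    · rw [← hE' _ hjk.le]; exact hexch.le_M

end Pivotal

end Place

/-! ### Listing the edges of a construction -/

/-- The edges of a colex hypergraph whose vertex `v_{i+1}` has the position `b i`: a pair `(i, y)`
stands for the edge of size `i + 1` whose last vertex has the position `y`. Only positions less than
`y` and edges of size greater than `i` are listed. -/
def listing (k : ℕ) (b : ℕ → ℕ) : ℕ → ℕ → List (ℕ × ℕ)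
  | 0, _ => []
  | y + 1, i => if i < k then
      if y = b i then listing k b y (i + 1) else (i, y) :: listing k b y i
    else []

/-- The list of the vertices with the positions `b 0, …, b (i - 1)`, followed by `x`. -/
def edgeRow (b : ℕ → ℕ) (i x : ℕ) : List ℕ := (List.range i).map (fun q => b q + 1) ++ [x]

/-- The edge with the last position `y`, after the exchange in the edge of size `j + 1` that comes
immediately before `v_{j+1}`. -/
def exchangedRow (b : ℕ → ℕ) (j p w i y : ℕ) : List ℕ :=
  if y = b j + 1 then edgeRow (Function.update b (p - 1) (b j)) i w else edgeRow b i (y + 1)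

/-- The vertex `u_M` of the exchanged edge, where `M = N_{j+1} - δ`. -/
def exchangedVertex (b : ℕ → ℕ) (j p δ : ℕ) : ℕ := if δ = 0 then b j + 2 else b j + j + 3 - p

section Listing

variable {n k j p δ : ℕ} {b : ℕ → ℕ}

theorem mem_listing (hb : IsPlaced n k b) {i' y' : ℕ} (y i : ℕ)
    (h : ∀ q, i ≤ q → q < k → b q < y) : (i', y') ∈ listing k b y i ↔
      i ≤ i' ∧ i' < k ∧ y' < y ∧ b i' < y' ∧ ∀ q, i ≤ q → q < i' → y' < b q := by
  induction y generalizing i with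
  | zero => simp [listing]
  | succ y ih =>
    rw [listing]
    by_cases hi : i < k
    · rw [if_pos hi]
      have h0 := h i le_rfl hi
      by_cases hy : y = b i
      · rw [if_pos hy, ih (i + 1) fun q h1 h2 => by
          have := hb.lt_of_lt (show i < q by omega) h2; omega]
        constructor
        · rintro ⟨h1, h2, h3, h4, h5⟩
          refine ⟨by omega, h2, by omega, h4, fun q h6 h7 => ?_⟩
          rcases Nat.eq_or_lt_of_le h6 with rfl | h6
          · omega
          · exact h5 q h6 h7
        · rintro ⟨h1, h2, h3, h4, h5⟩
          have hne : i ≠ i' := by rintro rfl; omega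
          have := h5 i le_rfl (by omega)
          exact ⟨by omega, h2, by omega, h4, fun q h6 h7 => h5 q (by omega) h7⟩
      · have hlt : ∀ q, i ≤ q → q < k → b q < y := fun q h1 h2 => by
          rcases Nat.eq_or_lt_of_le h1 with rfl | h1
          · omega
          · have := hb.lt_of_lt h1 h2; omega
        rw [if_neg hy, List.mem_cons, ih i hlt, Prod.mk.injEq]
        constructor
        · rintro (⟨rfl, rfl⟩ | ⟨h1, h2, h3, h4, h5⟩)
          · exact ⟨le_rfl, hi, by omega, by omega, fun q h1 h2 => absurd h1 (by omega)⟩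
          · exact ⟨h1, h2, by omega, h4, h5⟩
        · rintro ⟨h1, h2, h3, h4, h5⟩
          by_cases hyy : y' = y
          · refine Or.inl ⟨?_, hyy⟩
            by_contra hne
            have := h5 i le_rfl (by omega)
            omega
          · exact Or.inr ⟨h1, h2, by omega, h4, h5⟩
    · rw [if_neg hi]
      simp only [List.not_mem_nil, false_iff]
      omega

theorem nodup_listing (hb : IsPlaced n k b) (y i : ℕ) (h : ∀ q, i ≤ q → q < k → b q < y) :
    (listing k b y i).Nodup := by
  induction y generalizing i with
  | zero => exact List.nodup_nil
  | succ y ih =>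
    rw [listing]
    split_ifs with hi hy
    · exact ih (i + 1) fun q h1 h2 => by
        have := hb.lt_of_lt (show i < q by omega) h2; omega
    · have hlt : ∀ q, i ≤ q → q < k → b q < y := fun q h1 h2 => by
        have := h i le_rfl hi
        rcases Nat.eq_or_lt_of_le h1 with rfl | h1
        · omega
        · have := hb.lt_of_lt h1 h2; omega
      refine List.nodup_cons.2 ⟨fun hmem => ?_, ih i hlt⟩
      have := ((mem_listing hb y i hlt).1 hmem).2.2.1
      omega
    · exact List.nodup_nil

theorem length_edgeRow {b : ℕ → ℕ} {i x : ℕ} : (edgeRow b i x).length = i + 1 := by simp [edgeRow]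

theorem length_exchangedRow {w i y : ℕ} : (exchangedRow b j p w i y).length = i + 1 := by
  rw [exchangedRow]; split_ifs <;> exact length_edgeRow

theorem mem_edgeRow {b : ℕ → ℕ} {i x y : ℕ} : y ∈ edgeRow b i x ↔ y = x ∨ ∃ q < i, y = b q + 1 := by
  simp only [edgeRow, List.mem_append, List.mem_map, List.mem_range, List.mem_singleton]
  constructor
  · rintro (⟨q, h1, h2⟩ | h)
    exacts [Or.inr ⟨q, h1, h2.symm⟩, Or.inl h]
  · rintro (h | ⟨q, h1, h2⟩)
    exacts [Or.inr h, Or.inl ⟨q, h1, h2.symm⟩]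

theorem IsPlaced.vVertex_eq (hb : IsPlaced n k b) {q : ℕ} (h1 : 1 ≤ q) (hq : q ≤ k) :
    vVertex n (gaps n b) q = b (q - 1) + 1 := by
  have := hb.edgesUpTo_eq h1 hq
  rw [vVertex]
  omega

theorem IsPlaced.hasSize_iff (hb : IsPlaced n k b) {i r : ℕ} (hi : i < k) (hr : i + r ≤ n) :
    HasSize (gaps n b) (i + 1) r ↔ n - i - r < n ∧ b i < n - i - r ∧
      ∀ q < i, n - i - r < b q := by
  have h1 := hb.edgesUpTo_eq (show 1 ≤ i + 1 by omega) hi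
  rw [Nat.add_sub_cancel] at h1
  rw [HasSize, Nat.add_sub_cancel]
  rcases i with _ | i
  · rw [edgesUpTo_zero]
    refine ⟨fun h => ⟨by omega, by omega, fun q hq => by omega⟩, fun h => ⟨by omega, ?_, by omega⟩⟩
    omega
  · have h2 := hb.edgesUpTo_eq (show 1 ≤ i + 1 by omega) hi.le
    rw [Nat.add_sub_cancel] at h2
    constructor
    · rintro ⟨-, h3, h4⟩
      refine ⟨by omega, by omega, fun q hq => ?_⟩
      rcases Nat.lt_succ_iff_lt_or_eq.1 hq with hq | rfl
      · have := hb.lt_of_lt hq (by omega); omega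
      · omega
    · rintro ⟨h3, h4, h5⟩
      have := h5 i (by omega)
      exact ⟨by omega, by omega, by omega⟩

theorem IsPlaced.mem_listing_iff (hb : IsPlaced n k b) {i y : ℕ} : (i, y) ∈ listing k b n 0 ↔
    i < k ∧ y + i ≤ n ∧ HasSize (gaps n b) (i + 1) (n - i - y) := by
  rw [mem_listing hb n 0 fun q _ hq => hb.1 q hq]
  constructor
  · rintro ⟨-, h2, h3, h4, h5⟩
    have h6 : y + i ≤ n := by
      rcases Nat.eq_zero_or_pos i with rfl | hi
      · omega
      · have := h5 0 (Nat.zero_le _) hi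
        have h7 := h5 (i - 1) (Nat.zero_le _) (by omega)
        have h8 := hb.edgesUpTo_eq hi h2.le
        omega
    refine ⟨h2, h6, (hb.hasSize_iff h2 (by omega)).2 ?_⟩
    rw [show n - i - (n - i - y) = y by omega]
    exact ⟨h3, h4, fun q hq => h5 q (Nat.zero_le _) hq⟩
  · rintro ⟨h2, h6, h7⟩
    have := (hb.hasSize_iff h2 (by omega)).1 h7
    rw [show n - i - (n - i - y) = y by omega] at this
    exact ⟨Nat.zero_le _, h2, this.1, this.2.1, fun q _ hq => this.2.2 q hq⟩

theorem IsPlaced.toFinset_edgeRow (hb : IsPlaced n k b) {i y : ℕ} (h : (i, y) ∈ listing k b n 0) :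
    (edgeRow b i (y + 1)).toFinset = colexEdge n k (gaps n b) (i + 1) (n - i - y) := by
  obtain ⟨h1, h2, h3⟩ := hb.mem_listing_iff.1 h
  have := h3.one_le
  ext x
  rw [List.mem_toFinset, mem_edgeRow, mem_colexEdge, h3.uVertex_eq h1,
    show n + 2 - (n - i - y + (i + 1)) = y + 1 by omega]
  refine or_congr_right ⟨?_, ?_⟩
  · rintro ⟨q, hq, rfl⟩
    exact ⟨q + 1, by omega, by omega, by rw [hb.vVertex_eq (by omega) (by omega)]; rfl⟩
  · rintro ⟨q, hq, hq', rfl⟩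
    exact ⟨q - 1, by omega, hb.vVertex_eq hq (by omega)⟩

/-- The label of `u_M`: in Construction B, `u_N` is next to `v_{j+1}`; in Construction A, `u_{N-1}`
lies beyond the vertices `v_{p+1}, …, v_j`, which follow each other by the maximality of `p`. -/
theorem IsPlaced.uVertex_exchanged (hb : IsPlaced n k b)
    (h : Exchangeable n k j (gaps n b) p (edgesUpTo (gaps n b) (j + 1) - δ)) (hδ : δ ≤ 1)
    (hgr : ∀ s, p < s → s ≤ j → b (s - 1) + s ≤ b j + j + 2) :
    uVertex n k (gaps n b) (edgesUpTo (gaps n b) (j + 1) - δ) = exchangedVertex b j p δ := by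
  have h1 := hb.edgesUpTo_eq (show 1 ≤ j + 1 by omega) h.lt
  have h2 := h.lt
  have h3 := h.two
  have h4 := h.le
  rw [Nat.add_sub_cancel] at h1
  rw [exchangedVertex]
  split_ifs with h0
  · subst h0
    rw [Nat.sub_zero, h.last.uVertex_eq h.lt]
    omega
  · obtain ⟨i, h5, h6, h7⟩ := h.exists_size
    have hi : i = p + 1 := by
      by_contra hne
      have h8 := hgr (p + 1) (by omega) (by omega)
      have h9 := hb.edgesUpTo_eq (show 1 ≤ p + 1 by omega) (by omega)
      have h10 := edgesUpTo_mono (gaps n b) (show p + 1 ≤ i - 1 by omega)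
      have := h7.2.1
      omega
    rw [h7.uVertex_eq (by omega)]
    omega

theorem IsPlaced.toFinset_exchangedRow (hb : IsPlaced n k b)
    (h : Exchangeable n k j (gaps n b) p (edgesUpTo (gaps n b) (j + 1) - δ)) (hδ : δ ≤ 1)
    (hgr : ∀ s, p < s → s ≤ j → b (s - 1) + s ≤ b j + j + 2) {i y : ℕ}
    (hmem : (i, y) ∈ listing k b n 0) :
    (exchangedRow b j p (exchangedVertex b j p δ) i y).toFinset =
      if n - i - y = edgesUpTo (gaps n b) (j + 1) then
        exchangedEdge n k j (gaps n b) p (edgesUpTo (gaps n b) (j + 1) - δ)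
      else colexEdge n k (gaps n b) (i + 1) (n - i - y) := by
  have hE := hb.edgesUpTo_eq (show 1 ≤ j + 1 by omega) h.lt
  rw [Nat.add_sub_cancel] at hE
  obtain ⟨h1, h2, h3⟩ := hb.mem_listing_iff.1 hmem
  have hp1 := h.one_le
  have hp2 := h.le
  have hjk := h.lt
  have hiff : y = b j + 1 ↔ n - i - y = edgesUpTo (gaps n b) (j + 1) := by
    constructor
    · rintro rfl
      have h4 := (hb.hasSize_iff h1 (by omega)).1 h3
      rw [show n - i - (n - i - (b j + 1)) = b j + 1 by omega] at h4
      have hij : i = j := by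
        rcases lt_trichotomy i j with h5 | h5 | h5
        · have := hb.lt_of_lt h5 hjk; omega
        · exact h5
        · have := h4.2.2 j h5; omega
      omega
    · intro h4
      have := (h4 ▸ h3).unique h.last
      omega
  rw [exchangedRow]
  by_cases hy : y = b j + 1
  · have hN := hiff.1 hy
    have hij : i = j := by have := (hN ▸ h3).unique h.last; omega
    rw [if_pos hy, if_pos hN]
    ext x
    rw [List.mem_toFinset, mem_edgeRow, mem_exchangedEdge, hb.uVertex_exchanged h hδ hgr]
    refine or_congr_right ⟨?_, ?_⟩
    · rintro ⟨q, hq, rfl⟩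
      by_cases hqp : q = p - 1
      · subst hqp
        exact ⟨j + 1, by omega, le_rfl, by omega, by
          rw [Function.update_self, hb.vVertex_eq (by omega) hjk]; rfl⟩
      · exact ⟨q + 1, by omega, by omega, by omega, by
          rw [Function.update_of_ne hqp, hb.vVertex_eq (by omega) (by omega)]; rfl⟩
    · rintro ⟨q, hq1, hq2, hqp, rfl⟩
      by_cases hqj : q = j + 1
      · subst hqj
        exact ⟨p - 1, by omega, by
          rw [Function.update_self, hb.vVertex_eq (by omega) hjk]; rfl⟩
      · exact ⟨q - 1, by omega, by
          rw [Function.update_of_ne (by omega), hb.vVertex_eq (by omega) (by omega)]⟩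
  · rw [if_neg hy, if_neg (mt hiff.2 hy), hb.toFinset_edgeRow hmem]

theorem Exchangeable.exchangedEdge_ne_colexEdge {ν : ℕ → ℕ} {M i r : ℕ}
    (h : Exchangeable n k j ν p M) (hs : HasSize ν i r) (hi : i ≤ k) :
    exchangedEdge n k j ν p M ≠ colexEdge n k ν i r := by
  intro heq
  have h1 := h.lt
  have h2 := h.le
  have hc := congrArg Finset.card heq
  rw [h.card_edge, card_colexEdge h.valid hs hi] at hc
  exact h.notMem_edge (heq ▸ (vVertex_mem_colexEdge h.valid hs hi h.one_le (by omega)).2 (by omega))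

/-- The rows for the positions in the listing are the edges of the hypergraph of the construction. -/
theorem IsPlaced.listsEdges (hb : IsPlaced n k b)
    (h : Exchangeable n k j (gaps n b) p (edgesUpTo (gaps n b) (j + 1) - δ)) (hδ : δ ≤ 1)
    (hgr : ∀ s, p < s → s ≤ j → b (s - 1) + s ≤ b j + j + 2) :
    ListsEdges ((listing k b n 0).map fun x =>
        exchangedRow b j p (exchangedVertex b j p δ) x.1 x.2)
      (exchangedHypergraph n k j (gaps n b) p (edgesUpTo (gaps n b) (j + 1) - δ) k) := by
  set row : ℕ × ℕ → List ℕ := fun x => exchangedRow b j p (exchangedVertex b j p δ) x.1 x.2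
  have hval := edgesUpTo_gaps_le hb
  have hrow : ∀ x ∈ listing k b n 0, (row x).toFinset =
      if n - x.1 - x.2 = edgesUpTo (gaps n b) (j + 1) then
        exchangedEdge n k j (gaps n b) p (edgesUpTo (gaps n b) (j + 1) - δ)
      else colexEdge n k (gaps n b) (x.1 + 1) (n - x.1 - x.2) := fun x hx =>
    hb.toFinset_exchangedRow h hδ hgr hx
  have hcard : ∀ x ∈ listing k b n 0, (row x).toFinset.card = x.1 + 1 := by
    intro x hx
    obtain ⟨h1, h2, h3⟩ := hb.mem_listing_iff.1 hx
    rw [hrow x hx]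
    split_ifs with hN
    · have := (hN ▸ h3).unique h.last
      rw [h.card_edge, this]
    · exact card_colexEdge hval h3 h1
  refine ⟨fun e he => ?_, ?_, ?_⟩
  · obtain ⟨x, hx, rfl⟩ := List.mem_map.1 he
    exact Multiset.toFinset_card_eq_card_iff_nodup.1
      ((hcard x hx).trans length_exchangedRow.symm : (row x : Multiset ℕ).toFinset.card = _)
  · rw [List.map_map]
    refine List.Nodup.map_on (fun x hx y hy hxy => ?_) (nodup_listing hb n 0 fun q _ hq => hb.1 q hq)
    simp only [Function.comp_apply] at hxy
    obtain ⟨h1, h2, h3⟩ := hb.mem_listing_iff.1 hx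
    obtain ⟨h1', h2', h3'⟩ := hb.mem_listing_iff.1 hy
    have hfst : x.1 = y.1 := by
      have := congrArg Finset.card hxy
      rw [hcard x hx, hcard y hy] at this
      omega
    suffices hr : n - x.1 - x.2 = n - y.1 - y.2 from Prod.ext hfst (by omega)
    rw [hrow x hx, hrow y hy] at hxy
    split_ifs at hxy with e1 e2 e2
    · rw [e1, e2]
    · exact absurd hxy (h.exchangedEdge_ne_colexEdge h3' h1')
    · exact absurd hxy.symm (h.exchangedEdge_ne_colexEdge h3 h1)
    · refine ((uVertex_mem_colexEdge hval h3' h1' h3 h1).1 ?_)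
      rw [← hxy]
      exact mem_colexEdge.2 (Or.inl rfl)
  · ext e
    rw [List.mem_toFinset, List.mem_map, h.mem_hypergraph]
    constructor
    · rintro ⟨l, hl, rfl⟩
      obtain ⟨x, hx, rfl⟩ := List.mem_map.1 hl
      obtain ⟨h1, h2, h3⟩ := hb.mem_listing_iff.1 hx
      rw [hrow x hx]
      split_ifs with hN
      · exact Or.inl rfl
      · exact Or.inr ⟨_, _, h1, h3, hN, rfl⟩
    · have key : ∀ i r, i < k → HasSize (gaps n b) (i + 1) r →
          (i, n - i - r) ∈ listing k b n 0 ∧ n - i - (n - i - r) = r := by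
        intro i r hi hs
        have h4 := hs.2.2.trans (edgesUpTo_mono (gaps n b) hi)
        have h5 := add_le_of_le hval (show i + 1 ≤ k from hi)
        have h6 := hs.2.2
        have h7 : n - i - (n - i - r) = r := by omega
        exact ⟨hb.mem_listing_iff.2 ⟨hi, by omega, h7.symm ▸ hs⟩, h7⟩
      rintro (rfl | ⟨i, r, hi, hs, hr, rfl⟩)
      · obtain ⟨h4, h5⟩ := key j _ h.lt h.last
        refine ⟨_, List.mem_map_of_mem h4, ?_⟩
        rw [hrow _ h4, if_pos h5]
      · obtain ⟨i, rfl⟩ : ∃ i', i = i' + 1 := ⟨i - 1, by have := hs.1; omega⟩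
        obtain ⟨h4, h5⟩ := key i r hi hs
        refine ⟨_, List.mem_map_of_mem h4, ?_⟩
        rw [hrow _ h4, h5, if_neg hr]

end Listing

/-! ### Running time of programs -/

/-- The program halts within `T` steps, in a configuration with the property `Q`. -/
def Ends (W : ℕ) (c : Prog) (T : ℕ) (Q : Config → Prop) (s : Config) : Prop :=
  ∃ T' s', T' ≤ T ∧ Exec W c s T' s' ∧ Q s'

/-- The configuration with the value `v` placed in the memory cell `a`. -/
def Config.setMem (s : Config) (a v : ℕ) : Config := { s with mem := Function.update s.mem a v }

/-- The configuration after `v` has been written. -/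
def Config.emit (s : Config) (v : ℕ) : Config := { s with out := s.out ++ [v] }

/-- The configurations agree in the registers with numbers less than `N`. -/
def Config.Same (N : ℕ) (s s' : Config) : Prop := ∀ r < N, s'.reg r = s.reg r

namespace Config

variable (s s₀ : Config) (x v r N : ℕ)

@[simp] theorem reg_setReg : (s.setReg x v).reg r = if r = x then v else s.reg r :=
  Function.update_apply ..

@[simp] theorem mem_setReg : (s.setReg x v).mem = s.mem := rfl

@[simp] theorem out_setReg : (s.setReg x v).out = s.out := rfl

@[simp] theorem reg_setMem : (s.setMem x v).reg = s.reg := rfl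

@[simp] theorem mem_setMem : (s.setMem x v).mem r = if r = x then v else s.mem r :=
  Function.update_apply ..

@[simp] theorem out_setMem : (s.setMem x v).out = s.out := rfl

@[simp] theorem reg_emit : (s.emit v).reg = s.reg := rfl

@[simp] theorem mem_emit : (s.emit v).mem = s.mem := rfl

@[simp] theorem out_emit : (s.emit v).out = s.out ++ [v] := rfl

@[simp] theorem same_self : Same N s s := fun _ _ => rfl

variable {s s₀ x v N}

@[simp] theorem same_setReg (h : N ≤ x) : Same N s₀ (s.setReg x v) ↔ Same N s₀ s := by
  refine forall₂_congr fun r hr => ?_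
  rw [reg_setReg, if_neg (by omega)]

@[simp] theorem same_setMem : Same N s₀ (s.setMem x v) ↔ Same N s₀ s := Iff.rfl

@[simp] theorem same_emit : Same N s₀ (s.emit v) ↔ Same N s₀ s := Iff.rfl

theorem Same.trans {M N' : ℕ} {s₁ s₂ s₃ : Config} (h : Same N s₁ s₂) (h' : Same N' s₂ s₃)
    (hN : M ≤ N) (hN' : M ≤ N') : Same M s₁ s₃ := fun r hr =>
  (h' r (hr.trans_le hN')).trans (h r (hr.trans_le hN))

end Config

namespace Prog

/-- The weakest precondition for a program without loops to establish `Q`, without a number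
exceeding `W`. -/
@[simp] def wp (W : ℕ) : Prog → (Config → Prop) → Config → Prop
  | const x c, Q, s => c ≤ W ∧ Q (s.setReg x c)
  | plus x y z, Q, s => s.reg y + s.reg z ≤ W ∧ Q (s.setReg x (s.reg y + s.reg z))
  | minus x y z, Q, s => Q (s.setReg x (s.reg y - s.reg z))
  | load x y, Q, s => Q (s.setReg x (s.mem (s.reg y)))
  | store x y, Q, s => Q (s.setMem (s.reg x) (s.reg y))
  | write x, Q, s => Q (s.emit (s.reg x))
  | seq c d, Q, s => c.wp W (d.wp W Q) s
  | cond x c d, Q, s => (s.reg x = 0 → d.wp W Q s) ∧ (s.reg x ≠ 0 → c.wp W Q s)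
  | loop _ _, _, _ => False

/-- A bound for the running time of a program without loops. -/
@[simp] def cost : Prog → ℕ
  | seq c d => c.cost + d.cost
  | cond _ c d => c.cost + d.cost + 1
  | _ => 1

/-- The programs of the list, one after the other. -/
@[simp] def block : List Prog → Prog
  | [] => const 0 0
  | [c] => c
  | c :: d :: l => seq c (block (d :: l))

/-- Puts `1` into register `x` if the content of `y` is strictly between those of `a` and `b`, and
`0` otherwise. -/
def test (x a b y : ℕ) : Prog :=
  seq (minus x y a) (cond x (seq (minus x b y) (cond x (const x 1) (minus x x x))) (minus x x x))

@[simp] theorem cost_test {x a b y : ℕ} : (test x a b y).cost = 7 := rfl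

theorem wp_test {W x a b y : ℕ} {Q : Config → Prop} {s : Config} (hW : 1 ≤ W) (hb : b ≠ x)
    (hy : y ≠ x) : (test x a b y).wp W Q s ↔
      Q (s.setReg x (between (s.reg a) (s.reg b) (s.reg y))) := by
  have hset : ∀ u v, (s.setReg x u).setReg x v = s.setReg x v := fun u v => by
    simp [Config.setReg, Function.update_idem]
  simp only [test, wp, Config.reg_setReg, if_neg hb, if_neg hy, if_true, Nat.sub_self, hset, hW,
    true_and, between]
  by_cases h1 : s.reg y - s.reg a = 0
  · simp only [h1, true_imp_iff, ne_eq, not_true, false_imp_iff, and_true,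
      if_neg (show ¬ (s.reg a < s.reg y ∧ s.reg y < s.reg b) by omega)]
  · by_cases h2 : s.reg b - s.reg y = 0
    · simp only [h1, h2, false_imp_iff, true_imp_iff, ne_eq, not_true, not_false_eq_true, and_true,
        true_and, if_neg (show ¬ (s.reg a < s.reg y ∧ s.reg y < s.reg b) by omega)]
    · simp only [h1, h2, false_imp_iff, true_imp_iff, ne_eq, not_false_eq_true,
        true_and, if_pos (show s.reg a < s.reg y ∧ s.reg y < s.reg b by omega)]

end Prog

theorem Ends.mono {W T T' : ℕ} {c : Prog} {Q Q' : Config → Prop} {s : Config} (h : Ends W c T Q s)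
    (hT : T ≤ T') (hQ : ∀ s', Q s' → Q' s') : Ends W c T' Q' s := by
  obtain ⟨T₀, s', h1, h2, h3⟩ := h
  exact ⟨T₀, s', h1.trans hT, h2, hQ s' h3⟩

theorem Ends.le {W T T' : ℕ} {c : Prog} {Q : Config → Prop} {s : Config} (h : Ends W c T Q s)
    (hT : T ≤ T') : Ends W c T' Q s :=
  h.mono hT fun _ h => h

theorem ends_of_wp {W : ℕ} {c : Prog} {Q : Config → Prop} {s : Config} (h : c.wp W Q s) :
    Ends W c c.cost Q s := by
  induction c generalizing s Q with
  | const x c => exact ⟨1, _, le_rfl, .const h.1, h.2⟩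
  | plus x y z => exact ⟨1, _, le_rfl, .plus h.1, h.2⟩
  | minus x y z => exact ⟨1, _, le_rfl, .minus, h⟩
  | load x y => exact ⟨1, _, le_rfl, .load, h⟩
  | store x y => exact ⟨1, _, le_rfl, .store, h⟩
  | write x => exact ⟨1, _, le_rfl, .write, h⟩
  | seq c d ihc ihd =>
    obtain ⟨T, s₁, hT, h1, h2⟩ := ihc h
    obtain ⟨T', s₂, hT', h3, h4⟩ := ihd h2
    exact ⟨T + T', s₂, Nat.add_le_add hT hT', .seq h1 h3, h4⟩
  | cond x c d ihc ihd =>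
    by_cases hx : s.reg x = 0
    · obtain ⟨T, s₁, hT, h1, h2⟩ := ihd (h.1 hx)
      exact ⟨T + 1, s₁, by rw [Prog.cost]; omega, .condFalse hx h1, h2⟩
    · obtain ⟨T, s₁, hT, h1, h2⟩ := ihc (h.2 hx)
      exact ⟨T + 1, s₁, by rw [Prog.cost]; omega, .condTrue hx h1, h2⟩
  | loop x c => exact h.elim

theorem Ends.seq {W T T' : ℕ} {c d : Prog} {R Q : Config → Prop} {s : Config} (h : Ends W c T R s)
    (h' : ∀ s', R s' → Ends W d T' Q s') : Ends W (.seq c d) (T + T') Q s := by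
  obtain ⟨T₁, s₁, h1, h2, h3⟩ := h
  obtain ⟨T₂, s₂, h4, h5, h6⟩ := h' s₁ h3
  exact ⟨T₁ + T₂, s₂, Nat.add_le_add h1 h4, .seq h2 h5, h6⟩

/-- First a program without loops, then another program. -/
theorem Ends.step {W T : ℕ} {c d : Prog} {Q : Config → Prop} {s : Config} (R : Config → Prop)
    (h : c.wp W R s) (h' : ∀ s', R s' → Ends W d T Q s') : Ends W (.seq c d) (c.cost + T) Q s :=
  (ends_of_wp h).seq h'

theorem Ends.cond {W T : ℕ} {x : ℕ} {c d : Prog} {Q : Config → Prop} {s : Config}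
    (h0 : s.reg x = 0 → Ends W d T Q s) (h1 : s.reg x ≠ 0 → Ends W c T Q s) :
    Ends W (.cond x c d) (T + 1) Q s := by
  by_cases hx : s.reg x = 0
  · obtain ⟨T', s', h2, h3, h4⟩ := h0 hx
    exact ⟨T' + 1, s', by omega, .condFalse hx h3, h4⟩
  · obtain ⟨T', s', h2, h3, h4⟩ := h1 hx
    exact ⟨T' + 1, s', by omega, .condTrue hx h3, h4⟩

/-- A loop with the invariant `I`, whose body takes `B` steps and decreases `μ`. -/
theorem Ends.loop {W B x : ℕ} {c : Prog} (I : Config → Prop) (μ : Config → ℕ)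
    (h : ∀ s, I s → s.reg x ≠ 0 → Ends W c B (fun s' => I s' ∧ μ s' < μ s) s) {s : Config}
    (hs : I s) : Ends W (.loop x c) (μ s * (B + 1) + 1) (fun s' => I s' ∧ s'.reg x = 0) s := by
  induction hm : μ s using Nat.strong_induction_on generalizing s with
  | _ m ih =>
    by_cases hx : s.reg x = 0
    · exact ⟨1, s, by omega, .loopDone hx, hs, hx⟩
    · obtain ⟨T, s', h1, h2, h3, h4⟩ := h s hs hx
      obtain ⟨T', s'', h5, h6, h7⟩ := ih (μ s') (by omega) h3 rfl
      refine ⟨T + T' + 1, s'', ?_, .loopStep hx h2 h6, h7⟩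
      have : (μ s' + 1) * (B + 1) ≤ m * (B + 1) := Nat.mul_le_mul_right _ (by omega)
      rw [Nat.add_mul, one_mul] at this
      omega

/-! ### Writing the edges -/

/-- Writes the numbers `mem[a] + 1, mem[a + 1] + 1, …`, where `a` is the content of register `20`.
Their number is the content of register `21`. -/
def writeVertices : Prog := .loop 21 <| .block
  [.load 22 20, .plus 22 22 1, .write 22, .plus 20 20 1, .minus 21 21 1]

theorem ends_writeVertices {W : ℕ} {s : Config} (h1 : s.reg 1 = 1) (ha : s.reg 20 + s.reg 21 ≤ W)
    (hm : ∀ q < s.reg 21, s.mem (s.reg 20 + q) + 1 ≤ W) :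
    Ends W writeVertices (s.reg 21 * 6 + 1) (fun s' => s.Same 20 s' ∧ s'.mem = s.mem ∧
      s'.out = s.out ++ (List.range (s.reg 21)).map fun q => s.mem (s.reg 20 + q) + 1) s := by
  refine (Ends.loop (B := 5) (fun s' => s.Same 20 s' ∧ s'.mem = s.mem ∧
    s'.reg 20 + s'.reg 21 = s.reg 20 + s.reg 21 ∧ s.reg 20 ≤ s'.reg 20 ∧
    s'.out = s.out ++ (List.range (s'.reg 20 - s.reg 20)).map fun q => s.mem (s.reg 20 + q) + 1)
    (fun s' => s'.reg 21) ?_ ⟨fun _ _ => rfl, rfl, rfl, le_rfl, by simp⟩).mono le_rfl ?_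
  · rintro s' ⟨hr, hmem, hsum, hle, hout⟩ hx
    have e1 := hr 1 (by norm_num)
    have hcell : s'.mem (s'.reg 20) = s.mem (s.reg 20 + (s'.reg 20 - s.reg 20)) := by
      rw [hmem, Nat.add_sub_cancel' hle]
    have hb := hm (s'.reg 20 - s.reg 20) (by omega)
    refine ends_of_wp ?_
    simp [e1, h1, hr, hcell, hmem, hout]
    rw [show s'.reg 20 + 1 - s.reg 20 = s'.reg 20 - s.reg 20 + 1 by omega, List.range_succ]
    simp
    omega
  · rintro s' ⟨⟨hr, hmem, hsum, -, hout⟩, hx⟩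
    refine ⟨hr, hmem, ?_⟩
    rw [hout, show s'.reg 20 - s.reg 20 = s.reg 21 by omega]

/-- Writes one edge. The registers hold, from `10` to `14`, the position of `v_{j+1}`, the vertex
`u_M`, the address of the position of `v_p`, the position of the last vertex of the edge, and the
size of the edge minus one. -/
def writeRow : Prog :=
  .seq (.block [.plus 18 13 1, .load 19 12, .plus 16 10 1, .minus 17 13 16, .minus 16 16 13,
    .plus 17 17 16, .cond 17 (.minus 17 17 17) (.seq (.plus 18 11 0) (.store 12 10)),
    .plus 16 14 1, .write 16, .plus 20 5 0, .plus 21 14 0])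
  (.seq writeVertices (.block [.write 18, .store 12 19]))

/-- Writes all edges. The positions of the last vertices are visited in decreasing order. -/
def writeEdges : Prog := .loop 13 <| .seq (.block [.minus 13 13 1, .minus 15 3 14]) <|
  .cond 15 (.seq (.block [.plus 16 5 14, .load 16 16, .minus 17 13 16])
    (.cond 17 writeRow (.plus 14 14 1))) (.minus 15 15 15)

section Write

variable {W n k j p w : ℕ} {b : ℕ → ℕ} {s : Config}

theorem ends_writeRow (h0 : s.reg 0 = 0) (h1 : s.reg 1 = 1) (hmem : ∀ q < k, s.mem (s.reg 5 + q) = b q)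
    (hp1 : 1 ≤ p) (hp : p ≤ k) (h10 : s.reg 10 = b j) (h11 : s.reg 11 = w)
    (h12 : s.reg 12 = s.reg 5 + (p - 1)) (hb : ∀ q < k, b q < n) (hj : j < k) (hy : s.reg 13 < n)
    (hi : s.reg 14 < k) (hw : w ≤ W) (hW : s.reg 5 + 2 * (n + k) ≤ W) :
    Ends W writeRow (k * 6 + 20) (fun s' => (∀ r < 15, s'.reg r = s.reg r) ∧ s'.mem = s.mem ∧
      s'.out = s.out ++ (exchangedRow b j p w (s.reg 14) (s.reg 13)).length ::
        exchangedRow b j p w (s.reg 14) (s.reg 13)) s := by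
  have hbj := hb j hj
  set z := if s.reg 13 = b j + 1 then w else s.reg 13 + 1 with hz
  set b' := if s.reg 13 = b j + 1 then Function.update b (p - 1) (b j) else b with hb'
  have hrow : exchangedRow b j p w (s.reg 14) (s.reg 13) = edgeRow b' (s.reg 14) z := by
    rw [exchangedRow, hz, hb']; split_ifs <;> rfl
  rw [length_exchangedRow, hrow]
  have hpb := hmem (p - 1) (by omega)
  refine (Ends.step (fun s₁ => s.Same 15 s₁ ∧ s₁.reg 18 = z ∧ s₁.reg 19 = b (p - 1) ∧
    s₁.reg 20 = s.reg 5 ∧ s₁.reg 21 = s.reg 14 ∧ (∀ q < k, s₁.mem (s.reg 5 + q) = b' q) ∧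
    (∀ a, (if a = s.reg 5 + (p - 1) then b (p - 1) else s₁.mem a) = s.mem a) ∧
    s₁.out = s.out ++ [s.reg 14 + 1]) ?_ fun s₁ h => ?_).mono (T := _ + (((k - 1) * 6 + 1) + 2)) ?_
      fun _ h => h
  · have hres : ∀ a, (if a = s.reg 5 + (p - 1) then b (p - 1) else s.mem a) = s.mem a := by
      intro a
      split_ifs with ha
      · rw [ha, hpb]
      · rfl
    by_cases hsp : s.reg 13 = b j + 1
    · simp [h0, h1, h10, h11, h12, hsp, hz, hb', hpb]
      refine ⟨by omega, by omega, by omega, by omega, by omega, by omega, fun q hq => ?_, fun a => ?_⟩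
      · rw [Function.update_apply, hmem q hq]
      · rw [← hres a]
        split_ifs <;> rfl
    · simp [h0, h1, h10, h11, h12, hsp, hz, hb', hpb, hres]
      exact ⟨by omega, by omega, by omega, fun _ _ => by omega,
        fun _ => ⟨by omega, by omega, by omega, hmem⟩⟩
  · obtain ⟨hsame, h18, h19, h20, h21, hm, hres, hout⟩ := h
    have hbb : ∀ q < k, b' q < n := fun q hq => by
      rw [hb']
      split_ifs
      · rw [Function.update_apply]; split_ifs; exacts [hbj, hb q hq]
      · exact hb q hq
    refine ((ends_writeVertices ((hsame 1 (by norm_num)).trans h1) (by omega) fun q hq => ?_).mono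
      (by omega) fun _ h => h).seq fun s₂ h => ends_of_wp ?_
    · have := hbb q (by omega)
      rw [h20, hm q (by omega)]
      omega
    · obtain ⟨hsame₂, hmem₂, hout₂⟩ := h
      have e12 := hsame₂ 12 (by norm_num)
      have e18 := hsame₂ 18 (by norm_num)
      have e19 := hsame₂ 19 (by norm_num)
      rw [hsame 12 (by norm_num), h12] at e12
      simp
      refine ⟨hsame.trans hsame₂ le_rfl (by norm_num), ?_, ?_⟩
      · funext a
        simp [e12, e19, h19, hmem₂, hres]
      · rw [hout₂, hout, h20, h21, e18, h18, edgeRow]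
        have : (List.range (s.reg 14)).map (fun q => s₁.mem (s.reg 5 + q) + 1) =
            (List.range (s.reg 14)).map fun q => b' q + 1 :=
          List.map_congr_left fun q hq => by
            rw [hm q ((List.mem_range.1 hq).trans hi)]
        rw [this]
        simp
  · simp
    omega

/-- The output for a list of edges. -/
def written (L : List (List ℕ)) : List ℕ := L.flatMap fun e => e.length :: e

theorem ends_writeEdges (h0 : s.reg 0 = 0) (h1 : s.reg 1 = 1) (h3 : s.reg 3 = k)
    (hmem : ∀ q < k, s.mem (s.reg 5 + q) = b q) (hp1 : 1 ≤ p) (hp : p ≤ k) (h10 : s.reg 10 = b j)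
    (h11 : s.reg 11 = w) (h12 : s.reg 12 = s.reg 5 + (p - 1)) (h13 : s.reg 13 = n)
    (h14 : s.reg 14 = 0) (hb : IsPlaced n k b) (hj : j < k) (hw : w ≤ W)
    (hW : s.reg 5 + 2 * (n + k) ≤ W) :
    Ends W writeEdges (n * (k * 6 + 28) + 1) (fun s' => s'.out = s.out ++
      written ((listing k b n 0).map fun x => exchangedRow b j p w x.1 x.2)) s := by
  set row : ℕ × ℕ → List ℕ := fun x => exchangedRow b j p w x.1 x.2
  refine ((Ends.loop (B := k * 6 + 27) (fun s' => s.Same 13 s' ∧ s'.mem = s.mem ∧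
    s'.reg 13 ≤ n ∧ (∀ q, s'.reg 14 ≤ q → q < k → b q < s'.reg 13) ∧
    s'.out ++ written ((listing k b (s'.reg 13) (s'.reg 14)).map row) =
      s.out ++ written ((listing k b n 0).map row)) (fun s' => s'.reg 13) ?_ ?_).mono
      ?_ ?_)
  · rintro s' ⟨hsame, hm, hle, hlt, hout⟩ hy
    have e0 := hsame 0 (by norm_num)
    have e1 := hsame 1 (by norm_num)
    have e3 := hsame 3 (by norm_num)
    have e5 := hsame 5 (by norm_num)
    obtain ⟨y, hy'⟩ : ∃ y, s'.reg 13 = y + 1 := ⟨s'.reg 13 - 1, by omega⟩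
    have hlist : listing k b (s'.reg 13) (s'.reg 14) = if s'.reg 14 < k then
        if y = b (s'.reg 14) then listing k b y (s'.reg 14 + 1) else
          (s'.reg 14, y) :: listing k b y (s'.reg 14) else [] := by rw [hy', listing]
    refine Ends.le (Ends.step (fun s₁ => s.Same 13 s₁ ∧ s₁.mem = s.mem ∧ s₁.reg 13 = y ∧
      s₁.reg 14 = s'.reg 14 ∧ s₁.reg 15 = k - s'.reg 14 ∧ s₁.out = s'.out) ?_ fun s₁ h =>
        Ends.cond (T := k * 6 + 24) (fun hik => ?_) fun hik => ?_) (by simp; omega)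
    · simp [hsame, hm, e1, h1, hy', e3, h3]
    all_goals
      obtain ⟨hsame₁, hm₁, h13₁, h14₁, h15₁, hout₁⟩ := h
      have e0 := hsame₁ 0 (by norm_num)
      have e1 := hsame₁ 1 (by norm_num)
      have e5 := hsame₁ 5 (by norm_num)
      rw [h15₁] at hik
    · rw [if_neg (by omega)] at hlist
      refine (ends_of_wp ?_).le (by simp)
      simp [hsame₁, hm₁, h13₁, h14₁, hout₁, hy']
      refine ⟨by omega, fun q h4 h5 => absurd h5 (by omega), ?_⟩
      rw [← hout, hlist]
      cases y <;> simp [listing, written]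
      omega
    · rw [if_pos (by omega)] at hlist
      have hbi := hlt _ le_rfl (show s'.reg 14 < k by omega)
      have hcell := hmem (s'.reg 14) (by omega)
      refine Ends.le (Ends.step (fun s₂ => s.Same 13 s₂ ∧ s₂.mem = s.mem ∧ s₂.reg 13 = y ∧
        s₂.reg 14 = s'.reg 14 ∧ s₂.reg 17 = y - b (s'.reg 14) ∧ s₂.out = s'.out) ?_ fun s₂ h =>
          Ends.cond (T := k * 6 + 20) (fun hyb => ?_) fun hyb => ?_) (by simp; omega)
      · simp [hsame₁, hm₁, h13₁, h14₁, hout₁, e5, hcell]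
        omega
      all_goals
        obtain ⟨hsame₂, hm₂, h13₂, h14₂, h17₂, hout₂⟩ := h
        have e0 := hsame₂ 0 (by norm_num)
        have e1 := hsame₂ 1 (by norm_num)
        have e5 := hsame₂ 5 (by norm_num)
        rw [h17₂] at hyb
      · rw [if_pos (by omega)] at hlist
        refine (ends_of_wp ?_).le (by simp)
        simp [hsame₂, hm₂, h13₂, h14₂, hout₂, hy', e1, h1]
        refine ⟨by omega, by omega, fun q h4 h5 => ?_, ?_⟩
        · have := hb.lt_of_lt (show s'.reg 14 < q by omega) h5
          omega
        · rw [← hout, hlist]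
      · rw [if_neg (by omega)] at hlist
        refine (ends_writeRow (e0.trans h0) (e1.trans h1) (by rw [e5, hm₂]; exact hmem) hp1 hp
          ((hsame₂ 10 (by norm_num)).trans h10) ((hsame₂ 11 (by norm_num)).trans h11)
          (by rw [hsame₂ 12 (by norm_num), h12, e5]) hb.1 hj (by omega) (by omega) hw
          (by rw [e5]; exact hW)).mono le_rfl ?_
        rintro s₃ ⟨hsame₃, hm₃, hout₃⟩
        have e13 := hsame₃ 13 (by norm_num)
        have e14 := hsame₃ 14 (by norm_num)
        refine ⟨⟨hsame₂.trans hsame₃ le_rfl (by norm_num), hm₃.trans hm₂, by omega,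
          fun q h4 h5 => ?_, ?_⟩, by omega⟩
        · rcases Nat.eq_or_lt_of_le h4 with h6 | h6
          · rw [← h6, e13, e14, h13₂, h14₂]; omega
          · have := hb.lt_of_lt (show s'.reg 14 < q by omega) h5
            omega
        · rw [← hout, hlist, hout₃, hout₂, e13, e14, h13₂, h14₂]
          simp [written, row]
  · exact ⟨by simp, rfl, h13.le, fun q _ h5 => h13 ▸ hb.1 q h5, by rw [h13, h14]⟩
  · simp only [h13]
    exact le_rfl
  · rintro s' ⟨⟨-, -, -, -, hout⟩, hx⟩
    rw [← hout, hx, listing]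
    simp [written]

end Write

/-! ### The program for the carry condition -/

/-- One level of the decision procedure. Register `21` holds the excess above the position in
register `20`, and register `22` the sum of the new multiplicities. -/
def carryLevel : Prog := .loop 20 <| .block
  [.minus 20 20 1, .plus 23 6 20, .load 24 23, .store 23 21, .plus 22 22 21, .plus 21 21 24,
    .test 25 26 27 20, .plus 21 21 25, .test 25 18 14 20, .minus 21 21 25]

section Carry

variable {W n : ℕ} {s : Config}

theorem ends_carryLevel {Y f g : ℕ → ℕ} (h20 : s.reg 20 = n) (h1 : s.reg 1 = 1)
    (h21 : s.reg 21 = 0) (h22 : s.reg 22 = 0) (hY : ∀ y < n, s.mem (s.reg 6 + y) = Y y)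
    (hf : f = fun y => Y y + between (s.reg 26) (s.reg 27) y)
    (hg : g = between (s.reg 18) (s.reg 14))
    (hdom : ∀ l, ∑ y ∈ Ioo l n, g y ≤ ∑ y ∈ Ioo l n, f y) (hsum : ∑ y ∈ range n, f y ≤ n)
    (hW : s.reg 6 + n + n * n + 1 ≤ W) :
    Ends W carryLevel (n * 24 + 1) (fun s' => s.Same 20 s' ∧ s'.out = s.out ∧
      s'.reg 22 = ∑ l ∈ range n, carryDown n f g l ∧ s'.reg 22 ≤ n * n ∧
      ∀ a, s'.mem a = if s.reg 6 ≤ a ∧ a < s.reg 6 + n then carryDown n f g (a - s.reg 6)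
        else s.mem a) s := by
  have hIoo : ∀ y, Ioo y n = Ico (y + 1) n := fun y => by ext; simp
  have hfle : ∀ y, ∑ l ∈ Ico y n, f l ≤ n := fun y =>
    (sum_le_sum_of_subset fun l hl => mem_range.2 (mem_Ico.1 hl).2).trans hsum
  have hdown : ∀ y, ∑ l ∈ Ico y n, carryDown n f g l ≤ n * n := fun y => by
    refine (sum_le_card_nsmul _ _ n fun l _ => ?_).trans ?_
    · rw [carryDown, hIoo]
      exact (Nat.sub_le _ _).trans (hfle _)
    · rw [smul_eq_mul, Nat.card_Ico]
      exact Nat.mul_le_mul_right _ (Nat.sub_le _ _)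
  -- the positions are visited in decreasing order; register `21` accumulates the excess, which is the
  -- value that belongs into the cell before the current position is added
  refine ((Ends.loop (B := 23) (fun s' => s.Same 20 s' ∧ s'.out = s.out ∧ s'.reg 26 = s.reg 26 ∧
    s'.reg 27 = s.reg 27 ∧ s'.reg 20 ≤ n ∧
    s'.reg 21 = ∑ y ∈ Ico (s'.reg 20) n, f y - ∑ y ∈ Ico (s'.reg 20) n, g y ∧
    s'.reg 22 = ∑ l ∈ Ico (s'.reg 20) n, carryDown n f g l ∧
    ∀ a, s'.mem a = if s.reg 6 + s'.reg 20 ≤ a ∧ a < s.reg 6 + n then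
      carryDown n f g (a - s.reg 6) else s.mem a) (fun s' => s'.reg 20) ?_ ?_).mono
      ?_ ?_)
  · rintro s' ⟨hsame, ho, h26, h27, hle, hacc, hF, hm⟩ hx
    obtain ⟨y, hy⟩ : ∃ y, s'.reg 20 = y + 1 := ⟨s'.reg 20 - 1, by omega⟩
    have e1 := hsame 1 (by norm_num)
    have e6 := hsame 6 (by norm_num)
    have e14 := hsame 14 (by norm_num)
    have e18 := hsame 18 (by norm_num)
    rw [hy] at hacc hF hm
    have hYy : s'.mem (s.reg 6 + y) = Y y := by rw [hm, if_neg (by omega), hY y (by omega)]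
    have hcd : s'.reg 21 = carryDown n f g y := by rw [hacc, carryDown, hIoo]
    have hIco : ∀ w : ℕ → ℕ, ∑ l ∈ Ico y n, w l = w y + ∑ l ∈ Ico (y + 1) n, w l := fun w =>
      sum_eq_sum_Ico_succ_bot (by omega) w
    have h3 := hdom y
    have h4 := hfle y
    have h5 := hdown y
    rw [hIoo] at h3
    rw [hIco] at h4 h5
    have hfy : f y = Y y + between (s.reg 26) (s.reg 27) y := by rw [hf]
    have hgy : g y = between (s.reg 18) (s.reg 14) y := by rw [hg]
    refine (ends_of_wp ?_).le (by simp)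
    simp [Prog.wp_test (show 1 ≤ W by omega), hsame, ho, e1, h1, e6, hy, hYy, h26, h27, e14, e18]
    rw [hIco, hIco, hIco, hF, hcd, hfy, hgy]
    rw [hfy] at h4
    refine ⟨by omega, by omega, by omega, by omega, by omega, ?_, by omega, fun a => ?_⟩
    · rw [← hcd, hacc]
      omega
    · rw [hm]
      by_cases ha : a = s.reg 6 + y
      · rw [if_pos ha, if_pos (by omega), ha, Nat.add_sub_cancel_left]
      · rw [if_neg ha]
        exact if_congr (by omega) rfl rfl
  · refine ⟨by simp, rfl, rfl, rfl, h20.le, by simp [h20, h21], by simp [h20, h22], fun a => ?_⟩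
    rw [if_neg (by omega)]
  · simp only [h20]
    exact le_rfl
  · rintro s' ⟨⟨hsame, ho, -, -, -, -, hF, hm⟩, hx⟩
    rw [hx] at hF hm
    have := hF ▸ hdown 0
    rw [← range_eq_Ico] at hF
    exact ⟨hsame, ho, hF, this, hm⟩

/-- The decision procedure. The registers hold, from `12` to `17`, the number of levels left over,
the address of the position of the next vertex, the position of the current vertex before and after
the exchange, the number of required edges, and `1` as long as no level has failed. -/
def carryLoop : Prog := .loop 12 <|
  .seq (.block [.load 18 13, .minus 19 14 18, .minus 20 19 16]) <|
  .cond 20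
    (.seq (.block [.minus 19 15 20, .store 13 19, .plus 26 19 9, .plus 27 15 9, .plus 20 2 0,
      .plus 21 0 0, .plus 22 0 0]) <|
    .seq carryLevel <| .block [.plus 14 18 0, .plus 15 19 0, .plus 16 22 0, .plus 13 13 1,
      .minus 12 12 1])
    (.block [.plus 12 0 0, .plus 17 0 0])

theorem ends_carryLoop {k j p δ : ℕ} {b : ℕ → ℕ} (h : Pivotal n k j p δ b) (h0 : s.reg 0 = 0)
    (h1 : s.reg 1 = 1) (h2 : s.reg 2 = n) (h6 : s.reg 6 = s.reg 5 + k) (h9 : s.reg 9 = δ)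
    (h12 : s.reg 12 = k - (j + 1)) (h13 : s.reg 13 = s.reg 5 + j + 1) (h14 : s.reg 14 = b j)
    (h15 : s.reg 15 = b j)
    (h16 : s.reg 16 = carryLoad n δ (pivotGap b j p - δ) (fun i => b (j + i)) 0)
    (h17 : s.reg 17 = 1) (hb : ∀ q < k, s.mem (s.reg 5 + q) = b q)
    (hY : ∀ y < n, s.mem (s.reg 6 + y) =
      (carryState n δ (pivotGap b j p - δ) (fun i => b (j + i)) 0).2 y)
    (hW : s.reg 5 + k + n + n * n + 1 ≤ W) :
    Ends W carryLoop (k * (n * 24 + 18) + 1) (fun s' => s.Same 12 s' ∧ s'.out = s.out ∧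
      (s'.reg 17 = 0 ∧ ¬ Pivotal.Succeeds n k j p δ b ∨ s'.reg 17 = 1 ∧
        Pivotal.Succeeds n k j p δ b ∧
        ∀ q < k, s'.mem (s.reg 5 + q) = newPlace n δ j p b q)) s := by
  set c : ℕ → ℕ := fun i => b (j + i) with hc
  set F := pivotGap b j p - δ with hF
  have hjk := h.lt
  refine ((Ends.loop (B := n * 24 + 17) (fun s' => s.Same 12 s' ∧ s'.out = s.out ∧
    (s'.reg 17 = 0 ∧ s'.reg 12 = 0 ∧ ¬ Pivotal.Succeeds n k j p δ b ∨ s'.reg 17 = 1 ∧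
      ∃ i ≤ k - (j + 1), s'.reg 12 = k - (j + 1) - i ∧ s'.reg 13 = s.reg 5 + j + i + 1 ∧
      s'.reg 14 = c i ∧ s'.reg 15 = (carryState n δ F c i).1 ∧ s'.reg 16 = carryLoad n δ F c i ∧
      (∀ q < k, s'.mem (s.reg 5 + q) = if q ≤ j + i then newPlace n δ j p b q else b q) ∧
      (∀ y < n, s'.mem (s.reg 6 + y) = (carryState n δ F c i).2 y) ∧ CarryValid n δ F c i ∧
      ∀ i' < i, carryLoad n δ F c i' ≤ c i' - c (i' + 1) - 1)) (fun s' => s'.reg 12) ?_ ?_).mono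
      ?_ ?_)
  · rintro s' ⟨hsame, ho, ⟨-, hx0, -⟩ | ⟨e17, i, hi, e12, e13, e14, e15, e16, hmb, hmY, hval, hlow⟩⟩ hx
    · exact absurd hx0 hx
    have e0 := hsame 0 (by norm_num)
    have e2 := hsame 2 (by norm_num)
    have e6 := hsame 6 (by norm_num)
    have e9 := hsame 9 (by norm_num)
    have hdec : c (i + 1) < c i := h.placed.2 (j + i) (by omega)
    have hci : c i < n := h.placed.1 (j + i) (by omega)
    have hcell : s'.mem (s.reg 5 + j + i + 1) = c (i + 1) := by
      have := hmb (j + i + 1) (by omega)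
      rwa [if_neg (by omega), ← add_assoc, ← add_assoc] at this
    refine Ends.le (Ends.step (fun s₁ => s.Same 12 s₁ ∧ s₁.out = s.out ∧ s₁.mem = s'.mem ∧ s₁.reg 12 = s'.reg 12 ∧
      s₁.reg 13 = s'.reg 13 ∧ s₁.reg 14 = s'.reg 14 ∧ s₁.reg 15 = s'.reg 15 ∧ s₁.reg 16 = s'.reg 16 ∧
      s₁.reg 17 = 1 ∧ s₁.reg 18 = c (i + 1) ∧ s₁.reg 20 = c i - c (i + 1) - carryLoad n δ F c i)
      ?_ fun s₁ hs₁ => Ends.cond (T := n * 24 + 13) (fun hz => ?_) fun hz => ?_) (by simp; omega)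
    · simp [hsame, ho, e13, hcell, e14, e16, e17]
    all_goals
      obtain ⟨hsame₁, ho₁, hm₁, f12, f13, f14, f15, f16, f17, f18, f20⟩ := hs₁
      have e0 := (hsame₁ 0 (by norm_num)).trans h0
      have e1 := (hsame₁ 1 (by norm_num)).trans h1
      have e2 := (hsame₁ 2 (by norm_num)).trans h2
      have e9 := (hsame₁ 9 (by norm_num)).trans h9
      rw [f20] at hz
    -- too many edges are required: the level fails
    · refine (ends_of_wp ?_).le (by simp)
      simp [e0, hsame₁, ho₁]
      refine ⟨fun hs => ?_, by omega⟩
      have : carryLoad n δ F c i ≤ c i - c (i + 1) - 1 := hs i (by omega)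
      omega
    · have hle : carryLoad n δ F c i ≤ c i - c (i + 1) - 1 := by omega
      have hnext := hval.succ hle hdec
      have hB := carryState_fst_succ (n := n) (δ := δ) (F := F) (c := c) i
      rw [carryVector] at hB
      have hv1 := hval.bound
      have hv2 := hval.le
      set B' := (carryState n δ F c (i + 1)).1 with hB'
      have hnew : newPlace n δ j p b (j + i + 1) = B' := by
        rw [newPlace, if_neg (by omega), show j + i + 1 - j = i + 1 by omega]
      refine Ends.le (Ends.step (fun s₂ => s.Same 12 s₂ ∧ s₂.out = s.out ∧ s₂.reg 12 = s'.reg 12 ∧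
        s₂.reg 13 = s'.reg 13 ∧ s₂.reg 14 = c i ∧ s₂.reg 17 = 1 ∧ s₂.reg 18 = c (i + 1) ∧
        s₂.reg 19 = B' ∧ s₂.reg 20 = n ∧ s₂.reg 21 = 0 ∧ s₂.reg 22 = 0 ∧ s₂.reg 26 = B' + δ ∧
        s₂.reg 27 = (carryState n δ F c i).1 + δ ∧
        ∀ a, s₂.mem a = if a = s.reg 5 + j + i + 1 then B' else s'.mem a) ?_ fun s₂ hs₂ =>
        Ends.seq (T := n * 24 + 1) (T' := 5) (R := fun s₃ => s.Same 12 s₃ ∧ s₃.out = s.out ∧ s₃.reg 12 = s'.reg 12 ∧ s₃.reg 13 = s'.reg 13 ∧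
          s₃.reg 17 = 1 ∧ s₃.reg 18 = c (i + 1) ∧ s₃.reg 19 = B' ∧
          s₃.reg 22 = carryLoad n δ F c (i + 1) ∧ s₃.reg 22 ≤ n * n ∧
          (∀ y < n, s₃.mem (s.reg 6 + y) = (carryState n δ F c (i + 1)).2 y) ∧
          ∀ q < k, s₃.mem (s.reg 5 + q) = if q = j + i + 1 then B' else s'.mem (s.reg 5 + q))
          ?_ fun s₃ hs₃ => ends_of_wp ?_) (by simp; omega)
      · have : (carryState n δ F c i).1 - (c i - c (i + 1) - carryLoad n δ F c i) = B' := by omega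
        simp [hsame₁, ho₁, e0, e2, e9, f12, f13, f14, f15, f17, f18, f20, e14, e15, e13, this, hm₁]
        omega
      · obtain ⟨hsame₂, ho₂, g12, g13, g14, g17, g18, g19, g20, g21, g22, g26, g27, hm₂⟩ := hs₂
        have g6 := (hsame₂ 6 (by norm_num)).trans h6
        have hsb : ∑ y ∈ range n, between (B' + δ) ((carryState n δ F c i).1 + δ) y =
            (carryState n δ F c i).1 + δ - (B' + δ) - 1 := by
          simpa using sum_between (a := B' + δ) hv1 fun _ => 1
        refine (ends_carryLevel g20 ((hsame₂ 1 (by norm_num)).trans h1) g21 g22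
          (Y := (carryState n δ F c i).2) (fun y hy => ?_) rfl rfl ?_ ?_ (by rw [g6]; exact hW)).mono
          le_rfl ?_
        · rw [hm₂, g6, ← h6, hmY y hy, if_neg (by omega)]
        · rw [g14, g18, g26, g27]
          exact hval.dominated hdec
        · rw [g26, g27, sum_add_distrib, hsb]
          change carryLoad n δ F c i + _ ≤ n
          omega
        · rw [g14, g18, g26, g27, g6, ← h6]
          rintro s₃ ⟨hsame₃, ho₃, k22, k22', hm₃⟩
          refine ⟨hsame₂.trans hsame₃ le_rfl (by norm_num), ho₃.trans ho₂, by rw [hsame₃ 12 (by norm_num), g12],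
            by rw [hsame₃ 13 (by norm_num), g13], by rw [hsame₃ 17 (by norm_num), g17],
            by rw [hsame₃ 18 (by norm_num), g18], by rw [hsame₃ 19 (by norm_num), g19], k22, k22',
            fun y hy => ?_, fun q hq => ?_⟩
          · rw [hm₃, if_pos (by omega), Nat.add_sub_cancel_left]
            rfl
          · rw [hm₃, if_neg (by omega), hm₂]
            exact if_congr (by omega) rfl rfl
      · obtain ⟨hsame₃, ho₃, g12, g13, g17, g18, g19, g22, g22', hmY₃, hmb₃⟩ := hs₃
        have k0 := (hsame₃ 0 (by norm_num)).trans h0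
        have k1 := (hsame₃ 1 (by norm_num)).trans h1
        have hb1 := hnext.bound
        simp [hsame₃, ho₃, k0, k1, g12, g13, g17, g18, g19, g22, e12, e13]
        refine ⟨by omega, by omega, by omega, by omega, ⟨i + 1, by omega, by omega, by omega, rfl, rfl,
          rfl, fun q hq => ?_, hmY₃, hnext, fun i' hi' => ?_⟩, by omega⟩
        · rw [hmb₃ q hq, hmb q hq]
          by_cases hq1 : q = j + i + 1
          · rw [if_pos hq1, if_pos (by omega), hq1, hnew]
          · rw [if_neg hq1]
            exact if_congr (by omega) rfl rfl
        · rcases Nat.lt_succ_iff_lt_or_eq.1 hi' with hi' | rfl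
          · exact hlow i' hi'
          · exact hle
  · refine ⟨by simp, rfl, Or.inr ⟨h17, 0, Nat.zero_le _, h12, h13, h14, h15, h16, fun q hq => ?_, hY,
      carryValid_zero ?_, fun i' hi' => absurd hi' (by omega)⟩⟩
    · rw [hb q hq, newPlace, add_zero]
      split_ifs <;> rfl
    · have := h.gap_le
      have := h.delta_le
      change b j + δ + F ≤ n
      omega
  · simp only [h12]
    exact Nat.add_le_add_right (Nat.mul_le_mul_right _ (by omega)) _
  · rintro s' ⟨⟨hsame, ho, ⟨e17, -, hno⟩ | ⟨e17, i, hi, e12, -, -, -, -, hmb, -, -, hlow⟩⟩, hx⟩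
    · exact ⟨hsame, ho, Or.inl ⟨e17, hno⟩⟩
    · have hik : i = k - (j + 1) := by omega
      refine ⟨hsame, ho, Or.inr ⟨e17, fun i' hi' => hlow i' (by omega), fun q hq => ?_⟩⟩
      rw [hmb q hq, if_pos (by omega)]

end Carry

/-! ### The program that is given the positions of the vertices -/

/-- Searches for the pivot, in register `24`. Register `23` receives the number `N_{j+1} - N_p - 1`
for the candidate, if it is positive. -/
def searchPivot : Prog := .loop 21 <| .block
  [.plus 22 5 24, .minus 22 22 1, .load 23 22, .plus 23 23 24, .minus 23 23 20,
    .cond 23 (.minus 21 21 21) (.seq (.minus 24 24 1) (.plus 21 24 0))]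

/-- Fills in the multiplicities at the beginning of the decision procedure. -/
def initCarry : Prog := .loop 25 <| .block
  [.minus 25 25 1, .plus 22 6 25, .test 23 26 27 25, .store 22 23]

/-- Runs the decision procedure, given the pivot, and writes the answer. -/
def solveWithPivot : Prog :=
  .seq (.block [.plus 8 24 0, .minus 9 23 1, .cond 9 (.const 9 1) (.minus 9 9 9),
    .plus 26 10 9, .minus 26 26 1, .plus 27 10 23, .minus 16 23 9,
    .cond 9 (.block [.plus 11 10 7, .const 13 3, .plus 11 11 13, .minus 11 11 8])
      (.seq (.const 13 2) (.plus 11 10 13)),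
    .minus 12 3 7, .minus 12 12 1, .plus 13 5 7, .plus 13 13 1, .plus 14 10 0, .plus 15 10 0,
    .const 17 1, .plus 25 2 0]) <|
  .seq initCarry <| .seq carryLoop <|
  .cond 17 (.seq (.block [.write 1, .plus 12 5 8, .minus 12 12 1, .plus 13 2 0, .plus 14 0 0])
    writeEdges) (.write 0)

/-- The algorithm for data that are given by the positions of the vertices. Registers `2`, `3`, `4`
hold `n`, `k`, `t`, and register `5` the address of the positions. -/
def solve : Prog :=
  .seq (.block [.const 1 1, .plus 6 5 3, .minus 7 3 4, .minus 7 7 1, .plus 12 5 7, .load 10 12,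
    .minus 12 12 1, .load 11 12, .minus 11 11 10, .minus 11 11 1, .plus 20 10 7, .const 21 2,
    .plus 20 20 21, .plus 24 7 0, .plus 21 24 0]) <|
  .cond 11 (.seq searchPivot (.cond 24 solveWithPivot (.write 0))) (.write 0)

/-- The tests made before the decision procedure starts are necessary for a solution: `N_{j+1}` exceeds
`N_j`, and there is a pivot. -/
theorem IsPlaced.pivot_of_solution {n k t j : ℕ} {b : ℕ → ℕ} (hb : IsPlaced n k b) (ht : t + 1 < k)
    (hj : j + t + 1 = k) {S : Finset (Finset (Fin n))}
    (hS : IsSolution n k t (colexFamily n k (gaps n b) k).card S) :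
    b j + 1 < b (j - 1) ∧ ∃ p, 1 ≤ p ∧ p ≤ j ∧ b j + j + 3 ≤ b (p - 1) + p := by
  obtain ⟨hadm, p, hp, -⟩ := hS.criterion (edgesUpTo_gaps_le hb) ht
  rw [show k - (t + 1) = j by omega] at hadm hp
  refine ⟨?_, p, ((hb.isPivot_iff (by omega)).1 hp).1⟩
  have := hadm.2.2.1
  rw [show j + 1 = j - 1 + 2 by omega, gaps_eq, show j - 1 + 1 = j by omega] at this
  omega

section Solve

variable {W n k t j : ℕ} {b : ℕ → ℕ} {s : Config}

theorem ends_searchPivot (h0 : s.reg 0 = 0) (h1 : s.reg 1 = 1) (h20 : s.reg 20 = b j + j + 2)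
    (h24 : s.reg 24 = j) (h21 : s.reg 21 = j) (hj : j < k) (hb : ∀ q < k, b q < n)
    (hm : ∀ q < k, s.mem (s.reg 5 + q) = b q) (hW : s.reg 5 + n + k ≤ W) :
    Ends W searchPivot (j * 10 + 1) (fun s' => s.Same 21 s' ∧ s'.mem = s.mem ∧ s'.out = s.out ∧
      s'.reg 24 ≤ j ∧ (∀ q, s'.reg 24 < q → q ≤ j → b (q - 1) + q ≤ b j + j + 2) ∧
      (s'.reg 24 ≠ 0 → s'.reg 23 = pivotGap b j (s'.reg 24) ∧ 1 ≤ s'.reg 23)) s := by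
  refine ((Ends.loop (B := 9) (fun s' => s.Same 21 s' ∧ s'.mem = s.mem ∧ s'.out = s.out ∧
    s'.reg 24 ≤ j ∧ (∀ q, s'.reg 24 < q → q ≤ j → b (q - 1) + q ≤ b j + j + 2) ∧
    (s'.reg 21 = 0 → s'.reg 24 ≠ 0 → s'.reg 23 = pivotGap b j (s'.reg 24) ∧ 1 ≤ s'.reg 23) ∧
    (s'.reg 21 ≠ 0 → s'.reg 21 = s'.reg 24)) (fun s' => s'.reg 21) ?_ ?_).mono ?_ ?_)
  · rintro s' ⟨hsame, hm', ho, hle, hgr, -, heq⟩ hx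
    have e := heq hx
    have e0 := (hsame 0 (by norm_num)).trans h0
    have e1 := (hsame 1 (by norm_num)).trans h1
    have e5 := hsame 5 (by norm_num)
    have e20 := (hsame 20 (by norm_num)).trans h20
    have hcell : s.mem (s.reg 5 + s'.reg 24 - 1) = b (s'.reg 24 - 1) := by
      rw [Nat.add_sub_assoc (by omega)]
      exact hm _ (by omega)
    have hbp := hb (s'.reg 24 - 1) (by omega)
    refine (ends_of_wp ?_).le (by simp)
    simp [hsame, hm', ho, e0, e1, e5, e20, hcell]
    refine ⟨by omega, by omega, fun hz => ⟨by omega, ⟨by omega, fun q h2 h3 => ?_, by omega⟩,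
      by omega⟩, fun hz => ⟨⟨hle, hgr, fun _ => ⟨rfl, by omega⟩⟩, by omega⟩⟩
    by_cases hq : q = s'.reg 24
    · subst hq; omega
    · exact hgr q (by omega) h3
  · exact ⟨by simp, rfl, rfl, h24.le, fun q h2 h3 => absurd h2 (by omega),
      fun h2 h3 => absurd h2 (by omega), fun _ => by omega⟩
  · simp only [h21]
    exact le_rfl
  · rintro s' ⟨⟨hsame, hm', ho, hle, hgr, hd, -⟩, hx⟩
    exact ⟨hsame, hm', ho, hle, hgr, hd hx⟩

theorem ends_initCarry (h1 : s.reg 1 = 1) (h25 : s.reg 25 = n) (hW : s.reg 6 + n + 1 ≤ W) :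
    Ends W initCarry (n * 11 + 1) (fun s' => s.Same 22 s' ∧ s'.out = s.out ∧
      ∀ a, s'.mem a = if s.reg 6 ≤ a ∧ a < s.reg 6 + n then
        between (s.reg 26) (s.reg 27) (a - s.reg 6) else s.mem a) s := by
  refine ((Ends.loop (B := 10) (fun s' => s.Same 22 s' ∧ s'.out = s.out ∧ s'.reg 26 = s.reg 26 ∧
    s'.reg 27 = s.reg 27 ∧ s'.reg 25 ≤ n ∧
    ∀ a, s'.mem a = if s.reg 6 + s'.reg 25 ≤ a ∧ a < s.reg 6 + n then
      between (s.reg 26) (s.reg 27) (a - s.reg 6) else s.mem a) (fun s' => s'.reg 25) ?_ ?_).mono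
      ?_ ?_)
  · rintro s' ⟨hsame, ho, h26, h27, hle, hm⟩ hx
    have e1 := (hsame 1 (by norm_num)).trans h1
    have e6 := hsame 6 (by norm_num)
    refine (ends_of_wp ?_).le (by simp)
    simp [Prog.wp_test (show 1 ≤ W by omega), hsame, ho, e1, e6, h26, h27]
    refine ⟨by omega, ⟨by omega, fun a => ?_⟩, by omega⟩
    rw [hm]
    by_cases ha : a = s.reg 6 + (s'.reg 25 - 1)
    · rw [if_pos ha, if_pos (by omega), ha, Nat.add_sub_cancel_left]
    · rw [if_neg ha]
      exact if_congr (by omega) rfl rfl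
  · exact ⟨by simp, rfl, rfl, rfl, h25.le, fun a => by rw [if_neg (by omega)]⟩
  · simp only [h25]
    exact le_rfl
  · rintro s' ⟨⟨hsame, ho, -, -, -, hm⟩, hx⟩
    rw [hx] at hm
    exact ⟨hsame, ho, hm⟩

theorem ends_writeSolution {p δ : ℕ} (h : Pivotal n k j p δ b) (hs : Pivotal.Succeeds n k j p δ b)
    (hj : j + t + 1 = k) (h0 : s.reg 0 = 0) (h1 : s.reg 1 = 1) (h2 : s.reg 2 = n) (h3 : s.reg 3 = k)
    (h8 : s.reg 8 = p) (h10 : s.reg 10 = b j) (h11 : s.reg 11 = exchangedVertex b j p δ)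
    (hm : ∀ q < k, s.mem (s.reg 5 + q) = newPlace n δ j p b q)
    (ho : s.out = []) (hW : s.reg 5 + 2 * (n + k) + 3 ≤ W) :
    Ends W (.seq (.block [.write 1, .plus 12 5 8, .minus 12 12 1, .plus 13 2 0, .plus 14 0 0])
      writeEdges) (n * (k * 6 + 28) + 6)
      (fun s' => IsAnswer n k t (colexFamily n k (gaps n b) k).card s'.out) s := by
  have hle := h.le
  have h1p := h.one_le
  have hjk := h.lt
  have hbj := h.placed.1 j (by omega)
  refine (Ends.step (fun s₁ => s.Same 12 s₁ ∧ s₁.mem = s.mem ∧ s₁.out = [1] ∧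
    s₁.reg 12 = s.reg 5 + (p - 1) ∧ s₁.reg 13 = n ∧ s₁.reg 14 = 0) (T := n * (k * 6 + 28) + 1) ?_
    fun s₁ hs₁ => ?_).le (by simp; omega)
  · simp [h0, h1, h2, h8, ho]
    omega
  · obtain ⟨hsame, hm₁, ho₁, e12, e13, e14⟩ := hs₁
    have e5 := hsame 5 (by norm_num)
    refine (ends_writeEdges (b := newPlace n δ j p b) (j := j) ((hsame 0 (by norm_num)).trans h0)
      ((hsame 1 (by norm_num)).trans h1) ((hsame 3 (by norm_num)).trans h3) (by rw [e5, hm₁]; exact hm)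
      h1p (by omega) ((hsame 10 (by norm_num)).trans ?_) ((hsame 11 (by norm_num)).trans h11)
      (by rw [e12, e5]) e13 e14 (h.isPlaced_newPlace hs) (by omega) ?_ (by rw [e5]; omega)).mono
      le_rfl fun s₂ ho₂ => Or.inr ?_
    · rw [h10, newPlace, if_pos le_rfl]
    · rw [exchangedVertex]
      split_ifs <;> omega
    · obtain ⟨S, hS, hlab, hex⟩ := h.exists_solution hs
      rw [show k - (j + 1) = t by omega] at hS
      have hL := (h.isPlaced_newPlace hs).listsEdges hex h.delta_le.1 fun s hs₁ hs₂ => by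
        rw [newPlace, newPlace, if_pos (by omega), if_pos le_rfl]
        exact h.greatest s hs₁ hs₂
      refine ⟨S, _, hS, hlab ▸ hL, ?_⟩
      rw [ho₂, ho₁, exchangedVertex, exchangedVertex, newPlace, if_pos le_rfl]
      rfl

theorem ends_solveWithPivot {p d : ℕ} (hb : IsPlaced n k b) (ht : t + 1 < k) (ht1 : 1 ≤ t)
    (hj : j + t + 1 = k) (h0 : s.reg 0 = 0) (h1 : s.reg 1 = 1) (h2 : s.reg 2 = n) (h3 : s.reg 3 = k)
    (h6 : s.reg 6 = s.reg 5 + k) (h7 : s.reg 7 = j) (h10 : s.reg 10 = b j) (h24 : s.reg 24 = p)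
    (h23 : s.reg 23 = d) (hm : ∀ q < k, s.mem (s.reg 5 + q) = b q) (ho : s.out = [])
    (hW : s.reg 5 + 3 * n + 3 * k + n * n + 8 ≤ W) (hpos : b j + 1 < b (j - 1)) (hp1 : 1 ≤ p)
    (hpj : p ≤ j) (hd : d = pivotGap b j p) (hd1 : 1 ≤ d)
    (hgr : ∀ q, p < q → q ≤ j → b (q - 1) + q ≤ b j + j + 2) :
    Ends W solveWithPivot (30 * (n * k) + 39 * n + 18 * k + 60)
      (fun s' => IsAnswer n k t (colexFamily n k (gaps n b) k).card s'.out) s := by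
  obtain ⟨δ, hδ⟩ : ∃ δ, δ = if pivotGap b j p = 1 then 0 else 1 := ⟨_, rfl⟩
  have h : Pivotal n k j p δ b := ⟨hb, by omega, hp1, hpj, hpos, by omega, hgr, hδ⟩
  have hgap := h.gap_le
  have hδ1 := h.delta_le
  have hbj := hb.1 j (by omega)
  refine Ends.le (Ends.step (fun s₁ => s.Same 8 s₁ ∧ s₁.mem = s.mem ∧ s₁.out = [] ∧ s₁.reg 8 = p ∧
    s₁.reg 9 = δ ∧ s₁.reg 10 = b j ∧ s₁.reg 11 = exchangedVertex b j p δ ∧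
    s₁.reg 12 = k - (j + 1) ∧ s₁.reg 13 = s.reg 5 + j + 1 ∧ s₁.reg 14 = b j ∧ s₁.reg 15 = b j ∧
    s₁.reg 16 = d - δ ∧ s₁.reg 17 = 1 ∧ s₁.reg 25 = n ∧ s₁.reg 26 = b j + δ - 1 ∧
    s₁.reg 27 = b j + d) (T := n * 11 + 1 + (k * (n * 24 + 18) + 1 + (n * (k * 6 + 28) + 6 + 1)))
    ?_ fun s₁ hs₁ => ?_) ?_
  · rw [exchangedVertex]
    split_ifs at hδ with hd2
    · simp [h0, h1, h2, h3, h7, h10, h23, h24, ho, hδ, show d = 1 by omega]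
      omega
    · simp [h0, h1, h2, h3, h7, h10, h23, h24, ho, hδ, show ¬ d - 1 = 0 by omega]
      omega
  · obtain ⟨hsame, hm₁, ho₁, e8, e9, e10, e11, e12, e13, e14, e15, e16, e17, e25, e26, e27⟩ := hs₁
    have e1 := (hsame 1 (by norm_num)).trans h1
    have e5 := hsame 5 (by norm_num)
    have e6 := hsame 6 (by norm_num)
    have hY : (carryState n δ (pivotGap b j p - δ) (fun i => b (j + i)) 0).2 =
        between (s₁.reg 26) (s₁.reg 27) := by
      rw [e26, e27, ← show b j + δ + (pivotGap b j p - δ) = b j + d by omega]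
      rfl
    refine (ends_initCarry e1 e25 (by omega)).seq fun s₂ hs₂ => ?_
    obtain ⟨hsame₂, ho₂, hm₂⟩ := hs₂
    have hsm := hsame.trans hsame₂ (le_refl 8) (by norm_num)
    have f5 := hsm 5 (by norm_num)
    have f6 := hsm 6 (by norm_num)
    refine (ends_carryLoop h ((hsm 0 (by norm_num)).trans h0) ((hsm 1 (by norm_num)).trans h1)
      ((hsm 2 (by norm_num)).trans h2) (by rw [f5, f6, h6]) ((hsame₂ 9 (by norm_num)).trans e9)
      ((hsame₂ 12 (by norm_num)).trans e12) (by rw [hsame₂ 13 (by norm_num), e13, f5])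
      ((hsame₂ 14 (by norm_num)).trans e14) ((hsame₂ 15 (by norm_num)).trans e15) ?_
      ((hsame₂ 17 (by norm_num)).trans e17) (fun q hq => ?_) (fun y hy => ?_)
      (by rw [f5]; omega)).seq fun s₃ hs₃ => ?_
    · rw [hsame₂ 16 (by norm_num), e16, carryLoad, hY, e26, e27]
      have := sum_between (a := b j + δ - 1) (show b j + d ≤ n by omega) fun _ => 1
      simp only [mul_one, sum_const, card_range, smul_eq_mul] at this
      rw [this]
      have := hb.lt_of_lt (Nat.lt_succ_self j) (by omega)
      split_ifs at hδ <;> omega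
    · rw [hm₂, f5, if_neg (by omega), hm₁, hm q hq]
    · rw [hm₂, f6, e6, if_pos (by omega), hY, Nat.add_sub_cancel_left]
    · obtain ⟨hsame₃, ho₃, hans⟩ := hs₃
      have hsm' := hsame₂.trans hsame₃ (show 12 ≤ 22 by norm_num) le_rfl
      have hsm'' := hsm.trans hsame₃ (le_refl 8) (by norm_num)
      have ho' : s₃.out = [] := by rw [ho₃, ho₂, ho₁]
      have g0 := (hsm'' 0 (by norm_num)).trans h0
      refine Ends.cond (fun h17 => ?_) fun h17 => ?_
      · refine (ends_of_wp (W := W) ?_).le (by simp)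
        simp only [Prog.wp, Config.out_emit, ho', g0, List.nil_append]
        refine Or.inl ⟨fun ⟨S, hS⟩ => ?_, rfl⟩
        rcases hans with ⟨-, hno⟩ | ⟨h17', -⟩
        · exact hno fun i hi => h.load_le_of_solution ht (by omega) hS i (by omega)
        · omega
      · rcases hans with ⟨h17', -⟩ | ⟨h17', hs, hmem⟩
        · exact absurd h17' h17
        · have g5 := hsm'' 5 (by norm_num)
          refine ends_writeSolution h hs hj g0 ((hsm'' 1 (by norm_num)).trans h1)
            ((hsm'' 2 (by norm_num)).trans h2) ((hsm'' 3 (by norm_num)).trans h3)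
            ((hsm' 8 (by norm_num)).trans e8) ((hsm' 10 (by norm_num)).trans e10)
            ((hsm' 11 (by norm_num)).trans e11) (fun q hq => ?_) ho' (by rw [g5]; omega)
          rw [g5, ← f5]
          exact hmem q hq
  · simp
    ring_nf
    omega

theorem ends_solve (hb : IsPlaced n k b) (ht : t + 1 < k) (ht1 : 1 ≤ t) (h0 : s.reg 0 = 0)
    (h2 : s.reg 2 = n) (h3 : s.reg 3 = k) (h4 : s.reg 4 = t)
    (hm : ∀ q < k, s.mem (s.reg 5 + q) = b q) (ho : s.out = [])
    (hW : s.reg 5 + 3 * n + 3 * k + n * n + 8 ≤ W) :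
    Ends W solve (30 * (n * k) + 39 * n + 28 * k + 80)
      (fun s' => IsAnswer n k t (colexFamily n k (gaps n b) k).card s'.out) s := by
  obtain ⟨j, hj⟩ : ∃ j, j + t + 1 = k := ⟨k - (t + 1), by omega⟩
  have hbj := hb.1 j (by omega)
  have c1 := hm j (by omega)
  have c2 : s.mem (s.reg 5 + j - 1) = b (j - 1) := by
    rw [Nat.add_sub_assoc (by omega)]
    exact hm (j - 1) (by omega)
  -- the answer `0` is correct if one of the tests fails
  have hno : ∀ {s' : Config}, s'.reg 0 = 0 → s'.out = [] →
      ¬ (b j + 1 < b (j - 1) ∧ ∃ p, 1 ≤ p ∧ p ≤ j ∧ b j + j + 3 ≤ b (p - 1) + p) →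
      Prog.wp W (.write 0) (fun s' =>
        IsAnswer n k t (colexFamily n k (gaps n b) k).card s'.out) s' := fun h0 ho h => by
    simp only [Prog.wp, Config.out_emit, ho, h0, List.nil_append]
    exact Or.inl ⟨fun ⟨S, hS⟩ => h (hb.pivot_of_solution ht hj hS), rfl⟩
  refine Ends.le (Ends.step (fun s₁ => s₁.reg 0 = 0 ∧ s₁.reg 1 = 1 ∧ s₁.reg 2 = n ∧ s₁.reg 3 = k ∧
    s₁.reg 5 = s.reg 5 ∧ s₁.reg 6 = s.reg 5 + k ∧ s₁.reg 7 = j ∧ s₁.reg 10 = b j ∧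
    s₁.reg 11 = b (j - 1) - b j - 1 ∧ s₁.reg 20 = b j + j + 2 ∧ s₁.reg 24 = j ∧ s₁.reg 21 = j ∧
    s₁.mem = s.mem ∧ s₁.out = []) (T := j * 10 + 1 + (30 * (n * k) + 39 * n + 18 * k + 60 + 1) + 1)
    ?_ fun s₁ hs₁ => ?_) ?_
  · have : k - t - 1 = j := by omega
    simp [h0, h2, h3, h4, c1, c2, ho, this]
    omega
  · obtain ⟨e0, e1, e2, e3, e5, e6, e7, e10, e11, e20, e24, e21, hm₁, ho₁⟩ := hs₁
    refine Ends.cond (fun h11 => ?_) fun h11 => ?_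
    · exact (ends_of_wp (hno e0 ho₁ fun h => by omega)).le (Nat.le_add_left ..)
    · refine (ends_searchPivot e0 e1 e20 e24 e21 (by omega) hb.1 (by rw [e5, hm₁]; exact hm)
        (by rw [e5]; omega)).seq fun s₂ hs₂ => ?_
      obtain ⟨hsame, hm₂, ho₂, hle, hgr, hd⟩ := hs₂
      have f0 := (hsame 0 (by norm_num)).trans e0
      have f5 := (hsame 5 (by norm_num)).trans e5
      refine Ends.cond (fun h24 => ?_) fun h24 => ?_
      · refine (ends_of_wp (hno f0 (ho₂.trans ho₁) fun h => ?_)).le (Nat.le_add_left ..)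
        obtain ⟨-, p, hp1, hp2, hp⟩ := h
        have := hgr p (by omega) hp2
        omega
      · obtain ⟨hd1, hd2⟩ := hd h24
        exact ends_solveWithPivot hb ht ht1 hj f0 ((hsame 1 (by norm_num)).trans e1)
          ((hsame 2 (by norm_num)).trans e2) ((hsame 3 (by norm_num)).trans e3)
          (by rw [f5, hsame 6 (by norm_num), e6]) ((hsame 7 (by norm_num)).trans e7)
          ((hsame 10 (by norm_num)).trans e10) rfl rfl (by rw [f5, hm₂, hm₁]; exact hm)
          (ho₂.trans ho₁) (by rw [f5]; exact hW) (by omega) (by omega) hle hd1 hd2 hgr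
  · simp
    omega

end Solve

/-! ### Cardinalities given by their binomial decomposition -/

theorem runsTo_of_ends {P : Prog} {c T n k t m : ℕ} {inp : List ℕ}
    (h : Ends ((inp.sum + 2) ^ c) P T (fun s => IsAnswer n k t m s.out) (initConfig inp)) :
    ∃ out : List ℕ, RunsTo P c inp T out ∧ IsAnswer n k t m out := by
  obtain ⟨T', s, hT, hex, hs⟩ := h
  exact ⟨s.out, ⟨T', s, hT, hex, rfl⟩, hs⟩

/-- Computes the entries that come from a binomial decomposition. -/
def storeEntries : Prog := .loop 21 <| .block
  [.minus 22 20 18, .minus 22 20 22, .plus 22 22 17, .load 22 22, .plus 23 20 16, .minus 23 23 19,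
    .minus 22 22 23, .plus 23 5 20, .store 23 22, .plus 20 20 1, .minus 21 21 1]

/-- The algorithm for cardinalities that are given by their binomial decomposition. -/
def solveDecomp : Prog :=
  .seq (.block [.const 1 1, .load 2 0, .load 3 1, .const 16 2, .load 4 16, .const 22 3, .load 19 22,
    .const 17 4, .plus 5 3 17, .minus 18 19 1, .plus 21 3 0]) <|
  .seq storeEntries <|
  .seq (.block [.load 22 5, .minus 22 2 22]) <|
  .cond 22 solve (.write 0)

theorem entries_eq_getD (a : List ℕ) (i : ℕ) :
    entries a i = a.getD (i - (i - (a.length - 1))) 0 - (i + 2 - a.length) := by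
  rw [entries]
  split_ifs with h
  · rw [show i - (i - (a.length - 1)) = i by omega, show i + 2 - a.length = 0 by omega, Nat.sub_zero]
  · rw [show i - (i - (a.length - 1)) = a.length - 1 by omega]

section Decomp

variable {W n k t m : ℕ} {a : List ℕ} {s : Config}

theorem ends_storeEntries (ha : a.length ≤ k) (h1 : s.reg 1 = 1) (h5 : s.reg 5 = k + 4)
    (h16 : s.reg 16 = 2) (h17 : s.reg 17 = 4) (h18 : s.reg 18 = a.length - 1)
    (h19 : s.reg 19 = a.length) (h20 : s.reg 20 = 0) (h21 : s.reg 21 = k)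
    (hm : ∀ q < k, s.mem (q + 4) = a.getD q 0) (hW : 2 * k + 4 ≤ W) (hk : 1 ≤ k) :
    Ends W storeEntries (k * 12 + 1) (fun s' => s.Same 16 s' ∧ s'.out = s.out ∧
      ∀ q < k, s'.mem (k + 4 + q) = entries a q) s := by
  refine ((Ends.loop (B := 11) (fun s' => s.Same 20 s' ∧ s'.out = s.out ∧
    s'.reg 20 + s'.reg 21 = k ∧ (∀ q < k, s'.mem (q + 4) = a.getD q 0) ∧
    ∀ q < s'.reg 20, s'.mem (k + 4 + q) = entries a q) (fun s' => s'.reg 21) ?_ ?_).mono ?_ ?_)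
  · rintro s' ⟨hsame, ho, hsum, hm', hb⟩ hx
    have e1 := hsame 1 (by norm_num)
    have e5 := hsame 5 (by norm_num)
    have e16 := hsame 16 (by norm_num)
    have e17 := hsame 17 (by norm_num)
    have e18 := hsame 18 (by norm_num)
    have e19 := hsame 19 (by norm_num)
    have hcell := hm' (s'.reg 20 - (s'.reg 20 - (a.length - 1))) (by omega)
    refine (ends_of_wp ?_).le (by simp)
    simp only [Prog.wp, Prog.block]
    simp [hsame, ho, e1, e5, e16, e17, e18, e19, h1, h5, h16, h17, h18, h19, hcell]
    refine ⟨by omega, by omega, by omega, by omega, ⟨by omega, fun q hq => ?_, fun q hq => ?_⟩, by omega⟩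
    · rw [if_neg (by omega)]
      exact hm' q hq
    · by_cases hq' : q = s'.reg 20
      · rw [if_pos hq', hq', entries_eq_getD]
        simp
      · rw [if_neg hq']
        exact hb q (by omega)
  · exact ⟨by simp, rfl, by omega, hm, fun q hq => absurd hq (by omega)⟩
  · simp only [h21]
    exact le_rfl
  · rintro s' ⟨⟨hsame, ho, hsum, -, hb⟩, hx⟩
    exact ⟨hsame.trans (fun _ _ => rfl) (show 16 ≤ 20 by norm_num) le_rfl, ho,
      fun q hq => hb q (by omega)⟩

theorem ends_solveDecomp (ht1 : 1 ≤ t) (ht : t + 1 < k) (ha : IsBinomDecomp k m a)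
    (hW : 3 * n + 4 * k + n * n + 12 ≤ W) :
    Ends W solveDecomp (30 * (n * k) + 39 * n + 40 * k + 100) (fun s => IsAnswer n k t m s.out)
      (initConfig (n :: k :: t :: a.length :: a)) := by
  have hlen := ha.2.1
  refine Ends.le (Ends.step (fun s₁ => s₁.reg 0 = 0 ∧ s₁.reg 1 = 1 ∧ s₁.reg 2 = n ∧ s₁.reg 3 = k ∧
    s₁.reg 4 = t ∧ s₁.reg 5 = k + 4 ∧ s₁.reg 16 = 2 ∧ s₁.reg 17 = 4 ∧ s₁.reg 18 = a.length - 1 ∧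
    s₁.reg 19 = a.length ∧ s₁.reg 20 = 0 ∧ s₁.reg 21 = k ∧ (∀ q < k, s₁.mem (q + 4) = a.getD q 0) ∧
    s₁.out = []) (T := k * 12 + 1 + (2 + (30 * (n * k) + 39 * n + 28 * k + 80 + 1))) ?_
    fun s₁ hs₁ => ?_) (by simp; omega)
  · simp [initConfig]
    omega
  · obtain ⟨e0, e1, e2, e3, e4, e5, e16, e17, e18, e19, e20, e21, hm, ho⟩ := hs₁
    refine (ends_storeEntries hlen e1 e5 e16 e17 e18 e19 e20 e21 hm (by omega) (by omega)).seq
      fun s₂ hs₂ => ?_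
    obtain ⟨hsame, ho₂, hb⟩ := hs₂
    have f5 := (hsame 5 (by norm_num)).trans e5
    have f2 := (hsame 2 (by norm_num)).trans e2
    have hb0 := hb 0 (by omega)
    rw [add_zero] at hb0
    refine Ends.step (fun s₃ => s₂.Same 16 s₃ ∧ s₃.out = [] ∧ s₃.mem = s₂.mem ∧
      s₃.reg 22 = n - entries a 0) ?_ fun s₃ hs₃ => ?_
    · simp [f5, f2, hb0, ho₂, ho]
    · obtain ⟨hsame₃, ho₃, hm₃, e22⟩ := hs₃
      have hsm := hsame.trans hsame₃ (le_refl 16) le_rfl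
      have g0 := (hsm 0 (by norm_num)).trans e0
      have g5 := (hsm 5 (by norm_num)).trans e5
      refine Ends.cond (fun h22 => ?_) fun h22 => ?_
      · refine (ends_of_wp (W := W) ?_).le (Nat.le_add_left ..)
        simp only [Prog.wp, Config.out_emit, ho₃, g0, List.nil_append]
        refine Or.inl ⟨fun ⟨S, hS⟩ => ?_, rfl⟩
        have := ha.le_choose_iff.1 hS.card_pos.2
        omega
      · obtain ⟨hpl, hcard, -⟩ := ha.card_eq (ha.le_choose_iff.2 (show entries a 0 < n by omega))
        rw [← hcard]
        exact ends_solve hpl ht ht1 g0 ((hsm 2 (by norm_num)).trans e2)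
          ((hsm 3 (by norm_num)).trans e3) ((hsm 4 (by norm_num)).trans e4)
          (by rw [g5, hm₃]; exact hb) ho₃ (by rw [g5]; omega)

end Decomp

/-! ### Cardinalities given as numbers -/

/-- The entries of the first rows of Pascal's triangle, one row of length `w` after the other, cut
off at `m`. -/
def pascal (w m i : ℕ) : ℕ := min ((i / w).choose (i % w)) m

/-- Fills in Pascal's triangle. Register `20` holds the current address, `22` the position in the
row, `23` the length of a row, and `21` the number of rows left over. -/
def fillPascal : Prog := .loop 21 <| .block
  [.cond 22 (.block [.minus 24 20 23, .load 25 24, .minus 24 24 1, .load 26 24, .plus 25 25 26,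
      .minus 26 25 19, .minus 25 25 26]) (.plus 25 1 0),
    .store 20 25, .plus 20 20 1, .plus 22 22 1, .minus 24 23 22,
    .cond 24 (.plus 24 0 0) (.block [.plus 22 0 0, .minus 21 21 1])]

/-- Computes the entries greedily. Register `20` holds the next candidate plus one, `21` the address
of its row, `22` the number of missing entries, `24` the address of the next entry, and `18` the
number that is left over. -/
def unrank : Prog := .loop 20 <| .block
  [.minus 20 20 1, .minus 21 21 23,
    .cond 22 (.block [.plus 25 21 22, .load 25 25, .minus 26 25 18,
      .cond 26 (.plus 26 0 0) (.block [.minus 18 18 25, .store 24 20, .plus 24 24 1, .minus 22 22 1])])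
      (.plus 26 0 0)]

/-- The algorithm for cardinalities that are given as numbers. -/
def solveNumber : Prog :=
  .seq (.block [.const 1 1, .load 2 0, .load 3 1, .const 16 2, .load 4 16, .const 22 3, .load 19 22]) <|
  .cond 19
    (.seq (.block [.const 17 4, .plus 5 3 17, .plus 20 5 3, .plus 20 20 16, .plus 21 2 1, .plus 22 0 0,
      .plus 23 3 1]) <|
    .seq fillPascal <|
    .seq (.block [.minus 25 20 1, .load 25 25, .minus 25 19 25]) <|
    .cond 25 (.write 0)
      (.seq (.block [.minus 18 19 1, .minus 21 20 23, .plus 20 2 0, .plus 22 3 0, .plus 24 5 0]) <|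
      .seq unrank solve))
    (.write 0)

theorem pascal_add {w m z s : ℕ} (hs : s < w) : pascal w m (z * w + s) = min (z.choose s) m := by
  rw [pascal, mul_comm, Nat.mul_add_div (by omega), Nat.div_eq_of_lt hs, add_zero, Nat.mul_add_mod,
    Nat.mod_eq_of_lt hs]

/-- The greedy property: `k` decreasing entries below `n` have a sum of binomial coefficients less
than `C(n, k)`. -/
theorem IsPlaced.sum_lt {n k : ℕ} {b : ℕ → ℕ} (hb : IsPlaced n k b) :
    ∑ i ∈ range k, (b i).choose (k - i) < n.choose k := by
  have h : (colexFamily n k (gaps n b) k).card ≤ n.choose k :=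
    card_le_choose_of_sized (sized_avoiding _ _ _)
  rw [card_colexFamily_gaps hb le_rfl] at h
  omega

section Number

variable {W n k t m : ℕ} {s : Config}

theorem ends_fillPascal {β : ℕ} (h0 : s.reg 0 = 0) (h1 : s.reg 1 = 1) (h19 : s.reg 19 = m)
    (h20 : s.reg 20 = β) (h21 : s.reg 21 = n + 1) (h22 : s.reg 22 = 0) (h23 : s.reg 23 = k + 1)
    (hm1 : 1 ≤ m) (hβ : k + 5 ≤ β) (hm : ∀ a, 4 ≤ a → a < β → s.mem a = 0)
    (hW : β + (n + 1) * (k + 1) + 1 ≤ W) (hW' : 2 * m ≤ W) (hk : k + 1 ≤ W) :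
    Ends W fillPascal ((n + 1) * (k + 1) * 18 + 1) (fun s' => s.Same 20 s' ∧ s'.out = s.out ∧
      s'.reg 20 = β + (n + 1) * (k + 1) ∧ s'.reg 23 = k + 1 ∧
      ∀ i < (n + 1) * (k + 1), s'.mem (β + i) = pascal (k + 1) m i) s := by
  refine ((Ends.loop (B := 17) (fun s' => s.Same 20 s' ∧ s'.out = s.out ∧ s'.reg 23 = k + 1 ∧
    (∃ z, z + s'.reg 21 = n + 1 ∧ s'.reg 22 ≤ k ∧ (s'.reg 21 = 0 → s'.reg 22 = 0) ∧
      s'.reg 20 = β + (z * (k + 1) + s'.reg 22) ∧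
      ∀ i < z * (k + 1) + s'.reg 22, s'.mem (β + i) = pascal (k + 1) m i) ∧
    ∀ a, 4 ≤ a → a < β → s'.mem a = 0) (fun s' => s'.reg 21 * (k + 1) - s'.reg 22) ?_ ?_).mono
      ?_ ?_)
  · rintro s' ⟨hsame, ho, e23, ⟨z, hz, hs, -, e20, htab⟩, hzero⟩ hx
    obtain ⟨r, hr⟩ : ∃ r, s'.reg 21 = r + 1 := ⟨s'.reg 21 - 1, by omega⟩
    have e0 := (hsame 0 (by norm_num)).trans h0
    have e1 := (hsame 1 (by norm_num)).trans h1
    have e19 := (hsame 19 (by norm_num)).trans h19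
    set σ := s'.reg 22 with hσ
    set i := z * (k + 1) + σ with hi
    have hpi : pascal (k + 1) m i = min (z.choose σ) m := pascal_add (by omega)
    have htot : (n + 1) * (k + 1) = i - σ + r * (k + 1) + (k + 1) := by
      rw [← hz, hr, hi, Nat.add_sub_cancel]; ring
    have hcell : σ ≠ 0 → s'.mem (β + i - (k + 1)) + s'.mem (β + i - (k + 1) - 1) -
        (s'.mem (β + i - (k + 1)) + s'.mem (β + i - (k + 1) - 1) - m) = pascal (k + 1) m i ∧
        s'.mem (β + i - (k + 1)) + s'.mem (β + i - (k + 1) - 1) ≤ W := by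
      intro hσ0
      obtain ⟨τ, hτ⟩ : ∃ τ, σ = τ + 1 := ⟨σ - 1, by omega⟩
      -- in row `0` the cells that are read lie below the table and hold `0`
      rcases z with _ | z
      · rw [hzero _ (by omega) (by omega), hzero _ (by omega) (by omega), hpi, hτ]
        simp
      · have hi' : i = z * (k + 1) + (k + 1) + σ := by rw [hi, Nat.succ_mul]
        rw [show β + i - (k + 1) = β + (z * (k + 1) + σ) by omega,
          show β + (z * (k + 1) + σ) - 1 = β + (z * (k + 1) + τ) by omega,
          htab _ (by omega), htab _ (by omega), pascal_add (by omega), pascal_add (by omega), hpi, hτ,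
          Nat.choose_succ_succ]
        simp only [Nat.succ_eq_add_one]
        omega
    have hfirst : σ = 0 → pascal (k + 1) m i = 1 := fun hσ0 => by
      rw [hpi, hσ0, Nat.choose_zero_right]
      omega
    refine Ends.le (Ends.step (fun s₁ => s.Same 20 s₁ ∧ s₁.mem = s'.mem ∧ s₁.out = s.out ∧
      s₁.reg 20 = β + i ∧ s₁.reg 21 = r + 1 ∧ s₁.reg 22 = σ ∧ s₁.reg 23 = k + 1 ∧
      s₁.reg 25 = pascal (k + 1) m i) (T := 8) ?_ fun s₁ hs₁ => (ends_of_wp ?_).le (by simp)) (by simp)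
    · by_cases hσ0 : σ = 0
      · simp [← hσ, hσ0, e0, e1, hsame, ho, e20, hr, e23, hfirst hσ0]
        omega
      · have := hcell hσ0
        simp [← hσ, hσ0, e0, e1, hsame, ho, e20, hr, e23, e19, this]
    · obtain ⟨hsame₁, hm₁, ho₁, f20, f21, f22, f23, f25⟩ := hs₁
      have f0 := (hsame₁ 0 (by norm_num)).trans h0
      have f1 := (hsame₁ 1 (by norm_num)).trans h1
      have htab' : ∀ i' < i + 1, (if β + i' = β + i then pascal (k + 1) m i else s'.mem (β + i')) =
          pascal (k + 1) m i' := fun i' hi' => by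
        split_ifs with h
        · rw [show i' = i by omega]
        · exact htab i' (by omega)
      have hzero' : ∀ a, 4 ≤ a → a < β → (if a = β + i then pascal (k + 1) m i else s'.mem a) = 0 :=
        fun a h3 h4 => by rw [if_neg (by omega)]; exact hzero a h3 h4
      by_cases hlast : σ = k
      · simp [hsame₁, ho₁, f0, f1, f20, f21, f22, f23, f25, hm₁, hlast, hr]
        have h5 : (z + 1) * (k + 1) = i + 1 := by rw [Nat.succ_mul]; omega
        have h6 : (r + 1) * (k + 1) = r * (k + 1) + (k + 1) := Nat.succ_mul ..
        refine ⟨by omega, by omega, ⟨⟨z + 1, by omega, by omega, fun i' hi' => ?_⟩, hzero'⟩, by omega⟩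
        rw [← htab' i' (by omega)]
        exact if_congr (by omega) rfl rfl
      · simp [hsame₁, ho₁, f0, f1, f20, f21, f22, f23, f25, hm₁, hr]
        have h6 : (r + 1) * (k + 1) = r * (k + 1) + (k + 1) := Nat.succ_mul ..
        refine ⟨by omega, by omega, fun _ => by omega, fun _ =>
          ⟨⟨⟨z, by omega, by omega, by omega, fun i' hi' => ?_⟩, hzero'⟩, by omega⟩⟩
        rw [← htab' i' (by omega)]
        exact if_congr (by omega) rfl rfl
  · exact ⟨by simp, rfl, h23, ⟨0, by omega, by omega, fun _ => h22, by simp [h20, h22],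
      fun i hi => absurd hi (by omega)⟩, hm⟩
  · simp only [h21, h22]
    exact le_rfl
  · rintro s' ⟨⟨hsame, ho, e23, ⟨z, hz, -, h22', e20, htab⟩, -⟩, hx⟩
    rw [h22' hx, show z = n + 1 by omega, add_zero] at e20 htab
    exact ⟨hsame, ho, e20, e23, htab⟩

theorem ends_unrank {β : ℕ} {b : ℕ → ℕ} (hb : IsPlaced n k b)
    (hr : s.reg 18 = ∑ i ∈ range k, (b i).choose (k - i)) (hlt : s.reg 18 < m)
    (h0 : s.reg 0 = 0) (h1 : s.reg 1 = 1) (h20 : s.reg 20 = n) (h21 : s.reg 21 = β + n * (k + 1))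
    (h22 : s.reg 22 = k) (h23 : s.reg 23 = k + 1) (h24 : s.reg 24 = s.reg 5) (hβ : s.reg 5 + k ≤ β)
    (htab : ∀ i < (n + 1) * (k + 1), s.mem (β + i) = pascal (k + 1) m i)
    (hW : β + (n + 1) * (k + 1) + 1 ≤ W) :
    Ends W unrank (n * 15 + 1) (fun s' => s.Same 18 s' ∧ s'.out = s.out ∧
      ∀ q < k, s'.mem (s.reg 5 + q) = b q) s := by
  refine ((Ends.loop (B := 14) (fun s' => s.Same 18 s' ∧ s'.out = s.out ∧ s'.reg 23 = k + 1 ∧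
    s'.reg 20 ≤ n ∧ s'.reg 21 = β + s'.reg 20 * (k + 1) ∧
    (∀ i < (n + 1) * (k + 1), s'.mem (β + i) = pascal (k + 1) m i) ∧ s'.reg 18 < m ∧
    ∃ i, i + s'.reg 22 = k ∧ s'.reg 24 = s.reg 5 + i ∧ (∀ q < i, s'.mem (s.reg 5 + q) = b q) ∧
      IsPlaced (s'.reg 20) (s'.reg 22) (fun q => b (i + q)) ∧
      s'.reg 18 = ∑ q ∈ range (s'.reg 22), (b (i + q)).choose (s'.reg 22 - q))
    (fun s' => s'.reg 20) ?_ ?_).mono ?_ ?_)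
  · rintro s' ⟨hsame, ho, e23, hle, e21, ht, hlt', i, hi, e24, hst, hpl, e18⟩ hx
    obtain ⟨z, hz⟩ : ∃ z, s'.reg 20 = z + 1 := ⟨s'.reg 20 - 1, by omega⟩
    have e0 := (hsame 0 (by norm_num)).trans h0
    have e1 := (hsame 1 (by norm_num)).trans h1
    have e21' : s'.reg 21 - (k + 1) = β + z * (k + 1) := by rw [e21, hz, Nat.succ_mul]; omega
    rw [hz] at hpl
    have hrow : z * (k + 1) + (k + 1) ≤ n * (k + 1) := by
      rw [← Nat.succ_mul]
      exact Nat.mul_le_mul_right _ (by omega)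
    have hrow' : (n + 1) * (k + 1) = n * (k + 1) + (k + 1) := Nat.succ_mul ..
    refine (ends_of_wp ?_).le (by simp)
    rcases hu : s'.reg 22 with _ | u
    · simp [hsame, ho, hu, hz, e0, e1, e21', e23, e24]
      exact ⟨by omega, ht, hlt', by omega, fun q hq => hst q (by omega), ⟨by simp, by simp⟩,
        by rw [e18, hu]; simp⟩
    · have hcell : s'.mem (β + z * (k + 1) + (u + 1)) = min (z.choose (u + 1)) m := by
        rw [add_assoc, ht _ (by omega), pascal_add (by omega)]
      have hsum : s'.reg 18 = ∑ q ∈ range u, (b (i + 1 + q)).choose (u - q) +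
          (b i).choose (u + 1) := by
        rw [e18, hu, sum_range_succ']
        simp only [Nat.add_sub_add_right, add_zero, Nat.sub_zero, add_assoc, add_comm 1]
      have hb0 : b i < z + 1 := hpl.1 0 (by omega)
      -- the next entry is `z` if and only if `C(z, u + 1)` does not exceed the remainder; the
      -- remainder is less than `m`, so the cut-off does no harm
      by_cases hbz : b i = z
      · rw [hbz] at hsum
        have hmin : min (z.choose (u + 1)) m = z.choose (u + 1) := by omega
        rw [hmin] at hcell
        simp [hsame, ho, hu, hz, e0, e1, e21', e23, e24, hcell, show z.choose (u + 1) - s'.reg 18 = 0 by omega]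
        refine ⟨by omega, by omega, by omega, fun i' hi' => ?_, by omega, i + 1, by omega, by omega,
          fun q hq => ?_, isPlaced_of_lt (fun _ => hbz ▸ hb.2 i (by omega))
            fun q hq => hb.2 (i + 1 + q) (by omega), by omega⟩
        · rw [if_neg (by omega)]
          exact ht i' hi'
        · split_ifs with h
          · rw [h, hbz]
          · exact hst q (by omega)
      · have hpl' : IsPlaced z (u + 1) (fun q => b (i + q)) :=
          isPlaced_of_lt (fun _ => by rw [add_zero]; omega) fun q hq => hb.2 (i + q) (by omega)
        have hlt₁ := hpl'.sum_lt
        rw [← hu, ← e18, hu] at hlt₁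
        simp [hsame, ho, hu, hz, e0, e1, e21', e23, e24, hcell,
          show ¬ min (z.choose (u + 1)) m - s'.reg 18 = 0 by omega]
        exact ⟨by omega, by omega, ht, hlt', by omega, hst, hpl', by rw [e18, hu]⟩
  · refine ⟨by simp, rfl, h23, h20.le, by rw [h21, h20], htab, hlt, 0, by omega, by omega,
      fun q hq => absurd hq (by omega), ?_⟩
    rw [h20, h22]
    simpa using ⟨hb, hr⟩
  · simp only [h20]
    exact le_rfl
  · rintro s' ⟨⟨hsame, ho, -, -, -, -, -, i, hi, -, hst, hpl, -⟩, hx⟩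
    refine ⟨hsame, ho, fun q hq => hst q ?_⟩
    by_contra hlt
    have := hpl.1 0 (by omega)
    omega

theorem ends_unrankAndSolve (ht1 : 1 ≤ t) (ht : t + 1 < k)
    (hW : 3 * n + 4 * k + n * n + n * k + 2 * m + 12 ≤ W) (hm1 : 1 ≤ m) (hm : m ≤ n.choose k)
    (h0 : s.reg 0 = 0) (h1 : s.reg 1 = 1) (h2 : s.reg 2 = n) (h3 : s.reg 3 = k) (h4 : s.reg 4 = t)
    (h5 : s.reg 5 = k + 4) (h19 : s.reg 19 = m) (h20 : s.reg 20 = 2 * k + 6 + (n + 1) * (k + 1))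
    (h23 : s.reg 23 = k + 1)
    (htab : ∀ i < (n + 1) * (k + 1), s.mem (2 * k + 6 + i) = pascal (k + 1) m i) (ho : s.out = []) :
    Ends W (.seq (.block [.minus 18 19 1, .minus 21 20 23, .plus 20 2 0, .plus 22 3 0, .plus 24 5 0])
      (.seq unrank solve)) (30 * (n * k) + 54 * n + 28 * k + 86)
      (fun s => IsAnswer n k t m s.out) s := by
  have hnk : (n + 1) * (k + 1) = n * k + n + k + 1 := by ring
  obtain ⟨b, hb, hsum⟩ := exists_isPlaced (show m - 1 < n.choose k by omega)
  refine Ends.le (Ends.step (fun s' => s.Same 5 s' ∧ s'.mem = s.mem ∧ s'.out = [] ∧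
    s'.reg 5 = k + 4 ∧ s'.reg 18 = m - 1 ∧ s'.reg 20 = n ∧ s'.reg 21 = 2 * k + 6 + n * (k + 1) ∧
    s'.reg 22 = k ∧ s'.reg 23 = k + 1 ∧ s'.reg 24 = k + 4)
    (T := n * 15 + 1 + (30 * (n * k) + 39 * n + 28 * k + 80)) ?_ fun s' hs' => ?_) (by simp; omega)
  · simp [h0, h1, h2, h3, h5, h19, h20, h23, ho]
    rw [hnk, Nat.mul_succ]
    omega
  · obtain ⟨hsame, hm', ho', j5, j18, j20, j21, j22, j23, j24⟩ := hs'
    refine (ends_unrank hb (j18.trans hsum.symm) (show s'.reg 18 < m by omega)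
      ((hsame 0 (by norm_num)).trans h0) ((hsame 1 (by norm_num)).trans h1) j20 j21 j22 j23
      (j24.trans j5.symm) (by omega) (by rw [hm']; exact htab) (by rw [hnk]; omega)).seq
      fun s₂ hs₂ => ?_
    obtain ⟨hsame₂, ho₂, hst⟩ := hs₂
    have l5 := hsame₂ 5 (by norm_num)
    have hsm := hsame.trans hsame₂ (le_refl 5) (by norm_num)
    have hcard : (colexFamily n k (gaps n b) k).card = m := by
      rw [card_colexFamily_gaps hb le_rfl, hsum]
      omega
    rw [← hcard]
    exact ends_solve hb ht ht1 ((hsm 0 (by norm_num)).trans h0)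
      ((hsm 2 (by norm_num)).trans h2) ((hsm 3 (by norm_num)).trans h3)
      ((hsm 4 (by norm_num)).trans h4) (by rw [l5]; exact hst) (ho₂.trans ho')
      (by rw [l5, j5]; omega)

theorem ends_solveNumber (hn : 1 ≤ n) (ht1 : 1 ≤ t) (ht : t + 1 < k)
    (hW : 3 * n + 4 * k + n * n + n * k + 2 * m + 12 ≤ W) :
    Ends W solveNumber (48 * (n * k) + 72 * n + 46 * k + 150) (fun s => IsAnswer n k t m s.out)
      (initConfig [n, k, t, m]) := by
  have hnk : (n + 1) * (k + 1) = n * k + n + k + 1 := by ring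
  have hno : ∀ {s' : Config}, s'.reg 0 = 0 → s'.out = [] → ¬ (1 ≤ m ∧ m ≤ n.choose k) →
      Prog.wp W (.write 0) (fun s' => IsAnswer n k t m s'.out) s' := fun h0 ho h => by
    simp only [Prog.wp, Config.out_emit, ho, h0, List.nil_append]
    exact Or.inl ⟨fun ⟨S, hS⟩ => h hS.card_pos, rfl⟩
  refine Ends.le (Ends.step (fun s₁ => s₁.reg 0 = 0 ∧ s₁.reg 1 = 1 ∧ s₁.reg 2 = n ∧ s₁.reg 3 = k ∧
    s₁.reg 4 = t ∧ s₁.reg 16 = 2 ∧ s₁.reg 19 = m ∧ (∀ a, 4 ≤ a → s₁.mem a = 0) ∧ s₁.out = [])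
    (T := 7 + ((n + 1) * (k + 1) * 18 + 1 + (3 + (30 * (n * k) + 54 * n + 28 * k + 86 + 1))) + 1) ?_ fun s₁ hs₁ => ?_)
    (by rw [hnk]; simp; omega)
  · simp [initConfig]
    refine ⟨by omega, by omega, by omega, fun a ha => ?_⟩
    obtain ⟨a, rfl⟩ : ∃ a', a = a' + 4 := ⟨a - 4, by omega⟩
    simp
  · obtain ⟨e0, e1, e2, e3, e4, e16, e19, hm, ho⟩ := hs₁
    refine Ends.cond (fun h19 => ?_) fun h19 => ?_
    · exact (ends_of_wp (hno e0 ho fun h => by omega)).le (by simp; omega)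
    refine Ends.step (fun s₂ => s₁.Same 5 s₂ ∧ s₂.mem = s₁.mem ∧ s₂.out = [] ∧ s₂.reg 5 = k + 4 ∧
      s₂.reg 19 = m ∧ s₂.reg 20 = 2 * k + 6 ∧ s₂.reg 21 = n + 1 ∧ s₂.reg 22 = 0 ∧
      s₂.reg 23 = k + 1) ?_ fun s₂ hs₂ => ?_
    · simp [e0, e1, e2, e3, e16, e19, ho]
      omega
    obtain ⟨hsame₂, hm₂, ho₂, f5, f19, f20, f21, f22, f23⟩ := hs₂
    refine (ends_fillPascal ((hsame₂ 0 (by norm_num)).trans e0) ((hsame₂ 1 (by norm_num)).trans e1)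
      f19 f20 f21 f22 f23 (by omega) (by omega) (fun a h3 _ => by rw [hm₂]; exact hm a h3)
      (by rw [hnk]; omega) (by omega) (by omega)).seq fun s₃ hs₃ => ?_
    obtain ⟨hsame₃, ho₃, g20, g23, htab⟩ := hs₃
    have g5 := (hsame₃ 5 (by norm_num)).trans f5
    have g19 := (hsame₃ 19 (by norm_num)).trans f19
    have hsm₃ := hsame₂.trans hsame₃ (le_refl 5) (by norm_num)
    have hlast : s₃.mem (2 * k + 5 + (n + 1) * (k + 1)) = min (n.choose k) m := by
      rw [show 2 * k + 5 + (n + 1) * (k + 1) = 2 * k + 6 + (n * (k + 1) + k) by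
        rw [hnk, Nat.mul_succ]; omega, htab _ (by rw [hnk, Nat.mul_succ]; omega),
        pascal_add (by omega)]
    refine Ends.step (fun s₄ => s₃.Same 24 s₄ ∧ s₄.mem = s₃.mem ∧ s₄.out = [] ∧
      s₄.reg 25 = m - n.choose k) ?_ fun s₄ hs₄ => ?_
    · have := (hsm₃ 1 (by norm_num)).trans e1
      simp [this, g20, hlast, g19, ho₃, ho₂]
      omega
    obtain ⟨hsame₄, hm₄, ho₄, i25⟩ := hs₄
    have hsm₄ := hsm₃.trans hsame₄ (le_refl 5) (by norm_num)
    have i0 := (hsm₄ 0 (by norm_num)).trans e0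
    refine Ends.cond (fun h25 => ?_) fun h25 => ?_
    · exact ends_unrankAndSolve ht1 ht hW (by omega) (by omega) i0 ((hsm₄ 1 (by norm_num)).trans e1)
        ((hsm₄ 2 (by norm_num)).trans e2) ((hsm₄ 3 (by norm_num)).trans e3)
        ((hsm₄ 4 (by norm_num)).trans e4) ((hsame₄ 5 (by norm_num)).trans g5)
        ((hsame₄ 19 (by norm_num)).trans g19) ((hsame₄ 20 (by norm_num)).trans g20)
        ((hsame₄ 23 (by norm_num)).trans g23) (by rw [hm₄]; exact htab) ho₄
    · exact (ends_of_wp (hno i0 ho₄ fun h => by omega)).le (by simp)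

end Number

end ShadowDepth

theorem theorem8 :
    -- the algorithm, when `m` is given as a number
    (∃ (P : Prog) (c : ℕ), ∀ n k t m : ℕ, 1 ≤ n → 2 ≤ t → t + 1 < k →
      ∃ out : List ℕ, RunsTo P c [n, k, t, m] (c * (n * k)) out ∧ IsAnswer n k t m out) ∧
    -- the algorithm, when `m` is given by its binomial decomposition
    (∃ (P : Prog) (c : ℕ), ∀ (n k t m : ℕ) (a : List ℕ), 1 ≤ n → 2 ≤ t → t + 1 < k →
      IsBinomDecomp k m a →
      ∃ out : List ℕ, RunsTo P c (n :: k :: t :: a.length :: a) (c * (n * k)) out ∧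
        IsAnswer n k t m out) ∧
    -- Construction A or Construction B has the same depth and the same size
    (∀ (n k t : ℕ) (S : Finset (Finset (Fin n))), t + 1 < k → Extremal k S → HasDepthSucc k t S →
      ∃ S' : Finset (Finset (Fin n)), Extremal k S' ∧ S'.card = S.card ∧ HasDepthSucc k t S' ∧
        (IsConstructionA n k (k - (t + 1)) (labelledHypergraph k S') ∨
          IsConstructionB n k (k - (t + 1)) (labelledHypergraph k S'))) := by
  refine ⟨?_, ?_, fun n k t S ht hext hS => exists_construction ht hext hS⟩
  · refine ⟨solveNumber, 200, fun n k t m hn ht2 ht => runsTo_of_ends ?_⟩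
    have hle : k ≤ n * k := Nat.le_mul_of_pos_left k hn
    have hle' : n * 4 ≤ n * k := Nat.mul_le_mul_left n (by omega)
    refine (ends_solveNumber hn (by omega) ht (le_trans ?_ (Nat.pow_le_pow_right (n := _ + 2)
      (by omega) (show 2 ≤ 200 by norm_num)))).le (by omega)
    simp only [List.sum_cons, List.sum_nil, add_zero]
    nlinarith
  · refine ⟨solveDecomp, 200, fun n k t m a hn ht2 ht ha => runsTo_of_ends ?_⟩
    have hle : k ≤ n * k := Nat.le_mul_of_pos_left k hn
    have hle' : n * 4 ≤ n * k := Nat.mul_le_mul_left n (by omega)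
    refine (ends_solveDecomp (by omega) ht ha (le_trans ?_ (Nat.pow_le_pow_right (n := _ + 2)
      (by omega) (show 2 ≤ 200 by norm_num)))).le (by omega)
    refine le_trans ?_ (Nat.pow_le_pow_left (n := n + k + 2) ?_ 2)
    · nlinarith
    · simp only [List.sum_cons]
      omega
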